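/- **Setup.** Let $P=(\gamma,\theta,\nu)$ with $0<\gamma<1$, $0\le\theta<\tfrac12$, $0<\nu\le 1-\theta$. Vectors have arbitrary finite dimension; $|\mathbf x|$ is the sum of the components of $\mathbf x$, $\varnothing$ is the empty vector, and a subvector of $\mathbf x$ is $(x_i)_{i\in A}$ in the original order. $\tau$ is the divisor function and $p$ denotes primes. * $\mathcal R=\mathcal R(P)$ is the set of vectors with all components in $(0,1-\gamma)$, $|\mathbf x|=1$, and no proper subsum $\sum_{i\in A}x_i$ ($A$ a nonempty proper subset of the indices) in $[\theta,\theta+\nu]$. $\mathcal C(\mathcal R)$ is the set of coagulations of vectors $\mathbf x\in\mathcal R$, i.e. vectors $(|\mathbf x_1|,\dots,|\mathbf x_h|)$ where the components of $\mathbf x$ are partitioned into nonempty subvectors $\mathbf x_1,\dots,\mathbf x_h$. * $\mathcal H=\mathcal H(P)$ is the set of $\mathbf x\in\mathcal C(\mathcal R)$ with at least two components, all $\ge\nu$. $\mathcal Z$ is the set of subvectors of vectors in $\mathcal C(\mathcal R)$; $\psi(\mathbf x)=\sup\{|\boldsymbol\xi|:\xi_i<\nu\ \forall i,\ (\mathbf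 x,\boldsymbol\xi)\in\mathcal Z\}$; and $\mathcal G_1=\{\mathbf x\in\mathcal Z: x_i\ge\nu\ \forall i,\ |\mathbf x|+\psi(\mathbf x)\le\gamma\}$. * A convex polytope is a bounded set given by finitely many strict or weak linear inequalities. $\mathscr G_1$ is the set of real functions $g$ on vectors of arbitrary dimension (including $\varnothing$) that are symmetric in each dimension, vanish off $\mathcal G_1$, and whose restriction to nondecreasing vectors is a finite sum of bounded functions, each vanishing off a convex polytope contained in $\{0\le x_1\le\dots\le x_k\}$ for some $k$, with bounded continuous first order partial derivatives on the interior of the polytope. Put $(1\star g)(\mathbf x)=\sum_{\mathbf y\subseteq\mathbf x}g(\mathbf y)$, over all $2^{\dim\mathbf x}$ subvectors. * Integrals over subsets of $\{\mathbf x\in\mathbb R^k: x_1+\dots+x_k=1\}$ are with respect to the projection measure onto the first $k-1$ coordinates. **The constants.** For $B>0$, $\varpi>1$ and $x$ large, $\Psi(P;B,\varpi,x)$ is the set of pairs of nonnegative sequences $(a_n),(b_n)$ supported on $x/2<n\le x$ such that, with $w_n=a_n-b_n$: 1. $\sum_p b_p\ge x/(\log x)^{\varpi}$; 2. for all $2\le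 k\le 1/\nu$, convex $\mathcal T\subseteq\{\mathbf x\in\mathbb R^k\cap\mathcal C(\mathcal R):\nu\le x_1\le\dots\le x_k\}$ and $f:\mathcal T\to[-1,1]$ with Lipschitz constant $\le1$, $$\sum_{n=p_1\cdots p_k,\ p_1\le\dots\le p_k,\ \mathbf v(n)\in\mathcal T} b_n f(\mathbf v(n))=\Big(\sum_p b_p\Big)\Big(\int_{\mathcal T}\frac{f(\mathbf u)}{u_1\cdots u_k}\,d\mathbf u+E\Big),\qquad |E|\le\frac1B,$$ where $\mathbf v(n)=\big(\frac{\log p_1}{\log n},\dots,\frac{\log p_k}{\log n}\big)$; 3. (Type I) $\sum_{m\le x^\gamma}\tau(m)^B\max_{I\text{ interval}}\big|\sum_{x/2<mn\le x,\ n\in I}w_{mn}\big|\le x/(\log x)^B$; 4. (Type II) $\big|\sum_{(x/2)^\theta<m\le x^{\theta+\nu},\ x/2<mn\le x}\xi_m\kappa_n w_{mn}\big|\le x/(\log x)^B$ for all complex $\xi_m,\kappa_n$ with $|\xi_m|\le\tau(m)^B$, $|\kappa_n|\le\tau(n)^B$; 5. $\sum_n|w_n|\tau(n)\le x(\log x)^{\varpi}$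 and $w_n\ge -x^{\nu/10}$ for $x/2<n\le x$. $C^-(P)$ is the supremum of all real $C$ such that for every $\varpi>1$ there is $B>0$ such that for all sufficiently large $x$ and all $((a_n),(b_n))\in\Psi(P;B,\varpi,x)$ one has $\sum_p a_p\ge C\sum_p b_p$. $C^+(P)$ is the infimum of all real $C$ for which the same holds with $\sum_p a_p\le C\sum_p b_p$ instead ($C^+(P)=\infty$ if there is no such $C$). **Theorem (Sieve bounds).** Let $P$ be as above, suppose that $\mathcal R(P)$ is nonempty, and let $g\in\mathscr G_1$ satisfy $g(\varnothing)=1$. Then the integrals below converge absolutely, and: (a) If $(1\star g)(\mathbf x)\le0$ for all $\mathbf x\in\mathcal H(P)$, then $$C^-(P)\ \ge\ 1+\sum_{k=2}^{\lfloor1/\nu\rfloor}\ \int_{\mathbf x\in\mathcal H(P)\cap\mathbb R^k,\ x_1\le\dots\le x_k}\frac{(1\star g)(\mathbf x)}{x_1\cdots x_k}\,d\mathbf x.$$ (b) If $(1\star g)(\mathbf x)\ge0$ for all $\mathbf x\in\mathcal H(P)$, then $$C^+(P)\ \le\ 1+\sum_{k=2}^{\lfloor1/\nu\rfloor}\ \int_{\mathbf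 x\in\mathcal H(P)\cap\mathbb R^k,\ x_1\le\dots\le x_k}\frac{(1\star g)(\mathbf x)}{x_1\cdots x_k}\,d\mathbf x.$$ -/

import Mathlib

noncomputable section

namespace PrimeSieve

/-- The parameter triple `(γ, θ, ν)`. -/
structure Params where
  γ : ℝ
  θ : ℝ
  ν : ℝ

/-- The set `𝒬₀` of admissible triples. -/
def Params.InQ0 (P : Params) : Prop :=
  0 < P.γ ∧ P.γ < 1 ∧ 0 ≤ P.θ ∧ P.θ < 1 / 2 ∧ 0 < P.ν ∧ P.ν ≤ 1 - P.θ

/-! ### Vectors of arbitrary dimension -/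

/-- A set of vectors of varying dimensions, given by its part in each `ℝ^k`. -/
abbrev VecSet : Type := (k : ℕ) → Set (Fin k → ℝ)

/-- A real function on vectors of arbitrary dimension (dimension `0` included). -/
abbrev VecFun : Type := (k : ℕ) → (Fin k → ℝ) → ℝ

/-- The subvector `x_A`, with the order of the components preserved. -/
def subvec {k : ℕ} (x : Fin k → ℝ) (A : Finset (Fin k)) : Fin A.card → ℝ :=
  fun i => x (A.orderEmbOfFin rfl i)

/-- The fundamental region `ℛ(P)`: components in `(0, 1 - γ)`, sum `1`,
no proper subsum in `[θ, θ + ν]`. -/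
def fundRegion (P : Params) : VecSet := fun k =>
  {x | (∀ i, 0 < x i ∧ x i < 1 - P.γ) ∧ ∑ i, x i = 1 ∧
    ∀ A : Finset (Fin k), A.Nonempty → A ≠ Finset.univ →
      ∑ i ∈ A, x i ∉ Set.Icc P.θ (P.θ + P.ν)}

/-- `y` is a coagulation of `x`: the components of `x` are distributed into nonempty blocks
(block `i` is the fibre of `φ` over `i`) and `y` is the vector of block sums. -/
def IsCoagulation {h m : ℕ} (y : Fin h → ℝ) (x : Fin m → ℝ) : Prop :=
  ∃ φ : Fin m → Fin h, Function.Surjective φ ∧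
    ∀ i, y i = ∑ j ∈ Finset.univ.filter (fun j => φ j = i), x j

/-- The set `𝒞(R)` of all coagulations of all vectors in `R`. -/
def coagulations (R : VecSet) : VecSet := fun _ =>
  {y | ∃ (m : ℕ) (x : Fin m → ℝ), x ∈ R m ∧ IsCoagulation y x}

/-- `ℋ(P)`: vectors in `𝒞(ℛ)` with at least two components, all of them `≥ ν`. -/
def regionH (P : Params) : VecSet := fun k =>
  {x | x ∈ coagulations (fundRegion P) k ∧ (∀ i, P.ν ≤ x i) ∧ 2 ≤ k}

/-- `𝒵(P)`: all subvectors of vectors in `𝒞(ℛ)`. -/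
def regionZ (P : Params) : VecSet := fun k =>
  {y | ∃ (m : ℕ) (x : Fin m → ℝ) (ι : Fin k ↪o Fin m),
    x ∈ coagulations (fundRegion P) m ∧ y = fun i => x (ι i)}

/-- `ψ(x)`: the supremum of `|ξ|` over vectors `ξ` with all components `< ν` and
`(x, ξ) ∈ 𝒵(P)`. -/
def psi (P : Params) {k : ℕ} (x : Fin k → ℝ) : ℝ :=
  sSup {s : ℝ | ∃ (l : ℕ) (ξ : Fin l → ℝ), (∀ i, ξ i < P.ν) ∧
    Fin.append x ξ ∈ regionZ P (k + l) ∧ s = ∑ i, ξ i}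

/-- `𝒢₁(P)`, the set of vectors. -/
def regionG1 (P : Params) : VecSet := fun k =>
  {x | x ∈ regionZ P k ∧ (∀ i, P.ν ≤ x i) ∧ (∑ i, x i) + psi P x ≤ P.γ}

/-- The convolution `(1 ⋆ g)(x) = ∑_{y ⊆ x} g(y)` over all `2^k` subvectors. -/
def oneStar (g : VecFun) : VecFun := fun _ x =>
  ∑ A : Finset (Fin _), g A.card (subvec x A)

/-- Convex polytopes: bounded sets cut out by finitely many strict or weak linear inequalities. -/
def IsConvexPolytope {k : ℕ} (T : Set (Fin k → ℝ)) : Prop :=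
  Bornology.IsBounded T ∧
    ∃ (p q : ℕ) (c : Fin p → Fin k → ℝ) (b : Fin p → ℝ) (c' : Fin q → Fin k → ℝ) (b' : Fin q → ℝ),
      T = {x | (∀ i, ∑ j, c i j * x j < b i) ∧ ∀ i, ∑ j, c' i j * x j ≤ b' i}

/-- A bounded function supported on a convex polytope inside `0 ≤ x₁ ≤ ⋯ ≤ x_k`, with bounded
continuous first order partial derivatives on the interior of the polytope. -/
def IsSmoothPiece {k : ℕ} (h : (Fin k → ℝ) → ℝ) : Prop :=
  ∃ T : Set (Fin k → ℝ), IsConvexPolytope T ∧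
    T ⊆ {x | (∀ i, 0 ≤ x i) ∧ Monotone x} ∧
    (∀ x, x ∉ T → h x = 0) ∧
    (∃ K : ℝ, ∀ x, |h x| ≤ K) ∧
    ContDiffOn ℝ 1 h (interior T) ∧
    ∃ K : ℝ, ∀ x ∈ interior T, ‖fderiv ℝ h x‖ ≤ K

/-- The class `𝒢₁` of functions: symmetric, supported on the set `𝒢₁(P)`, and on nondecreasingly
ordered vectors a finite sum of smooth pieces. (A symmetric function is determined by its values
on ordered vectors. Vectors in `𝒢₁(P)` have at most `γ / ν` components, so that finitely many
pieces in each dimension are finitely many altogether.) -/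
def ClassG1 (P : Params) : Set VecFun :=
  {g | (∀ (k : ℕ) (σ : Equiv.Perm (Fin k)) (x : Fin k → ℝ), g k (fun i => x (σ i)) = g k x) ∧
    (∀ (k : ℕ) (x : Fin k → ℝ), x ∉ regionG1 P k → g k x = 0) ∧
    ∀ k : ℕ, ∃ (N : ℕ) (h : Fin N → (Fin k → ℝ) → ℝ), (∀ j, IsSmoothPiece (h j)) ∧
      ∀ x : Fin k → ℝ, Monotone x → g k x = ∑ j, h j x}

/-! ### Integrals over subsets of the hyperplane `x₁ + ⋯ + x_k = 1` -/

/-- The point `(u₁, …, u_k, 1 - u₁ - ⋯ - u_k)` of the hyperplane of vectors with sum `1`. -/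
def hyperplanePoint {k : ℕ} (u : Fin k → ℝ) : Fin (k + 1) → ℝ :=
  Fin.snoc (α := fun _ => ℝ) u (1 - ∑ i, u i)

/-- The integral of `F` over the part of `S` in the hyperplane `x₁ + ⋯ + x_k = 1`, with respect to
the projection measure onto the first `k - 1` coordinates. (For `k = 0` the hyperplane is
empty.) -/
def hyperplaneIntegral : (k : ℕ) → Set (Fin k → ℝ) → ((Fin k → ℝ) → ℝ) → ℝ
  | 0, _, _ => 0
  | k + 1, S, F => ∫ u in {u : Fin k → ℝ | hyperplanePoint u ∈ S}, F (hyperplanePoint u)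

/-- Integrability of the integrand of `hyperplaneIntegral`. -/
def HyperplaneIntegrable : (k : ℕ) → Set (Fin k → ℝ) → ((Fin k → ℝ) → ℝ) → Prop
  | 0, _, _ => True
  | k + 1, S, F => MeasureTheory.IntegrableOn (fun u : Fin k → ℝ => F (hyperplanePoint u))
      {u : Fin k → ℝ | hyperplanePoint u ∈ S}

/-! ### The sequences under consideration -/

/-- The integers `n` with `x / 2 < n ≤ x`. -/
def window (x : ℝ) : Finset ℕ := Finset.Ioc ⌊x / 2⌋₊ ⌊x⌋₊

theorem mem_window {x : ℝ} (hx : 0 ≤ x) (n : ℕ) :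
    n ∈ window x ↔ x / 2 < (n : ℝ) ∧ (n : ℝ) ≤ x := by
  rw [window, Finset.mem_Ioc, Nat.floor_lt (by positivity), Nat.le_floor_iff hx]

/-- `∑_p a_p` over the primes `p ∈ (x/2, x]`. -/
def primeSum (x : ℝ) (a : ℕ → ℝ) : ℝ := ∑ p ∈ (window x).filter Nat.Prime, a p

/-- The divisor function `τ`, as a real number. -/
def tau (n : ℕ) : ℝ := (n.divisors.card : ℝ)

/-- For `n = p₁ ⋯ p_k` with primes `p₁ ≤ ⋯ ≤ p_k`, the vector
`v(n) = (log p₁ / log n, …, log p_k / log n)`. It is used only for `n` with exactly `k` prime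
factors; `Nat.primeFactorsList` lists them with multiplicity in nondecreasing order. -/
def primeVec (k n : ℕ) : Fin k → ℝ := fun i =>
  Real.log ((n.primeFactorsList.getD i 1 : ℕ) : ℝ) / Real.log (n : ℝ)

/-- The Type I bound. The bound is asked for every choice of an interval `[c m, d m]` of integers
for each `m`, that is, for the sum over `m` of the maxima over intervals. -/
def TypeI (P : Params) (B x : ℝ) (w : ℕ → ℝ) : Prop :=
  ∀ c d : ℕ → ℕ,
    ∑ m ∈ Finset.Icc 1 ⌊x ^ P.γ⌋₊, tau m ^ B *
      |∑ n ∈ (Finset.Icc (c m) (d m)).filter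
          (fun n : ℕ => x / 2 < (m : ℝ) * (n : ℝ) ∧ (m : ℝ) * (n : ℝ) ≤ x), w (m * n)|
      ≤ x / Real.log x ^ B

/-- The Type II bound. -/
def TypeII (P : Params) (B x : ℝ) (w : ℕ → ℝ) : Prop :=
  ∀ ξ κ : ℕ → ℂ, (∀ m, 1 ≤ m → ‖ξ m‖ ≤ tau m ^ B) → (∀ n, 1 ≤ n → ‖κ n‖ ≤ tau n ^ B) →
    ‖∑ q ∈ (Finset.Icc 1 ⌊x⌋₊ ×ˢ Finset.Icc 1 ⌊x⌋₊).filter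
        (fun q : ℕ × ℕ => (x / 2) ^ P.θ < (q.1 : ℝ) ∧ (q.1 : ℝ) ≤ x ^ (P.θ + P.ν) ∧
          x / 2 < (q.1 : ℝ) * (q.2 : ℝ) ∧ (q.1 : ℝ) * (q.2 : ℝ) ≤ x),
        ξ q.1 * κ q.2 * ((w (q.1 * q.2) : ℝ) : ℂ)‖
      ≤ x / Real.log x ^ B

/-- The growth conditions on `w`. -/
def Growth (P : Params) (ϖ x : ℝ) (w : ℕ → ℝ) : Prop :=
  ∑ n ∈ window x, |w n| * tau n ≤ x * Real.log x ^ ϖ ∧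
    ∀ n ∈ window x, -x ^ (P.ν / 10) ≤ w n

/-- Lower bound for the sum of `b` over primes. -/
def PrimesLower (ϖ x : ℝ) (b : ℕ → ℝ) : Prop :=
  x / Real.log x ^ ϖ ≤ primeSum x b

open Classical in
/-- The generalized prime number theorem for `b`, with relative error at most `1 / B`: for every
`2 ≤ k ≤ 1 / ν`, convex `T ⊆ {x ∈ ℝ^k ∩ 𝒞(ℛ) : ν ≤ x₁ ≤ ⋯ ≤ x_k}` and `1`-bounded function `f`
on `T` with (Euclidean) Lipschitz constant `≤ 1`. -/
def GenPNT (P : Params) (B x : ℝ) (b : ℕ → ℝ) : Prop :=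
  ∀ k : ℕ, 2 ≤ k → (k : ℝ) ≤ 1 / P.ν →
  ∀ T : Set (Fin k → ℝ), Convex ℝ T →
    T ⊆ {u | u ∈ coagulations (fundRegion P) k ∧ (∀ i, P.ν ≤ u i) ∧ Monotone u} →
  ∀ f : (Fin k → ℝ) → ℝ, (∀ u ∈ T, |f u| ≤ 1) →
    (∀ u ∈ T, ∀ v ∈ T, |f u - f v| ≤ Real.sqrt (∑ i, (u i - v i) ^ 2)) →
  ∃ E : ℝ, |E| ≤ 1 / B ∧
    ∑ n ∈ (window x).filter (fun n => n.primeFactorsList.length = k ∧ primeVec k n ∈ T),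
        b n * f (primeVec k n)
      = primeSum x b * (hyperplaneIntegral k T (fun u => f u / ∏ i, u i) + E)

/-- The set `Ψ(γ, θ, ν; B, ϖ, x)` of pairs of sequences `((a_n), (b_n))`. -/
structure InPsi (P : Params) (B ϖ x : ℝ) (a b : ℕ → ℝ) : Prop where
  supp_a : ∀ n : ℕ, ¬(x / 2 < (n : ℝ) ∧ (n : ℝ) ≤ x) → a n = 0
  supp_b : ∀ n : ℕ, ¬(x / 2 < (n : ℝ) ∧ (n : ℝ) ≤ x) → b n = 0
  nonneg_a : ∀ n, 0 ≤ a n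
  nonneg_b : ∀ n, 0 ≤ b n
  primes_lower : PrimesLower ϖ x b
  gen_pnt : GenPNT P B x b
  type_one : TypeI P B x (fun n => a n - b n)
  type_two : TypeII P B x (fun n => a n - b n)
  growth : Growth P ϖ x (fun n => a n - b n)

/-- `C` is an admissible constant for the lower bound. -/
def LowerAdmissible (P : Params) (C : ℝ) : Prop :=
  ∀ ϖ : ℝ, 1 < ϖ → ∃ B : ℝ, 0 < B ∧ ∃ x₀ : ℝ, ∀ x : ℝ, x₀ ≤ x →
    ∀ a b : ℕ → ℝ, InPsi P B ϖ x a b → C * primeSum x b ≤ primeSum x a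

/-- `C` is an admissible constant for the upper bound. -/
def UpperAdmissible (P : Params) (C : ℝ) : Prop :=
  ∀ ϖ : ℝ, 1 < ϖ → ∃ B : ℝ, 0 < B ∧ ∃ x₀ : ℝ, ∀ x : ℝ, x₀ ≤ x →
    ∀ a b : ℕ → ℝ, InPsi P B ϖ x a b → primeSum x a ≤ C * primeSum x b

/-- `C⁻(γ, θ, ν)`, the supremum of the admissible constants for the lower bound. -/
def Cminus (P : Params) : EReal := sSup {c : EReal | ∃ C : ℝ, LowerAdmissible P C ∧ c = (C : EReal)}

/-- `C⁺(γ, θ, ν)`, the infimum of the admissible constants for the upper bound; it is `∞` if there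
are none. -/
def Cplus (P : Params) : EReal := sInf {c : EReal | ∃ C : ℝ, UpperAdmissible P C ∧ c = (C : EReal)}

/-! ### The sieve constant -/

/-- The part of `ℋ(P) ∩ ℝ^k` with `x₁ ≤ ⋯ ≤ x_k`. -/
def orderedH (P : Params) (k : ℕ) : Set (Fin k → ℝ) := {x | x ∈ regionH P k ∧ Monotone x}

/-- The integrand `(1 ⋆ g)(x) / (x₁ ⋯ x_k)`. -/
def sieveIntegrand (g : VecFun) (k : ℕ) (x : Fin k → ℝ) : ℝ := oneStar g k x / ∏ i, x i

/-- `1 + ∑_{k=2}^{⌊1/ν⌋} ∫ (1 ⋆ g)(x) / (x₁ ⋯ x_k) dx` over `x ∈ ℋ(P) ∩ ℝ^k`,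
`x₁ ≤ ⋯ ≤ x_k`. -/
def sieveConstant (P : Params) (g : VecFun) : ℝ :=
  1 + ∑ k ∈ Finset.Icc 2 ⌊1 / P.ν⌋₊, hyperplaneIntegral k (orderedH P k) (sieveIntegrand g k)

end PrimeSieve

end

/-! Write `w = a - b`. Everything rests on one asymptotic identity: if `h` is a function supported
on 𝒢₁(P) that depends only on the signs of finitely many affine forms, then the sum of `w n * ∑_{d ∣
n} h(d)`, over the integers `n` whose vector of prime factors is a coagulation with components `≥
ν`, is an admissible error (`exists_bound_coagSum`). Here `h(d)` is the value at the vector of the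
numbers `log p / log n`, `p` running through the prime factors of `d`. A prime `n` contributes
`h(∅)`, because the vector `(1)` has sum greater than `γ`; the other `n` have their vectors in ℋ(P).
With `g` for `h` the identity says that `∑ a_p` equals `∑ b_p` plus the sum of `b_n (1 ⋆ g)` over ℋ,
minus the sum of `a_n (1 ⋆ g)` over ℋ, up to an error. In (a) the subtracted sum is nonpositive and
may be dropped, since `a ≥ 0`; the sum with `b` is evaluated by the generalized prime number theorem
and yields the integrals. Part (b) is the same with reversed sign (`exists_sieve_bound`).

For the identity, write `n = d e k`, where `d` carries `h` and `e` carries the Möbius function of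
smooth numbers, so that the sum over `e` sifts `n / d`. If `n` is a coagulation in the wider sense
`BigCoag`, where a smooth part of any size is allowed, then the definition of 𝒢₁ by `ψ` says that
`d` times the smooth part of `n` is at most `n ^ γ` (`BigCoag.log_add_le`). So the truncation `d e ≤
n ^ γ` costs nothing (`sum_tripleWt`), and without the condition on `n` the truncated sum is a Type
I sum (`Balanced.linear`). What remains are the integers that violate the coagulation condition.

These are treated by `exists_bound_primes`, on tuples of smooth numbers and primes that avoid the
coagulations, by induction towards more primes. Primes are replaced by integers without small prime
factors; the difference consists of tuples with more primes, which again avoid the coagulations. In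
the sum over sifted integers the sieve condition is opened, so that each of them becomes `e_q k_q`.
If some `k_q` is at least `n ^ (1 - γ)`, this is a Type I sum. Otherwise everything is factored into
smooth numbers and primes. If there were no factorization in the Type II range, then the primes
together with the smooth numbers, cut into small equal parts, would form a vector of ℛ
(`InR0.of_no_factorization`), and the tuple would be a coagulation. Hence a Type II factorization
always exists and `exists_bound_normalForm` applies.

The variables have to be separated with a loss of only powers of `log x`. All the conditions depend
on the signs of a bounded number of affine forms in the logarithms of the variables, and such
functions are Schur multipliers with norm a power of the logarithm (`SM.signFn`). That the existence
of a coagulation is such a condition follows from quantifier elimination (`Semilin.exists_pi`), once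
the number of pieces is bounded by means of `InR0.swap`.

Finally, `g` is approximated by a function `h` of signs, up to `ε` and off finitely many hyperplanes
(`exists_approx`). The majorant of the error, `cellErr`, is itself a function of signs, so the
identity also bounds its sum against `a`. Integers with repeated prime factors need care, since
their divisor sum is not `1 ⋆ g`. Squares of primes below `n ^ γ` are negligible by the Type I bound
and the lower bound for `w`. If all repeated primes are larger, the divisor sum is the mean of `1 ⋆
g` at two members of ℋ (`star_nonpos_of_repeated`), so its sign persists; squares of primes are
treated separately. -/

noncomputable section
namespace PrimeSieve
open Finset

/-! ### Functions that depend on the signs of finitely many affine forms -/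

/-- Evaluation of the affine form `(c, b)`. -/
def affEval {I : Type*} [Fintype I] (l : (I → ℝ) × ℝ) (v : I → ℝ) : ℝ := ∑ i, l.1 i * v i + l.2

/-- Affine real functions. -/
def IsAff {I : Type*} [Fintype I] (f : (I → ℝ) → ℝ) : Prop := ∃ l, ∀ v, f v = affEval l v

/-- `f` factors through the signs of at most `N` affine forms. -/
def SignFn {I : Type*} [Fintype I] {α : Type*} (N : ℕ) (f : (I → ℝ) → α) : Prop :=
  ∃ S : Finset ((I → ℝ) × ℝ), S.card ≤ N ∧
    ∀ v v', (∀ l ∈ S, SignType.sign (affEval l v) = SignType.sign (affEval l v')) → f v = f v'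

/-- `f` factors through the signs of finitely many affine forms. -/
def Semilin {I : Type*} [Fintype I] {α : Type*} (f : (I → ℝ) → α) : Prop := ∃ N, SignFn N f

section
variable {I J : Type*} [Fintype I] [Fintype J] {α β γ : Type*}

namespace IsAff

theorem const (c : ℝ) : IsAff (fun _ : I → ℝ => c) := ⟨(0, c), fun v => by simp [affEval]⟩

theorem coord (i : I) : IsAff (fun v : I → ℝ => v i) := by
  classical
  exact ⟨(Pi.single i 1, 0), fun v => by simp [affEval, Pi.single_apply]⟩

theorem add {f g : (I → ℝ) → ℝ} (hf : IsAff f) (hg : IsAff g) : IsAff (fun v => f v + g v) := by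
  obtain ⟨l, hl⟩ := hf
  obtain ⟨m, hm⟩ := hg
  refine ⟨(l.1 + m.1, l.2 + m.2), fun v => ?_⟩
  simp only [hl, hm, affEval, Pi.add_apply, add_mul, sum_add_distrib]
  ring

theorem mulc {f : (I → ℝ) → ℝ} (c : ℝ) (hf : IsAff f) : IsAff (fun v => c * f v) := by
  obtain ⟨l, hl⟩ := hf
  refine ⟨(c • l.1, c * l.2), fun v => ?_⟩
  simp only [hl, affEval, Pi.smul_apply, smul_eq_mul, mul_add, mul_sum, mul_assoc]

theorem neg {f : (I → ℝ) → ℝ} (hf : IsAff f) : IsAff (fun v => - f v) := by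
  simpa using hf.mulc (-1)

theorem sub {f g : (I → ℝ) → ℝ} (hf : IsAff f) (hg : IsAff g) : IsAff (fun v => f v - g v) := by
  simpa [sub_eq_add_neg] using hf.add hg.neg

theorem sum {κ : Type*} (s : Finset κ) {f : κ → (I → ℝ) → ℝ} (hf : ∀ k ∈ s, IsAff (f k)) :
    IsAff (fun v => ∑ k ∈ s, f k v) := by
  classical
  induction s using Finset.induction_on with
  | empty => simpa using const 0
  | insert a s ha ih =>
    simp only [sum_insert ha]
    exact (hf a (by simp)).add (ih fun k hk => hf k (by simp [hk]))

theorem comp {f : (J → ℝ) → ℝ} (hf : IsAff f) {A : (I → ℝ) → J → ℝ}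
    (hA : ∀ j, IsAff fun v => A v j) : IsAff (fun v => f (A v)) := by
  obtain ⟨l, hl⟩ := hf
  simp only [hl, affEval]
  exact (IsAff.sum _ fun j _ => (hA j).mulc _).add (const _)

end IsAff

namespace SignFn

theorem mono {f : (I → ℝ) → α} {N M : ℕ} (h : SignFn N f) (hNM : N ≤ M) : SignFn M f := by
  obtain ⟨S, hS, h⟩ := h
  exact ⟨S, hS.trans hNM, h⟩

theorem const (a : α) : SignFn 0 (fun _ : I → ℝ => a) := ⟨∅, by simp, fun _ _ _ => rfl⟩

theorem map {f : (I → ℝ) → α} {N : ℕ} (h : SignFn N f) (F : α → β) : SignFn N fun v => F (f v) := by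
  obtain ⟨S, hS, h⟩ := h
  exact ⟨S, hS, fun v v' hv => congrArg F (h v v' hv)⟩

theorem map₂ {f : (I → ℝ) → α} {g : (I → ℝ) → β} {N M : ℕ} (hf : SignFn N f) (hg : SignFn M g)
    (F : α → β → γ) : SignFn (N + M) fun v => F (f v) (g v) := by
  classical
  obtain ⟨S, hS, h⟩ := hf
  obtain ⟨S', hS', h'⟩ := hg
  refine ⟨S ∪ S', (card_union_le _ _).trans (add_le_add hS hS'), fun v v' hv => ?_⟩
  exact congrArg₂ F (h v v' fun l hl => hv l (by simp [hl])) (h' v v' fun l hl => hv l (by simp [hl]))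

theorem pi {κ : Type*} [Fintype κ] {f : κ → (I → ℝ) → α} {N : ℕ} (hf : ∀ k, SignFn N (f k)) :
    SignFn (Fintype.card κ * N) fun v k => f k v := by
  classical
  choose S hS h using hf
  refine ⟨univ.biUnion S, ?_, fun v v' hv => ?_⟩
  · refine card_biUnion_le.trans ((sum_le_card_nsmul _ _ N fun k _ => hS k).trans ?_)
    simp
  · funext k
    exact h k v v' fun l hl => hv l (by simpa using ⟨k, hl⟩)

theorem comp {f : (J → ℝ) → α} {N : ℕ} (hf : SignFn N f) {A : (I → ℝ) → J → ℝ}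
    (hA : ∀ j, IsAff fun v => A v j) : SignFn N (fun v => f (A v)) := by
  classical
  obtain ⟨S, hS, h⟩ := hf
  have : ∀ l : (J → ℝ) × ℝ, ∃ m : (I → ℝ) × ℝ, ∀ v, affEval l (A v) = affEval m v := fun l =>
    IsAff.comp (f := affEval l) ⟨l, fun _ => rfl⟩ hA
  choose m hm using this
  refine ⟨S.image m, card_image_le.trans hS, fun v v' hv => h _ _ fun l hl => ?_⟩
  rw [hm, hm]
  exact hv _ (mem_image_of_mem m hl)

theorem sign {f : (I → ℝ) → ℝ} (hf : IsAff f) : SignFn 1 fun v => SignType.sign (f v) := by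
  obtain ⟨l, hl⟩ := hf
  exact ⟨{l}, by simp, fun v v' hv => by simpa [hl] using hv l (by simp)⟩

theorem lt {f g : (I → ℝ) → ℝ} (hf : IsAff f) (hg : IsAff g) : SignFn 1 fun v => f v < g v := by
  have := (sign (hg.sub hf)).map (fun s => s = 1)
  simpa [sign_eq_one_iff] using this

theorem le {f g : (I → ℝ) → ℝ} (hf : IsAff f) (hg : IsAff g) : SignFn 1 fun v => f v ≤ g v := by
  simpa using (lt hg hf).map Not

theorem eq {f g : (I → ℝ) → ℝ} (hf : IsAff f) (hg : IsAff g) : SignFn 1 fun v => f v = g v := by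
  have := (sign (hf.sub hg)).map (fun s => s = 0)
  simpa only [sign_eq_zero_iff, sub_eq_zero] using this

/-- Homogeneity: multiplying an affine form at `A v / t v` by `t v > 0` keeps its sign and leaves an
affine function of `v`. One further form tells whether `t v > 0`. This is how conditions on
normalized vectors become conditions on logarithms. -/
theorem div {f : (J → ℝ) → α} {N : ℕ} (hf : SignFn N f) {A : (I → ℝ) → J → ℝ}
    (hA : ∀ j, IsAff fun v => A v j) {t : (I → ℝ) → ℝ} (ht : IsAff t) (c : α) :
    SignFn (N + 1) (fun v => open Classical in if 0 < t v then f (fun j => A v j / t v) else c) := by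
  classical
  obtain ⟨S, hS, h⟩ := hf
  have : ∀ l : (J → ℝ) × ℝ, ∃ m : (I → ℝ) × ℝ, ∀ v,
      ∑ j, l.1 j * A v j + l.2 * t v = affEval m v := fun l =>
    (IsAff.sum _ fun j _ => (hA j).mulc _).add (ht.mulc _)
  choose m hm using this
  obtain ⟨l₀, hl₀⟩ := ht
  have key : ∀ l v, 0 < t v →
      SignType.sign (affEval l fun j => A v j / t v) = SignType.sign (affEval (m l) v) := by
    intro l v hv
    have : affEval (m l) v = t v * affEval l fun j => A v j / t v := by
      rw [← hm, affEval, mul_add, mul_sum]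
      congr 1
      · refine sum_congr rfl fun j _ => ?_
        field_simp
      · ring
    rw [this, sign_mul, sign_pos hv, one_mul]
  refine ⟨insert l₀ (S.image m), (card_insert_le _ _).trans (by
    have := card_image_le (s := S) (f := m); omega), fun v v' hv => ?_⟩
  have h0 : SignType.sign (t v) = SignType.sign (t v') := by
    simpa [hl₀] using hv l₀ (by simp)
  have h1 : 0 < t v ↔ 0 < t v' := by rw [← sign_eq_one_iff, h0, sign_eq_one_iff]
  beta_reduce
  by_cases ht : 0 < t v
  · rw [if_pos ht, if_pos (h1.1 ht)]
    refine h _ _ fun l hl => ?_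
    rw [key l v ht, key l v' (h1.1 ht)]
    exact hv _ (by simp only [mem_insert, mem_image]; exact Or.inr ⟨l, hl, rfl⟩)
  · rw [if_neg ht, if_neg (fun h => ht (h1.2 h))]

end SignFn

namespace Semilin

theorem const (a : α) : Semilin (fun _ : I → ℝ => a) := ⟨0, SignFn.const a⟩

theorem map {f : (I → ℝ) → α} (h : Semilin f) (F : α → β) : Semilin fun v => F (f v) :=
  h.imp fun _ h => h.map F

theorem map₂ {f : (I → ℝ) → α} {g : (I → ℝ) → β} (hf : Semilin f) (hg : Semilin g)
    (F : α → β → γ) : Semilin fun v => F (f v) (g v) := by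
  obtain ⟨N, hN⟩ := hf
  obtain ⟨M, hM⟩ := hg
  exact ⟨_, hN.map₂ hM F⟩

theorem and {f g : (I → ℝ) → Prop} (hf : Semilin f) (hg : Semilin g) :
    Semilin fun v => f v ∧ g v := hf.map₂ hg And

theorem or {f g : (I → ℝ) → Prop} (hf : Semilin f) (hg : Semilin g) :
    Semilin fun v => f v ∨ g v := hf.map₂ hg Or

theorem imp {f g : (I → ℝ) → Prop} (hf : Semilin f) (hg : Semilin g) :
    Semilin fun v => f v → g v := hf.map₂ hg (fun a b => a → b)

theorem pi {κ : Type*} [Finite κ] {f : κ → (I → ℝ) → α} (hf : ∀ k, Semilin (f k)) :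
    Semilin fun v k => f k v := by
  have := Fintype.ofFinite κ
  choose N hN using hf
  exact ⟨_, SignFn.pi fun k => (hN k).mono (single_le_sum (fun _ _ => Nat.zero_le _) (mem_univ k))⟩

theorem all {κ : Type*} [Finite κ] {f : κ → (I → ℝ) → Prop} (hf : ∀ k, Semilin (f k)) :
    Semilin fun v => ∀ k, f k v := (pi hf).map (fun p => ∀ k, p k)

theorem ex {κ : Type*} [Finite κ] {f : κ → (I → ℝ) → Prop} (hf : ∀ k, Semilin (f k)) :
    Semilin fun v => ∃ k, f k v := (pi hf).map (fun p => ∃ k, p k)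

theorem comp {f : (J → ℝ) → α} (hf : Semilin f) {A : (I → ℝ) → J → ℝ}
    (hA : ∀ j, IsAff fun v => A v j) : Semilin (fun v => f (A v)) :=
  let ⟨N, h⟩ := hf; ⟨N, h.comp hA⟩

theorem lt {f g : (I → ℝ) → ℝ} (hf : IsAff f) (hg : IsAff g) : Semilin fun v => f v < g v :=
  ⟨1, SignFn.lt hf hg⟩

theorem le {f g : (I → ℝ) → ℝ} (hf : IsAff f) (hg : IsAff g) : Semilin fun v => f v ≤ g v :=
  ⟨1, SignFn.le hf hg⟩

theorem eq {f g : (I → ℝ) → ℝ} (hf : IsAff f) (hg : IsAff g) : Semilin fun v => f v = g v :=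
  ⟨1, SignFn.eq hf hg⟩

end Semilin

/-- The midpoints and neighbours of finitely many reals realise all sign patterns. -/
theorem exists_test_point (R : Finset ℝ) (t : ℝ) :
    ∃ t', (t' = 0 ∨ (∃ r ∈ R, t' = r + 1 ∨ t' = r - 1) ∨ ∃ r ∈ R, ∃ s ∈ R, t' = (r + s) / 2) ∧
      ∀ r ∈ R, SignType.sign (t' - r) = SignType.sign (t - r) := by
  classical
  have hpos : ∀ {a b : ℝ}, 0 < a → 0 < b → SignType.sign a = SignType.sign b := fun h h' => by
    rw [sign_pos h, sign_pos h']
  have hneg : ∀ {a b : ℝ}, a < 0 → b < 0 → SignType.sign a = SignType.sign b := fun h h' => by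
    rw [sign_neg h, sign_neg h']
  by_cases ht : t ∈ R
  · exact ⟨t, Or.inr (Or.inr ⟨t, ht, t, ht, by ring⟩), fun _ _ => rfl⟩
  have hne : ∀ r ∈ R, r ≠ t := fun r hr h => ht (h ▸ hr)
  rcases (R.filter (· < t)).eq_empty_or_nonempty with hl | hl
  · rcases R.eq_empty_or_nonempty with hR | hR
    · exact ⟨0, Or.inl rfl, by simp [hR]⟩
    · refine ⟨R.min' hR - 1, Or.inr (Or.inl ⟨_, R.min'_mem hR, Or.inr rfl⟩), fun r hr => hneg ?_ ?_⟩
      · linarith [R.min'_le r hr]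
      · have : ¬ r < t := fun h => by
          have : r ∈ R.filter (· < t) := by simp [hr, h]
          simp [hl] at this
        have := lt_of_le_of_ne (not_lt.1 this) (hne r hr).symm
        linarith
  rcases (R.filter (t < ·)).eq_empty_or_nonempty with hu | hu
  · have hR : R.Nonempty := hl.mono (filter_subset _ _)
    refine ⟨R.max' hR + 1, Or.inr (Or.inl ⟨_, R.max'_mem hR, Or.inl rfl⟩), fun r hr => hpos ?_ ?_⟩
    · linarith [R.le_max' r hr]
    · have : ¬ t < r := fun h => by
        have : r ∈ R.filter (t < ·) := by simp [hr, h]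
        simp [hu] at this
      have := lt_of_le_of_ne (not_lt.1 this) (hne r hr)
      linarith
  · set a := (R.filter (· < t)).max' hl
    set b := (R.filter (t < ·)).min' hu
    have ha : a ∈ R ∧ a < t := mem_filter.1 ((R.filter (· < t)).max'_mem hl)
    have hb : b ∈ R ∧ t < b := mem_filter.1 ((R.filter (t < ·)).min'_mem hu)
    refine ⟨(a + b) / 2, Or.inr (Or.inr ⟨a, ha.1, b, hb.1, rfl⟩), fun r hr => ?_⟩
    rcases lt_or_gt_of_ne (hne r hr) with h | h
    · have : r ≤ a := le_max' _ _ (by simp [hr, h])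
      exact hpos (by linarith) (by linarith)
    · have : b ≤ r := min'_le _ _ (by simp [hr, h])
      exact hneg (by linarith) (by linarith)

/-- Quantifier elimination for one real variable. -/
theorem Semilin.exists_real {f : (Option I → ℝ) → Prop} (hf : Semilin f) :
    Semilin fun v : I → ℝ => ∃ t : ℝ, f fun o => o.elim t v := by
  classical
  obtain ⟨N, S, hS, h⟩ := hf
  set root : (Option I → ℝ) × ℝ → (I → ℝ) → ℝ := fun l v =>
    (-1 / l.1 none) * (∑ i, l.1 (some i) * v i + l.2) with hroot
  have hra : ∀ l, IsAff (root l) := fun l =>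
    ((IsAff.sum _ fun i _ => (IsAff.coord i).mulc _).add (IsAff.const _)).mulc _
  have hev : ∀ (l : (Option I → ℝ) × ℝ) (v : I → ℝ) (t : ℝ), affEval l (fun o => o.elim t v)
      = l.1 none * t + (∑ i, l.1 (some i) * v i + l.2) := by
    intro l v t
    simp [affEval, Fintype.sum_option, add_assoc]
  have hev' : ∀ (l : (Option I → ℝ) × ℝ) (v : I → ℝ) (t : ℝ), l.1 none ≠ 0 →
      affEval l (fun o => o.elim t v) = l.1 none * (t - root l v) := by
    intro l v t hl
    rw [hev, hroot]
    field_simp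
    ring
  have hsub : ∀ (s : (I → ℝ) → ℝ), IsAff s → Semilin fun v : I → ℝ => f fun o => o.elim (s v) v := by
    intro s hs
    refine Semilin.comp ⟨N, S, hS, h⟩ fun o => ?_
    cases o with
    | none => exact hs
    | some i => exact IsAff.coord i
  -- The signs of the forms change only at their roots, and the roots are affine in `v`. So the test
  -- points of `exists_test_point` are affine in `v`, and the quantifier becomes a finite
  -- disjunction of substitutions.
  have key : (fun v : I → ℝ => ∃ t : ℝ, f fun o => o.elim t v) = fun v =>
      (f fun o => o.elim (0 : ℝ) v) ∨
      (∃ l : S, (f fun o => o.elim (root l v + 1) v) ∨ (f fun o => o.elim (root l v - 1) v)) ∨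
      ∃ p : S × S, f fun o => o.elim ((root p.1 v + root p.2 v) / 2) v := by
    funext v
    refine propext ⟨fun ⟨t, ht⟩ => ?_, ?_⟩
    · obtain ⟨t', ht', hs⟩ := exists_test_point
        ((S.filter fun l => l.1 none ≠ 0).image fun l => root l v) t
      have hft : f fun o => o.elim t' v := by
        rw [h _ (fun o => o.elim t v) fun l hl => ?_]
        · exact ht
        by_cases hl0 : l.1 none = 0
        · rw [hev, hev, hl0, zero_mul, zero_mul]
        · rw [hev' l v t' hl0, hev' l v t hl0, sign_mul, sign_mul,
            hs _ (mem_image.2 ⟨l, by simp [hl, hl0], rfl⟩)]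
      rcases ht' with rfl | ⟨r, hr, hr'⟩ | ⟨r, hr, s, hs', rfl⟩
      · exact Or.inl hft
      · obtain ⟨l, hl, rfl⟩ := mem_image.1 hr
        refine Or.inr (Or.inl ⟨⟨l, (mem_filter.1 hl).1⟩, ?_⟩)
        rcases hr' with rfl | rfl
        · exact Or.inl hft
        · exact Or.inr hft
      · obtain ⟨l, hl, rfl⟩ := mem_image.1 hr
        obtain ⟨l', hl', rfl⟩ := mem_image.1 hs'
        exact Or.inr (Or.inr ⟨(⟨l, (mem_filter.1 hl).1⟩, ⟨l', (mem_filter.1 hl').1⟩), hft⟩)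
    · rintro (h | ⟨l, h | h⟩ | ⟨p, h⟩) <;> exact ⟨_, h⟩
  rw [key]
  refine (hsub _ (IsAff.const 0)).or (Semilin.or (Semilin.ex fun l => ?_) (Semilin.ex fun p => ?_))
  · exact (hsub _ ((hra _).add (IsAff.const 1))).or (hsub _ ((hra _).sub (IsAff.const 1)))
  · refine hsub _ ?_
    simpa [div_eq_inv_mul] using ((hra p.1).add (hra p.2)).mulc 2⁻¹

/-- Quantifier elimination for finitely many real variables. -/
theorem Semilin.exists_pi {K : Type*} [Fintype K] {f : (I ⊕ K → ℝ) → Prop} (hf : Semilin f) :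
    Semilin fun v : I → ℝ => ∃ u : K → ℝ, f (Sum.elim v u) := by
  have main : ∀ (n : ℕ) (f : (I ⊕ Fin n → ℝ) → Prop), Semilin f →
      Semilin fun v : I → ℝ => ∃ u : Fin n → ℝ, f (Sum.elim v u) := by
    intro n
    induction n with
    | zero =>
      intro f hf
      have : (fun v : I → ℝ => ∃ u : Fin 0 → ℝ, f (Sum.elim v u)) =
          fun v => f (Sum.elim v Fin.elim0) := by
        funext v
        exact propext ⟨fun ⟨u, hu⟩ => by rwa [Subsingleton.elim Fin.elim0 u], fun h => ⟨_, h⟩⟩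
      rw [this]
      refine hf.comp fun j => ?_
      rcases j with i | j
      · exact IsAff.coord i
      · exact j.elim0
    | succ n ih =>
      intro f hf
      have h1 : Semilin fun y : Option (I ⊕ Fin n) → ℝ =>
          f (Sum.elim (fun i => y (some (.inl i)))
            (Fin.cons (y none) fun j => y (some (.inr j)) : Fin (n + 1) → ℝ)) := by
        refine hf.comp fun j => ?_
        rcases j with i | j
        · exact IsAff.coord _
        · refine Fin.cases ?_ (fun j => ?_) j
          · exact IsAff.coord none
          · exact IsAff.coord (some (Sum.inr j))
      have h2 := ih _ h1.exists_real
      refine (congrArg Semilin (funext fun v => propext ⟨?_, ?_⟩)).mp h2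
      · rintro ⟨u, t, h⟩
        exact ⟨_, h⟩
      · rintro ⟨u, h⟩
        refine ⟨Fin.tail u, u 0, ?_⟩
        simp only [Option.elim_some, Sum.elim_inl, Option.elim_none, Sum.elim_inr]
        have : (Fin.cons (u 0) (fun j => Fin.tail u j) : Fin (n + 1) → ℝ) = u := Fin.cons_self_tail u
        rw [this]
        exact h
  have e := Fintype.equivFin K
  have h1 := main _ (fun y : I ⊕ Fin (Fintype.card K) → ℝ =>
    f (Sum.elim (fun i => y (.inl i)) fun k => y (.inr (e k))))
    (hf.comp fun j => by rcases j with i | j <;> exact IsAff.coord _)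
  refine (congrArg Semilin (funext fun v => propext ⟨?_, ?_⟩)).mp h1
  · rintro ⟨u, h⟩
    exact ⟨u ∘ e, h⟩
  · rintro ⟨u, h⟩
    refine ⟨u ∘ e.symm, ?_⟩
    simpa using h

end

/-! ### The fundamental region with vanishing components allowed -/

/-- The conditions defining `ℛ(P)` for a finite family of nonnegative reals; vanishing members are
irrelevant. -/
def InR0 (P : Params) {ι : Type*} [Fintype ι] (x : ι → ℝ) : Prop :=
  (∀ i, 0 ≤ x i ∧ x i < 1 - P.γ) ∧ ∑ i, x i = 1 ∧
    ∀ A : Finset ι, ∑ i ∈ A, x i ∈ Set.Icc P.θ (P.θ + P.ν) → ∑ i ∈ A, x i = 0 ∨ ∑ i ∈ A, x i = 1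

/-- Admissible parameters with nonempty fundamental region. -/
structure Params.Good (P : Params) : Prop where
  γ_pos : 0 < P.γ
  γ_lt : P.γ < 1
  θ_nonneg : 0 ≤ P.θ
  ν_pos : 0 < P.ν
  add_lt : P.θ + P.ν < 1
  ν_lt : P.ν < 1 - P.γ

/-- `(ξ, x)` is a coagulation of a vector of the fundamental region, for some vector `ξ` with
components below `ν` and sum `σ`. -/
def HasCoag (P : Params) {κ : Type*} (σ : ℝ) (x : κ → ℝ) : Prop :=
  open Classical in
  (∀ i, 0 < x i) ∧ ∃ (m : ℕ) (φ : Fin m → Option κ) (w : Fin m → ℝ), InR0 P w ∧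
    (∀ j, φ j = none → w j < P.ν) ∧ ∑ j with φ j = none, w j = σ ∧
    ∀ i, ∑ j with φ j = some i, w j = x i

section
variable {P : Params} {ι ι' κ κ' α α' β : Type*} [Fintype ι] [Fintype ι'] [Fintype κ] [Fintype κ']
  [Fintype α] [Fintype α'] [Fintype β]

/-- Partial sums that grow in steps of at most `ν` cannot jump over an interval of length `ν`. -/
theorem exists_subset_sum_mem (s : Finset ι) (x : ι → ℝ) {θ ν τ : ℝ} (hν : ∀ i ∈ s, x i ≤ ν)
    (hτ : τ ≤ θ + ν) (h : θ ≤ τ + ∑ i ∈ s, x i) :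
    ∃ A ⊆ s, τ + ∑ i ∈ A, x i ∈ Set.Icc θ (θ + ν) := by
  classical
  induction s using Finset.induction_on with
  | empty => exact ⟨∅, Subset.rfl, h, by simpa using hτ⟩
  | insert a s ha ih =>
    by_cases hs : θ ≤ τ + ∑ i ∈ s, x i
    · obtain ⟨A, hA, h'⟩ := ih (fun i hi => hν i (by simp [hi])) hs
      exact ⟨A, hA.trans (subset_insert _ _), h'⟩
    · refine ⟨insert a s, Subset.rfl, h, ?_⟩
      rw [sum_insert ha]
      have := hν a (by simp)
      linarith [not_le.1 hs]

theorem InR0.of_subsums {x : ι → ℝ} {x' : ι' → ℝ} (h : InR0 P x)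
    (h0 : ∀ i, 0 ≤ x' i ∧ x' i < 1 - P.γ) (h1 : ∑ i, x' i = 1)
    (h2 : ∀ A' : Finset ι', ∃ A : Finset ι, ∑ i ∈ A', x' i = ∑ i ∈ A, x i) : InR0 P x' := by
  refine ⟨h0, h1, fun A' hA' => ?_⟩
  obtain ⟨A, hA⟩ := h2 A'
  rw [hA] at hA' ⊢
  exact h.2.2 A hA'

theorem InR0.comp_equiv {x : ι → ℝ} (h : InR0 P x) (e : ι' ≃ ι) : InR0 P (fun i => x (e i)) :=
  h.of_subsums (fun i => h.1 _) (by rw [e.sum_comp x, h.2.1])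
    fun A' => ⟨A'.map e.toEmbedding, by simp⟩

theorem InR0.extend {x : ι → ℝ} (hP : P.Good) (h : InR0 P x) {e : ι → ι'}
    (he : Function.Injective e) : InR0 P (Function.extend e x 0) := by
  classical
  have hz : ∀ i, i ∉ Set.range e → Function.extend e x 0 i = 0 := fun i hi =>
    Function.extend_apply' (f := e) x 0 i hi
  refine h.of_subsums (fun i => ?_) ?_ fun A' => ⟨univ.filter fun i => e i ∈ A', ?_⟩
  · by_cases hi : ∃ a, e a = i
    · obtain ⟨a, rfl⟩ := hi
      rw [he.extend_apply]
      exact h.1 a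
    · rw [Function.extend_apply' _ _ _ hi]
      exact ⟨le_rfl, by simpa using hP.γ_lt⟩
  · rw [← h.2.1]
    exact (Fintype.sum_of_injective e he _ _ (fun i hi => hz i hi)
      fun i => (he.extend_apply _ _ _).symm).symm
  · rw [← sum_filter_add_sum_filter_not A' (fun i => i ∈ Set.range e),
      sum_eq_zero (s := A'.filter fun i => ¬ i ∈ Set.range e) fun i hi => hz i (mem_filter.1 hi).2,
      add_zero]
    symm
    refine sum_bij (fun i _ => e i) (by simp) (fun _ _ _ _ h => he h) ?_ fun i _ =>
      (he.extend_apply _ _ _).symm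
    simp only [mem_filter, mem_univ, true_and]
    rintro b ⟨hb, a, rfl⟩
    exact ⟨a, hb, rfl⟩

theorem InR0.sum_lt_one {x : ι → ℝ} (hP : P.Good) (h : InR0 P x) {A : Finset ι}
    (hA : ∑ i ∈ A, x i ∈ Set.Icc P.θ (P.θ + P.ν)) : ∑ i ∈ A, x i = 0 := by
  rcases h.2.2 A hA with h | h
  · exact h
  · have := hA.2
    linarith [hP.add_lt]

theorem sum_disjSum_elim {γ : Type*} (b : β → ℝ) (v : γ → ℝ) (B : Finset β) (C : Finset γ) :
    ∑ i ∈ B.disjSum C, Sum.elim b v i = ∑ i ∈ B, b i + ∑ i ∈ C, v i := by simp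

/-- Components below `ν` matter only through their sum. If a subsum involving new small components
lies in `[θ, θ + ν]`, then the old ones, added one at a time to the same large components, land
there as well, so that this old subsum is zero. Then `θ = 0`, each old small component is itself a
subsum in the interval, and the whole small part vanishes. -/
theorem InR0.swap (hP : P.Good) {b : β → ℝ} {u : α → ℝ} {u' : α' → ℝ} (h : InR0 P (Sum.elim b u))
    (hu : ∀ i, u i < P.ν) (hu' : ∀ i, 0 ≤ u' i ∧ u' i < P.ν) (hs : ∑ i, u' i = ∑ i, u i) :
    InR0 P (Sum.elim b u') := by
  classical
  have hb := fun i => h.1 (.inl i)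
  have hu0 := fun i => h.1 (.inr i)
  simp only [Sum.elim_inl, Sum.elim_inr] at hb hu0
  refine ⟨?_, ?_, fun A' hA' => Or.inl ?_⟩
  · rintro (i | i)
    · exact hb i
    · exact ⟨(hu' i).1, (hu' i).2.trans hP.ν_lt⟩
  · have := h.2.1
    simp only [Fintype.sum_sum_type, Sum.elim_inl, Sum.elim_inr] at this ⊢
    rw [hs, this]
  rw [← toLeft_disjSum_toRight (u := A'), sum_disjSum_elim] at hA' ⊢
  set τ := ∑ i ∈ A'.toLeft, b i
  set s' := ∑ i ∈ A'.toRight, u' i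
  have hτ0 : 0 ≤ τ := sum_nonneg fun i _ => (hb i).1
  have hs0 : 0 ≤ s' := sum_nonneg fun i _ => (hu' i).1
  have hs1 : s' ≤ ∑ i, u i := by
    rw [← hs]
    exact sum_le_sum_of_subset_of_nonneg (subset_univ _) fun i _ _ => (hu' i).1
  obtain ⟨A, -, hA⟩ := exists_subset_sum_mem (θ := P.θ) (τ := τ) univ u (fun i _ => (hu i).le)
    (by linarith [hA'.2]) (by linarith [hA'.1])
  rw [← sum_disjSum_elim] at hA
  have h0 := h.sum_lt_one hP hA
  rw [h0] at hA
  have hθ : P.θ = 0 := le_antisymm hA.1 hP.θ_nonneg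
  rw [sum_disjSum_elim] at h0
  have hA0 : 0 ≤ ∑ i ∈ A, u i := sum_nonneg fun i _ => (hu0 i).1
  have hτ : τ = 0 := by linarith
  have hsum : ∑ i, u i = 0 := by
    refine sum_eq_zero fun i _ => ?_
    have hi : ∑ j ∈ (∅ : Finset β).disjSum {i}, Sum.elim b u j = u i := by rw [sum_disjSum_elim]; simp
    have := h.sum_lt_one hP (A := (∅ : Finset β).disjSum {i})
      (by rw [hi, hθ, zero_add]; exact ⟨(hu0 i).1, (hu i).le⟩)
    rwa [hi] at this
  linarith

theorem fundRegion.inR0 {k : ℕ} {x : Fin k → ℝ} (h : x ∈ fundRegion P k) : InR0 P x := by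
  refine ⟨fun i => ⟨(h.1 i).1.le, (h.1 i).2⟩, h.2.1, fun A hA => ?_⟩
  by_cases h0 : A.Nonempty
  · by_cases h1 : A = univ
    · exact Or.inr (h1 ▸ h.2.1)
    · exact absurd hA (h.2.2 A h0 h1)
  · rw [not_nonempty_iff_eq_empty.1 h0]
    simp

/-- Degenerate parameters leave no vectors. If `θ + ν = 1`, then a component and the sum of the
others are proper subsums outside `[θ, 1]`, so both lie below `θ < 1 / 2`, although they add up to
`1`. If `1 - γ ≤ ν`, then all components are below `ν` and a subsum must land in the forbidden
interval. -/
theorem Params.InQ0.good (hP : P.InQ0) (hR : ∃ k, (fundRegion P k).Nonempty) : P.Good := by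
  classical
  obtain ⟨h1, h2, h3, h4, h5, h6⟩ := hP
  obtain ⟨k, x, hx⟩ := hR
  have hk : 0 < k := by
    rcases k.eq_zero_or_pos with rfl | h
    · have := hx.2.1
      simp at this
    · exact h
  have hadd : P.θ + P.ν < 1 := by
    by_contra! hcon
    have hone : P.θ + P.ν = 1 := by linarith
    have hx0 := hx.1 ⟨0, hk⟩
    set i : Fin k := ⟨0, hk⟩
    have hs : x i + ∑ j ∈ univ.erase i, x j = 1 := by
      rw [add_sum_erase _ _ (mem_univ i), hx.2.1]
    have hn : (univ.erase i).Nonempty := by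
      by_contra h
      rw [not_nonempty_iff_eq_empty.1 h] at hs
      simp at hs
      linarith
    have hpos : 0 < ∑ j ∈ univ.erase i, x j := sum_pos (fun j _ => (hx.1 j).1) hn
    have a1 := hx.2.2 {i} (singleton_nonempty i) (by
      rintro h
      rw [← h] at hn
      simp at hn)
    have a2 := hx.2.2 (univ.erase i) hn (by
      intro h
      have := mem_univ i
      rw [← h] at this
      simp at this)
    rw [Set.mem_Icc, not_and_or] at a1 a2
    rw [sum_singleton] at a1
    rcases a1 with a1 | a1 <;> rcases a2 with a2 | a2 <;> linarith
  refine ⟨h1, h2, h3, h5, hadd, ?_⟩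
  by_contra! hcon
  have h0 := fundRegion.inR0 hx
  have hsm : ∀ i, x i < P.ν := fun i => (hx.1 i).2.trans_le hcon
  obtain ⟨A, -, hA⟩ := exists_subset_sum_mem (θ := P.θ) (τ := 0) univ x (fun i _ => (hsm i).le)
    (by linarith) (by rw [hx.2.1]; linarith)
  rw [zero_add] at hA
  rcases h0.2.2 A hA with h | h
  · rw [h] at hA
    have hθ : P.θ = 0 := le_antisymm hA.1 h3
    have := h0.2.2 {⟨0, hk⟩} (by
      rw [sum_singleton, hθ, zero_add]
      exact ⟨(hx.1 _).1.le, (hsm _).le⟩)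
    rw [sum_singleton] at this
    rcases this with h | h
    · exact (hx.1 _).1.ne' h
    · have := hsm ⟨0, hk⟩
      linarith
  · rw [h] at hA
    linarith [hA.2]

theorem HasCoag.of_family {σ : ℝ} {x : κ → ℝ} (hx : ∀ i, 0 < x i) (φ : ι → Option κ) (w : ι → ℝ)
    (hw : InR0 P w) (h1 : ∀ j, φ j = none → w j < P.ν)
    (h2 : open Classical in ∑ j with φ j = none, w j = σ)
    (h3 : open Classical in ∀ i, ∑ j with φ j = some i, w j = x i) : HasCoag P σ x := by
  classical
  set e := (Fintype.equivFin ι).symm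
  have key : ∀ o, ∑ j with φ (e j) = o, w (e j) = ∑ j with φ j = o, w j := by
    intro o
    rw [sum_filter, sum_filter]
    exact e.sum_comp fun j => if φ j = o then w j else 0
  refine ⟨hx, _, fun j => φ (e j), fun j => w (e j), hw.comp_equiv e, fun j hj => h1 _ hj, ?_, ?_⟩
  · convert (key none).trans (by convert h2)
  · intro i
    convert (key (some i)).trans (by convert h3 i)

/-- The underlying vector of ℛ is kept and its pieces are only relabelled. Blocks may be united, and
a block with sum below `ν` may be dissolved into the small part, since all its pieces are below `ν`
too. -/
theorem HasCoag.coarsen {σ σ' : ℝ} {x : κ → ℝ} {y : κ' → ℝ} (h : HasCoag P σ x)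
    (f : κ → Option κ') (hf : ∀ i, f i = none → x i < P.ν) (hy : ∀ i, 0 < y i)
    (hσ : open Classical in σ' = σ + ∑ i with f i = none, x i)
    (hxy : open Classical in ∀ j, y j = ∑ i with f i = some j, x i) : HasCoag P σ' y := by
  classical
  obtain ⟨hx, m, φ, w, hw, h1, h2, h3⟩ := h
  have hle : ∀ i j, φ j = some i → w j ≤ x i := by
    intro i j hj
    rw [← h3 i]
    exact single_le_sum (f := w) (fun k _ => (hw.1 k).1) (by simp [hj])
  have hsum : ∀ o : Option κ', ∑ i with f i = o, x i =
      ∑ j with (∃ i, φ j = some i ∧ f i = o), w j := by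
    intro o
    have : ∀ i, x i = ∑ j with φ j = some i, w j := fun i => by rw [← h3 i]
    rw [sum_congr rfl fun i _ => this i, ← sum_biUnion]
    · refine sum_congr ?_ fun _ _ => rfl
      ext j
      simp only [mem_biUnion, mem_filter, mem_univ, true_and]
      exact ⟨fun ⟨i, h, h'⟩ => ⟨i, h', h⟩, fun ⟨i, h, h'⟩ => ⟨i, h', h⟩⟩
    · intro i _ i' _ hii'
      refine disjoint_left.2 fun j hj hj' => hii' ?_
      simp only [mem_filter, mem_univ, true_and] at hj hj'
      exact Option.some.inj (hj.symm.trans hj')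
  refine ⟨hy, m, fun j => (φ j).bind f, w, hw, ?_, ?_, ?_⟩
  · intro j hj
    beta_reduce at hj
    rcases hφ : φ j with _ | i
    · exact h1 j hφ
    · rw [hφ] at hj
      exact (hle i j hφ).trans_lt (hf i hj)
  · rw [hσ, hsum, ← h2, ← sum_union]
    · refine sum_congr ?_ fun _ _ => rfl
      ext j
      rcases hφ : φ j with _ | i <;> simp [hφ]
    · refine disjoint_left.2 fun j hj hj' => ?_
      simp only [mem_filter, mem_univ, true_and] at hj hj'
      obtain ⟨i, hi, -⟩ := hj'
      rw [hj] at hi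
      cases hi
  · intro i
    rw [hxy, hsum]
    refine sum_congr ?_ fun _ _ => rfl
    ext j
    rcases hφ : φ j with _ | i <;> simp [hφ]

theorem HasCoag.reindex {σ : ℝ} {x : κ → ℝ} (h : HasCoag P σ x) (e : κ' ≃ κ) :
    HasCoag P σ (fun i => x (e i)) := by
  classical
  refine h.coarsen (fun i => some (e.symm i)) (by simp) (fun i => h.1 _) (by simp) fun j => ?_
  simp only [Option.some.injEq]
  rw [sum_eq_single_of_mem (e j) (by simp)]
  intro b hb hne
  simp only [mem_filter, mem_univ, true_and] at hb
  exact absurd (by rw [← hb, e.apply_symm_apply]) hne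

/-- The small pieces may be displayed as components. -/
theorem HasCoag.expose {σ : ℝ} {x : κ → ℝ} (h : HasCoag P σ x) :
    ∃ (l : ℕ) (ξ : Fin l → ℝ), (∀ i, 0 < ξ i ∧ ξ i < P.ν) ∧ ∑ i, ξ i = σ ∧
      HasCoag P 0 (Sum.elim x ξ) := by
  classical
  obtain ⟨hx, m, φ, w, hw, h1, h2, h3⟩ := h
  let Λ := {j : Fin m // φ j = none ∧ w j ≠ 0}
  let e := (Fintype.equivFin Λ)
  have hpos : ∀ i : Λ, 0 < w i.1 := fun i => lt_of_le_of_ne (hw.1 _).1 i.2.2.symm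
  refine ⟨Fintype.card Λ, fun i => w (e.symm i).1, fun i => ⟨hpos _, h1 _ (e.symm i).2.1⟩, ?_, ?_⟩
  · rw [e.symm.sum_comp fun i : Λ => w i.1, ← h2]
    rw [← sum_filter_ne_zero (s := univ.filter fun j => φ j = none), filter_filter]
    exact (sum_subtype _ (by simp) _).symm
  · let ψ : Fin m → Option (κ ⊕ Fin (Fintype.card Λ)) := fun j =>
      if hj : φ j = none ∧ w j ≠ 0 then some (.inr (e ⟨j, hj⟩)) else (φ j).map Sum.inl
    have hψ1 : ∀ j, ψ j = none ↔ φ j = none ∧ w j = 0 := by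
      intro j
      by_cases hj : φ j = none ∧ w j ≠ 0
      · simp only [ψ, dif_pos hj]
        simp [hj.2]
      · simp only [ψ, dif_neg hj, Option.map_eq_none_iff]
        tauto
    have hψ2 : ∀ j i, ψ j = some (.inl i) ↔ φ j = some i := by
      intro j i
      by_cases hj : φ j = none ∧ w j ≠ 0
      · simp only [ψ, dif_pos hj]
        simp [hj.1]
      · simp only [ψ, dif_neg hj]
        rcases φ j with _ | i' <;> simp
    have hψ3 : ∀ j i, ψ j = some (.inr i) ↔ j = (e.symm i).1 := by
      intro j i
      by_cases hj : φ j = none ∧ w j ≠ 0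
      · simp only [ψ, dif_pos hj, Option.some.injEq, Sum.inr.injEq]
        rw [← Equiv.eq_symm_apply, ← Subtype.coe_inj]
      · simp only [ψ, dif_neg hj]
        constructor
        · intro h
          rcases hφ : φ j with _ | i' <;> simp [hφ] at h
        · rintro rfl
          exact absurd (e.symm i).2 hj
    refine ⟨?_, m, ψ, w, hw, fun j hj => h1 j ((hψ1 j).1 hj).1, ?_, ?_⟩
    · rintro (i | i)
      · exact hx i
      · exact hpos _
    · exact sum_eq_zero fun j hj => ((hψ1 j).1 (mem_filter.1 hj).2).2
    · rintro (i | i)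
      · simp only [hψ2, Sum.elim_inl, h3]
      · simp only [hψ3, Sum.elim_inr]
        rw [sum_eq_single_of_mem (e.symm i).1 (by simp)]
        intro b hb hne
        exact absurd (mem_filter.1 hb).2 hne

theorem HasCoag.total {σ : ℝ} {x : κ → ℝ} (h : HasCoag P σ x) : σ + ∑ i, x i = 1 := by
  classical
  obtain ⟨hx, m, φ, w, hw, h1, h2, h3⟩ := h
  rw [← hw.2.1, ← h2, ← sum_congr rfl fun i _ => h3 i, ← sum_fiberwise (s := univ) φ w,
    Fintype.sum_option]

end

section
variable {P : Params} {ι ι' κ κ' α α' β : Type*} [Fintype ι] [Fintype ι'] [Fintype κ] [Fintype κ']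
  [Fintype α] [Fintype α'] [Fintype β]

/-- A form of `HasCoag` with a bounded number of pieces. -/
theorem HasCoag.iff_bounded (hP : P.Good) {M : ℕ} (hM : 1 / P.ν < M) {σ : ℝ} {x : κ → ℝ} :
    HasCoag P σ x ↔ (∀ i, 0 < x i) ∧ ∃ w : (Option κ × Fin M) ⊕ (Option κ × Fin M) → ℝ,
      InR0 P w ∧ (∀ j, w (.inl (none, j)) < P.ν ∧ w (.inr (none, j)) < P.ν) ∧
      ∑ j, (w (.inl (none, j)) + w (.inr (none, j))) = σ ∧
      ∀ i, ∑ j, (w (.inl (some i, j)) + w (.inr (some i, j))) = x i := by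
  classical
  have hM0 : (0 : ℝ) < M := (by have := hP.ν_pos; positivity : (0 : ℝ) < 1 / P.ν).trans hM
  have hMν : 1 / (M : ℝ) < P.ν := by rw [div_lt_comm₀ hM0 hP.ν_pos]; exact hM
  have hblock : ∀ (w : (Option κ × Fin M) ⊕ (Option κ × Fin M) → ℝ) (o : Option κ),
      ∑ j with Sum.elim Prod.fst Prod.fst j = o, w j =
        ∑ j, (w (.inl (o, j)) + w (.inr (o, j))) := by
    intro w o
    rw [sum_filter, Fintype.sum_sum_type]
    simp only [Sum.elim_inl, Sum.elim_inr, Fintype.sum_prod_type]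
    rw [sum_eq_single_of_mem o (mem_univ _), sum_eq_single_of_mem o (mem_univ _)]
    · simp [sum_add_distrib]
    all_goals
      intro b _ hb
      simp [hb]
  constructor
  · rintro ⟨hx, m, φ, w, hw, h1, h2, h3⟩
    -- Fewer than `M` pieces are `≥ ν`, so `M` slots in each block can hold them. By `InR0.swap` the
    -- small pieces of a block may be replaced by `M` equal ones with the same sum, each of them at
    -- most `1 / M < ν`.
    let Big := {j : Fin m // P.ν ≤ w j}
    let Small := {j : Fin m // ¬ P.ν ≤ w j}
    have hw' : InR0 P (Sum.elim (fun j : Big => w j.1) (fun j : Small => w j.1)) := by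
      convert hw.comp_equiv (Equiv.sumCompl fun j => P.ν ≤ w j) using 1
      funext j
      rcases j with j | j <;> rfl
    have hcard : ∀ o, Fintype.card {j : Big // φ j.1 = o} ≤ Fintype.card (Fin M) := by
      intro o
      have hc : Fintype.card {j : Big // φ j.1 = o} ≤ Fintype.card Big := Fintype.card_subtype_le _
      have : (Fintype.card Big : ℝ) * P.ν ≤ 1 := by
        have h4 : ∑ j : Big, w j.1 ≤ 1 := by
          have := hw'.2.1
          simp only [Fintype.sum_sum_type, Sum.elim_inl, Sum.elim_inr] at this
          have h5 : 0 ≤ ∑ j : Small, w j.1 := sum_nonneg fun i _ => (hw.1 _).1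
          linarith
        have h5 : ∑ j : Big, P.ν ≤ ∑ j : Big, w j.1 := sum_le_sum fun j _ => j.2
        simp only [sum_const, card_univ, nsmul_eq_mul] at h5
        linarith
      rw [← le_div_iff₀ hP.ν_pos] at this
      rw [Fintype.card_fin]
      have : (Fintype.card Big : ℝ) < M := this.trans_lt hM
      exact hc.trans (by exact_mod_cast this.le)
    have hρ := fun o => (Function.Embedding.nonempty_of_card_le (hcard o)).some
    let e : Big → Option κ × Fin M := fun j => (φ j.1, hρ (φ j.1) ⟨j, rfl⟩)
    have he : Function.Injective e := by
      have aux : ∀ o o' (ho : o = o') (j j' : Big) (h : φ j.1 = o) (h' : φ j'.1 = o'),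
          hρ o ⟨j, h⟩ = hρ o' ⟨j', h'⟩ → j = j' := by
        intro o o' ho j j' h h' hh
        subst ho
        simpa using (hρ o).injective hh
      intro j j' hjj
      exact aux _ _ (congrArg Prod.fst hjj) j j' rfl rfl (congrArg Prod.snd hjj)
    set s : Option κ → ℝ := fun o => ∑ j : Small with φ j.1 = o, w j.1 with hs
    have hs0 : ∀ o, 0 ≤ s o := fun o => sum_nonneg fun i _ => (hw.1 _).1
    have hstot : ∑ o, s o = ∑ j : Small, w j.1 := sum_fiberwise _ _ _
    have hs1 : ∀ o, s o ≤ 1 := by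
      intro o
      have h4 : s o ≤ ∑ o, s o := single_le_sum (fun o _ => hs0 o) (mem_univ o)
      have := hw'.2.1
      simp only [Fintype.sum_sum_type, Sum.elim_inl, Sum.elim_inr] at this
      have h5 : 0 ≤ ∑ j : Big, w j.1 := sum_nonneg fun i _ => (hw.1 _).1
      linarith
    set c : Option κ × Fin M → ℝ := Function.extend e (fun j => w j.1) 0 with hc
    have hcz : ∀ p, p ∉ Set.range e → c p = 0 := fun p hp =>
      Function.extend_apply' (fun j : Big => w j.1) (0 : Option κ × Fin M → ℝ) p hp
    have hce : ∀ j, c (e j) = w j.1 := fun j => he.extend_apply _ _ _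
    have hR : InR0 P (Sum.elim c (fun p : Option κ × Fin M => s p.1 / M)) := by
      have h5 : InR0 P (Sum.elim c fun j : Small => w j.1) := by
        convert hw'.extend hP (e := Sum.map e id)
          (Function.Injective.sumMap he Function.injective_id) using 1
        funext p
        rcases p with p | j
        · by_cases hp : p ∈ Set.range e
          · obtain ⟨j, rfl⟩ := hp
            rw [Sum.elim_inl, hce, show (.inl (e j) : (Option κ × Fin M) ⊕ Small) =
              Sum.map e id (.inl j) from rfl,
              (Function.Injective.sumMap he Function.injective_id).extend_apply, Sum.elim_inl]
          · rw [Function.extend_apply', Sum.elim_inl, hcz p hp]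
            · rfl
            · rintro ⟨a | a, ha⟩
              · exact hp ⟨a, Sum.inl.inj ha⟩
              · cases ha
        · rw [show (.inr j : (Option κ × Fin M) ⊕ Small) = Sum.map e id (.inr j) from rfl,
            (Function.Injective.sumMap he Function.injective_id).extend_apply]
          rfl
      refine h5.swap hP (fun i => not_le.1 i.2) (fun p => ⟨div_nonneg (hs0 _) hM0.le, ?_⟩) ?_
      · exact (div_le_div_of_nonneg_right (hs1 _) hM0.le).trans_lt hMν
      · rw [Fintype.sum_prod_type, ← hstot]
        refine sum_congr rfl fun o _ => ?_
        change ∑ _y : Fin M, s o / M = s o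
        rw [sum_const, card_univ, Fintype.card_fin, nsmul_eq_mul]
        field_simp
    have hfib : ∀ o, ∑ j, (c (o, j) + s o / M) = ∑ j with φ j = o, w j := by
      intro o
      rw [sum_add_distrib, sum_const, card_univ, Fintype.card_fin, nsmul_eq_mul,
        mul_div_cancel₀ _ hM0.ne']
      have h6 : ∑ j, c (o, j) = ∑ j : Big with φ j.1 = o, w j.1 := by
        rw [sum_filter]
        have : ∑ j, c (o, j) = ∑ p : Option κ × Fin M, if p.1 = o then c p else 0 := by
          rw [Fintype.sum_prod_type, sum_eq_single_of_mem o (mem_univ _)]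
          · simp
          · intro b _ hb
            simp [hb]
        rw [this]
        refine (Fintype.sum_of_injective e he _ _ (fun p hp => ?_) fun j => ?_).symm
        · simp [hcz p hp]
        · rw [hce]
      rw [h6, show s o = ∑ j : Small with φ j.1 = o, w j.1 from rfl, sum_filter, sum_filter, sum_filter,
        ← (Equiv.sumCompl fun j => P.ν ≤ w j).sum_comp fun j => if φ j = o then w j else 0,
        Fintype.sum_sum_type]
      rfl
    refine ⟨hx, _, hR, fun j => ⟨?_, ?_⟩, ?_, fun i => ?_⟩
    · rw [Sum.elim_inl]
      by_cases hp : (none, j) ∈ Set.range e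
      · obtain ⟨b, hb⟩ := hp
        have : φ b.1 = none := congrArg Prod.fst hb
        exact absurd (h1 _ this) (not_lt.2 b.2)
      · rw [hcz _ hp]
        exact hP.ν_pos
    · exact (div_le_div_of_nonneg_right (hs1 _) hM0.le).trans_lt hMν
    · exact (hfib none).trans h2
    · exact (hfib (some i)).trans (h3 i)
  · rintro ⟨hx, w, hw, h1, h2, h3⟩
    refine HasCoag.of_family hx (Sum.elim Prod.fst Prod.fst) w hw ?_ ?_ fun i => ?_
    · rintro (⟨o, j⟩ | ⟨o, j⟩) h
      · simp only [Sum.elim_inl] at h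
        exact h ▸ (h1 j).1
      · simp only [Sum.elim_inr] at h
        exact h ▸ (h1 j).2
    · convert (hblock w none).trans h2
    · convert (hblock w (some i)).trans (h3 i)

theorem Semilin.inR0 : Semilin fun x : ι → ℝ => InR0 P x := by
  have hs : ∀ A : Finset ι, IsAff fun x : ι → ℝ => ∑ i ∈ A, x i := fun A =>
    IsAff.sum _ fun i _ => IsAff.coord i
  refine Semilin.and (Semilin.all fun i => (Semilin.le (IsAff.const 0) (IsAff.coord i)).and
    (Semilin.lt (IsAff.coord i) (IsAff.const _))) (Semilin.and (Semilin.eq (hs univ)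
    (IsAff.const 1)) (Semilin.all fun A => Semilin.imp (Semilin.and
    (Semilin.le (IsAff.const _) (hs A)) (Semilin.le (hs A) (IsAff.const _))) (Semilin.or
    (Semilin.eq (hs A) (IsAff.const 0)) (Semilin.eq (hs A) (IsAff.const 1)))))

/-- With a fixed number of pieces the existence of a coagulation is an existential statement over
finitely many reals, and quantifier elimination applies. Without that bound the number of affine
forms would not be finite. -/
theorem Semilin.hasCoag (hP : P.Good) :
    Semilin fun v : Option κ → ℝ => HasCoag P (v none) fun i => v (some i) := by
  obtain ⟨M, hM⟩ := exists_nat_gt (1 / P.ν)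
  simp_rw [HasCoag.iff_bounded hP hM]
  refine Semilin.and (Semilin.all fun i => Semilin.lt (IsAff.const 0) (IsAff.coord _)) ?_
  set K := (Option κ × Fin M) ⊕ (Option κ × Fin M)
  have h : Semilin fun y : Option κ ⊕ K → ℝ =>
      InR0 P (fun k => y (.inr k)) ∧ (∀ j : Fin M, y (.inr (.inl (none, j))) < P.ν ∧
        y (.inr (.inr (none, j))) < P.ν) ∧
      ∑ j : Fin M, (y (.inr (.inl (none, j))) + y (.inr (.inr (none, j)))) =
        y (.inl none) ∧
      ∀ i : κ, ∑ j : Fin M, (y (.inr (.inl (some i, j))) + y (.inr (.inr (some i, j))))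
        = y (.inl (some i)) := by
    have hb : ∀ o : Option κ, IsAff fun y : Option κ ⊕ K → ℝ =>
        ∑ j : Fin M, (y (.inr (.inl (o, j))) + y (.inr (.inr (o, j)))) := fun o =>
      IsAff.sum _ fun j _ => (IsAff.coord _).add (IsAff.coord _)
    refine Semilin.and (Semilin.comp Semilin.inR0 fun j => IsAff.coord _) (Semilin.and ?_
      (Semilin.and (Semilin.eq (hb none) (IsAff.coord _)) (Semilin.all fun i =>
        Semilin.eq (hb (some i)) (IsAff.coord _))))
    exact Semilin.all fun j => (Semilin.lt (IsAff.coord _) (IsAff.const _)).and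
      (Semilin.lt (IsAff.coord _) (IsAff.const _))
  exact h.exists_pi

/-! ### Translation of the sets of vectors -/

/-- When `σ = 0` the small part consists of zeros. Once the vanishing pieces are dropped, a nonempty
proper subsum is neither `0` nor `1`, and the exceptions allowed by `InR0` disappear. -/
theorem mem_coagulations_iff {k : ℕ} {x : Fin k → ℝ} :
    x ∈ coagulations (fundRegion P) k ↔ HasCoag P 0 x := by
  classical
  constructor
  · rintro ⟨m, w, hw, φ, hφ, h⟩
    refine ⟨fun i => ?_, m, fun j => some (φ j), w, fundRegion.inR0 hw, by simp, by simp, ?_⟩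
    · rw [h i]
      obtain ⟨j, hj⟩ := hφ i
      exact sum_pos (fun j _ => (hw.1 j).1) ⟨j, by simp [hj]⟩
    · intro i
      rw [h i]
      simp
  · rintro ⟨hx, m, φ, w, hw, h1, h2, h3⟩
    have hnone : ∀ j, φ j = none → w j = 0 := fun j hj =>
      (sum_eq_zero_iff_of_nonneg fun i _ => (hw.1 i).1).1 h2 j (by simp [hj])
    let Λ := {j : Fin m // w j ≠ 0}
    have hΛ : ∀ j : Λ, (φ j.1).isSome := fun j => by
      rw [Option.isSome_iff_ne_none]
      exact fun h => j.2 (hnone _ h)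
    let e := (Fintype.equivFin Λ).symm
    have hpos : ∀ j : Λ, 0 < w j.1 := fun j => lt_of_le_of_ne (hw.1 _).1 j.2.symm
    have hΛs : ∀ (p : Fin m → Prop) [DecidablePred p], ∑ j : Λ with p j.1, w j.1 = ∑ j with p j, w j := by
      intro p _
      rw [sum_filter, sum_filter]
      have h4 : ∑ j : Λ, (if p j.1 then w j.1 else 0) =
          ∑ j with w j ≠ 0, (if p j then w j else 0) :=
        (sum_subtype _ (by simp) fun j => if p j then w j else 0).symm
      rw [h4, sum_filter_of_ne]
      intro j _ hj h0
      simp [h0] at hj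
    have hsub : ∀ A : Finset (Fin (Fintype.card Λ)), ∃ B : Finset (Fin m),
        ∑ i ∈ A, w (e i).1 = ∑ j ∈ B, w j := fun A =>
      ⟨A.map (e.toEmbedding.trans (Function.Embedding.subtype _)), by rw [sum_map]; rfl⟩
    have h3' : ∀ i, ∑ j with φ j = some i, w j = x i := fun i => by convert h3 i
    have htot : ∑ i, w (e i).1 = 1 := by
      rw [e.sum_comp fun j : Λ => w j.1, ← hw.2.1]
      simpa using hΛs fun _ => True
    refine ⟨Fintype.card Λ, fun i => w (e i).1, ⟨fun i => ⟨hpos _, (hw.1 _).2⟩, htot, ?_⟩,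
      fun i => (φ (e i).1).get (hΛ _), ?_, ?_⟩
    · intro A hA hA' hmem
      obtain ⟨B, hB⟩ := hsub A
      rw [hB] at hmem
      rcases hw.2.2 B hmem with h | h
      · rw [← hB] at h
        exact (sum_pos (fun j _ => hpos (e j)) hA).ne' h
      · rw [← hB] at h
        obtain ⟨i, hi⟩ : ∃ i, i ∉ A := by
          by_contra! hcon
          exact hA' (eq_univ_iff_forall.2 hcon)
        have : ∑ i ∈ A, w (e i).1 < ∑ i, w (e i).1 :=
          sum_lt_sum_of_subset (subset_univ _) (mem_univ i) hi (hpos _) fun j _ _ => (hpos _).le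
        linarith
    · intro i
      have : ∑ j with φ j = some i, w j ≠ 0 := by rw [h3']; exact (hx i).ne'
      obtain ⟨j, hj, hj0⟩ := exists_ne_zero_of_sum_ne_zero this
      refine ⟨e.symm ⟨j, hj0⟩, ?_⟩
      simp only [Equiv.apply_symm_apply]
      exact Option.get_of_eq_some _ (mem_filter.1 hj).2
    · intro i
      rw [← h3' i]
      refine (hΛs fun j => φ j = some i).symm.trans ?_
      rw [sum_filter, sum_filter, ← e.sum_comp fun j : Λ => if φ j.1 = some i then w j.1 else 0]
      refine sum_congr rfl fun j _ => ?_
      refine if_congr ?_ rfl rfl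
      exact Option.eq_some_iff_get_eq.trans (by simp [hΛ])

/-- The vector `x` together with a last component which makes the sum equal to `1 - σ`. -/
def complete {κ : Type*} [Fintype κ] (σ : ℝ) (x : κ → ℝ) : Option κ → ℝ :=
  fun o => o.elim (1 - σ - ∑ i, x i) x

/-- `(x, ξ)` is a subvector of a coagulation for some `ξ` with components `< ν` and sum `σ`. -/
def SubCoag (P : Params) {κ : Type*} [Fintype κ] (σ : ℝ) (x : κ → ℝ) : Prop :=
  HasCoag P σ x ∨ HasCoag P σ (complete σ x)

/-- Restricting a coagulation to some of its components, putting some others into the small part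
and gathering the remaining ones. -/
theorem HasCoag.restrict {σ σ' : ℝ} {y : κ' → ℝ} (h : HasCoag P σ y) {x : κ → ℝ}
    (f : κ' → Option (Option κ)) (hf : ∀ i, f i = none → y i < P.ν)
    (hσ : open Classical in σ' = σ + ∑ i with f i = none, y i)
    (hxy : open Classical in ∀ j, x j = ∑ i with f i = some (some j), y i) (hx : ∀ j, 0 < x j) :
    SubCoag P σ' x := by
  classical
  have htot : σ' + ∑ j, x j + ∑ i with f i = some none, y i = 1 := by
    rw [← h.total, ← sum_fiberwise univ f y, Fintype.sum_option, Fintype.sum_option, hσ,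
      sum_congr rfl fun j _ => hxy j]
    ring
  by_cases hn : ∃ i, f i = some none
  · right
    obtain ⟨i₀, hi₀⟩ := hn
    have hpos : 0 < ∑ i with f i = some none, y i := sum_pos (fun i _ => h.1 i) ⟨i₀, by simp [hi₀]⟩
    refine h.coarsen f hf ?_ hσ ?_
    · rintro (_ | j)
      · simp only [complete, Option.elim_none]
        have h5 : 1 - σ' - ∑ i, x i = ∑ i with f i = some none, y i := by linarith
        rw [h5]
        exact hpos
      · exact hx j
    · rintro (_ | j)
      · simp only [complete, Option.elim_none]
        have h5 : 1 - σ' - ∑ i, x i = ∑ i with f i = some none, y i := by linarith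
        convert h5
      · simp only [complete, Option.elim_some]
        convert hxy j
  · left
    push Not at hn
    refine h.coarsen (fun i => (f i).join) (fun i hi => hf i ?_) hx ?_ fun j => ?_
    · rcases hfi : f i with _ | _ | j
      · rfl
      · exact absurd hfi (hn i)
      · simp [hfi] at hi
    · rw [hσ]
      congr 1
      refine sum_congr (filter_congr fun i _ => ?_) fun _ _ => rfl
      rcases hfi : f i with _ | _ | j
      · simp
      · exact absurd hfi (hn i)
      · simp
    · rw [hxy]
      refine sum_congr (filter_congr fun i _ => ?_) fun _ _ => rfl
      rcases hfi : f i with _ | _ | j <;> simp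

/-- The components that are not selected may be merged into one, whose size is forced by the total
`1`. Hence `x` is itself a coagulation or becomes one with a single further component. The order
does not matter, since coagulations are closed under permutations. -/
theorem mem_regionZ_iff {k : ℕ} {x : Fin k → ℝ} : x ∈ regionZ P k ↔ SubCoag P 0 x := by
  classical
  constructor
  · rintro ⟨m, y, ι, hy, rfl⟩
    rw [mem_coagulations_iff] at hy
    refine hy.restrict (fun i => some (if h : ∃ j, ι j = i then some h.choose else none))
      (by simp) (by simp) (fun j => ?_) fun j => hy.1 _
    rw [sum_eq_single_of_mem (ι j)]
    · simp only [mem_filter, mem_univ, true_and, Option.some.injEq]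
      have h : ∃ j', ι j' = ι j := ⟨j, rfl⟩
      rw [dif_pos h, Option.some.injEq]
      exact ι.injective h.choose_spec
    · intro b hb hne
      simp only [mem_filter, mem_univ, true_and, Option.some.injEq] at hb
      by_cases h : ∃ j, ι j = b
      · rw [dif_pos h, Option.some.injEq] at hb
        exact absurd (hb ▸ h.choose_spec).symm hne
      · rw [dif_neg h] at hb
        cases hb
  · rintro (h | h)
    · exact ⟨k, x, (OrderIso.refl _).toOrderEmbedding, mem_coagulations_iff.2 h, rfl⟩
    · have := h.reindex (finSuccEquivLast)
      refine ⟨k + 1, _, Fin.castSuccOrderEmb, mem_coagulations_iff.2 this, ?_⟩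
      funext i
      simp [complete]

/-- The sums `|ξ|` in the definition of `ψ(x)` are exactly the `σ` with `SubCoag P σ x`: the
components of `ξ` move into the small part, and `HasCoag.expose` moves them back. These `σ` are
bounded by `1` and include `0`, so the bound for the supremum is a bound for each of them. -/
theorem mem_regionG1_iff {k : ℕ} {x : Fin k → ℝ} : x ∈ regionG1 P k ↔
    SubCoag P 0 x ∧ (∀ i, P.ν ≤ x i) ∧ ∀ σ, SubCoag P σ x → ∑ i, x i + σ ≤ P.γ := by
  classical
  have hpos : ∀ {σ} {y : Fin k → ℝ}, SubCoag P σ y → ∀ i, 0 < y i := by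
    rintro σ y (h | h) i
    · exact h.1 i
    · exact h.1 (some i)
  have hle : ∀ {σ} {y : Fin k → ℝ}, SubCoag P σ y → σ ≤ 1 := by
    rintro σ y (h | h)
    · have := h.total
      have h' : 0 ≤ ∑ i, y i := sum_nonneg fun i _ => (h.1 i).le
      linarith
    · have := h.total
      have h' : 0 ≤ ∑ i, complete σ y i := sum_nonneg fun i _ => (h.1 i).le
      linarith
  have hset : ∀ s : ℝ, (∃ (l : ℕ) (ξ : Fin l → ℝ), (∀ i, ξ i < P.ν) ∧
      Fin.append x ξ ∈ regionZ P (k + l) ∧ s = ∑ i, ξ i) ↔ SubCoag P s x := by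
    intro s
    constructor
    · rintro ⟨l, ξ, hξ, hZ, rfl⟩
      rw [mem_regionZ_iff] at hZ
      have hx : ∀ i, 0 < x i := fun i => by
        have : 0 < Fin.append x ξ (Fin.castAdd l i) := by
          rcases hZ with h | h
          · exact h.1 _
          · exact h.1 (some (Fin.castAdd l i))
        simpa using this
      rcases hZ with h | h
      · have h' := h.reindex finSumFinEquiv
        refine h'.restrict (Sum.elim (fun i => some (some i)) fun _ => none) ?_ ?_ ?_ hx
        · rintro (i | i) hi
          · simp at hi
          · simpa using hξ i
        · simp [sum_filter]
        · intro j
          simp [sum_filter]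
      · have h' := h.reindex (Equiv.optionCongr finSumFinEquiv)
        refine h'.restrict (fun o => o.elim (some none)
          (Sum.elim (fun i => some (some i)) fun _ => none)) ?_ ?_ ?_ hx
        · rintro (_ | i | i) hi
          · simp at hi
          · simp at hi
          · simpa [complete] using hξ i
        · simp [sum_filter, complete, Fintype.sum_option]
        · intro j
          simp [sum_filter, complete, Fintype.sum_option]
    · rintro (h | h)
      · obtain ⟨l, ξ, hξ, rfl, h0⟩ := h.expose
        refine ⟨l, ξ, fun i => (hξ i).2, mem_regionZ_iff.2 (Or.inl ?_), rfl⟩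
        convert h0.reindex finSumFinEquiv.symm using 1
        funext i
        refine Fin.addCases (fun i => ?_) (fun i => ?_) i <;> simp
      · obtain ⟨l, ξ, hξ, rfl, h0⟩ := h.expose
        refine ⟨l, ξ, fun i => (hξ i).2, mem_regionZ_iff.2 ?_, rfl⟩
        refine h0.restrict (Sum.elim (fun o => o.elim (some none)
          fun i => some (some (Fin.castAdd l i))) fun i => some (some (Fin.natAdd k i))) ?_ ?_ ?_ ?_
        · rintro ((_ | i) | i) hi <;> simp at hi
        · simp [sum_filter, Fintype.sum_option]
        · intro j
          refine Fin.addCases (fun j => ?_) (fun j => ?_) j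
          · simp only [sum_filter, Fintype.sum_sum_type, Fintype.sum_option, complete, Fin.ext_iff,
              Sum.elim_inl, Sum.elim_inr, Option.elim_none, Option.elim_some, Option.some.injEq,
              reduceCtorEq, if_false, zero_add, Fin.val_castAdd, Fin.val_natAdd, Fin.append_left]
            have h6 : ∀ i : Fin l, ¬ k + (i : ℕ) = j := fun i => by have := j.2; omega
            have h7 : ∀ i : Fin k, ((i : ℕ) = j) = (i = j) := fun i => by rw [Fin.ext_iff]
            simp [h6, h7]
          · simp only [sum_filter, Fintype.sum_sum_type, Fintype.sum_option, complete, Fin.ext_iff,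
              Sum.elim_inl, Sum.elim_inr, Option.elim_none, Option.elim_some, Option.some.injEq,
              reduceCtorEq, if_false, zero_add, Fin.val_castAdd, Fin.val_natAdd, Fin.append_right]
            have h6 : ∀ i : Fin k, ¬ (i : ℕ) = k + j := fun i => by have := i.2; omega
            have h7 : ∀ i : Fin l, ((i : ℕ) = j) = (i = j) := fun i => by rw [Fin.ext_iff]
            simp [h6, h7]
        · intro j
          refine Fin.addCases (fun j => ?_) (fun j => ?_) j
          · rw [Fin.append_left]
            exact h.1 (some j)
          · simpa using (hξ j).1
  have hS : {s : ℝ | ∃ (l : ℕ) (ξ : Fin l → ℝ), (∀ i, ξ i < P.ν) ∧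
      Fin.append x ξ ∈ regionZ P (k + l) ∧ s = ∑ i, ξ i} = {s | SubCoag P s x} :=
    Set.ext hset
  change x ∈ regionZ P k ∧ (∀ i, P.ν ≤ x i) ∧ (∑ i, x i) + psi P x ≤ P.γ ↔ _
  rw [psi, hS, mem_regionZ_iff]
  refine and_congr_right fun hZ => and_congr_right fun _ => ?_
  have hbdd : BddAbove {s | SubCoag P s x} := ⟨1, fun s hs => hle hs⟩
  rw [← le_sub_iff_add_le', csSup_le_iff hbdd ⟨0, hZ⟩]
  exact forall₂_congr fun s _ => le_sub_iff_add_le'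

theorem Semilin.subCoag (hP : P.Good) :
    Semilin fun v : Option κ → ℝ => SubCoag P (v none) fun i => v (some i) := by
  refine (Semilin.hasCoag hP).or ?_
  have := (Semilin.hasCoag (κ := Option κ) hP).comp (I := Option κ)
    (A := fun v o => o.elim (v none) (complete (v none) fun i => v (some i))) (by
      rintro (_ | _ | i)
      · exact IsAff.coord none
      · exact ((IsAff.const 1).sub (IsAff.coord none)).sub (IsAff.sum _ fun i _ => IsAff.coord _)
      · exact IsAff.coord (some i))
  exact this

theorem Semilin.regionG1 (hP : P.Good) (k : ℕ) : Semilin fun x : Fin k → ℝ => x ∈ regionG1 P k := by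
  simp_rw [mem_regionG1_iff]
  refine Semilin.and ?_ (Semilin.and (Semilin.all fun i => Semilin.le (IsAff.const _)
    (IsAff.coord i)) ?_)
  · refine (Semilin.subCoag hP).comp (I := Fin k) (A := fun v o => o.elim 0 v) ?_
    rintro (_ | i)
    · exact IsAff.const 0
    · exact IsAff.coord i
  · have h : Semilin fun v : Option (Fin k) → ℝ => ¬ (SubCoag P (v none) (fun i => v (some i)) →
        ∑ i, v (some i) + v none ≤ P.γ) :=
      (Semilin.imp (Semilin.subCoag hP) (Semilin.le ((IsAff.sum _ fun i _ =>
        IsAff.coord (some i)).add (IsAff.coord none)) (IsAff.const _))).map Not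
    have := h.exists_real.map Not
    simpa using this

theorem Semilin.coagulations (hP : P.Good) (k : ℕ) :
    Semilin fun x : Fin k → ℝ => x ∈ coagulations (fundRegion P) k := by
  simp_rw [mem_coagulations_iff]
  refine (Semilin.hasCoag hP).comp (I := Fin k) (A := fun v o => o.elim 0 v) ?_
  rintro (_ | i)
  · exact IsAff.const 0
  · exact IsAff.coord i

end

/-! ### Schur multipliers of bilinear forms -/

section
variable {α β : Type*} {S : Finset α} {S' : Finset β}

/-- The bilinear form with matrix `M` is bounded by `Δ` on the unit balls of `ℓ^∞`. -/
def SchurBd (S : Finset α) (S' : Finset β) (M : α → β → ℝ) (Δ : ℝ) : Prop :=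
  ∀ (ξ : α → ℝ) (κ : β → ℝ), (∀ a, |ξ a| ≤ 1) → (∀ b, |κ b| ≤ 1) →
    |∑ a ∈ S, ∑ b ∈ S', ξ a * κ b * M a b| ≤ Δ

/-- `φ` is a Schur multiplier with constant `c`. -/
def SM (S : Finset α) (S' : Finset β) (c : ℝ) (φ : α → β → ℝ) : Prop :=
  0 ≤ c ∧ ∀ (M : α → β → ℝ) (Δ : ℝ), SchurBd S S' M Δ →
    SchurBd S S' (fun a b => φ a b * M a b) (c * Δ)

theorem SchurBd.nonneg {M : α → β → ℝ} {Δ : ℝ} (h : SchurBd S S' M Δ) : 0 ≤ Δ :=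
  (abs_nonneg _).trans (h (fun _ => 0) (fun _ => 0) (by simp) (by simp))

namespace SM

theorem congr {c : ℝ} {φ ψ : α → β → ℝ} (h : SM S S' c φ)
    (hφ : ∀ a ∈ S, ∀ b ∈ S', φ a b = ψ a b) : SM S S' c ψ := by
  refine ⟨h.1, fun M Δ hM ξ κ hξ hκ => ?_⟩
  have := h.2 M Δ hM ξ κ hξ hκ
  have h2 : ∑ a ∈ S, ∑ b ∈ S', ξ a * κ b * (φ a b * M a b) =
      ∑ a ∈ S, ∑ b ∈ S', ξ a * κ b * (ψ a b * M a b) :=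
    sum_congr rfl fun a ha => sum_congr rfl fun b hb => by rw [hφ a ha b hb]
  rwa [h2] at this

theorem mono {c d : ℝ} {φ : α → β → ℝ} (h : SM S S' c φ) (hcd : c ≤ d) : SM S S' d φ :=
  ⟨h.1.trans hcd, fun M Δ hM ξ κ hξ hκ => (h.2 M Δ hM ξ κ hξ hκ).trans
    (mul_le_mul_of_nonneg_right hcd hM.nonneg)⟩

theorem sep {u : α → ℝ} {v : β → ℝ} (hu : ∀ a, |u a| ≤ 1) (hv : ∀ b, |v b| ≤ 1) :
    SM S S' 1 fun a b => u a * v b := by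
  refine ⟨zero_le_one, fun M Δ hM ξ κ hξ hκ => ?_⟩
  rw [one_mul]
  have : ∀ a b, ξ a * κ b * (u a * v b * M a b) = ξ a * u a * (κ b * v b) * M a b :=
    fun a b => by ring
  simp only [this]
  refine hM (fun a => ξ a * u a) (fun b => κ b * v b) (fun a => ?_) (fun b => ?_)
  · rw [abs_mul]; exact mul_le_one₀ (hξ a) (abs_nonneg _) (hu a)
  · rw [abs_mul]; exact mul_le_one₀ (hκ b) (abs_nonneg _) (hv b)

theorem one : SM S S' 1 fun _ _ => 1 := by
  simpa using sep (S := S) (S' := S') (u := fun _ => 1) (v := fun _ => 1) (by simp) (by simp)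

theorem left {u : α → ℝ} (hu : ∀ a, |u a| ≤ 1) : SM S S' 1 fun a _ => u a := by
  simpa using sep (S := S) (S' := S') (v := fun _ => 1) hu (by simp)

theorem mul {c d : ℝ} {φ ψ : α → β → ℝ} (h : SM S S' c φ) (h' : SM S S' d ψ) :
    SM S S' (c * d) fun a b => φ a b * ψ a b := by
  refine ⟨mul_nonneg h.1 h'.1, fun M Δ hM => ?_⟩
  have := h.2 _ _ (h'.2 M Δ hM)
  simpa only [mul_assoc] using this

theorem add {c d : ℝ} {φ ψ : α → β → ℝ} (h : SM S S' c φ) (h' : SM S S' d ψ) :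
    SM S S' (c + d) fun a b => φ a b + ψ a b := by
  refine ⟨add_nonneg h.1 h'.1, fun M Δ hM ξ κ hξ hκ => ?_⟩
  simp only [add_mul, mul_add, sum_add_distrib]
  exact (abs_add_le _ _).trans (add_le_add (h.2 M Δ hM ξ κ hξ hκ) (h'.2 M Δ hM ξ κ hξ hκ))

theorem smul {c : ℝ} {φ : α → β → ℝ} (r : ℝ) (h : SM S S' c φ) :
    SM S S' (|r| * c) fun a b => r * φ a b := by
  refine ⟨mul_nonneg (abs_nonneg _) h.1, fun M Δ hM ξ κ hξ hκ => ?_⟩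
  have : ∑ a ∈ S, ∑ b ∈ S', ξ a * κ b * (r * φ a b * M a b) =
      r * ∑ a ∈ S, ∑ b ∈ S', ξ a * κ b * (φ a b * M a b) := by
    simp only [mul_sum]
    exact sum_congr rfl fun a _ => sum_congr rfl fun b _ => by ring
  rw [this, abs_mul, mul_assoc]
  exact mul_le_mul_of_nonneg_left (h.2 M Δ hM ξ κ hξ hκ) (abs_nonneg _)

theorem sub {c d : ℝ} {φ ψ : α → β → ℝ} (h : SM S S' c φ) (h' : SM S S' d ψ) :
    SM S S' (c + d) fun a b => φ a b - ψ a b := by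
  have := h.add (h'.smul (-1))
  simpa [sub_eq_add_neg] using this

theorem sum {κ : Type*} (s : Finset κ) {c : κ → ℝ} {φ : κ → α → β → ℝ}
    (h : ∀ k ∈ s, SM S S' (c k) (φ k)) : SM S S' (∑ k ∈ s, c k) fun a b => ∑ k ∈ s, φ k a b := by
  classical
  induction s using Finset.induction_on with
  | empty =>
    refine ⟨le_rfl, fun M Δ _ ξ κ _ _ => by simp⟩
  | insert a s ha ih =>
    simp only [sum_insert ha]
    exact (h a (by simp)).add (ih fun k hk => h k (by simp [hk]))

theorem prod {κ : Type*} (s : Finset κ) {c : κ → ℝ} {φ : κ → α → β → ℝ}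
    (h : ∀ k ∈ s, SM S S' (c k) (φ k)) : SM S S' (∏ k ∈ s, c k) fun a b => ∏ k ∈ s, φ k a b := by
  classical
  induction s using Finset.induction_on with
  | empty => simpa using one
  | insert a s ha ih =>
    simp only [prod_insert ha]
    exact (h a (by simp)).mul (ih fun k hk => h k (by simp [hk]))

/-- Two numbers agree if all their binary digits agree. For one digit, with signs `s, s' = ±1`, the
indicator of equality is `(1 + s s') / 2`, whose constant is `1`; so the product over all digits
costs nothing. -/
theorem eq_nat (L : ℕ) : ∀ (ρ : α → ℕ) (σ : β → ℕ), (∀ a, ρ a < 2 ^ L) → (∀ b, σ b < 2 ^ L) →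
    SM S S' 1 fun a b => if ρ a = σ b then 1 else 0 := by
  induction L with
  | zero =>
    intro ρ σ hρ hσ
    refine one.congr fun a _ b _ => ?_
    have h1 := hρ a
    have h2 := hσ b
    rw [if_pos (by omega)]
  | succ L ih =>
    intro ρ σ hρ hσ
    have h := ih (fun a => ρ a / 2) (fun b => σ b / 2) (fun a => by have := hρ a; omega)
      fun b => by have := hσ b; omega
    have h' : SM S S' (|2⁻¹| * (1 + 1)) fun a b => (2⁻¹ : ℝ) * (1 +
        (if ρ a % 2 = 0 then (1 : ℝ) else -1) * (if σ b % 2 = 0 then 1 else -1)) :=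
      (one.add (sep (fun a => by split_ifs <;> simp) fun b => by split_ifs <;> simp)).smul _
    refine ((h.mul h').mono (by norm_num [abs_of_pos])).congr fun a _ b _ => ?_
    rcases Nat.mod_two_eq_zero_or_one (ρ a) with h1 | h1 <;>
    rcases Nat.mod_two_eq_zero_or_one (σ b) with h2 | h2 <;> simp only [h1, h2] <;>
    split_ifs <;> first | contradiction | omega | norm_num

/-- `ρ < σ` holds if `ρ / 2 < σ / 2`, or if these are equal and the last digits are `0` and `1`. The
second case has constant `1`, so each digit adds `1` to the norm, which becomes logarithmic in the
size of the sets. -/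
theorem lt_nat (L : ℕ) : ∀ (ρ : α → ℕ) (σ : β → ℕ), (∀ a, ρ a < 2 ^ L) → (∀ b, σ b < 2 ^ L) →
    SM S S' L fun a b => if ρ a < σ b then 1 else 0 := by
  induction L with
  | zero =>
    intro ρ σ hρ hσ
    refine ((sum ∅ (c := fun _ : ℕ => 0) (φ := fun _ _ _ => 0) (by simp)).mono (by simp)).congr
      fun a _ b _ => ?_
    have h1 := hρ a
    have h2 := hσ b
    rw [if_neg (by omega)]
    simp
  | succ L ih =>
    intro ρ σ hρ hσ
    have hρ' : ∀ a, ρ a / 2 < 2 ^ L := fun a => by have := hρ a; omega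
    have hσ' : ∀ b, σ b / 2 < 2 ^ L := fun b => by have := hσ b; omega
    have h := ih _ _ hρ' hσ'
    have h' : SM S S' 1 fun a b => (if ρ a % 2 = 0 then (1 : ℝ) else 0) *
        (if σ b % 2 = 0 then 0 else 1) :=
      sep (fun a => by split_ifs <;> simp) fun b => by split_ifs <;> simp
    refine ((h.add ((eq_nat L _ _ hρ' hσ').mul h')).mono (by push_cast; simp)).congr
      fun a _ b _ => ?_
    rcases Nat.mod_two_eq_zero_or_one (ρ a) with h1 | h1 <;>
    rcases Nat.mod_two_eq_zero_or_one (σ b) with h2 | h2 <;> simp only [h1, h2] <;>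
    split_ifs <;> first | contradiction | omega | norm_num

/-- Only the order of the finitely many values on the two sets matters, so values in any linear
order may be replaced by ranks with few binary digits. -/
theorem exists_rank {γ : Type*} [LinearOrder γ] (f : α → γ) (g : β → γ) {L : ℕ}
    (hL : #S + #S' < 2 ^ L) :
    ∃ (ρ : α → ℕ) (σ : β → ℕ), (∀ a, ρ a < 2 ^ L) ∧ (∀ b, σ b < 2 ^ L) ∧
      ∀ a ∈ S, ∀ b ∈ S', (ρ a < σ b ↔ f a < g b) ∧ (ρ a = σ b ↔ f a = g b) := by
  classical
  set V := S.image f ∪ S'.image g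
  have hV : #V < 2 ^ L := ((card_union_le _ _).trans
    (add_le_add card_image_le card_image_le)).trans_lt hL
  have hr : ∀ v, #{y ∈ V | y < v} < 2 ^ L := fun v => (card_filter_le _ _).trans_lt hV
  have hmono : ∀ v ∈ V, ∀ v', v < v' → #{y ∈ V | y < v} < #{y ∈ V | y < v'} := fun v hv v' h => by
    refine card_lt_card ⟨fun y hy => ?_, fun hsub => ?_⟩
    · rw [mem_filter] at hy ⊢
      exact ⟨hy.1, hy.2.trans h⟩
    · have := hsub (mem_filter.2 ⟨hv, h⟩)
      simp at this
  refine ⟨fun a => #{y ∈ V | y < f a}, fun b => #{y ∈ V | y < g b}, fun a => hr _, fun b => hr _,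
    fun a ha b hb => ?_⟩
  have ha' : f a ∈ V := mem_union_left _ (mem_image_of_mem _ ha)
  have hb' : g b ∈ V := mem_union_right _ (mem_image_of_mem _ hb)
  rcases lt_trichotomy (f a) (g b) with h | h | h
  · have := hmono _ ha' _ h
    simp [h, h.ne, this, this.ne]
  · simp [h]
  · have := hmono _ hb' _ h
    simp [h.not_gt, h.ne', this.not_gt, this.ne']

theorem eq_of_card {γ : Type*} [LinearOrder γ] (f : α → γ) (g : β → γ) {L : ℕ}
    (hL : #S + #S' < 2 ^ L) : SM S S' 1 fun a b => if f a = g b then 1 else 0 := by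
  obtain ⟨ρ, σ, hρ, hσ, h⟩ := exists_rank (S := S) (S' := S') f g hL
  exact (eq_nat L ρ σ hρ hσ).congr fun a ha b hb => by simp only [(h a ha b hb).2]

theorem lt_of_card {γ : Type*} [LinearOrder γ] (f : α → γ) (g : β → γ) {L : ℕ}
    (hL : #S + #S' < 2 ^ L) : SM S S' L fun a b => if f a < g b then 1 else 0 := by
  obtain ⟨ρ, σ, hρ, hσ, h⟩ := exists_rank (S := S) (S' := S') f g hL
  exact (lt_nat L ρ σ hρ hσ).congr fun a ha b hb => by simp only [(h a ha b hb).1]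

theorem le_of_card {γ : Type*} [LinearOrder γ] (f : α → γ) (g : β → γ) {L : ℕ}
    (hL : #S + #S' < 2 ^ L) : SM S S' (L + 1) fun a b => if f a ≤ g b then 1 else 0 := by
  refine ((lt_of_card f g hL).add (eq_of_card f g hL)).congr fun a _ b _ => ?_
  rcases lt_trichotomy (f a) (g b) with h | h | h
  · simp [h, h.le, h.ne]
  · simp [h]
  · simp [h.not_ge, h.not_gt, h.ne']

theorem sign_of_card (f : α → ℝ) (g : β → ℝ) {L : ℕ} (hL : #S + #S' < 2 ^ L) (s : SignType) :
    SM S S' (L + 1) fun a b => if SignType.sign (f a + g b) = s then 1 else 0 := by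
  cases s with
  | zero =>
    refine ((eq_of_card f (fun b => - g b) hL).mono (by simp)).congr fun a _ b _ => ?_
    simp [sign_eq_zero_iff, eq_neg_iff_add_eq_zero]
  | neg =>
    refine ((lt_of_card f (fun b => - g b) hL).mono (by simp)).congr fun a _ b _ => ?_
    simp [sign_eq_neg_one_iff, lt_neg_iff_add_neg]
  | pos =>
    refine ((lt_of_card (fun a => - f a) g hL).mono (by simp)).congr fun a _ b _ => ?_
    simp [sign_eq_one_iff, neg_lt_iff_pos_add']

/-- The function is the sum, over the at most `3 ^ K` sign patterns, of its value there times the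
indicator of the pattern. That indicator is a product of at most `K` comparisons between a function
of `a` and a function of `b`, each costing `L + 1`. -/
theorem signFn {I : Type*} [Fintype I] {Ω : (I → ℝ) → ℝ} {K : ℕ} (hΩ : SignFn K Ω)
    (h1 : ∀ v, |Ω v| ≤ 1) (f : α → I → ℝ) (g : β → I → ℝ) {L : ℕ} (hL : #S + #S' < 2 ^ L) :
    SM S S' ((3 * (L + 1)) ^ K) fun a b => Ω (fun i => f a i + g b i) := by
  classical
  obtain ⟨F, hF, hs⟩ := hΩ
  -- The value on a pattern is read off at a chosen vector; the default `0` belongs to patterns that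
  -- no vector realises.
  have key : ∀ σ : F → SignType, SM S S' (1 * ∏ l : F, ((L : ℝ) + 1)) fun a b =>
      (if h : ∃ v, ∀ l : F, SignType.sign (affEval l.1 v) = σ l then Ω h.choose else 0) *
      ∏ l : F, if SignType.sign ((∑ i, l.1.1 i * f a i) + (∑ i, l.1.1 i * g b i + l.1.2)) = σ l
        then 1 else 0 := fun σ => by
    refine SM.mul (left fun _ => ?_) (prod _ fun l _ => sign_of_card _ _ hL _)
    split_ifs
    · exact h1 _
    · simp
  refine ((SM.sum univ fun σ _ => key σ).mono ?_).congr fun a _ b _ => ?_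
  · rw [sum_const, prod_const, one_mul, nsmul_eq_mul, card_univ, card_univ, Fintype.card_fun,
      Fintype.card_coe]
    have : Fintype.card SignType = 3 := by decide
    rw [this, mul_pow, Nat.cast_pow]
    have h3 : (1 : ℝ) ≤ L + 1 := by simp
    exact mul_le_mul (by exact_mod_cast pow_le_pow_right₀ (by norm_num) hF)
      (pow_le_pow_right₀ h3 hF) (by positivity) (by positivity)
  · have hv : ∀ l : F, SignType.sign ((∑ i, l.1.1 i * f a i) + (∑ i, l.1.1 i * g b i + l.1.2)) =
        SignType.sign (affEval l.1 fun i => f a i + g b i) := fun l => by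
      simp only [affEval, mul_add, sum_add_distrib, add_assoc]
    rw [sum_eq_single_of_mem (fun l : F => SignType.sign (affEval l.1 fun i => f a i + g b i))
      (mem_univ _)]
    · have hex : ∃ v, ∀ l : F, SignType.sign (affEval l.1 v) =
          SignType.sign (affEval l.1 fun i => f a i + g b i) := ⟨_, fun l => rfl⟩
      rw [dif_pos hex, hs hex.choose (fun i => f a i + g b i) fun l hl => hex.choose_spec ⟨l, hl⟩]
      simp [hv]
    · intro σ _ hσ
      obtain ⟨l, hl⟩ := Function.ne_iff.1 hσ
      rw [prod_eq_zero (mem_univ l), mul_zero]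
      rw [hv, if_neg hl.symm]

end SM

end

/-! ### Sums over tuples of positive integers -/

open Classical in
/-- The tuples of positive integers bounded by `N`. -/
def box (I : Type*) [Fintype I] (N : ℕ) : Finset (I → ℕ) :=
  Fintype.piFinset fun _ => Icc 1 N

section
variable {I : Type*} [Fintype I]

theorem mem_box {N : ℕ} {f : I → ℕ} : f ∈ box I N ↔ ∀ i, 1 ≤ f i ∧ f i ≤ N := by
  simp [box]

theorem mem_box_of_prod_le {N : ℕ} {f : I → ℕ} (h : ∀ i, 1 ≤ f i) (hN : ∏ i, f i ≤ N) :
    f ∈ box I N :=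
  mem_box.2 fun i => ⟨h i, (single_le_prod' (f := f) (fun i _ => h i) (mem_univ i)).trans hN⟩

/-- Each component of a factorization is a divisor, hence the bound by a power of the divisor
function. It is the reason why the Type I and Type II bounds allow coefficients up to `τ ^ B`. -/
theorem card_filter_prod_eq_le (N m : ℕ) (hm : m ≠ 0) :
    #{f ∈ box I N | ∏ i, f i = m} ≤ #m.divisors ^ Fintype.card I := by
  classical
  have : #(Fintype.piFinset fun _ : I => m.divisors) = #m.divisors ^ Fintype.card I := by
    rw [Fintype.card_piFinset, prod_const, card_univ]
  rw [← this]
  refine card_le_card fun f hf => ?_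
  rw [mem_filter] at hf
  rw [Fintype.mem_piFinset]
  intro i
  rw [Nat.mem_divisors]
  exact ⟨hf.2 ▸ dvd_prod_of_mem f (mem_univ i), hm⟩

theorem card_box (N : ℕ) : #(box I N) = N ^ Fintype.card I := by
  simp [box]

/-- The sum of `W f * w (∏ f)` over the tuples `f`. -/
def tupleSum (N : ℕ) (w : ℕ → ℝ) (W : (I → ℕ) → ℝ) : ℝ := ∑ f ∈ box I N, W f * w (∏ i, f i)

end

/-- The logarithms of the components of a tuple. -/
def lg {I : Type*} (f : I → ℕ) : I → ℝ := fun i => Real.log (f i)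

/-- A sequence on `(x/2, x]` which satisfies the Type I and Type II bounds. -/
structure Balanced (P : Params) (B x : ℝ) (w : ℕ → ℝ) : Prop where
  good : P.Good
  eight_le : 8 ≤ x
  supp : ∀ n : ℕ, w n ≠ 0 → x / 2 < n ∧ (n : ℝ) ≤ x
  type_one : TypeI P B x w
  type_two : TypeII P B x w

theorem one_le_tau {m : ℕ} (hm : m ≠ 0) : 1 ≤ tau m := by
  unfold tau
  exact_mod_cast Nat.one_le_iff_ne_zero.2 (card_ne_zero_of_mem (Nat.mem_divisors_self m hm))

section
variable {I : Type*} [Fintype I] {P : Params} {B x : ℝ} {w : ℕ → ℝ}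

theorem sum_fiber_mul_sum_fiber {α β : Type*} (S : Finset α) (S' : Finset β) (p : α → ℕ) (q : β → ℕ)
    (ξ : α → ℝ) (κ : β → ℝ) (Φ : Finset (ℕ × ℕ)) (W : ℕ → ℕ → ℝ) :
    ∑ r ∈ Φ, (∑ F ∈ S with p F = r.1, ξ F) * (∑ G ∈ S' with q G = r.2, κ G) * W r.1 r.2 =
      ∑ F ∈ S, ∑ G ∈ S', ξ F * κ G * (if (p F, q G) ∈ Φ then W (p F) (q G) else 0) := by
  have h1 : ∀ r ∈ Φ, (∑ F ∈ S with p F = r.1, ξ F) * (∑ G ∈ S' with q G = r.2, κ G) * W r.1 r.2 =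
      ∑ F ∈ S, ∑ G ∈ S', if r = (p F, q G) then ξ F * κ G * W (p F) (q G) else 0 := by
    intro r _
    rw [sum_filter, sum_filter, sum_mul_sum, sum_mul]
    refine sum_congr rfl fun F _ => ?_
    rw [sum_mul]
    refine sum_congr rfl fun G _ => ?_
    by_cases h1 : p F = r.1
    · by_cases h2 : q G = r.2
      · simp [h1, h2]
      · simp [h2, Prod.ext_iff, Ne.symm h2]
    · simp [h1, Prod.ext_iff, Ne.symm h1]
  rw [sum_congr rfl h1, sum_comm]
  refine sum_congr rfl fun F hF => ?_
  rw [sum_comm]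
  refine sum_congr rfl fun G hG => ?_
  rw [sum_ite_eq', mul_ite, mul_zero]

theorem norm_sum_fiber_le (hB : Fintype.card I ≤ B) (N : ℕ) (η : (I → ℕ) → ℝ) (hη : ∀ F, |η F| ≤ 1)
    (m : ℕ) (hm : 1 ≤ m) :
    ‖((∑ F ∈ box I N with ∏ i, F i = m, η F : ℝ) : ℂ)‖ ≤ tau m ^ B := by
  rw [Complex.norm_real, Real.norm_eq_abs]
  refine (abs_sum_le_sum_abs _ _).trans ((sum_le_sum fun F _ => hη F).trans ?_)
  rw [sum_const, nsmul_eq_mul, mul_one]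
  have h1 := card_filter_prod_eq_le (I := I) N m (by omega)
  calc ((#{F ∈ box I N | ∏ i, F i = m} : ℕ) : ℝ) ≤ ((#m.divisors ^ Fintype.card I : ℕ) : ℝ) := by
        exact_mod_cast h1
    _ = tau m ^ (Fintype.card I : ℝ) := by rw [Real.rpow_natCast]; simp [tau]
    _ ≤ tau m ^ B := Real.rpow_le_rpow_of_exponent_le (one_le_tau (by omega)) hB

/-- Tuples with equal product are collected. Bounded coefficients of tuples then give coefficients
`≤ τ ^ B` of the products, to which the Type II bound applies; the other range conditions are
implied by the support of `w`. -/
theorem Balanced.schurBd (h : Balanced P B x w) (hB : Fintype.card I ≤ B) :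
    SchurBd (box I ⌊x⌋₊) (box I ⌊x⌋₊) (fun F G =>
      if (x / 2) ^ P.θ < ((∏ i, F i : ℕ) : ℝ) ∧ ((∏ i, F i : ℕ) : ℝ) ≤ x ^ (P.θ + P.ν) then
        w ((∏ i, F i) * ∏ i, G i) else 0) (x / Real.log x ^ B) := by
  intro ξ κ hξ hκ
  have hx0 : 0 ≤ x := by linarith [h.eight_le]
  set N := ⌊x⌋₊
  have h0 := h.type_two _ _ (norm_sum_fiber_le hB N ξ hξ) (norm_sum_fiber_le hB N κ hκ)
  simp only [← Complex.ofReal_mul, ← Complex.ofReal_sum, Complex.norm_real, Real.norm_eq_abs]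
    at h0
  rw [sum_fiber_mul_sum_fiber (W := fun m n => w (m * n))] at h0
  refine le_of_eq_of_le (congrArg _ (sum_congr rfl fun F hF => sum_congr rfl fun G hG => ?_)) h0
  have hF1 : 1 ≤ ∏ i, F i := Finset.one_le_prod' fun i _ => (mem_box.1 hF i).1
  have hG1 : 1 ≤ ∏ i, G i := Finset.one_le_prod' fun i _ => (mem_box.1 hG i).1
  congr 1
  by_cases hw : w ((∏ i, F i) * ∏ i, G i) = 0
  · simp [hw]
  obtain ⟨h2, h3⟩ := h.supp _ hw
  have h4 : (∏ i, F i) * ∏ i, G i ≤ N := Nat.le_floor h3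
  have h5 : ∏ i, F i ≤ N := (Nat.le_mul_of_pos_right _ hG1).trans h4
  have h6 : ∏ i, G i ≤ N := (Nat.le_mul_of_pos_left _ hF1).trans h4
  refine if_congr ?_ rfl rfl
  rw [mem_filter, mem_product, mem_Icc, mem_Icc]
  rw [Nat.cast_mul] at h2 h3
  exact ⟨fun hh => ⟨⟨⟨hF1, h5⟩, hG1, h6⟩, hh.1, hh.2, h2, h3⟩, fun hh => ⟨hh.2.1, hh.2.2.1⟩⟩

end

/-! ### Error bounds -/

/-- The admissible errors `A (log x)^A x / (log x)^B`. -/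
def errBd (A : ℕ) (B x : ℝ) : ℝ := A * Real.log x ^ A * (x / Real.log x ^ B)

theorem two_le_log {x : ℝ} (hx : 8 ≤ x) : 2 ≤ Real.log x := by
  rw [Real.le_log_iff_exp_le (by linarith)]
  have h := Real.exp_one_lt_d9
  have h2 : Real.exp 2 = Real.exp 1 ^ 2 := by rw [← Real.exp_nat_mul]; norm_num
  rw [h2]
  nlinarith [Real.exp_pos 1]

theorem errBd_nonneg {A : ℕ} {B x : ℝ} (hx : 8 ≤ x) : 0 ≤ errBd A B x := by
  have := two_le_log hx
  unfold errBd
  positivity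

theorem le_errBd {M : ℝ} {k A : ℕ} {B x : ℝ} (hx : 8 ≤ x) (hM : M ≤ A) (hk : k ≤ A) :
    M * Real.log x ^ k * (x / Real.log x ^ B) ≤ errBd A B x := by
  have := two_le_log hx
  unfold errBd
  gcongr
  linarith

theorem errBd_mono {A A' : ℕ} {B x : ℝ} (hx : 8 ≤ x) (h : A ≤ A') : errBd A B x ≤ errBd A' B x :=
  le_errBd hx (by exact_mod_cast h) h

theorem errBd_add {A A' : ℕ} {B x : ℝ} (hx : 8 ≤ x) :
    errBd A B x + errBd A' B x ≤ errBd (A + A') B x := by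
  have h2 := two_le_log hx
  have h1 : ∀ {C : ℕ}, C ≤ A + A' → errBd C B x ≤
      C * Real.log x ^ (A + A') * (x / Real.log x ^ B) := fun {C} hC => by
    unfold errBd
    gcongr
    linarith
  refine (add_le_add (h1 (by omega)) (h1 (by omega))).trans (le_of_eq ?_)
  unfold errBd
  push_cast
  ring

theorem sum_errBd_le {ι : Type*} (s : Finset ι) (A : ι → ℕ) {B x : ℝ} (hx : 8 ≤ x) :
    ∑ i ∈ s, errBd (A i) B x ≤ errBd (∑ i ∈ s, A i) B x := by
  classical
  induction s using Finset.induction_on with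
  | empty => simp [errBd]
  | insert a s ha ih =>
    rw [sum_insert ha, sum_insert ha]
    exact (add_le_add_right ih _).trans (errBd_add hx)

/-- A number of bits that suffices for ranks in a box. -/
def bits (d N : ℕ) : ℕ := 2 + d * Nat.size N

theorem pow_add_pow_lt_bits (d N : ℕ) : N ^ d + N ^ d < 2 ^ bits d N := by
  have h : N ^ d ≤ 2 ^ (d * Nat.size N) := by
    rw [mul_comm, pow_mul]
    exact Nat.pow_le_pow_left (Nat.lt_size_self N).le d
  have h1 : 0 < 2 ^ (d * Nat.size N) := by positivity
  rw [bits, pow_add]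
  omega

theorem bits_le (d : ℕ) {x : ℝ} (hx : 8 ≤ x) :
    3 * ((bits d ⌊x⌋₊ : ℕ) + 1 : ℝ) ≤ (9 + 9 * d : ℕ) * Real.log x := by
  have h2 := two_le_log hx
  have hN : ⌊x⌋₊ ≠ 0 := by
    have : 1 ≤ ⌊x⌋₊ := Nat.le_floor (by norm_num; linarith)
    omega
  have h3 : (Nat.size ⌊x⌋₊ : ℝ) ≤ 3 * Real.log x := by
    obtain ⟨k, hk⟩ : ∃ k, Nat.size ⌊x⌋₊ = k + 1 :=
      Nat.exists_eq_succ_of_ne_zero (by rw [Ne, Nat.size_eq_zero]; exact hN)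
    have h4 : 2 ^ k ≤ ⌊x⌋₊ := Nat.lt_size.1 (by omega)
    have h5 : (2 : ℝ) ^ k ≤ x := by
      have : ((2 ^ k : ℕ) : ℝ) ≤ x := (Nat.le_floor_iff (by linarith)).1 h4
      exact_mod_cast this
    have h6 : k * Real.log 2 ≤ Real.log x := by
      rw [← Real.log_pow]
      exact Real.log_le_log (by positivity) h5
    have h7 := Real.log_two_gt_d9
    rw [hk]
    push_cast
    nlinarith
  unfold bits
  push_cast
  nlinarith [(Nat.cast_nonneg d : (0 : ℝ) ≤ d)]

/-- Separating variables by `K` comparisons in a box of side `x` costs `O((log x) ^ K)`, which an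
admissible error absorbs. -/
theorem bits_pow_le (d K : ℕ) : ∃ A : ℕ, ∀ B x : ℝ, 8 ≤ x →
    (3 * ((bits d ⌊x⌋₊ : ℕ) + 1 : ℝ)) ^ K * (x / Real.log x ^ B) ≤ errBd A B x := by
  refine ⟨(9 + 9 * d) ^ K + K, fun B x hx => ?_⟩
  have h2 := two_le_log hx
  have h : (3 * ((bits d ⌊x⌋₊ : ℕ) + 1 : ℝ)) ^ K ≤ ((9 + 9 * d) ^ K : ℕ) * Real.log x ^ K := by
    push_cast
    rw [← mul_pow]
    refine pow_le_pow_left₀ (by positivity) ?_ _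
    have := bits_le d hx
    push_cast at this
    exact this
  refine (mul_le_mul_of_nonneg_right h (by positivity)).trans ?_
  exact le_errBd hx (by push_cast; simp) (by omega)

/-! ### Uniform families of sign functions -/

/-- Families of functions of the signs of a bounded number of affine forms. -/
def Unif {I : Type*} [Fintype I] {α π : Type*} (f : π → (I → ℝ) → α) : Prop :=
  ∃ N, ∀ a, SignFn N (f a)

namespace Unif
variable {I J α β δ π : Type*} [Fintype I] [Fintype J]

theorem of_signFn {f : π → (I → ℝ) → α} {N : ℕ} (h : ∀ a, SignFn N (f a)) : Unif f := ⟨N, h⟩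

theorem const (c : π → α) : Unif fun a => fun _ : I → ℝ => c a := ⟨0, fun a => SignFn.const _⟩

theorem map {f : π → (I → ℝ) → α} (h : Unif f) (F : π → α → β) :
    Unif fun a v => F a (f a v) :=
  ⟨h.choose, fun a => (h.choose_spec a).map (F a)⟩

theorem map₂ {f : π → (I → ℝ) → α} {g : π → (I → ℝ) → β} (hf : Unif f) (hg : Unif g)
    (F : π → α → β → δ) : Unif fun a v => F a (f a v) (g a v) :=
  ⟨hf.choose + hg.choose, fun a => (hf.choose_spec a).map₂ (hg.choose_spec a) (F a)⟩

theorem and {f g : π → (I → ℝ) → Prop} (hf : Unif f) (hg : Unif g) :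
    Unif fun a v => f a v ∧ g a v := hf.map₂ hg fun _ p q => p ∧ q

theorem or {f g : π → (I → ℝ) → Prop} (hf : Unif f) (hg : Unif g) :
    Unif fun a v => f a v ∨ g a v := hf.map₂ hg fun _ p q => p ∨ q

theorem imp {f g : π → (I → ℝ) → Prop} (hf : Unif f) (hg : Unif g) :
    Unif fun a v => f a v → g a v := hf.map₂ hg fun _ p q => p → q

theorem not {f : π → (I → ℝ) → Prop} (hf : Unif f) : Unif fun a v => ¬ f a v :=
  hf.map fun _ p => ¬ p

theorem pi {κ : Type*} [Finite κ] {f : κ → π → (I → ℝ) → α} (hf : ∀ k, Unif (f k)) :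
    Unif fun a v k => f k a v := by
  have := Fintype.ofFinite κ
  choose N hN using hf
  exact ⟨_, fun a => SignFn.pi (N := ∑ k, N k) fun k => (hN k a).mono
    (single_le_sum (fun _ _ => Nat.zero_le _) (mem_univ k))⟩

theorem all {κ : Type*} [Finite κ] {f : κ → π → (I → ℝ) → Prop} (hf : ∀ k, Unif (f k)) :
    Unif fun a v => ∀ k, f k a v := (pi hf).map fun _ p => ∀ k, p k

theorem ex {κ : Type*} [Finite κ] {f : κ → π → (I → ℝ) → Prop} (hf : ∀ k, Unif (f k)) :
    Unif fun a v => ∃ k, f k a v := (pi hf).map fun _ p => ∃ k, p k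

theorem comp {f : π → (J → ℝ) → α} (hf : Unif f) {A : π → (I → ℝ) → J → ℝ}
    (hA : ∀ a j, IsAff fun v => A a v j) : Unif fun a v => f a (A a v) :=
  ⟨hf.choose, fun a => (hf.choose_spec a).comp (hA a)⟩

theorem lt {f g : π → (I → ℝ) → ℝ} (hf : ∀ a, IsAff (f a)) (hg : ∀ a, IsAff (g a)) :
    Unif fun a v => f a v < g a v := ⟨1, fun a => SignFn.lt (hf a) (hg a)⟩

theorem le {f g : π → (I → ℝ) → ℝ} (hf : ∀ a, IsAff (f a)) (hg : ∀ a, IsAff (g a)) :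
    Unif fun a v => f a v ≤ g a v := ⟨1, fun a => SignFn.le (hf a) (hg a)⟩

theorem eq {f g : π → (I → ℝ) → ℝ} (hf : ∀ a, IsAff (f a)) (hg : ∀ a, IsAff (g a)) :
    Unif fun a v => f a v = g a v := ⟨1, fun a => SignFn.eq (hf a) (hg a)⟩

theorem ite {c : π → (I → ℝ) → Prop} {_ : ∀ a v, Decidable (c a v)} {f g : π → (I → ℝ) → α}
    (hc : Unif c) (hf : Unif f) (hg : Unif g) : Unif fun a v => if c a v then f a v else g a v := by
  classical
  have := (hc.map₂ (hf.map₂ hg fun _ => Prod.mk) fun _ p r => if p then r.1 else r.2)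
  convert this

end Unif

/-! ### Bilinear sums -/

section
variable {I : Type*} [Fintype I] {P : Params} {B x : ℝ} {w : ℕ → ℝ}

theorem Balanced.x_pos (h : Balanced P B x w) : 0 < x := by linarith [h.eight_le]

theorem lg_mul {F G : I → ℕ} (hF : ∀ i, 1 ≤ F i) (hG : ∀ i, 1 ≤ G i) :
    lg (fun i => F i * G i) = fun i => lg F i + lg G i := by
  funext i
  have h1 := hF i
  have h2 := hG i
  simp only [lg, Nat.cast_mul]
  rw [Real.log_mul] <;> (norm_cast; omega)

theorem abs_prod_le_one {ι : Type*} (s : Finset ι) {u : ι → ℝ} (h : ∀ i, |u i| ≤ 1) :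
    |∏ i ∈ s, u i| ≤ 1 := by
  rw [abs_prod]
  exact prod_le_one (fun i _ => abs_nonneg _) fun i _ => h i

open Classical in
/-- Type II sums: the components in `A` have their product in the range of the Type II bound. -/
theorem Balanced.bilinear (h : Balanced P B x w) (hB : Fintype.card I ≤ B) (A : Finset I)
    (ω : I → ℕ → ℝ) (hω : ∀ i n, |ω i n| ≤ 1) {Ω : (I → ℝ) → ℝ} {K : ℕ} (hΩ : SignFn K Ω)
    (hΩ1 : ∀ v, |Ω v| ≤ 1) (X : (I → ℕ) → ℝ) {χ : (I → ℕ) → (I → ℕ) → ℝ} {c : ℝ}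
    (hχ : SM (box I ⌊x⌋₊) (box I ⌊x⌋₊) c χ)
    (hX : ∀ F G : I → ℕ, (∀ i ∉ A, F i = 1) → (∀ i ∈ A, G i = 1) →
      X (fun i => F i * G i) = χ F G)
    (hsupp : ∀ f ∈ box I ⌊x⌋₊, (∏ i, ω i (f i)) * X f * Ω (lg f) ≠ 0 → w (∏ i, f i) ≠ 0 →
      (x / 2) ^ P.θ < ((∏ i ∈ A, f i : ℕ) : ℝ) ∧ ((∏ i ∈ A, f i : ℕ) : ℝ) ≤ x ^ (P.θ + P.ν)) :
    |tupleSum ⌊x⌋₊ w fun f => (∏ i, ω i (f i)) * X f * Ω (lg f)| ≤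
      c * (3 * ((bits (Fintype.card I) ⌊x⌋₊ : ℕ) + 1)) ^ K * (x / Real.log x ^ B) := by
  set N := ⌊x⌋₊
  have hL : #(box I N) + #(box I N) < 2 ^ bits (Fintype.card I) N := by
    rw [card_box]
    exact pow_add_pow_lt_bits _ _
  have hS := (hχ.mul (SM.signFn hΩ hΩ1 (lg (I := I)) (lg (I := I)) hL)).2 _ _ (h.schurBd hB)
  -- A tuple `f` is written as `F * G`, where `F` equals `1` off `A` and `G` equals `1` on `A`. The
  -- vectors of the bilinear form live on such `F` and `G`, which makes the decomposition unique and
  -- puts the product over `A` into the first variable.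
  set ξ : (I → ℕ) → ℝ := fun F => if ∀ i ∉ A, F i = 1 then ∏ i ∈ A, ω i (F i) else 0 with hξ
  set κ : (I → ℕ) → ℝ := fun G => if ∀ i ∈ A, G i = 1 then ∏ i ∈ Aᶜ, ω i (G i) else 0 with hκ
  have h0 := hS ξ κ (fun F => by
    rw [hξ]; dsimp only; split_ifs; exacts [abs_prod_le_one _ fun i => hω _ _, by simp])
    (fun G => by
    rw [hκ]; dsimp only; split_ifs; exacts [abs_prod_le_one _ fun i => hω _ _, by simp])
  refine le_of_eq_of_le (congrArg _ ?_) h0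
  rw [← sum_product', tupleSum]
  symm
  have hmulA : ∀ F G : I → ℕ, (∀ i ∉ A, F i = 1) → (∀ i ∈ A, G i = 1) → ∀ i,
      F i * G i = if i ∈ A then F i else G i := by
    intro F G hF hG i
    split_ifs with hi
    · rw [hG i hi, mul_one]
    · rw [hF i hi, one_mul]
  have hval : ∀ F ∈ box I N, ∀ G ∈ box I N, (∀ i ∉ A, F i = 1) → (∀ i ∈ A, G i = 1) →
      ξ F * κ G * (χ F G * Ω (fun i => lg F i + lg G i) *
        if (x / 2) ^ P.θ < ((∏ i, F i : ℕ) : ℝ) ∧ ((∏ i, F i : ℕ) : ℝ) ≤ x ^ (P.θ + P.ν) then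
        w ((∏ i, F i) * ∏ i, G i) else 0) =
      (∏ i, ω i (F i * G i)) * X (fun i => F i * G i) * Ω (lg fun i => F i * G i) *
        w (∏ i, (F i * G i)) := by
    intro F hFb G hGb hF hG
    have hF1 := fun i => (mem_box.1 hFb i).1
    have hG1 := fun i => (mem_box.1 hGb i).1
    have hbox : (fun i => F i * G i) ∈ box I N := by
      rw [mem_box]
      intro i
      rw [hmulA F G hF hG]
      split_ifs
      exacts [mem_box.1 hFb i, mem_box.1 hGb i]
    have hpA : ∏ i ∈ A, F i * G i = ∏ i, F i := by
      rw [← prod_subset (subset_univ A) fun i _ hi => hF i hi]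
      exact prod_congr rfl fun i hi => by rw [hG i hi, mul_one]
    have hω' : ∏ i, ω i (F i * G i) = ξ F * κ G := by
      rw [hξ, hκ]
      simp only
      rw [if_pos hF, if_pos hG, ← prod_mul_prod_compl A]
      congr 1
      · exact prod_congr rfl fun i hi => by rw [hG i hi, mul_one]
      · exact prod_congr rfl fun i hi => by rw [hF i (mem_compl.1 hi), one_mul]
    rw [hX F G hF hG, lg_mul hF1 hG1, ← prod_mul_distrib, hω']
    have h2 := hsupp _ hbox
    rw [hpA, hX F G hF hG, lg_mul hF1 hG1, hω'] at h2
    split_ifs with h3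
    · ring
    · by_contra h4
      rw [mul_zero, mul_zero] at h4
      exact h3 (h2 (left_ne_zero_of_mul (Ne.symm h4)) (right_ne_zero_of_mul (Ne.symm h4)))
  have hne : ∀ q : (I → ℕ) × (I → ℕ), ξ q.1 * κ q.2 * (χ q.1 q.2 *
      Ω (fun i => lg q.1 i + lg q.2 i) *
        if (x / 2) ^ P.θ < ((∏ i, q.1 i : ℕ) : ℝ) ∧ ((∏ i, q.1 i : ℕ) : ℝ) ≤ x ^ (P.θ + P.ν) then
        w ((∏ i, q.1 i) * ∏ i, q.2 i) else 0) ≠ 0 → (∀ i ∉ A, q.1 i = 1) ∧ ∀ i ∈ A, q.2 i = 1 := by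
    intro q hq
    have h1 := left_ne_zero_of_mul (left_ne_zero_of_mul hq)
    have h2 := right_ne_zero_of_mul (left_ne_zero_of_mul hq)
    rw [hξ] at h1
    rw [hκ] at h2
    simp only [ne_eq, ite_eq_right_iff, not_forall] at h1 h2
    exact ⟨h1.1, h2.1⟩
  refine sum_bij_ne_zero (fun q _ _ => fun i => q.1 i * q.2 i) ?_ ?_ ?_ ?_
  · intro q hq h1
    obtain ⟨hF, hG⟩ := hne q h1
    rw [mem_product] at hq
    rw [mem_box]
    intro i
    rw [hmulA _ _ hF hG]
    split_ifs
    exacts [mem_box.1 hq.1 i, mem_box.1 hq.2 i]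
  · intro q hq h1 q' hq' h1' heq
    obtain ⟨hF, hG⟩ := hne q h1
    obtain ⟨hF', hG'⟩ := hne q' h1'
    refine Prod.ext (funext fun i => ?_) (funext fun i => ?_)
    · have := congrFun heq i
      by_cases hi : i ∈ A
      · simpa [hmulA _ _ hF hG, hmulA _ _ hF' hG', hi] using this
      · rw [hF i hi, hF' i hi]
    · have := congrFun heq i
      by_cases hi : i ∈ A
      · rw [hG i hi, hG' i hi]
      · simpa [hmulA _ _ hF hG, hmulA _ _ hF' hG', hi] using this
  · intro f hf h1
    set F : I → ℕ := fun i => if i ∈ A then f i else 1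
    set G : I → ℕ := fun i => if i ∈ A then 1 else f i
    have hN : 1 ≤ N := Nat.le_floor (by norm_num; linarith [h.eight_le])
    have hFb : F ∈ box I N := mem_box.2 fun i => by
      simp only [F]; split_ifs; exacts [mem_box.1 hf i, ⟨le_rfl, hN⟩]
    have hGb : G ∈ box I N := mem_box.2 fun i => by
      simp only [G]; split_ifs; exacts [⟨le_rfl, hN⟩, mem_box.1 hf i]
    have hF : ∀ i ∉ A, F i = 1 := fun i hi => by simp [F, hi]
    have hG : ∀ i ∈ A, G i = 1 := fun i hi => by simp [G, hi]
    have hFG : (fun i => F i * G i) = f := by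
      funext i
      rw [hmulA F G hF hG]
      simp only [F, G]
      split_ifs <;> rfl
    refine ⟨(F, G), mem_product.2 ⟨hFb, hGb⟩, ?_, hFG⟩
    have := hval F hFb G hGb hF hG
    rw [this]
    rw [show (∏ i, ω i (F i * G i)) = ∏ i, ω i ((fun i => F i * G i) i) from rfl,
      show ∏ i, (F i * G i) = ∏ i, (fun i => F i * G i) i from rfl, hFG]
    exact h1
  · intro q hq h1
    obtain ⟨hF, hG⟩ := hne q h1
    rw [mem_product] at hq
    exact hval _ hq.1 _ hq.2 hF hG

end

/-! ### Splitting an integer at a prime factor -/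

/-- The largest prime factor (`0` for `1`). -/
def pmax (u : ℕ) : ℕ∞ := u.primeFactors.sup fun p => (p : ℕ∞)

/-- The least prime factor (`⊤` for `1`). -/
def pmin (u : ℕ) : ℕ∞ := u.primeFactors.inf fun p => (p : ℕ∞)

theorem pmax_le_pmin_iff {u v : ℕ} :
    pmax u ≤ pmin v ↔ ∀ p ∈ u.primeFactors, ∀ q ∈ v.primeFactors, p ≤ q := by
  simp only [pmax, pmin, Finset.sup_le_iff, Finset.le_inf_iff, Nat.cast_le]
  exact ⟨fun h p hp q hq => h q hq p hp, fun h q hq p hp => h p hp q hq⟩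

theorem pmax_mem {u : ℕ} (h0 : u ≠ 0) (h1 : u ≠ 1) : ∃ p ∈ u.primeFactors, pmax u = p := by
  obtain ⟨p, hp, h⟩ := exists_mem_eq_sup u.primeFactors
    (by rw [Nat.nonempty_primeFactors]; omega) fun p => (p : ℕ∞)
  exact ⟨p, hp, h⟩

theorem pmin_mem {u : ℕ} (h0 : u ≠ 0) (h1 : u ≠ 1) : ∃ p ∈ u.primeFactors, pmin u = p := by
  obtain ⟨p, hp, h⟩ := exists_mem_eq_inf u.primeFactors
    (by rw [Nat.nonempty_primeFactors]; omega) fun p => (p : ℕ∞)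
  exact ⟨p, hp, h⟩

theorem primeFactorsList_mul_of_le {u v : ℕ} (hu : u ≠ 0) (hv : v ≠ 0) (h : pmax u ≤ pmin v) :
    (u * v).primeFactorsList = u.primeFactorsList ++ v.primeFactorsList := by
  rw [pmax_le_pmin_iff] at h
  refine (Nat.perm_primeFactorsList_mul hu hv).eq_of_sortedLE (Nat.primeFactorsList_sorted _) ?_
  rw [List.sortedLE_iff_pairwise, List.pairwise_append]
  refine ⟨(Nat.primeFactorsList_sorted _).pairwise, (Nat.primeFactorsList_sorted _).pairwise,
    fun p hp q hq => h p (by simpa using hp) q (by simpa using hq)⟩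

/-- `u` is the shortest initial product of the primes, in nondecreasing order, for which `c u`
exceeds `θ`. A longer `u'` is a multiple `u t` with `t ≥ p` for every prime `p` of `u'`, so that `c
u' ≥ c u p > θ p`, which contradicts the upper bound for `u'`. -/
theorem split_unique {θ c : ℝ} (hc : 0 < c) {u v u' v' : ℕ} (hu : u ≠ 0) (hv : v ≠ 0)
    (hu' : u' ≠ 0) (hv' : v' ≠ 0) (h : pmax u ≤ pmin v) (h' : pmax u' ≤ pmin v')
    (huv : u * v = u' * v') (h1 : θ < c * u) (h1' : θ < c * u')
    (h2 : ∃ p ∈ u.primeFactors, c * u ≤ θ * p) (h2' : ∃ p ∈ u'.primeFactors, c * u' ≤ θ * p) :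
    u = u' := by
  wlog hlen : u.primeFactorsList.length ≤ u'.primeFactorsList.length generalizing u v u' v'
  · exact (this hu' hv' hu hv h' h huv.symm h1' h1 h2' h2 (le_of_not_ge hlen)).symm
  have e : u.primeFactorsList ++ v.primeFactorsList = u'.primeFactorsList ++ v'.primeFactorsList := by
    rw [← primeFactorsList_mul_of_le hu hv h, huv, primeFactorsList_mul_of_le hu' hv' h']
  obtain ⟨t, ht⟩ : u.primeFactorsList <+: u'.primeFactorsList :=
    List.prefix_of_prefix_length_le (e ▸ List.prefix_append _ _) (List.prefix_append _ _) hlen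
  have hmul : u' = u * t.prod := by
    rw [← Nat.prod_primeFactorsList hu', ← ht, List.prod_append, Nat.prod_primeFactorsList hu]
  rcases t with _ | ⟨a, t⟩
  · simpa using hmul.symm
  exfalso
  obtain ⟨p, hp, hpc⟩ := h2'
  have hp' : p ∈ u'.primeFactorsList := by simpa using hp
  have ht0 : 1 ≤ (a :: t).prod := by
    rcases Nat.eq_zero_or_pos (a :: t).prod with h0 | h0
    · rw [h0] at hmul; omega
    · exact h0
  have hpt : p ≤ (a :: t).prod := by
    rw [← ht, List.mem_append] at hp'
    rcases hp' with hp' | hp'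
    · have hs := (Nat.primeFactorsList_sorted u').pairwise
      rw [← ht, List.pairwise_append] at hs
      exact (hs.2.2 p hp' a (by simp)).trans (Nat.le_of_dvd ht0 (List.dvd_prod (by simp)))
    · exact Nat.le_of_dvd ht0 (List.dvd_prod hp')
  have hp0 : (0 : ℝ) < p := by exact_mod_cast (Nat.prime_of_mem_primeFactors hp).pos
  rw [hmul] at hpc
  push_cast at hpc
  have h3 : (p : ℝ) ≤ ((a :: t).prod : ℕ) := by exact_mod_cast hpt
  push_cast at h3
  have h4 : c * u * p ≤ c * (u * ((a : ℝ) * (t.prod : ℕ))) := by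
    rw [← mul_assoc]
    refine mul_le_mul_of_nonneg_left ?_ (by positivity)
    simpa using h3
  have h5 : θ * p < c * u * p := mul_lt_mul_of_pos_right h1 hp0
  simp at hpc
  simp at h4
  linarith

/-- Primes are multiplied in nondecreasing order until the product exceeds `θ / c`; before the last
prime it did not, which gives the upper bound. -/
theorem split_exists {θ c : ℝ} {s : ℕ} (hs : s ≠ 0) (hc : c ≤ θ) (h : θ < c * s) :
    ∃ u v : ℕ, u ≠ 0 ∧ v ≠ 0 ∧ u * v = s ∧ pmax u ≤ pmin v ∧ θ < c * u ∧
      ∃ p ∈ u.primeFactors, c * u ≤ θ * p := by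
  have key : ∀ (l : List ℕ) (c : ℝ), (∀ p ∈ l, p.Prime) → c ≤ θ → θ < c * (l.prod : ℕ) →
      ∃ l₁ l₂, l = l₁ ++ l₂ ∧ θ < c * (l₁.prod : ℕ) ∧ ∃ p ∈ l₁, c * (l₁.prod : ℕ) ≤ θ * p := by
    intro l
    induction l with
    | nil =>
      intro c _ hc h
      simp at h
      linarith
    | cons a l ih =>
      intro c hl hc h
      by_cases ha : θ < c * a
      · refine ⟨[a], l, rfl, by simpa using ha, a, by simp, ?_⟩
        simp only [List.prod_cons, List.prod_nil, mul_one]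
        exact mul_le_mul_of_nonneg_right hc (by positivity)
      · obtain ⟨l₁, l₂, h1, h2, p, hp, h3⟩ := ih (c * a) (fun p hp => hl p (by simp [hp]))
          (not_lt.1 ha) (by simpa [mul_assoc] using h)
        refine ⟨a :: l₁, l₂, by simp [h1], by simpa [mul_assoc] using h2, p, by simp [hp], ?_⟩
        simpa [mul_assoc] using h3
  obtain ⟨l₁, l₂, h1, h2, p, hp, h3⟩ := key s.primeFactorsList c
    (fun p hp => Nat.prime_of_mem_primeFactorsList hp) hc
    (by rwa [Nat.prod_primeFactorsList hs])
  have hpr : ∀ p ∈ l₁ ++ l₂, p.Prime := fun p hp => Nat.prime_of_mem_primeFactorsList (h1 ▸ hp)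
  have hmem : ∀ l : List ℕ, (∀ p ∈ l, p.Prime) → l.prod ≠ 0 ∧ ∀ p, p ∈ l.prod.primeFactors ↔ p ∈ l := by
    intro l hl
    have h0 : l.prod ≠ 0 := List.prod_ne_zero fun h => Nat.not_prime_zero (hl 0 h)
    refine ⟨h0, fun p => ?_⟩
    rw [Nat.primeFactors, List.mem_toFinset]
    exact (Nat.primeFactorsList_unique rfl hl).mem_iff.symm
  obtain ⟨hu0, hu⟩ := hmem l₁ fun p hp => hpr p (by simp [hp])
  obtain ⟨hv0, hv⟩ := hmem l₂ fun p hp => hpr p (by simp [hp])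
  refine ⟨l₁.prod, l₂.prod, hu0, hv0, ?_, ?_, h2, p, (hu p).2 hp, h3⟩
  · rw [← List.prod_append, ← h1, Nat.prod_primeFactorsList hs]
  · rw [pmax_le_pmin_iff]
    intro p hp q hq
    have hs := (Nat.primeFactorsList_sorted s).pairwise
    rw [h1, List.pairwise_append] at hs
    exact hs.2.2 p ((hu p).1 hp) q ((hv q).1 hq)

/-! ### Weights -/

open Classical in
/-- The indicator function of integers with all prime factors below `z`, possibly weighted by the
Möbius function. -/
def smoothWt (z : ℝ) (t : Bool) (n : ℕ) : ℝ :=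
  if ∀ p ∈ n.primeFactors, (p : ℝ) < z then (if t then (ArithmeticFunction.moebius n : ℝ) else 1)
  else 0

open Classical in
/-- The indicator function of the primes `≥ z` together with `1`. -/
def primeOneWt (z : ℝ) (n : ℕ) : ℝ := if n = 1 ∨ n.Prime ∧ z ≤ n then 1 else 0

open Classical in
/-- The indicator function of the primes `≥ z`. -/
def primeWt (z : ℝ) (n : ℕ) : ℝ := if n.Prime ∧ z ≤ n then 1 else 0

theorem abs_moebius_le (n : ℕ) : |(ArithmeticFunction.moebius n : ℝ)| ≤ 1 := by
  exact_mod_cast ArithmeticFunction.abs_moebius_le_one (n := n)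

theorem abs_smoothWt_le (z : ℝ) (t : Bool) (n : ℕ) : |smoothWt z t n| ≤ 1 := by
  unfold smoothWt
  split_ifs
  · exact abs_moebius_le n
  · simp
  · simp

theorem abs_primeOneWt_le (z : ℝ) (n : ℕ) : |primeOneWt z n| ≤ 1 := by
  unfold primeOneWt
  split_ifs <;> simp

theorem lt_of_smoothWt_ne_zero {z : ℝ} {t : Bool} {n : ℕ} (h : smoothWt z t n ≠ 0) :
    ∀ p ∈ n.primeFactors, (p : ℝ) < z := by
  unfold smoothWt at h
  by_contra hc
  exact h (if_neg hc)

theorem coprime_of_pmax {u v : ℕ} (hu : u ≠ 0) (hv : v ≠ 0) (h : pmax u ≤ pmin v)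
    (hne : pmax u ≠ pmin v) : u.Coprime v := by
  rw [← Nat.disjoint_primeFactors hu hv, disjoint_left]
  intro p hp hq
  refine hne (le_antisymm h ?_)
  exact (inf_le hq).trans (le_sup (f := fun p : ℕ => (p : ℕ∞)) hp)

/-- When `pmax u ≤ pmin v`, the numbers `u` and `v` can share a prime only if equality holds.
Excluding equality thus makes the Möbius function multiplicative here; without the Möbius function
nothing has to be excluded. -/
theorem smoothWt_mul {z : ℝ} {t : Bool} {u v : ℕ} (hu : u ≠ 0) (hv : v ≠ 0) (h : pmax u ≤ pmin v)
    (hne : t = true → pmax u ≠ pmin v) : smoothWt z t (u * v) = smoothWt z t u * smoothWt z t v := by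
  have h1 : (∀ p ∈ (u * v).primeFactors, (p : ℝ) < z) ↔
      (∀ p ∈ u.primeFactors, (p : ℝ) < z) ∧ ∀ p ∈ v.primeFactors, (p : ℝ) < z := by
    rw [Nat.primeFactors_mul hu hv]
    simp only [mem_union, or_imp, forall_and]
  unfold smoothWt
  by_cases h2 : ∀ p ∈ u.primeFactors, (p : ℝ) < z
  · by_cases h3 : ∀ p ∈ v.primeFactors, (p : ℝ) < z
    · rw [if_pos (h1.2 ⟨h2, h3⟩), if_pos h2, if_pos h3]
      cases t with
      | false => simp
      | true =>
        have := ArithmeticFunction.isMultiplicative_moebius.map_mul_of_coprime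
          (coprime_of_pmax hu hv h (hne rfl))
        simp only [if_true]
        exact_mod_cast this
    · rw [if_neg fun h => h3 (h1.1 h).2, if_neg h3, mul_zero]
  · rw [if_neg fun h => h2 (h1.1 h).1, if_neg h2, zero_mul]

theorem pmax_ne_pmin_of_smoothWt {z : ℝ} {t : Bool} {u v : ℕ} (hu : u ≠ 0) (hv : v ≠ 0)
    (hu1 : u ≠ 1) (h : smoothWt z t (u * v) ≠ 0) (ht : t = true) : pmax u ≠ pmin v := by
  subst ht
  have hsq : Squarefree (u * v) := by
    by_contra hc
    apply h
    unfold smoothWt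
    simp [ArithmeticFunction.moebius_eq_zero_of_not_squarefree hc]
  obtain ⟨p, hp, hpu⟩ := pmax_mem hu hu1
  intro he
  by_cases hv1 : v = 1
  · subst hv1
    rw [hpu] at he
    simp [pmin] at he
  · obtain ⟨q, hq, hqv⟩ := pmin_mem hv hv1
    rw [hpu, hqv, Nat.cast_inj] at he
    subst he
    have hco := Nat.coprime_of_squarefree_mul hsq
    rw [← Nat.disjoint_primeFactors hu hv, disjoint_left] at hco
    exact hco hp hq

section
variable {I : Type*} [Fintype I] {P : Params} {B x : ℝ} {w : ℕ → ℝ}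

/-- Type II sums with the components in `A` having their product in the right range. -/
theorem Balanced.bilinear_direct (h : Balanced P B x w) (hB : Fintype.card I ≤ B) (A : Finset I)
    (ω : I → ℕ → ℝ) (hω : ∀ i n, |ω i n| ≤ 1) {Ω : (I → ℝ) → ℝ} {K : ℕ} (hΩ : SignFn K Ω)
    (hΩ1 : ∀ v, |Ω v| ≤ 1)
    (hsupp : ∀ f ∈ box I ⌊x⌋₊, (∏ i, ω i (f i)) ≠ 0 → Ω (lg f) ≠ 0 → w (∏ i, f i) ≠ 0 →
      (x / 2) ^ P.θ < ((∏ i ∈ A, f i : ℕ) : ℝ) ∧ ((∏ i ∈ A, f i : ℕ) : ℝ) ≤ x ^ (P.θ + P.ν)) :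
    |tupleSum ⌊x⌋₊ w fun f => (∏ i, ω i (f i)) * Ω (lg f)| ≤
      (3 * ((bits (Fintype.card I) ⌊x⌋₊ : ℕ) + 1)) ^ K * (x / Real.log x ^ B) := by
  have := h.bilinear hB A ω hω hΩ hΩ1 (fun _ => 1) SM.one (fun _ _ _ _ => rfl)
    (fun f hf h1 h2 => hsupp f hf (left_ne_zero_of_mul (left_ne_zero_of_mul h1))
      (right_ne_zero_of_mul h1) h2)
  simpa using this

open Classical in
/-- Type II sums in which the component `y₀` has to be split. -/
theorem Balanced.bilinear_split (h : Balanced P B x w) (hB : Fintype.card I + 1 ≤ B) (A : Finset I)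
    {y₀ : I} (hy₀ : y₀ ∉ A) (t : Bool)
    (ω : I → ℕ → ℝ) (hω : ∀ i n, |ω i n| ≤ 1) (hωy : ω y₀ = smoothWt ((x / 2) ^ P.ν) t)
    {Ω : (I → ℝ) → ℝ} {K : ℕ} (hΩ : SignFn K Ω) (hΩ1 : ∀ v, |Ω v| ≤ 1)
    (hsupp : ∀ f ∈ box I ⌊x⌋₊, (∏ i, ω i (f i)) ≠ 0 → Ω (lg f) ≠ 0 → w (∏ i, f i) ≠ 0 →
      ((∏ i ∈ A, f i : ℕ) : ℝ) ≤ (x / 2) ^ P.θ ∧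
      (x / 2) ^ P.θ < ((∏ i ∈ A, f i : ℕ) : ℝ) * f y₀) :
    |tupleSum ⌊x⌋₊ w fun f => (∏ i, ω i (f i)) * Ω (lg f)| ≤
      (3 * ((bits (Fintype.card I + 1) ⌊x⌋₊ : ℕ) + 1)) ^ (K + 1) * (x / Real.log x ^ B) := by
  set N := ⌊x⌋₊ with hN
  set θ := (x / 2) ^ P.θ with hθ
  have hx0 := h.x_pos
  have hx8 := h.eight_le
  have hcard : Fintype.card (Option I) = Fintype.card I + 1 := Fintype.card_option
  have hL : #(box (Option I) N) + #(box (Option I) N) < 2 ^ bits (Fintype.card I + 1) N := by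
    rw [card_box, hcard]
    exact pow_add_pow_lt_bits _ _
  set L := bits (Fintype.card I + 1) N
  set A' : Finset (Option I) := insertNone A with hA'
  have hnone : none ∈ A' := by simp [hA']
  have hy' : some y₀ ∉ A' := by simpa [hA'] using hy₀
  have hprodA : ∀ f : Option I → ℕ, ∏ o ∈ A', f o = f none * ∏ i ∈ A, f (some i) := fun f => by
    rw [hA', prod_insertNone]
  -- The component `none` carries the initial part `u` of the component `y₀`, and `some y₀` keeps
  -- the cofactor. This condition singles out the unique cut of `split_unique`; it involves only the
  -- components in `A'`, hence only one side of the bilinear form.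
  let LC : (Option I → ℕ) → Prop := fun f =>
    θ < ((∏ i ∈ A, f (some i) : ℕ) : ℝ) * f none ∧
      ∃ p ∈ (f none).primeFactors, ((∏ i ∈ A, f (some i) : ℕ) : ℝ) * f none ≤ θ * p
  -- The coupling of the two factors is the order of their extreme primes, strict when the Möbius
  -- function is present. It is a comparison of a function of one side with a function of the other,
  -- which costs one more factor of the logarithm.
  let X : (Option I → ℕ) → ℝ := fun f => (if LC f then 1 else 0) *
    ((if pmax (f none) ≤ pmin (f (some y₀)) then 1 else 0) *
    (1 - if pmax (f none) = pmin (f (some y₀)) then (if t then 1 else 0) else 0))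
  let χ : (Option I → ℕ) → (Option I → ℕ) → ℝ := fun F G => (if LC F then 1 else 0) *
    ((if pmax (F none) ≤ pmin (G (some y₀)) then 1 else 0) *
    (1 - (if t then 1 else 0) * if pmax (F none) = pmin (G (some y₀)) then 1 else 0))
  have hχ : SM (box (Option I) N) (box (Option I) N) (3 * (L + 1)) χ := by
    have h1 : SM (box (Option I) N) (box (Option I) N) (1 * (((L : ℝ) + 1) *
        (1 + |(if t then (1 : ℝ) else 0)| * 1))) χ :=
      (SM.left fun F => by split_ifs <;> simp).mul ((SM.le_of_card _ _ hL).mul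
        (SM.one.sub ((SM.eq_of_card _ _ hL).smul (if t then (1 : ℝ) else 0))))
    refine h1.mono ?_
    have : |(if t then (1 : ℝ) else 0)| ≤ 1 := by split_ifs <;> simp
    nlinarith [(Nat.cast_nonneg L : (0 : ℝ) ≤ L)]
  have hX : ∀ F G : Option I → ℕ, (∀ i ∉ A', F i = 1) → (∀ i ∈ A', G i = 1) →
      X (fun i => F i * G i) = χ F G := by
    intro F G hF hG
    have e1 : F none * G none = F none := by rw [hG none hnone, mul_one]
    have e2 : F (some y₀) * G (some y₀) = G (some y₀) := by rw [hF _ hy', one_mul]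
    have e3 : ∏ i ∈ A, F (some i) * G (some i) = ∏ i ∈ A, F (some i) :=
      prod_congr rfl fun i hi => by rw [hG (some i) (by simpa [hA'] using hi), mul_one]
    simp only [X, χ, LC, e1, e2, e3]
    congr 3
    split_ifs <;> simp
  let ω' : Option I → ℕ → ℝ := fun o => o.elim (ω y₀) ω
  have hω' : ∀ o n, |ω' o n| ≤ 1 := by
    rintro (_ | i) n
    exacts [hω _ _, hω _ _]
  let Ω' : (Option I → ℝ) → ℝ := fun v => Ω fun i => v (some i) + if i = y₀ then v none else 0
  have hΩ' : SignFn K Ω' := hΩ.comp fun i => (IsAff.coord (some i)).add (by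
    by_cases hi : i = y₀
    · simpa [hi] using IsAff.coord (none : Option I)
    · simpa [hi] using IsAff.const 0)
  let Φ : (Option I → ℕ) → I → ℕ := fun f i => f (some i) * if i = y₀ then f none else 1
  have hΦprod : ∀ f, ∏ i, Φ f i = ∏ o, f o := fun f => by
    simp only [Φ]
    rw [Fintype.prod_option, prod_mul_distrib, prod_ite_eq' univ y₀]
    simp [mul_comm]
  have hΦA : ∀ f, ∏ i ∈ A, Φ f i = ∏ i ∈ A, f (some i) := fun f =>
    prod_congr rfl fun i hi => by
      simp only [Φ]
      rw [if_neg (by rintro rfl; exact hy₀ hi), mul_one]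
  have hΦ1 : ∀ f ∈ box (Option I) N, ∀ i, 1 ≤ Φ f i := fun f hf i => by
    simp only [Φ]
    refine Nat.one_le_iff_ne_zero.2 (mul_ne_zero ?_ ?_)
    · have := (mem_box.1 hf (some i)).1; omega
    · have := (mem_box.1 hf none).1
      split_ifs <;> omega
  have hΦlg : ∀ f ∈ box (Option I) N, lg (Φ f) = fun i => lg f (some i) +
      if i = y₀ then lg f none else 0 := fun f hf => by
    funext i
    have h1 : (f (some i) : ℝ) ≠ 0 := by have := (mem_box.1 hf (some i)).1; norm_cast; omega
    have h2 : (f none : ℝ) ≠ 0 := by have := (mem_box.1 hf none).1; norm_cast; omega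
    simp only [lg, Φ]
    split_ifs
    · push_cast
      rw [Real.log_mul h1 h2]
    · simp
  have hprim : ∀ f, X f ≠ 0 → LC f ∧ pmax (f none) ≤ pmin (f (some y₀)) ∧
      (t = true → pmax (f none) ≠ pmin (f (some y₀))) ∧ X f = 1 := by
    intro f hf
    have h1 : LC f := by
      by_contra hc
      simp [X, hc] at hf
    have h2 : pmax (f none) ≤ pmin (f (some y₀)) := by
      by_contra hc
      simp [X, hc] at hf
    have h3 : t = true → pmax (f none) ≠ pmin (f (some y₀)) := by
      intro ht hc
      simp [X, hc, ht] at hf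
    refine ⟨h1, h2, h3, ?_⟩
    simp only [X, if_pos h1, if_pos h2]
    by_cases h4 : pmax (f none) = pmin (f (some y₀))
    · have : ¬ t = true := fun ht => h3 ht h4
      simp [this]
    · simp [h4]
  have hω0 : ∀ f ∈ box (Option I) N, X f ≠ 0 → ∏ i, ω i (Φ f i) = ∏ o, ω' o (f o) := by
    intro f hf hXf
    obtain ⟨-, h2, h3, -⟩ := hprim f hXf
    have hu : f none ≠ 0 := by have := (mem_box.1 hf none).1; omega
    have hv : f (some y₀) ≠ 0 := by have := (mem_box.1 hf (some y₀)).1; omega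
    rw [Fintype.prod_option]
    have : ∀ i, ω i (Φ f i) = (if i = y₀ then ω' none (f none) else 1) * ω i (f (some i)) := by
      intro i
      simp only [Φ]
      split_ifs with hi
      · subst hi
        simp only [ω', Option.elim_none, hωy]
        rw [mul_comm, smoothWt_mul hu hv h2 h3]
      · simp
    rw [prod_congr rfl fun i _ => this i, prod_mul_distrib, prod_ite_eq' univ y₀]
    simp [ω']
  have hval : ∀ f ∈ box (Option I) N, X f ≠ 0 →
      (∏ o, ω' o (f o)) * X f * Ω' (lg f) * w (∏ o, f o) =
      (∏ i, ω i (Φ f i)) * Ω (lg (Φ f)) * w (∏ i, Φ f i) := by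
    intro f hf hXf
    rw [hω0 f hf hXf, hΦprod, hΦlg f hf, (hprim f hXf).2.2.2, mul_one]
  have hbox : ∀ f ∈ box (Option I) N, w (∏ o, f o) ≠ 0 → Φ f ∈ box I N := by
    intro f hf hw
    refine mem_box_of_prod_le (hΦ1 f hf) ?_
    rw [hΦprod]
    exact Nat.le_floor (h.supp _ hw).2
  have hposA : ∀ f : I → ℕ, f ∈ box I N → (0 : ℝ) < ((∏ i ∈ A, f i : ℕ) : ℝ) := fun f hf => by
    exact_mod_cast prod_pos fun i _ => (mem_box.1 hf i).1
  have hθ0 : 0 < θ := by positivity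
  have heq : tupleSum N w (fun f => (∏ i, ω i (f i)) * Ω (lg f)) =
      tupleSum N w (fun f => (∏ o, ω' o (f o)) * X f * Ω' (lg f)) := by
    symm
    rw [tupleSum, tupleSum]
    refine sum_bij_ne_zero (fun f _ _ => Φ f) ?_ ?_ ?_ ?_
    · intro f hf hne
      exact hbox f hf (right_ne_zero_of_mul hne)
    · intro f hf hne f' hf' hne' he
      have hXf : X f ≠ 0 := right_ne_zero_of_mul (left_ne_zero_of_mul (left_ne_zero_of_mul hne))
      have hXf' : X f' ≠ 0 := right_ne_zero_of_mul (left_ne_zero_of_mul (left_ne_zero_of_mul hne'))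
      obtain ⟨⟨h1, h2⟩, h3, -⟩ := hprim f hXf
      obtain ⟨⟨h1', h2'⟩, h3', -⟩ := hprim f' hXf'
      have hb := hbox f hf (right_ne_zero_of_mul hne)
      have hAe : ∏ i ∈ A, f (some i) = ∏ i ∈ A, f' (some i) := by
        rw [← hΦA, ← hΦA]
        exact congrArg (fun g : I → ℕ => ∏ i ∈ A, g i) he
      have hc := hposA _ hb
      rw [hΦA] at hc
      rw [← hAe] at h1' h2'
      have hne0 : ∀ g ∈ box (Option I) N, ∀ o, g o ≠ 0 := fun g hg o => by
        have := (mem_box.1 hg o).1; omega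
      have hy : f none * f (some y₀) = f' none * f' (some y₀) := by
        have := congrFun he y₀
        simp only [Φ, if_true] at this
        rw [mul_comm, this, mul_comm]
      have hu : f none = f' none := split_unique hc (hne0 f hf _) (hne0 f hf _)
        (hne0 f' hf' _) (hne0 f' hf' _) h3 h3' hy h1 h1' h2 h2'
      funext o
      rcases o with _ | i
      · exact hu
      · by_cases hi : i = y₀
        · subst hi
          rw [hu] at hy
          exact Nat.eq_of_mul_eq_mul_left (Nat.pos_of_ne_zero (hne0 f' hf' _)) hy
        · have := congrFun he i
          simpa [Φ, hi] using this
    · intro f hf hne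
      have hω1 := left_ne_zero_of_mul (left_ne_zero_of_mul hne)
      obtain ⟨h1, h2⟩ := hsupp f hf hω1 (right_ne_zero_of_mul (left_ne_zero_of_mul hne))
        (right_ne_zero_of_mul hne)
      have hf0 : f y₀ ≠ 0 := by have := (mem_box.1 hf y₀).1; omega
      obtain ⟨u, v, hu, hv, huv, hle, h3, p, hp, h4⟩ := split_exists hf0 h1 h2
      set f' : Option I → ℕ := fun o => o.elim u fun i => if i = y₀ then v else f i with hf'
      have hΦf : Φ f' = f := by
        funext i
        by_cases hi : i = y₀
        · subst hi
          simp only [Φ, hf', Option.elim_some, Option.elim_none, if_true]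
          rw [mul_comm, huv]
        · simp [Φ, hf', hi]
      have huN : u ≤ f y₀ := huv ▸ Nat.le_mul_of_pos_right _ (Nat.pos_of_ne_zero hv)
      have hvN : v ≤ f y₀ := huv ▸ Nat.le_mul_of_pos_left _ (Nat.pos_of_ne_zero hu)
      have hyN := (mem_box.1 hf y₀).2
      have hf'b : f' ∈ box (Option I) N := by
        rw [mem_box]
        rintro (_ | i)
        · simp only [hf', Option.elim_none]; omega
        · simp only [hf', Option.elim_some]
          split_ifs
          · omega
          · exact mem_box.1 hf i
      have hA2 : ∏ i ∈ A, f' (some i) = ∏ i ∈ A, f i := by rw [← hΦA, hΦf]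
      have hX1 : X f' ≠ 0 := by
        have hLC : LC f' := by
          simp only [LC, hA2]
          exact ⟨h3, p, hp, h4⟩
        have e1 : f' none = u := rfl
        have e2 : f' (some y₀) = v := by simp [hf']
        simp only [X, if_pos hLC, e1, e2, if_pos hle]
        have hu1 : u ≠ 1 := by
          rintro rfl
          simp at hp
        have hne' : t = true → pmax u ≠ pmin v := pmax_ne_pmin_of_smoothWt hu hv hu1 (by
          rw [huv, ← hωy]
          exact prod_ne_zero_iff.1 hω1 y₀ (mem_univ _))
        by_cases h5 : pmax u = pmin v
        · have : ¬ t = true := fun ht => hne' ht h5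
          simp [this]
        · simp [h5]
      refine ⟨f', hf'b, ?_, hΦf⟩
      rw [hval f' hf'b hX1, hΦf]
      exact hne
    · intro f hf hne
      exact hval f hf (right_ne_zero_of_mul (left_ne_zero_of_mul (left_ne_zero_of_mul hne)))
  rw [heq]
  have := h.bilinear (by rw [hcard]; exact_mod_cast hB) A' ω' hω' hΩ' (fun v => hΩ1 _) X hχ hX ?_
  · rw [hcard] at this
    refine this.trans (le_of_eq ?_)
    rw [pow_succ']
  · intro f hf h1 h2
    have hXf : X f ≠ 0 := right_ne_zero_of_mul (left_ne_zero_of_mul h1)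
    obtain ⟨⟨h3, p, hp, h4⟩, -⟩ := hprim f hXf
    rw [hprodA]
    push_cast at h3 h4 ⊢
    rw [mul_comm]
    refine ⟨h3, h4.trans ?_⟩
    have hsm : smoothWt ((x / 2) ^ P.ν) t (f none) ≠ 0 := by
      have := prod_ne_zero_iff.1 (left_ne_zero_of_mul (left_ne_zero_of_mul h1)) none (mem_univ _)
      simpa only [ω', Option.elim_none, hωy] using this
    have hpz := lt_of_smoothWt_ne_zero hsm p hp
    -- The last prime overshoots the lower end of the Type II range by a factor below `(x / 2) ^ ν`,
    -- which is no more than the width of the range.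
    calc θ * p ≤ (x / 2) ^ P.θ * (x / 2) ^ P.ν := by gcongr
      _ = (x / 2) ^ (P.θ + P.ν) := (Real.rpow_add (by linarith) _ _).symm
      _ ≤ x ^ (P.θ + P.ν) := Real.rpow_le_rpow (by linarith) (by linarith)
          (add_nonneg h.good.θ_nonneg h.good.ν_pos.le)

end

/-! ### Tuples of smooth numbers and primes with a Type II factorization -/

section

theorem sum_first {C : Type*} [Fintype C] {n : ℕ} (e : C ≃ Fin n) (G : C → Prop)
    {_ : ∀ c, Decidable (G c ∧ ∀ c', e c' < e c → ¬ G c')} (a : ℝ) (h : ∃ c, G c) : ∑ c, (if G c ∧ ∀ c', e c' < e c → ¬ G c' then a else 0) = a := by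
  classical
  obtain ⟨c, hc⟩ := h
  have hex : (univ.filter fun i : Fin n => G (e.symm i)).Nonempty := ⟨e c, by simp [hc]⟩
  set i := (univ.filter fun i : Fin n => G (e.symm i)).min' hex with hi
  have hiG : G (e.symm i) := (mem_filter.1 (min'_mem _ hex)).2
  have hmin : ∀ j, G (e.symm j) → i ≤ j := fun j hj => min'_le _ _ (by simp [hj])
  rw [sum_eq_single_of_mem (e.symm i) (mem_univ _), if_pos]
  · refine ⟨hiG, fun c' hc' hG => ?_⟩
    rw [Equiv.apply_symm_apply] at hc'
    exact absurd (hmin (e c') (by simpa using hG)) (not_le.2 hc')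
  · intro b _ hb
    rw [if_neg]
    rintro ⟨hG, hf⟩
    have h1 := hmin (e b) (by simpa using hG)
    rcases h1.lt_or_eq with h2 | h2
    · exact hf (e.symm i) (by simpa using h2) hiG
    · exact hb (by rw [h2, Equiv.symm_apply_apply])

theorem sum_lg {I : Type*} {f : I → ℕ} (hf : ∀ i, 1 ≤ f i) (A : Finset I) :
    ∑ i ∈ A, lg f i = Real.log ((∏ i ∈ A, f i : ℕ) : ℝ) := by
  rw [Nat.cast_prod, Real.log_prod]
  · rfl
  · intro i _
    have := hf i
    norm_cast
    omega

/-- The weight of a tuple consisting of smooth numbers and of primes (or `1`). -/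
def nfWt {Y Q : Type*} (z : ℝ) (τ : Y → Bool) : Y ⊕ Q → ℕ → ℝ :=
  Sum.elim (fun y => smoothWt z (τ y)) fun _ => primeOneWt z

theorem tupleSum_add {I : Type*} [Fintype I] (N : ℕ) (w : ℕ → ℝ) (W W' : (I → ℕ) → ℝ) :
    tupleSum N w (fun f => W f + W' f) = tupleSum N w W + tupleSum N w W' := by
  simp only [tupleSum, add_mul, sum_add_distrib]

theorem tupleSum_sum {I κ : Type*} [Fintype I] (s : Finset κ) (N : ℕ) (w : ℕ → ℝ)
    (W : κ → (I → ℕ) → ℝ) :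
    tupleSum N w (fun f => ∑ k ∈ s, W k f) = ∑ k ∈ s, tupleSum N w (W k) := by
  simp only [tupleSum, sum_mul]
  exact sum_comm

theorem tupleSum_congr {I : Type*} [Fintype I] {N : ℕ} {w : ℕ → ℝ}
    {W W' : (I → ℕ) → ℝ} (h : ∀ f ∈ box I N, w (∏ i, f i) ≠ 0 → W f = W' f) :
    tupleSum N w W = tupleSum N w W' :=
  sum_congr rfl fun f hf => by
    by_cases hw : w (∏ i, f i) = 0
    · rw [hw, mul_zero, mul_zero]
    · rw [h f hf hw]

open Classical in
/-- Sums over tuples of smooth numbers and of primes are small if each of the tuples has a Type II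
factorization. -/
theorem exists_bound_normalForm (Y Q : Type) [Fintype Y] [Fintype Q] (K : ℕ) :
    ∃ A : ℕ, ∀ (P : Params) (B x : ℝ) (w : ℕ → ℝ), Balanced P B x w → A ≤ B →
      ∀ (τ : Y → Bool) (Ω : (Y ⊕ Q → ℝ) → ℝ), SignFn K Ω → (∀ v, |Ω v| ≤ 1) →
      (∀ f ∈ box (Y ⊕ Q) ⌊x⌋₊, (∏ i, nfWt ((x / 2) ^ P.ν) τ i (f i)) ≠ 0 → Ω (lg f) ≠ 0 →
        w (∏ i, f i) ≠ 0 → ∃ A₀ : Finset Q,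
          ((∏ q ∈ A₀, f (.inr q) : ℕ) : ℝ) ≤ x ^ (P.θ + P.ν) ∧ (x / 2) ^ P.θ <
            ((∏ q ∈ A₀, f (.inr q) : ℕ) : ℝ) * ((∏ y, f (.inl y) : ℕ) : ℝ)) →
      |tupleSum ⌊x⌋₊ w fun f => (∏ i, nfWt ((x / 2) ^ P.ν) τ i (f i)) * Ω (lg f)| ≤
        errBd A B x := by
  -- A configuration is a set of components whose product lies in the Type II range, or a set below
  -- the range together with a smooth component which carries the product over its lower end. There
  -- are finitely many, and each tuple is assigned to the first one that fits in a fixed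
  -- enumeration.
  let Cfg := Finset (Y ⊕ Q) × Option Y
  let e := Fintype.equivFin Cfg
  let Good : ℝ × ℝ → Cfg → (Y ⊕ Q → ℝ) → Prop := fun a c v => match c.2 with
    | none => a.1 < ∑ i ∈ c.1, v i ∧ ∑ i ∈ c.1, v i ≤ a.2
    | some y => .inl y ∉ c.1 ∧ ∑ i ∈ c.1, v i ≤ a.1 ∧ a.1 < ∑ i ∈ c.1, v i + v (.inl y)
  have hsum : ∀ A : Finset (Y ⊕ Q), IsAff fun v : Y ⊕ Q → ℝ => ∑ i ∈ A, v i := fun A =>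
    IsAff.sum _ fun i _ => IsAff.coord i
  have hGood : ∀ c, Unif fun a v => Good a c v := by
    rintro ⟨A, _ | y⟩
    · exact (Unif.lt (fun a => IsAff.const _) fun a => hsum A).and
        (Unif.le (fun a => hsum A) fun a => IsAff.const _)
    · exact (Unif.const _).and ((Unif.le (fun a => hsum A) fun a => IsAff.const _).and
        (Unif.lt (fun a => IsAff.const _) fun a => (hsum A).add (IsAff.coord _)))
  have hFirst : ∀ c, Unif fun a v => Good a c v ∧ ∀ c', e c' < e c → ¬ Good a c' v := fun c =>
    (hGood c).and (Unif.all fun c' => Unif.imp (Unif.const _) (hGood c').not)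
  choose N hN using hFirst
  choose A₁ hA₁ using fun c => bits_pow_le (Fintype.card (Y ⊕ Q)) (K + N c)
  choose A₂ hA₂ using fun c => bits_pow_le (Fintype.card (Y ⊕ Q) + 1) (K + N c + 1)
  refine ⟨∑ c, (A₁ c + A₂ c) + (Fintype.card (Y ⊕ Q) + 1), fun P B x w h hB τ Ω hΩ hΩ1 hsupp => ?_⟩
  have hx8 := h.eight_le
  have hBI : ((Fintype.card (Y ⊕ Q) : ℕ) : ℝ) + 1 ≤ B := by
    refine le_trans ?_ hB
    push_cast
    have : (0 : ℝ) ≤ ∑ c, ((A₁ c : ℝ) + A₂ c) := by positivity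
    linarith
  set a : ℝ × ℝ := (P.θ * Real.log (x / 2), (P.θ + P.ν) * Real.log x) with ha
  let Ωc : Cfg → (Y ⊕ Q → ℝ) → ℝ := fun c v =>
    @ite ℝ (Good a c v ∧ ∀ c', e c' < e c → ¬ Good a c' v) (Classical.propDecidable _) (Ω v) 0
  have hΩc : ∀ c, SignFn (K + N c) (Ωc c) := fun c =>
    hΩ.map₂ (hN c a) fun r p => if p then r else 0
  have hΩc1 : ∀ c v, |Ωc c v| ≤ 1 := fun c v => by
    simp only [Ωc]
    split_ifs
    · exact hΩ1 v
    · simp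
  have hlt : ∀ n : ℕ, 1 ≤ n → (a.1 < Real.log n ↔ (x / 2) ^ P.θ < n) := fun n hn => by
    rw [ha, ← Real.log_rpow (by linarith), Real.log_lt_log_iff (by positivity) (by positivity)]
  have hle : ∀ n : ℕ, 1 ≤ n → (Real.log n ≤ a.1 ↔ (n : ℝ) ≤ (x / 2) ^ P.θ) := fun n hn => by
    rw [← not_lt, hlt n hn, not_lt]
  have hle' : ∀ n : ℕ, 1 ≤ n → (Real.log n ≤ a.2 ↔ (n : ℝ) ≤ x ^ (P.θ + P.ν)) := fun n hn => by
    change Real.log n ≤ (P.θ + P.ν) * Real.log x ↔ _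
    rw [← Real.log_rpow (by linarith), Real.log_le_log_iff (by positivity) (by positivity)]
  have hwt : ∀ (i : Y ⊕ Q) n, |nfWt ((x / 2) ^ P.ν) τ i n| ≤ 1 := by
    rintro (y | q) n
    exacts [abs_smoothWt_le _ _ _, abs_primeOneWt_le _ _]
  have hbd : ∀ c, |tupleSum ⌊x⌋₊ w fun f => (∏ i, nfWt ((x / 2) ^ P.ν) τ i (f i)) * Ωc c (lg f)| ≤
      errBd (A₁ c + A₂ c) B x := by
    intro c
    have hG : ∀ v, Ωc c v ≠ 0 → Good a c v := fun v hv => by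
      by_contra hc
      exact hv (if_neg fun h => hc h.1)
    obtain ⟨A, _ | y⟩ := c
    · have hb := (hA₁ (A, none) B x hx8).trans
        (errBd_mono hx8 (Nat.le_add_right _ (A₂ (A, none))))
      have hBI' : ((Fintype.card (Y ⊕ Q) : ℕ) : ℝ) ≤ B := by linarith
      refine (h.bilinear_direct hBI' A _ hwt (hΩc (A, none)) (hΩc1 (A, none)) ?_).trans hb
      intro f hf _ h2 _
      have h1 : ∀ i, 1 ≤ f i := fun i => (mem_box.1 hf i).1
      obtain ⟨h3, h4⟩ := hG _ h2
      rw [sum_lg h1] at h3 h4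
      exact ⟨(hlt _ (Finset.one_le_prod' fun i _ => h1 i)).1 h3,
        (hle' _ (Finset.one_le_prod' fun i _ => h1 i)).1 h4⟩
    · by_cases hy : .inl y ∈ A
      · have : ∀ v, Ωc (A, some y) v = 0 := fun v => if_neg fun h => h.1.1 hy
        simp only [this, mul_zero, tupleSum, zero_mul, sum_const_zero, abs_zero]
        exact errBd_nonneg hx8
      · have hb := (hA₂ (A, some y) B x hx8).trans
          (errBd_mono hx8 (Nat.le_add_left _ (A₁ (A, some y))))
        refine (h.bilinear_split hBI A hy (τ y) _ hwt rfl (hΩc (A, some y))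
          (hΩc1 (A, some y)) ?_).trans hb
        intro f hf _ h2 _
        have h1 : ∀ i, 1 ≤ f i := fun i => (mem_box.1 hf i).1
        obtain ⟨-, h3, h4⟩ := hG _ h2
        have h5 := Finset.one_le_prod' (s := A) fun i _ => h1 i
        rw [sum_lg h1] at h3 h4
        refine ⟨(hle _ h5).1 h3, ?_⟩
        have h6 : Real.log ((∏ i ∈ A, f i : ℕ) : ℝ) + lg f (.inl y) =
            Real.log (((∏ i ∈ A, f i) * f (.inl y) : ℕ) : ℝ) := by
          have := h1 (.inl y)
          rw [Nat.cast_mul, Real.log_mul (by norm_cast; omega) (by norm_cast; omega)]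
          rfl
        rw [h6, hlt _ (Nat.mul_pos h5 (h1 _))] at h4
        exact_mod_cast h4
  have hdec : (tupleSum ⌊x⌋₊ w fun f => (∏ i, nfWt ((x / 2) ^ P.ν) τ i (f i)) * Ω (lg f)) =
      ∑ c, tupleSum ⌊x⌋₊ w fun f => (∏ i, nfWt ((x / 2) ^ P.ν) τ i (f i)) * Ωc c (lg f) := by
    rw [← tupleSum_sum]
    refine tupleSum_congr fun f hf hw => ?_
    rw [← mul_sum]
    by_cases h0 : (∏ i, nfWt ((x / 2) ^ P.ν) τ i (f i)) = 0
    · rw [h0, zero_mul, zero_mul]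
    by_cases h2 : Ω (lg f) = 0
    · simp only [Ωc, h2, ite_self, sum_const_zero]
    congr 1
    symm
    apply sum_first
    have h1 : ∀ i, 1 ≤ f i := fun i => (mem_box.1 hf i).1
    obtain ⟨A₀, h3, h4⟩ := hsupp f hf h0 h2 hw
    by_contra! hno
    have hA₀ : ∀ g : Y ⊕ Q → ℕ, ∏ i ∈ A₀.map Function.Embedding.inr, g i = ∏ q ∈ A₀, g (.inr q) :=
      fun g => prod_map _ _ _
    have hp := fun s : Finset (Y ⊕ Q) => Finset.one_le_prod' (s := s) fun i _ => h1 i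
    -- The smooth components are added one at a time to the given set of primes. If no configuration
    -- fitted, the product would never pass the lower end of the range, contrary to the hypothesis
    -- on the product with all smooth components.
    have key : ∀ Y₁ : Finset Y, ((∏ i ∈ A₀.map Function.Embedding.inr ∪
        Y₁.map Function.Embedding.inl, f i : ℕ) : ℝ) ≤ (x / 2) ^ P.θ := by
      intro Y₁
      induction Y₁ using Finset.induction_on with
      | empty =>
        by_contra hc
        rw [map_empty, union_empty, hA₀] at hc
        refine hno (A₀.map Function.Embedding.inr, none) ?_
        simp only [Good]
        rw [sum_lg h1, hlt _ (hp _), hle' _ (hp _), hA₀]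
        exact ⟨not_le.1 hc, h3⟩
      | insert y Y₁ hy ih =>
        by_contra hc
        have hni : (.inl y : Y ⊕ Q) ∉ A₀.map Function.Embedding.inr ∪
            Y₁.map Function.Embedding.inl := by simp [hy]
        refine hno (A₀.map Function.Embedding.inr ∪ Y₁.map Function.Embedding.inl, some y) ?_
        simp only [Good]
        rw [add_comm, ← sum_insert hni, sum_lg h1, sum_lg h1, hlt _ (hp _), hle _ (hp _)]
        refine ⟨hni, ih, ?_⟩
        rw [map_insert, union_insert] at hc
        exact not_le.1 hc
    have h5 := key univ
    rw [prod_union, hA₀, prod_map] at h5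
    · push_cast at h4 h5
      exact absurd h4 (not_lt.2 h5)
    · rw [disjoint_left]
      intro i hi hi'
      rw [mem_map] at hi hi'
      obtain ⟨q, -, rfl⟩ := hi
      obtain ⟨y, -, hy⟩ := hi'
      cases hy
  rw [hdec]
  refine (abs_sum_le_sum_abs _ _).trans ((sum_le_sum fun c _ => hbd c).trans
    ((sum_errBd_le _ _ hx8).trans (errBd_mono hx8 (by omega))))

end

/-! ### Type I sums -/

section
variable {I : Type*} [Fintype I] [DecidableEq I] {P : Params} {B x : ℝ} {w : ℕ → ℝ}

theorem sign_eq_of_between {a b c : ℝ} (h : a ≤ b ∧ b ≤ c ∨ c ≤ b ∧ b ≤ a)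
    (hs : SignType.sign a = SignType.sign c) : SignType.sign b = SignType.sign a := by
  rcases h with ⟨h1, h2⟩ | ⟨h1, h2⟩
  · exact le_antisymm (hs ▸ SignType.sign.monotone h2) (SignType.sign.monotone h1)
  · exact le_antisymm (SignType.sign.monotone h2) (hs ▸ SignType.sign.monotone h1)

/-- Sets of integers that are order convex are intervals. -/
theorem exists_eq_Icc {N : ℕ} {s : Finset ℕ} (hs : s ⊆ Icc 1 N)
    (hc : ∀ a ∈ s, ∀ b ∈ s, ∀ n, a ≤ n → n ≤ b → n ∈ s) :
    ∃ c ∈ range (N + 2), ∃ d ∈ range (N + 2), s = Icc c d := by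
  by_cases h : s.Nonempty
  · refine ⟨s.min' h, ?_, s.max' h, ?_, ?_⟩
    · have := mem_Icc.1 (hs (s.min'_mem h))
      rw [mem_range]; omega
    · have := mem_Icc.1 (hs (s.max'_mem h))
      rw [mem_range]; omega
    · ext n
      rw [mem_Icc]
      exact ⟨fun hn => ⟨s.min'_le n hn, s.le_max' n hn⟩,
        fun hn => hc _ (s.min'_mem h) _ (s.max'_mem h) n hn.1 hn.2⟩
  · refine ⟨1, by simp, 0, by simp, ?_⟩
    rw [not_nonempty_iff_eq_empty.1 h]
    rfl

open Classical in
/-- Type I sums: for fixed values of the other components, the weight depends on the component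
`i₀` through the signs of affine functions of its logarithm. -/
theorem Balanced.linear (h : Balanced P B x w) (hB : Fintype.card I ≤ B) (i₀ : I)
    (V : (I → ℕ) → ℝ) (hV1 : ∀ f, |V f| ≤ 1) (hV : ∀ f k, V (Function.update f i₀ k) = V f)
    {Ω : (I → ℝ) → ℝ} {K : ℕ} (hΩ : SignFn K Ω) (hΩ1 : ∀ v, |Ω v| ≤ 1)
    (hsupp : ∀ f ∈ box I ⌊x⌋₊, V f ≠ 0 → Ω (lg f) ≠ 0 → w (∏ i, f i) ≠ 0 →
      ((∏ i ∈ univ.erase i₀, f i : ℕ) : ℝ) ≤ x ^ P.γ) :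
    |tupleSum ⌊x⌋₊ w fun f => V f * Ω (lg f)| ≤ 3 ^ K * (x / Real.log x ^ B) := by
  set N := ⌊x⌋₊ with hNdef
  have hx8 := h.eight_le
  have hN1 : 1 ≤ N := Nat.le_floor (by norm_num; linarith)
  obtain ⟨F, hF, hs⟩ := hΩ
  -- the inner sum
  let J : ℕ → ℕ × ℕ → ℝ := fun m q => |∑ n ∈ (Icc q.1 q.2).filter
    (fun n : ℕ => x / 2 < (m : ℝ) * (n : ℝ) ∧ (m : ℝ) * (n : ℝ) ≤ x), w (m * n)|
  -- The Type I bound admits one interval for each `m`; it is taken at the maximum, so that it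
  -- serves all sign patterns and all tuples with product `m`.
  have hmax : ∀ m, ∃ q : ℕ × ℕ, ∀ q' ∈ range (N + 2) ×ˢ range (N + 2), J m q' ≤ J m q := by
    intro m
    obtain ⟨q, -, hq⟩ := exists_max_image (range (N + 2) ×ˢ range (N + 2)) (J m)
      ⟨(0, 0), by simp⟩
    exact ⟨q, hq⟩
  choose q hq using hmax
  let S := (box I N).filter fun g => g i₀ = 1
  have hprodu : ∀ (g : I → ℕ), g i₀ = 1 → ∀ k, ∏ i, Function.update g i₀ k i = (∏ i, g i) * k := by
    intro g hg k
    rw [prod_update_of_mem (mem_univ _), ← mul_prod_erase univ g (mem_univ i₀), hg, one_mul,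
      sdiff_singleton_eq_erase, mul_comm]
  have hproder : ∀ (g : I → ℕ), g i₀ = 1 → ∀ k,
      ∏ i ∈ univ.erase i₀, Function.update g i₀ k i = ∏ i, g i := by
    intro g hg k
    rw [← mul_prod_erase univ g (mem_univ i₀), hg, one_mul]
    exact prod_congr rfl fun i hi => Function.update_of_ne (ne_of_mem_erase hi) _ _
  have hsplit : (tupleSum N w fun f => V f * Ω (lg f)) =
      ∑ g ∈ S, V g * ∑ k ∈ Icc 1 N, Ω (lg (Function.update g i₀ k)) * w ((∏ i, g i) * k) := by
    simp only [mul_sum]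
    rw [← sum_product' S (Icc 1 N) fun g k =>
      V g * (Ω (lg (Function.update g i₀ k)) * w ((∏ i, g i) * k)), tupleSum]
    refine sum_bij' (fun f _ => (Function.update f i₀ 1, f i₀)) (fun p _ => Function.update p.1 i₀ p.2)
      ?_ ?_ ?_ ?_ ?_
    · intro f hf
      simp only [S, mem_product, mem_filter, Function.update_self, and_true]
      refine ⟨mem_box.2 fun i => ?_, mem_Icc.2 (mem_box.1 hf i₀)⟩
      by_cases hi : i = i₀
      · subst hi; simpa using hN1
      · simpa [hi] using mem_box.1 hf i
    · intro p hp
      simp only [S, mem_product, mem_filter] at hp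
      refine mem_box.2 fun i => ?_
      by_cases hi : i = i₀
      · subst hi; simpa using hp.2
      · simpa [hi] using mem_box.1 hp.1.1 i
    · intro f hf
      simp
    · intro p hp
      simp only [S, mem_product, mem_filter] at hp
      refine Prod.ext ?_ (by simp)
      simp only [Function.update_idem]
      rw [← hp.1.2, Function.update_eq_self]
    · intro f hf
      simp only [Function.update_idem, Function.update_eq_self, hV]
      rw [← hprodu _ (by simp), Function.update_idem, Function.update_eq_self, mul_assoc]
  have hinner : ∀ g ∈ S, |V g * ∑ k ∈ Icc 1 N, Ω (lg (Function.update g i₀ k)) *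
      w ((∏ i, g i) * k)| ≤ if ∏ i, g i ∈ Icc 1 ⌊x ^ P.γ⌋₊ then
        3 ^ K * J (∏ i, g i) (q (∏ i, g i)) else 0 := by
    intro g hg
    obtain ⟨hgb, hg1⟩ := mem_filter.1 hg
    have hm1 : 1 ≤ ∏ i, g i := Finset.one_le_prod' fun i _ => (mem_box.1 hgb i).1
    set m := ∏ i, g i
    split_ifs with hm
    · rw [abs_mul]
      refine (mul_le_of_le_one_left (abs_nonneg _) (hV1 g)).trans ?_
      let pat : ℕ → F → SignType := fun k l => SignType.sign (affEval l.1 (lg (Function.update g i₀ k)))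
      have haff : ∀ (l : F) k, affEval l.1 (lg (Function.update g i₀ k)) =
          l.1.1 i₀ * Real.log k + (∑ i ∈ univ.erase i₀, l.1.1 i * lg g i + l.1.2) := by
        intro l k
        rw [affEval, ← add_sum_erase univ _ (mem_univ i₀), add_assoc]
        congr 1
        · simp [lg]
        · congr 1
          refine sum_congr rfl fun i hi => ?_
          simp [lg, Function.update_of_ne (ne_of_mem_erase hi)]
      -- For fixed other components each form is affine in `log k`, hence monotone in `k`. So each
      -- sign pattern holds on an interval of integers `k`, and there are at most `3 ^ K` patterns.
      have hconv : ∀ σ : F → SignType, ∃ c ∈ range (N + 2), ∃ d ∈ range (N + 2),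
          (Icc 1 N).filter (fun k => pat k = σ) = Icc c d := by
        intro σ
        refine exists_eq_Icc (filter_subset _ _) fun a ha b hb n han hnb => ?_
        rw [mem_filter, mem_Icc] at ha hb ⊢
        refine ⟨⟨ha.1.1.trans han, hnb.trans hb.1.2⟩, ?_⟩
        funext l
        rw [← ha.2]
        refine sign_eq_of_between (c := affEval l.1 (lg (Function.update g i₀ b))) ?_
          (congrFun (ha.2.trans hb.2.symm) l)
        have ha0 : (0 : ℝ) < a := by exact_mod_cast ha.1.1
        have h1 : Real.log a ≤ Real.log n := Real.log_le_log ha0 (by exact_mod_cast han)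
        have h2 : Real.log n ≤ Real.log b := Real.log_le_log
          (ha0.trans_le (by exact_mod_cast han)) (by exact_mod_cast hnb)
        simp only [haff]
        rcases le_total 0 (l.1.1 i₀) with h0 | h0
        · left
          constructor <;> gcongr
        · right
          constructor <;>
          · have := mul_le_mul_of_nonpos_left h1 h0
            have := mul_le_mul_of_nonpos_left h2 h0
            linarith
      have hfib : ∑ k ∈ Icc 1 N, Ω (lg (Function.update g i₀ k)) * w (m * k) =
          ∑ σ : F → SignType, ∑ k ∈ (Icc 1 N).filter (fun k => pat k = σ),
            Ω (lg (Function.update g i₀ k)) * w (m * k) := (sum_fiberwise _ _ _).symm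
      rw [hfib]
      have hσ : ∀ σ : F → SignType, |∑ k ∈ (Icc 1 N).filter (fun k => pat k = σ),
            Ω (lg (Function.update g i₀ k)) * w (m * k)| ≤ J m (q m) := by
        intro σ
        obtain ⟨c, hc, d, hd, hcd⟩ := hconv σ
        by_cases hne : ((Icc 1 N).filter (fun k => pat k = σ)).Nonempty
        · obtain ⟨k₀, hk₀⟩ := hne
          have hconst : ∀ k ∈ (Icc 1 N).filter (fun k => pat k = σ),
              Ω (lg (Function.update g i₀ k)) * w (m * k) =
              Ω (lg (Function.update g i₀ k₀)) * w (m * k) := by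
            intro k hk
            rw [hs _ (lg (Function.update g i₀ k₀)) fun l hl => ?_]
            exact congrFun ((mem_filter.1 hk).2.trans (mem_filter.1 hk₀).2.symm) ⟨l, hl⟩
          rw [sum_congr rfl hconst, ← mul_sum, abs_mul]
          refine (mul_le_of_le_one_left (abs_nonneg _) (hΩ1 _)).trans ?_
          rw [hcd]
          refine le_trans (le_of_eq ?_) (hq m (c, d) (mem_product.2 ⟨hc, hd⟩))
          simp only [J]
          congr 1
          symm
          refine sum_filter_of_ne fun k _ hk => ?_
          have := h.supp _ hk
          push_cast at this
          exact this
        · rw [not_nonempty_iff_eq_empty.1 hne, sum_empty, abs_zero]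
          exact abs_nonneg _
      refine (abs_sum_le_sum_abs _ _).trans ((sum_le_sum fun σ _ => hσ σ).trans ?_)
      rw [sum_const, nsmul_eq_mul, card_univ, Fintype.card_fun, Fintype.card_coe]
      have : Fintype.card SignType = 3 := by decide
      rw [this]
      refine mul_le_mul_of_nonneg_right ?_ (abs_nonneg _)
      exact_mod_cast Nat.pow_le_pow_right (by norm_num) hF
    · rw [abs_nonpos_iff]
      by_contra hne
      obtain ⟨k, hk, hk0⟩ := exists_ne_zero_of_sum_ne_zero (right_ne_zero_of_mul hne)
      apply hm
      rw [mem_Icc]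
      refine ⟨hm1, Nat.le_floor ?_⟩
      have := hsupp (Function.update g i₀ k) ?_ (by rw [hV]; exact left_ne_zero_of_mul hne)
        (left_ne_zero_of_mul hk0) (by rw [hprodu g hg1]; exact right_ne_zero_of_mul hk0)
      · rwa [hproder g hg1] at this
      · refine mem_box.2 fun i => ?_
        by_cases hi : i = i₀
        · subst hi; simpa using hk
        · simpa [hi] using mem_box.1 hgb i
  rw [hsplit]
  refine (abs_sum_le_sum_abs _ _).trans ((sum_le_sum hinner).trans ?_)
  rw [← sum_filter]
  have hm : ∀ g ∈ S.filter (fun g => ∏ i, g i ∈ Icc 1 ⌊x ^ P.γ⌋₊), ∏ i, g i ∈ Icc 1 ⌊x ^ P.γ⌋₊ :=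
    fun g hg => (mem_filter.1 hg).2
  rw [← sum_fiberwise_of_maps_to hm]
  have h3 := h.type_one (fun m => (q m).1) (fun m => (q m).2)
  refine le_trans ?_ (mul_le_mul_of_nonneg_left h3 (by positivity : (0 : ℝ) ≤ 3 ^ K))
  rw [mul_sum]
  refine sum_le_sum fun m hm => ?_
  have hm0 : m ≠ 0 := by have := (mem_Icc.1 hm).1; omega
  rw [sum_congr rfl fun g hg => by rw [(mem_filter.1 hg).2], sum_const, nsmul_eq_mul]
  -- The number of tuples with product `m` is covered by the weight `τ(m) ^ B` of the Type I bound.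
  have hcard : ((#{g ∈ S.filter (fun g => ∏ i, g i ∈ Icc 1 ⌊x ^ P.γ⌋₊) | ∏ i, g i = m} : ℕ) : ℝ) ≤
      tau m ^ B := by
    calc ((#{g ∈ S.filter (fun g => ∏ i, g i ∈ Icc 1 ⌊x ^ P.γ⌋₊) | ∏ i, g i = m} : ℕ) : ℝ)
        ≤ ((#m.divisors ^ Fintype.card I : ℕ) : ℝ) := by
          refine Nat.cast_le.2 (le_trans (card_le_card ?_) (card_filter_prod_eq_le N m hm0))
          intro g hg
          simp only [S, mem_filter] at hg ⊢
          exact ⟨hg.1.1.1, hg.2⟩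
      _ = tau m ^ (Fintype.card I : ℝ) := by rw [Real.rpow_natCast]; simp [tau]
      _ ≤ tau m ^ B := Real.rpow_le_rpow_of_exponent_le (one_le_tau hm0) hB
  calc _ ≤ tau m ^ B * (3 ^ K * J m (q m)) := mul_le_mul_of_nonneg_right hcard
        (mul_nonneg (by positivity) (abs_nonneg _))
    _ = _ := by simp only [J]; ring

end

/-! ### The smooth part and the large prime factors -/

open Classical in
/-- The prime factors `≥ z`, in nondecreasing order. -/
def roughList (z : ℝ) (n : ℕ) : List ℕ := n.primeFactorsList.filter fun p : ℕ => z ≤ (p : ℝ)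

open Classical in
/-- The `z`-smooth part of `n`. -/
def smoothPart (z : ℝ) (n : ℕ) : ℕ := (n.primeFactorsList.filter fun p : ℕ => ¬ z ≤ (p : ℝ)).prod

/-- The tuple consisting of the members of a list, followed by ones. -/
def pad (T : ℕ) (l : List ℕ) : Fin T → ℕ := fun i => l.getD i 1

/-- The tuples of the form `pad T l` with a sorted list `l`. -/
def Padded {T : ℕ} (q : Fin T → ℕ) : Prop := ∀ i j, i < j → q j = 1 ∨ q i ≠ 1 ∧ q i ≤ q j

theorem prod_pad (T : ℕ) : ∀ l : List ℕ, l.length ≤ T → ∏ i, pad T l i = l.prod := by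
  induction T with
  | zero =>
    intro l hl
    rw [List.length_eq_zero_iff.1 (Nat.le_zero.1 hl)]
    simp
  | succ T ih =>
    intro l hl
    rcases l with _ | ⟨a, l⟩
    · simp [pad]
    · rw [Fin.prod_univ_succ, List.prod_cons, ← ih l (by simpa using hl)]
      rfl

theorem pad_mem {T : ℕ} {l : List ℕ} (i : Fin T) : pad T l i = 1 ∨ pad T l i ∈ l := by
  unfold pad
  by_cases hi : (i : ℕ) < l.length
  · right
    rw [List.getD_eq_getElem _ _ hi]
    exact List.getElem_mem hi
  · left
    exact List.getD_eq_default _ _ (not_lt.1 hi)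

theorem padded_pad {T : ℕ} {l : List ℕ} (hs : l.SortedLE) (h1 : ∀ p ∈ l, p ≠ 1) :
    Padded (pad T l) := by
  intro i j hij
  unfold pad
  by_cases hj : (j : ℕ) < l.length
  · right
    have hi : (i : ℕ) < l.length := lt_trans hij hj
    rw [List.getD_eq_getElem _ _ hj, List.getD_eq_getElem _ _ hi]
    exact ⟨h1 _ (List.getElem_mem hi),
      List.pairwise_iff_getElem.1 hs.pairwise _ _ hi hj hij⟩
  · left
    exact List.getD_eq_default _ _ (not_lt.1 hj)

theorem Padded.exists_list {T : ℕ} : ∀ {q : Fin T → ℕ}, Padded q →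
    ∃ l : List ℕ, l.SortedLE ∧ (∀ p ∈ l, ∃ i, q i = p ∧ p ≠ 1) ∧ l.length ≤ T ∧ pad T l = q := by
  induction T with
  | zero => exact fun _ => ⟨[], by simp [List.sortedLE_iff_pairwise], by simp, le_rfl, funext fun i => i.elim0⟩
  | succ T ih =>
    intro q hq
    by_cases h0 : q 0 = 1
    · refine ⟨[], by simp [List.sortedLE_iff_pairwise], by simp, by simp, funext fun i => ?_⟩
      have : pad (T + 1) [] i = 1 := by simp [pad]
      rw [this]
      rcases Fin.eq_zero_or_eq_succ i with rfl | ⟨j, rfl⟩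
      · exact h0.symm
      · rcases hq 0 j.succ (Fin.succ_pos j) with h | h
        · exact h.symm
        · exact absurd h0 h.1
    · obtain ⟨l, hl, hm, hlen, hp⟩ := ih (q := fun i => q i.succ) fun i j hij =>
        hq _ _ (Fin.succ_lt_succ_iff.2 hij)
      refine ⟨q 0 :: l, ?_, ?_, by simpa using hlen, funext fun i => ?_⟩
      · rw [List.sortedLE_iff_pairwise, List.pairwise_cons]
        refine ⟨fun p hp => ?_, hl.pairwise⟩
        obtain ⟨i, hi, h1⟩ := hm p hp
        rcases hq 0 i.succ (Fin.succ_pos i) with h | h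
        · exact absurd (hi.symm.trans h) h1
        · exact hi ▸ h.2
      · intro p hp
        rcases List.mem_cons.1 hp with rfl | hp
        · exact ⟨0, rfl, h0⟩
        · obtain ⟨i, hi, h1⟩ := hm p hp
          exact ⟨i.succ, hi, h1⟩
      · rcases Fin.eq_zero_or_eq_succ i with rfl | ⟨j, rfl⟩
        · rfl
        · exact congrFun hp j

section
variable {z : ℝ} {n : ℕ}

theorem mem_roughList (hn : n ≠ 0) {p : ℕ} : p ∈ roughList z n ↔ p.Prime ∧ p ∣ n ∧ z ≤ p := by
  simp [roughList, Nat.mem_primeFactorsList hn, and_assoc]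

theorem roughList_sorted : (roughList z n).SortedLE := by
  rw [List.sortedLE_iff_pairwise]
  exact (Nat.primeFactorsList_sorted n).pairwise.filter _

theorem smoothPart_mul_prod (hn : n ≠ 0) : smoothPart z n * (roughList z n).prod = n := by
  classical
  conv_rhs => rw [← Nat.prod_primeFactorsList hn]
  rw [smoothPart, roughList, mul_comm]
  have := (List.filter_append_perm (fun p : ℕ => decide (z ≤ (p : ℝ))) n.primeFactorsList).prod_eq
  rw [List.prod_append] at this
  rw [← this]
  congr 3
  funext p
  rw [decide_not]

theorem smoothPart_ne_zero : smoothPart z n ≠ 0 :=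
  List.prod_ne_zero fun h => Nat.not_prime_zero
    (Nat.prime_of_mem_primeFactorsList (List.mem_of_mem_filter h))

theorem mem_primeFactors_list_prod {l : List ℕ} (hl : ∀ p ∈ l, p.Prime) {p : ℕ} :
    p ∈ l.prod.primeFactors ↔ p ∈ l := by
  rw [Nat.primeFactors, List.mem_toFinset]
  exact (Nat.primeFactorsList_unique rfl hl).mem_iff.symm

theorem lt_of_mem_smoothPart {p : ℕ} (hp : p ∈ (smoothPart z n).primeFactors) : (p : ℝ) < z := by
  rw [smoothPart, mem_primeFactors_list_prod fun p hp =>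
    Nat.prime_of_mem_primeFactorsList (List.mem_of_mem_filter hp), List.mem_filter] at hp
  simpa using hp.2

/-- The factorization of an integer into a smooth number and large primes is unique. -/
theorem factor_unique {s : ℕ} {l : List ℕ} (hs : s ≠ 0) (hsz : ∀ p ∈ s.primeFactors, (p : ℝ) < z)
    (hl : ∀ p ∈ l, p.Prime ∧ z ≤ p) (hls : l.SortedLE) :
    smoothPart z (s * l.prod) = s ∧ roughList z (s * l.prod) = l := by
  classical
  have hl0 : l.prod ≠ 0 := List.prod_ne_zero fun h => Nat.not_prime_zero (hl 0 h).1
  have hperm : (s * l.prod).primeFactorsList.Perm (s.primeFactorsList ++ l) :=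
    (Nat.perm_primeFactorsList_mul hs hl0).trans
      ((Nat.primeFactorsList_unique rfl fun p hp => (hl p hp).1).symm.append_left _)
  have h1 : ∀ p ∈ s.primeFactorsList, ¬ z ≤ (p : ℝ) := fun p hp =>
    not_le.2 (hsz p (by simpa using hp))
  constructor
  · rw [smoothPart, (hperm.filter _).prod_eq, List.filter_append, List.filter_eq_self.2 (by
      simpa using h1), List.filter_eq_nil_iff.2 (by simpa using fun p hp => (hl p hp).2),
      List.append_nil, Nat.prod_primeFactorsList hs]
  · refine List.Perm.eq_of_sortedLE roughList_sorted hls ?_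
    have h2 := hperm.filter fun p : ℕ => decide (z ≤ (p : ℝ))
    rwa [List.filter_append, List.filter_eq_nil_iff (l := s.primeFactorsList).2 (by simpa using h1),
      List.filter_eq_self (l := l).2 (by simpa using fun p hp => (hl p hp).2), List.nil_append] at h2

open Classical in
/-- The indicator function of the integers with all prime factors `≥ z`. -/
def roughWt (z : ℝ) (n : ℕ) : ℝ := if ∀ p ∈ n.primeFactors, z ≤ (p : ℝ) then 1 else 0

theorem smoothPart_eq_one_iff (hn : n ≠ 0) :
    smoothPart z n = 1 ↔ ∀ p ∈ n.primeFactors, z ≤ (p : ℝ) := by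
  constructor
  · intro h p hp
    have h1 := smoothPart_mul_prod (z := z) hn
    rw [h, one_mul] at h1
    rw [← h1, mem_primeFactors_list_prod fun p hp => ((mem_roughList hn).1 hp).1] at hp
    exact ((mem_roughList hn).1 hp).2.2
  · intro h
    have h0 : ∀ p, p ∉ (smoothPart z n).primeFactors := fun p hp => by
      have h1 := lt_of_mem_smoothPart hp
      have h2 := h p (Nat.primeFactors_mono ⟨_, (smoothPart_mul_prod hn).symm⟩ hn hp)
      linarith
    have := eq_empty_of_forall_notMem h0
    rw [Nat.primeFactors_eq_empty] at this
    exact this.resolve_left smoothPart_ne_zero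

theorem dvd_smoothPart_iff (hn : n ≠ 0) {e : ℕ} :
    e ∣ smoothPart z n ↔ e ∣ n ∧ ∀ p ∈ e.primeFactors, (p : ℝ) < z := by
  have h1 := smoothPart_mul_prod (z := z) hn
  constructor
  · intro h
    exact ⟨h.trans ⟨_, h1.symm⟩, fun p hp =>
      lt_of_mem_smoothPart (Nat.primeFactors_mono h smoothPart_ne_zero hp)⟩
  · rintro ⟨h, hz⟩
    rw [← h1] at h
    refine Nat.Coprime.dvd_of_dvd_mul_right ?_ h
    have he0 : e ≠ 0 := by
      rintro rfl
      exact hn (by simpa [h1] using h)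
    have hr0 : (roughList z n).prod ≠ 0 := fun h0 => hn (by rw [← h1, h0, mul_zero])
    rw [← Nat.disjoint_primeFactors he0 hr0, disjoint_left]
    intro p hp hq
    rw [mem_primeFactors_list_prod fun p hp => ((mem_roughList hn).1 hp).1] at hq
    exact absurd ((mem_roughList hn).1 hq).2.2 (not_le.2 (hz p hp))

/-- The smooth divisors of `n` are the divisors of its smooth part, and the Möbius function sums to
`0` over them unless this part is `1`. -/
theorem sum_smoothWt (hn : n ≠ 0) : ∑ e ∈ n.divisors, smoothWt z true e = roughWt z n := by
  classical
  have h1 : ∑ e ∈ n.divisors, smoothWt z true e =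
      ∑ e ∈ (smoothPart z n).divisors, (ArithmeticFunction.moebius e : ℝ) := by
    simp only [smoothWt, if_true]
    rw [← sum_filter]
    refine sum_congr ?_ fun _ _ => rfl
    ext e
    rw [mem_filter, Nat.mem_divisors, Nat.mem_divisors, dvd_smoothPart_iff hn]
    have := smoothPart_ne_zero (z := z) (n := n)
    tauto
  rw [h1, roughWt]
  have h2 : ∑ e ∈ (smoothPart z n).divisors, ArithmeticFunction.moebius e =
      if smoothPart z n = 1 then 1 else 0 := by
    rw [← ArithmeticFunction.coe_mul_zeta_apply, ArithmeticFunction.moebius_mul_coe_zeta,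
      ArithmeticFunction.one_apply]
  have h3 : ∑ e ∈ (smoothPart z n).divisors, (ArithmeticFunction.moebius e : ℝ) =
      ((∑ e ∈ (smoothPart z n).divisors, ArithmeticFunction.moebius e : ℤ) : ℝ) := by
    push_cast; rfl
  rw [h3, h2]
  by_cases h4 : smoothPart z n = 1
  · rw [if_pos h4, if_pos ((smoothPart_eq_one_iff hn).1 h4), Int.cast_one]
  · rw [if_neg h4, if_neg fun h => h4 ((smoothPart_eq_one_iff hn).2 h), Int.cast_zero]

end

/-! ### Expansion of free variables into primes -/

open Classical in
/-- The indicator function of `Padded`. -/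
def padWt {T : ℕ} (q : Fin T → ℕ) : ℝ := if Padded q then 1 else 0

section
variable {Y Q : Type*} [Fintype Y] [Fintype Q]

/-- The tuple with components `s_q ∏ₜ p_{q,t}`. -/
def mulOut {T : ℕ} (f : (Y ⊕ Q) ⊕ (Q × Fin T) → ℕ) : Y ⊕ Q → ℕ :=
  Sum.elim (fun y => f (.inl (.inl y)))
    fun q => f (.inl (.inr q)) * ∏ t, f (.inr (q, t))

theorem prod_mulOut {T : ℕ} (f : (Y ⊕ Q) ⊕ (Q × Fin T) → ℕ) : ∏ i, mulOut f i = ∏ i, f i := by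
  simp only [mulOut, Fintype.prod_sum_type, Sum.elim_inl, Sum.elim_inr, prod_mul_distrib,
    Fintype.prod_prod_type, mul_assoc]

theorem smoothWt_false_eq {z : ℝ} {n : ℕ} (h : smoothWt z false n ≠ 0) : smoothWt z false n = 1 := by
  unfold smoothWt at h ⊢
  rw [if_pos (lt_of_smoothWt_ne_zero h)]
  simp

theorem primeOneWt_eq {z : ℝ} {n : ℕ} (h : primeOneWt z n ≠ 0) :
    (n = 1 ∨ n.Prime ∧ z ≤ n) ∧ primeOneWt z n = 1 := by
  unfold primeOneWt at h ⊢
  by_cases hc : n = 1 ∨ n.Prime ∧ z ≤ n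
  · exact ⟨hc, if_pos hc⟩
  · exact absurd (if_neg hc) h

theorem primeWt_eq {z : ℝ} {n : ℕ} (h : primeWt z n ≠ 0) :
    (n.Prime ∧ z ≤ n) ∧ primeWt z n = 1 := by
  unfold primeWt at h ⊢
  by_cases hc : n.Prime ∧ z ≤ n
  · exact ⟨hc, if_pos hc⟩
  · exact absurd (if_neg hc) h

/-- Each of the components in `Q` is factored into a smooth number and large primes. -/
theorem tupleSum_expand {z : ℝ} {T N : ℕ} {w : ℕ → ℝ} (hw : ∀ n, w n ≠ 0 → n ≤ N)
    (hT : ∀ n, n ≠ 0 → n ≤ N → (roughList z n).length ≤ T) (W : (Y ⊕ Q → ℕ) → ℝ) :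
    tupleSum N w W = tupleSum N w fun f : (Y ⊕ Q) ⊕ (Q × Fin T) → ℕ =>
      (∏ q, smoothWt z false (f (.inl (.inr q)))) * (∏ b, primeOneWt z (f (.inr b))) *
        (∏ q, padWt fun t => f (.inr (q, t))) * W (mulOut f) := by
  symm
  -- By uniqueness of the factorization the smooth part and the padded list of primes can be
  -- recovered from the product. So the expansion is injective and every weight that occurs is `1`.
  have hdec : ∀ f ∈ box ((Y ⊕ Q) ⊕ (Q × Fin T)) N,
      (∏ q, smoothWt z false (f (.inl (.inr q)))) ≠ 0 →
      (∏ b, primeOneWt z (f (.inr b))) ≠ 0 → (∏ q, padWt fun t => f (.inr (q, t))) ≠ 0 →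
      (∀ q, f (.inl (.inr q)) = smoothPart z (mulOut f (.inr q)) ∧
        (fun t => f (.inr (q, t))) = pad T (roughList z (mulOut f (.inr q)))) := by
    intro f hf h1 h2 h3 q
    have hs := (prod_ne_zero_iff.1 h1 q (mem_univ _))
    have hp : Padded fun t => f (.inr (q, t)) := by
      have := (prod_ne_zero_iff.1 h3 q (mem_univ _))
      unfold padWt at this
      by_contra hc
      exact this (if_neg hc)
    obtain ⟨l, hl, hm, hlen, hpad⟩ := hp.exists_list
    have hf0 : f (.inl (.inr q)) ≠ 0 := by
      have := (mem_box.1 hf (.inl (.inr q))).1; omega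
    have := factor_unique (z := z) hf0 (lt_of_smoothWt_ne_zero hs) (l := l) (fun p hp => by
      obtain ⟨t, ht, hp1⟩ := hm p hp
      have := (primeOneWt_eq (prod_ne_zero_iff.1 h2 (q, t) (mem_univ _))).1
      rw [ht] at this
      exact this.resolve_left hp1) hl
    have he : mulOut f (.inr q) = f (.inl (.inr q)) * l.prod := by
      rw [← prod_pad T l hlen, hpad]
      rfl
    rw [he, this.1, this.2]
    exact ⟨rfl, hpad.symm⟩
  have hone : ∀ f : (Y ⊕ Q) ⊕ (Q × Fin T) → ℕ,
      (∏ q, smoothWt z false (f (.inl (.inr q)))) ≠ 0 →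
      (∏ b, primeOneWt z (f (.inr b))) ≠ 0 → (∏ q, padWt fun t => f (.inr (q, t))) ≠ 0 →
      (∏ q, smoothWt z false (f (.inl (.inr q)))) * (∏ b, primeOneWt z (f (.inr b))) *
        (∏ q, padWt fun t => f (.inr (q, t))) = 1 := by
    intro f h1 h2 h3
    rw [prod_eq_one fun q hq => smoothWt_false_eq (prod_ne_zero_iff.1 h1 q hq),
      prod_eq_one fun q hq => (primeOneWt_eq (prod_ne_zero_iff.1 h2 q hq)).2,
      prod_eq_one fun q hq => ?_]
    · simp
    · have := prod_ne_zero_iff.1 h3 q hq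
      unfold padWt at this ⊢
      by_contra hc
      by_cases hp : Padded fun t => f (.inr (q, t))
      · exact hc (if_pos hp)
      · exact this (if_neg hp)
  rw [tupleSum, tupleSum]
  refine sum_bij_ne_zero (fun f _ _ => mulOut f) ?_ ?_ ?_ ?_
  · intro f hf hne
    refine mem_box_of_prod_le ?_ ?_
    · rintro (y | q)
      · exact (mem_box.1 hf _).1
      · exact Nat.mul_pos (mem_box.1 hf _).1 (prod_pos fun t _ => (mem_box.1 hf _).1)
    · rw [prod_mulOut]
      exact hw _ (right_ne_zero_of_mul hne)
  · intro f hf hne f' hf' hne' he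
    have g1 := left_ne_zero_of_mul (left_ne_zero_of_mul hne)
    have g1' := left_ne_zero_of_mul (left_ne_zero_of_mul hne')
    have h1 := hdec f hf (left_ne_zero_of_mul (left_ne_zero_of_mul g1))
      (right_ne_zero_of_mul (left_ne_zero_of_mul g1)) (right_ne_zero_of_mul g1)
    have h2 := hdec f' hf' (left_ne_zero_of_mul (left_ne_zero_of_mul g1'))
      (right_ne_zero_of_mul (left_ne_zero_of_mul g1')) (right_ne_zero_of_mul g1')
    funext i
    rcases i with (y | q) | ⟨q, t⟩
    · exact congrFun he (.inl y)
    · rw [(h1 q).1, (h2 q).1, he]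
    · have e1 := congrFun (h1 q).2 t
      have e2 := congrFun (h2 q).2 t
      rw [e1, e2, he]
  · intro g hg hne
    have hg0 : ∀ i, g i ≠ 0 := fun i => by have := (mem_box.1 hg i).1; omega
    let f : (Y ⊕ Q) ⊕ (Q × Fin T) → ℕ := Sum.elim (Sum.elim (fun y => g (.inl y))
      fun q => smoothPart z (g (.inr q))) fun b => pad T (roughList z (g (.inr b.1))) b.2
    have hlen : ∀ q, (roughList z (g (.inr q))).length ≤ T := fun q =>
      hT _ (hg0 _) (mem_box.1 hg _).2
    have hfg : mulOut f = g := by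
      funext i
      rcases i with y | q
      · rfl
      · change smoothPart z (g (.inr q)) * ∏ t, pad T (roughList z (g (.inr q))) t = _
        rw [prod_pad T _ (hlen q), smoothPart_mul_prod (hg0 _)]
    have hf1 : ∀ i, 1 ≤ f i := by
      rintro ((y | q) | ⟨q, t⟩)
      · exact (mem_box.1 hg _).1
      · exact Nat.one_le_iff_ne_zero.2 smoothPart_ne_zero
      · change 1 ≤ pad T _ t
        rcases pad_mem (l := roughList z (g (.inr q))) t with h | h
        · exact h.ge
        · exact ((mem_roughList (hg0 _)).1 h).1.one_le
    have hp : ∏ i, f i = ∏ i, g i := by rw [← prod_mulOut, hfg]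
    have hN := hw _ (right_ne_zero_of_mul hne)
    have h1 : (∏ q, smoothWt z false (f (.inl (.inr q)))) ≠ 0 :=
      prod_ne_zero_iff.2 fun q _ => by
        unfold smoothWt
        rw [if_pos]
        · simp
        · exact fun p hp => lt_of_mem_smoothPart hp
    have h2 : (∏ b, primeOneWt z (f (.inr b))) ≠ 0 := prod_ne_zero_iff.2 fun b _ => by
      unfold primeOneWt
      rw [if_pos]
      · simp
      · rcases pad_mem (l := roughList z (g (.inr b.1))) b.2 with h | h
        · exact Or.inl h
        · have := (mem_roughList (hg0 _)).1 h
          exact Or.inr ⟨this.1, this.2.2⟩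
    have h3 : (∏ q, padWt fun t => f (.inr (q, t))) ≠ 0 := prod_ne_zero_iff.2 fun q _ => by
      unfold padWt
      rw [if_pos]
      · simp
      · exact padded_pad (l := roughList z (g (.inr q))) roughList_sorted
          fun p hp => ((mem_roughList (hg0 _)).1 hp).1.ne_one
    refine ⟨f, mem_box_of_prod_le hf1 (hp ▸ hN), ?_, hfg⟩
    rw [hone f h1 h2 h3, one_mul, hfg, hp]
    exact hne
  · intro f hf hne
    have g1 := left_ne_zero_of_mul (left_ne_zero_of_mul hne)
    rw [hone f (left_ne_zero_of_mul (left_ne_zero_of_mul g1))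
      (right_ne_zero_of_mul (left_ne_zero_of_mul g1)) (right_ne_zero_of_mul g1), one_mul,
      prod_mulOut]

open Classical in
/-- Extension of a tuple by ones. -/
def extendOne {K : Type*} (S : Finset K) (f : Y ⊕ S → ℕ) : Y ⊕ K → ℕ :=
  Sum.elim (fun y => f (.inl y)) fun k => if h : k ∈ S then f (.inr ⟨k, h⟩) else 1

theorem prod_extendOne {K : Type*} [Fintype K] (S : Finset K) (f : Y ⊕ S → ℕ) :
    ∏ i, extendOne S f i = ∏ i, f i := by
  classical
  rw [Fintype.prod_sum_type, Fintype.prod_sum_type]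
  congr 1
  simp only [extendOne, Sum.elim_inr]
  rw [← prod_subset (subset_univ S) fun k _ hk => by rw [dif_neg hk], ← prod_coe_sort S]
  exact prod_congr rfl fun k _ => by rw [dif_pos k.2]

/-- Sums over tuples of primes and ones are split according to the position of the primes. -/
theorem tupleSum_pad {K : Type*} [Fintype K] {z : ℝ} {N : ℕ} {w : ℕ → ℝ} (hN : 1 ≤ N)
    (W : (Y ⊕ K → ℕ) → ℝ) :
    tupleSum N w (fun f => (∏ k, primeOneWt z (f (.inr k))) * W f) =
      ∑ S : Finset K, tupleSum N w fun f : Y ⊕ S → ℕ =>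
        (∏ k, primeWt z (f (.inr k))) * W (extendOne S f) := by
  classical
  rw [tupleSum, ← sum_fiberwise (box (Y ⊕ K) N) fun f => univ.filter fun k => f (.inr k) ≠ 1]
  refine sum_congr rfl fun S _ => ?_
  rw [tupleSum]
  symm
  have hval : ∀ f : Y ⊕ S → ℕ, (∏ k, primeWt z (f (.inr k))) =
      if ∀ k, f (.inr k) ≠ 1 then ∏ k, primeOneWt z (extendOne S f (.inr k)) else 0 := by
    intro f
    have h1 : ∏ k, primeOneWt z (extendOne S f (.inr k)) =
        ∏ k : S, primeOneWt z (f (.inr k)) := by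
      simp only [extendOne, Sum.elim_inr]
      rw [← prod_subset (subset_univ S) fun k _ hk => by
        rw [dif_neg hk]; simp [primeOneWt], ← prod_coe_sort S]
      exact prod_congr rfl fun k _ => by rw [dif_pos k.2]
    split_ifs with h
    · rw [h1]
      exact prod_congr rfl fun k _ => by simp [primeWt, primeOneWt, h k]
    · push Not at h
      obtain ⟨k, hk⟩ := h
      exact prod_eq_zero (mem_univ k) (by rw [hk]; simp [primeWt, Nat.not_prime_one])
  refine sum_bij_ne_zero (fun f _ _ => extendOne S f) ?_ ?_ ?_ ?_
  · intro f hf hne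
    rw [mem_filter, mem_box]
    have h1 := left_ne_zero_of_mul (left_ne_zero_of_mul hne)
    rw [hval] at h1
    have h2 : ∀ k, f (.inr k) ≠ 1 := by
      by_contra hc
      exact h1 (if_neg hc)
    constructor
    · rintro (y | k)
      · exact mem_box.1 hf _
      · simp only [extendOne, Sum.elim_inr]
        split_ifs
        exacts [mem_box.1 hf _, ⟨le_rfl, hN⟩]
    · ext k
      simp only [extendOne, Sum.elim_inr]
      by_cases hk : k ∈ S
      · simp [hk, h2]
      · simp [hk]
  · intro f hf _ f' hf' _ he
    funext i
    rcases i with y | k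
    · exact congrFun he (.inl y)
    · have := congrFun he (.inr k.1)
      simpa [extendOne] using this
  · intro g hg hne
    obtain ⟨hgb, hgS⟩ := mem_filter.1 hg
    let f : Y ⊕ S → ℕ := Sum.elim (fun y => g (.inl y)) fun k => g (.inr k)
    have hfg : extendOne S f = g := by
      funext i
      rcases i with y | k
      · rfl
      · simp only [extendOne, Sum.elim_inr, f]
        split_ifs with hk
        · rfl
        · by_contra hc
          apply hk
          rw [← hgS, mem_filter]
          exact ⟨mem_univ _, fun h => hc h.symm⟩
    have h2 : ∀ k, f (.inr k) ≠ 1 := fun k => by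
      have h3 := (Finset.ext_iff.1 hgS k.1).2 k.2
      exact (mem_filter.1 h3).2
    refine ⟨f, mem_box.2 ?_, ?_, hfg⟩
    · rintro (y | k)
      exacts [mem_box.1 hgb _, mem_box.1 hgb _]
    · rw [hval, if_pos h2, ← prod_extendOne, hfg]
      exact hne
  · intro f hf hne
    have h1 := left_ne_zero_of_mul (left_ne_zero_of_mul hne)
    rw [hval] at h1 ⊢
    rw [if_pos (by by_contra hc; exact h1 (if_neg hc)), prod_extendOne]

/-- The tuple with components `e_q k_q`. -/
def mulPair (f : (Y ⊕ Q) ⊕ Q → ℕ) : Y ⊕ Q → ℕ :=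
  Sum.elim (fun y => f (.inl (.inl y))) fun q => f (.inl (.inr q)) * f (.inr q)

theorem prod_mulPair (f : (Y ⊕ Q) ⊕ Q → ℕ) : ∏ i, mulPair f i = ∏ i, f i := by
  simp only [mulPair, Fintype.prod_sum_type, Sum.elim_inl, Sum.elim_inr, prod_mul_distrib,
    mul_assoc]

/-- Opening of divisor sums. -/
theorem tupleSum_divisors {N : ℕ} {w : ℕ → ℝ} (hw : ∀ n, w n ≠ 0 → n ≤ N) (c : ℕ → ℝ)
    (W : (Y ⊕ Q → ℕ) → ℝ) :
    tupleSum N w (fun f => (∏ q, ∑ e ∈ (f (.inr q)).divisors, c e) * W f) =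
      tupleSum N w fun f : (Y ⊕ Q) ⊕ Q → ℕ =>
        (∏ q, c (f (.inl (.inr q)))) * W (mulPair f) := by
  classical
  have h1 : (tupleSum N w fun f : (Y ⊕ Q) ⊕ Q → ℕ =>
      (∏ q, c (f (.inl (.inr q)))) * W (mulPair f)) =
      ∑ f ∈ (box ((Y ⊕ Q) ⊕ Q) N).filter (fun f => mulPair f ∈ box (Y ⊕ Q) N),
        (∏ q, c (f (.inl (.inr q)))) * W (mulPair f) * w (∏ i, f i) := by
    rw [tupleSum, sum_filter_of_ne]
    intro f hf hne
    refine mem_box_of_prod_le ?_ ?_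
    · rintro (y | q)
      · exact (mem_box.1 hf _).1
      · exact Nat.mul_pos (mem_box.1 hf _).1 (mem_box.1 hf _).1
    · rw [prod_mulPair]
      exact hw _ (right_ne_zero_of_mul hne)
  rw [h1, tupleSum, ← sum_fiberwise_of_maps_to (t := box (Y ⊕ Q) N) (g := mulPair)
    fun f hf => (mem_filter.1 hf).2]
  refine sum_congr rfl fun g hg => ?_
  rw [prod_univ_sum, sum_mul, sum_mul]
  have hg1 := mem_box.1 hg
  refine sum_bij' (fun e _ => (Sum.elim (Sum.elim (fun y => g (.inl y)) e)
    fun q => g (.inr q) / e q : (Y ⊕ Q) ⊕ Q → ℕ)) (fun f _ q => f (.inl (.inr q))) ?_ ?_ ?_ ?_ ?_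
  · intro e he
    rw [Fintype.mem_piFinset] at he
    have hd := fun q => Nat.dvd_of_mem_divisors (he q)
    have hpair : mulPair (Sum.elim (Sum.elim (fun y => g (.inl y)) e)
        fun q => g (.inr q) / e q : (Y ⊕ Q) ⊕ Q → ℕ) = g := by
      funext i
      rcases i with y | q
      · rfl
      · exact Nat.mul_div_cancel' (hd q)
    rw [mem_filter, mem_filter, mem_box]
    refine ⟨⟨?_, by rw [hpair]; exact hg⟩, hpair⟩
    rintro ((y | q) | q)
    · exact hg1 _
    · exact ⟨Nat.pos_of_dvd_of_pos (hd q) (hg1 _).1, (Nat.le_of_dvd (hg1 _).1 (hd q)).trans (hg1 _).2⟩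
    · exact ⟨Nat.div_pos (Nat.le_of_dvd (hg1 _).1 (hd q)) (Nat.pos_of_dvd_of_pos (hd q) (hg1 _).1),
        (Nat.div_le_self _ _).trans (hg1 _).2⟩
  · intro f hf
    rw [mem_filter, mem_filter] at hf
    rw [Fintype.mem_piFinset]
    intro q
    rw [← hf.2, Nat.mem_divisors]
    exact ⟨⟨_, rfl⟩, Nat.mul_ne_zero (by have := (mem_box.1 hf.1.1 (.inl (.inr q))).1; omega)
      (by have := (mem_box.1 hf.1.1 (.inr q)).1; omega)⟩
  · intro e he
    rfl
  · intro f hf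
    rw [mem_filter, mem_filter] at hf
    funext i
    rcases i with (y | q) | q
    · exact (congrFun hf.2 (.inl y)).symm
    · rfl
    · change g (.inr q) / f (.inl (.inr q)) = f (.inr q)
      rw [← hf.2]
      exact Nat.mul_div_cancel_left _ (mem_box.1 hf.1.1 (.inl (.inr q))).1
  · intro e he
    rw [Fintype.mem_piFinset] at he
    have hd := fun q => Nat.dvd_of_mem_divisors (he q)
    have hpair : mulPair (Sum.elim (Sum.elim (fun y => g (.inl y)) e)
        fun q => g (.inr q) / e q : (Y ⊕ Q) ⊕ Q → ℕ) = g := by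
      funext i
      rcases i with y | q
      · rfl
      · exact Nat.mul_div_cancel' (hd q)
    rw [← prod_mulPair, hpair]
    rfl

end

/-! ### Sums over tuples of smooth numbers and primes -/

/-- A bound for the number of prime factors `≥ (x/2)^ν` of integers up to `x`. -/
def maxPrimes (P : Params) : ℕ := ⌈2 / P.ν⌉₊

theorem one_le_rpow_nu {P : Params} (hP : P.Good) {x : ℝ} (hx : 8 ≤ x) : 1 ≤ (x / 2) ^ P.ν :=
  Real.one_le_rpow (by linarith) hP.ν_pos.le

/-- As many factors as `2 / ν` would have a product of at least `(x / 2) ^ 2`, which exceeds `x`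
when `x ≥ 8`. -/
theorem lt_maxPrimes {P : Params} (hP : P.Good) {x : ℝ} (hx : 8 ≤ x) {k : ℕ}
    (h : ((x / 2) ^ P.ν) ^ k ≤ x) : k < maxPrimes P := by
  by_contra hk
  have h1 : ((x / 2) ^ P.ν) ^ maxPrimes P ≤ x :=
    (pow_le_pow_right₀ (one_le_rpow_nu hP hx) (not_lt.1 hk)).trans h
  rw [← Real.rpow_natCast, ← Real.rpow_mul (by linarith)] at h1
  have h2 : (2 : ℝ) ≤ P.ν * (maxPrimes P : ℕ) := by
    have := Nat.le_ceil (2 / P.ν)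
    rw [div_le_iff₀ hP.ν_pos] at this
    unfold maxPrimes
    linarith
  have h3 : (x / 2) ^ (2 : ℝ) ≤ x :=
    (Real.rpow_le_rpow_of_exponent_le (by linarith) h2).trans h1
  rw [Real.rpow_two] at h3
  nlinarith

theorem pow_length_le_prod {z : ℝ} (hz : 0 ≤ z) : ∀ l : List ℕ, (∀ p ∈ l, z ≤ (p : ℝ)) →
    z ^ l.length ≤ (l.prod : ℕ) := by
  intro l
  induction l with
  | nil => simp
  | cons a l ih =>
    intro h
    rw [List.length_cons, pow_succ', List.prod_cons, Nat.cast_mul]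
    exact mul_le_mul (h a (by simp)) (ih fun p hp => h p (by simp [hp])) (by positivity)
      (by positivity)

theorem roughList_length_lt {P : Params} (hP : P.Good) {x : ℝ} (hx : 8 ≤ x) {n : ℕ} (hn : n ≠ 0)
    (hnx : (n : ℝ) ≤ x) : (roughList ((x / 2) ^ P.ν) n).length < maxPrimes P := by
  have hz := one_le_rpow_nu hP hx
  refine lt_maxPrimes hP hx ((pow_length_le_prod (by linarith) _ fun p hp =>
    ((mem_roughList hn).1 hp).2.2).trans (le_trans ?_ hnx))
  have h1 := smoothPart_mul_prod (z := (x / 2) ^ P.ν) hn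
  exact_mod_cast Nat.le_of_dvd (Nat.pos_of_ne_zero hn) ⟨_, (mul_comm _ _).trans h1 |>.symm⟩

theorem Balanced.le_floor {P : Params} {B x : ℝ} {w : ℕ → ℝ} (h : Balanced P B x w) (n : ℕ)
    (hn : w n ≠ 0) : n ≤ ⌊x⌋₊ := Nat.le_floor (h.supp n hn).2

theorem lg_nonneg {I : Type*} (f : I → ℕ) (i : I) : 0 ≤ lg f i := Real.log_natCast_nonneg _

theorem lg_eq_zero_iff {I : Type*} {f : I → ℕ} {i : I} (h : 1 ≤ f i) : lg f i = 0 ↔ f i = 1 := by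
  constructor
  · intro h0
    by_contra h1
    have : 0 < Real.log (f i) := Real.log_pos (by norm_cast; omega)
    exact this.ne' h0
  · intro h1
    simp [lg, h1]

theorem lg_le_lg_iff {I J : Type*} {f : I → ℕ} {g : J → ℕ} {i : I} {j : J} (h : 1 ≤ f i)
    (h' : 1 ≤ g j) : lg f i ≤ lg g j ↔ f i ≤ g j := by
  unfold lg
  rw [Real.log_le_log_iff (by positivity) (by positivity)]
  exact Nat.cast_le

section
variable {U V : Type*} [Fintype U] [Fintype V]

/-- If there is no Type II factorization then the primes together with the smooth numbers, divided
into equal parts, form a vector of the fundamental region. -/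
theorem InR0.of_no_factorization {P : Params} (hP : P.Good) {M : ℕ} (hM : 1 / P.ν < M) {u : U → ℝ}
    {v : V → ℝ} {ℓ l₁ l₂ : ℝ} (hu : ∀ i, 0 ≤ u i) (hv : ∀ i, 0 ≤ v i ∧ v i < (1 - P.γ) * ℓ)
    (hl₁ : l₁ < ℓ) (hl₂ : ℓ ≤ l₂) (hℓ : 0 < ℓ) (hsum : ∑ i, u i + ∑ i, v i = ℓ)
    (h : ∀ A : Finset V, ∑ i ∈ A, v i ≤ (P.θ + P.ν) * l₂ →
      ∑ i ∈ A, v i + ∑ i, u i ≤ P.θ * l₁) :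
    InR0 P (Sum.elim (fun i => v i / ℓ) fun p : U × Fin M => u p.1 / ℓ / M) := by
  classical
  have hM0 : (0 : ℝ) < M := (by have := hP.ν_pos; positivity : (0 : ℝ) < 1 / P.ν).trans hM
  have hMν : 1 / (M : ℝ) < P.ν := by rw [div_lt_comm₀ hM0 hP.ν_pos]; exact hM
  have hv0 : 0 ≤ ∑ i, v i := sum_nonneg fun i _ => (hv i).1
  have hu1 : ∀ i, u i / ℓ ≤ 1 := fun i => by
    rw [div_le_one hℓ]
    have := single_le_sum (fun i _ => hu i) (mem_univ i)
    linarith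
  have hu0 : ∀ i, 0 ≤ u i / ℓ := fun i => div_nonneg (hu i) hℓ.le
  have htot : ∑ p : U × Fin M, u p.1 / ℓ / M = (∑ i, u i) / ℓ := by
    rw [Fintype.sum_prod_type, sum_div]
    refine sum_congr rfl fun i _ => ?_
    change ∑ _j : Fin M, u i / ℓ / M = u i / ℓ
    rw [sum_const, card_univ, Fintype.card_fin, nsmul_eq_mul]
    field_simp
  refine ⟨?_, ?_, fun A hA => Or.inl ?_⟩
  · rintro (i | p)
    · exact ⟨div_nonneg (hv i).1 hℓ.le, by rw [Sum.elim_inl, div_lt_iff₀ hℓ]; exact (hv i).2⟩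
    · refine ⟨div_nonneg (hu0 _) hM0.le, ?_⟩
      exact ((div_le_div_of_nonneg_right (hu1 _) hM0.le).trans_lt hMν).trans hP.ν_lt
  · rw [Fintype.sum_sum_type]
    simp only [Sum.elim_inl, Sum.elim_inr]
    rw [htot, ← sum_div, ← add_div, add_comm, hsum, div_self hℓ.ne']
  · rw [← toLeft_disjSum_toRight (u := A), sum_disjSum] at hA ⊢
    simp only [Sum.elim_inl, Sum.elim_inr] at hA ⊢
    set r := ∑ p ∈ A.toRight, u p.1 / ℓ / M with hr
    have hr0 : 0 ≤ r := sum_nonneg fun p _ => div_nonneg (hu0 _) hM0.le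
    have hr1 : r ≤ (∑ i, u i) / ℓ := by
      rw [← htot]
      exact sum_le_sum_of_subset_of_nonneg (subset_univ _) fun p _ _ => div_nonneg (hu0 _) hM0.le
    rw [← sum_div] at hA ⊢
    set t := ∑ i ∈ A.toLeft, v i with ht
    have ht0 : 0 ≤ t := sum_nonneg fun i _ => (hv i).1
    have hθν : 0 ≤ P.θ + P.ν := add_nonneg hP.θ_nonneg hP.ν_pos.le
    obtain ⟨hA1, hA2⟩ := hA
    have h1 : t ≤ (P.θ + P.ν) * l₂ := by
      have h2 : t / ℓ ≤ P.θ + P.ν := by linarith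
      rw [div_le_iff₀ hℓ] at h2
      exact h2.trans (mul_le_mul_of_nonneg_left hl₂ hθν)
    -- The primes in the subsum stay below the upper end of the Type II range. By hypothesis they
    -- then stay below its lower end even with all the smooth numbers added. If `θ > 0` this puts
    -- the subsum strictly below `θ`, as `l₁ < ℓ`; if `θ = 0` it forces the subsum to vanish.
    have h2 := h _ h1
    rw [← ht] at h2
    have h3 : t / ℓ + r ≤ P.θ * l₁ / ℓ := by
      refine le_trans (add_le_add_right hr1 _) ?_
      rw [← add_div]
      exact div_le_div_of_nonneg_right h2 hℓ.le
    rcases hP.θ_nonneg.eq_or_lt with h0 | h0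
    · rw [← h0, zero_mul, zero_div] at h3
      have : 0 ≤ t / ℓ := div_nonneg ht0 hℓ.le
      linarith
    · have : P.θ * l₁ / ℓ < P.θ := by
        rw [div_lt_iff₀ hℓ]
        exact mul_lt_mul_of_pos_left hl₁ h0
      linarith

end

section
variable {Y Q : Type*} [Fintype Y] [Fintype Q]

/-- The logarithmic form of `mulOut`. -/
def addOut {T : ℕ} (L : (Y ⊕ Q) ⊕ (Q × Fin T) → ℝ) : Y ⊕ Q → ℝ :=
  Sum.elim (fun y => L (.inl (.inl y)))
    fun q => L (.inl (.inr q)) + ∑ t, L (.inr (q, t))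

theorem lg_mulOut {T : ℕ} {f : (Y ⊕ Q) ⊕ (Q × Fin T) → ℕ} (hf : ∀ i, 1 ≤ f i) :
    lg (mulOut f) = addOut (lg f) := by
  funext i
  rcases i with y | q
  · rfl
  · have h1 : (f (.inl (.inr q)) : ℝ) ≠ 0 := by
      have := hf (.inl (.inr q)); norm_cast; omega
    have h2 : ∀ t, (f (.inr (q, t)) : ℝ) ≠ 0 := fun t => by
      have := hf (.inr (q, t)); norm_cast; omega
    simp only [lg, mulOut, addOut, Sum.elim_inr]
    push_cast
    rw [Real.log_mul h1 (prod_ne_zero_iff.2 fun t _ => h2 t), Real.log_prod fun t _ => h2 t]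

theorem isAff_addOut {T : ℕ} (i : Y ⊕ Q) :
    IsAff fun L : (Y ⊕ Q) ⊕ (Q × Fin T) → ℝ => addOut L i := by
  rcases i with y | q
  · exact IsAff.coord _
  · exact (IsAff.coord _).add (IsAff.sum _ fun t _ => IsAff.coord _)

theorem sum_addOut {T : ℕ} (L : (Y ⊕ Q) ⊕ (Q × Fin T) → ℝ) : ∑ i, addOut L i = ∑ i, L i := by
  simp only [addOut, Fintype.sum_sum_type, Sum.elim_inl, Sum.elim_inr, sum_add_distrib,
    Fintype.sum_prod_type, add_assoc]

/-- The logarithmic form of `Padded`. -/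
def PaddedLog {K : Type*} {T : ℕ} (L : K × Fin T → ℝ) : Prop :=
  ∀ q, ∀ i j : Fin T, i < j → L (q, j) = 0 ∨ L (q, i) ≠ 0 ∧ L (q, i) ≤ L (q, j)

theorem padded_iff {K : Type*} {T : ℕ} {f : K × Fin T → ℕ} (hf : ∀ b, 1 ≤ f b) :
    (∀ q, Padded fun t => f (q, t)) ↔ PaddedLog (lg f) := by
  refine forall_congr' fun q => forall₃_congr fun i j _ => ?_
  simp only [ne_eq, lg_eq_zero_iff (hf _), lg_le_lg_iff (hf _) (hf _)]

theorem unif_paddedLog {I K π : Type*} [Fintype I] [Finite K] {T : ℕ} (e : (I → ℝ) → K × Fin T → ℝ)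
    (he : ∀ b, IsAff fun L => e L b) : Unif fun (_ : π) L => PaddedLog (e L) := by
  refine Unif.all fun q => Unif.all fun i => Unif.all fun j => Unif.imp (Unif.const _) ?_
  exact (Unif.eq (fun _ => he _) fun _ => IsAff.const _).or
    ((Unif.eq (fun _ => he _) fun _ => IsAff.const _).not.and
      (Unif.le (fun _ => he _) fun _ => he _))

open Classical in
theorem prod_padWt {K : Type*} [Fintype K] {T : ℕ} {f : K × Fin T → ℕ} (hf : ∀ b, 1 ≤ f b) :
    (∏ q, padWt fun t => f (q, t)) = if PaddedLog (lg f) then 1 else 0 := by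
  rw [← padded_iff hf]
  split_ifs with h
  · exact prod_eq_one fun q _ => if_pos (h q)
  · push Not at h
    obtain ⟨q, hq⟩ := h
    exact prod_eq_zero (mem_univ q) (if_neg hq)

end

theorem sum_lg_univ {I : Type*} [Fintype I] {f : I → ℕ} (hf : ∀ i, 1 ≤ f i) :
    ∑ i, lg f i = Real.log ((∏ i, f i : ℕ) : ℝ) := sum_lg hf univ

open Classical in
/-- Sums over smooth numbers and free variables: the case in which no free variable is large. -/
theorem exists_bound_small (P : Params) (Y Q : Type) [Fintype Y] [Fintype Q] (K : ℕ) :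
    ∃ A : ℕ, ∀ (B x : ℝ) (w : ℕ → ℝ), Balanced P B x w → A ≤ B →
      ∀ (τ : Y ⊕ Q → Bool) (Ω : ((Y ⊕ Q) ⊕ Q → ℝ) → ℝ), SignFn K Ω → (∀ v, |Ω v| ≤ 1) →
      (∀ L, (∀ i, 0 ≤ L i) → Ω L ≠ 0 → (∀ q, L (.inr q) < (1 - P.γ) * ∑ i, L i) ∧
        (∀ q, 0 < L (.inl (.inr q)) + L (.inr q)) ∧
        ¬ HasCoag P ((∑ y, L (.inl (.inl y))) / ∑ i, L i)
          fun q => (L (.inl (.inr q)) + L (.inr q)) / ∑ i, L i) →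
      |tupleSum ⌊x⌋₊ w fun f => (∏ i, smoothWt ((x / 2) ^ P.ν) (τ i) (f (.inl i))) *
        Ω (lg f)| ≤ errBd A B x := by
  let T := maxPrimes P
  obtain ⟨N, hN⟩ := unif_paddedLog (π := Unit) (I := ((Y ⊕ Q) ⊕ Q) ⊕ (Q × Fin T)) (K := Q)
    (T := T) (fun L b => L (.inr b)) fun b => IsAff.coord _
  obtain ⟨A, hA⟩ := exists_bound_normalForm ((Y ⊕ Q) ⊕ Q) (Q × Fin T) (N + K)
  refine ⟨A, fun B x w h hB τ Ω hΩ hΩ1 hcoag => ?_⟩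
  have hx8 := h.eight_le
  have hP := h.good
  set z := (x / 2) ^ P.ν with hz
  let Ω' : (((Y ⊕ Q) ⊕ Q) ⊕ (Q × Fin T) → ℝ) → ℝ := fun L =>
    (fun (p : Prop) (r : ℝ) => if p then r else 0) (PaddedLog fun b => L (.inr b)) (Ω (addOut L))
  have hΩ' : SignFn (N + K) Ω' := (hN ()).map₂ (hΩ.comp fun i => isAff_addOut i)
    fun (p : Prop) (r : ℝ) => if p then r else 0
  have hΩ'1 : ∀ v, |Ω' v| ≤ 1 := fun v => by
    simp only [Ω']
    split_ifs
    · exact hΩ1 _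
    · simp
  -- Every free variable is factored completely; the tuple then consists of smooth numbers and
  -- primes, and a Type II factorization is sought among them.
  rw [tupleSum_expand (z := z) (T := T) h.le_floor (fun n hn hnN =>
    (roughList_length_lt hP hx8 hn ((Nat.le_floor_iff (by linarith)).1 hnN)).le)]
  have hmain := hA P B x w h hB (Sum.elim τ fun _ => false) Ω' hΩ' hΩ'1 ?_
  · refine le_of_eq_of_le (congrArg _ (tupleSum_congr fun f hf hw => ?_)) hmain
    have hf1 : ∀ i, 1 ≤ f i := fun i => (mem_box.1 hf i).1
    rw [lg_mulOut hf1]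
    have h1 := prod_padWt (f := fun b => f (.inr b)) fun b => hf1 (.inr b)
    have h2 : (∏ i, nfWt z (Sum.elim τ fun _ => false) i (f i)) =
        (∏ i, smoothWt z (τ i) (f (.inl (.inl i)))) *
        (∏ q, smoothWt z false (f (.inl (.inr q)))) * ∏ b, primeOneWt z (f (.inr b)) := by
      rw [Fintype.prod_sum_type, Fintype.prod_sum_type]
      rfl
    have h3 : Ω' (lg f) = (if PaddedLog (lg fun b => f (.inr b)) then 1 else 0) *
        Ω (addOut (lg f)) := by
      change (if PaddedLog (lg fun b => f (.inr b)) then Ω (addOut (lg f)) else 0) = _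
      split_ifs <;> simp
    rw [h1, h2, h3]
    simp only [mulOut, Sum.elim_inl]
    ring
  · intro f hf h1 h2 hw
    have hf1 : ∀ i, 1 ≤ f i := fun i => (mem_box.1 hf i).1
    by_contra! hno
    have h3 : Ω (addOut (lg f)) ≠ 0 := by
      intro h0
      apply h2
      simp [Ω', h0]
    have hL0 : ∀ i, 0 ≤ addOut (lg f) i := fun i => by
      rw [← lg_mulOut hf1]; exact lg_nonneg _ _
    obtain ⟨h4, h5, h6⟩ := hcoag _ hL0 h3
    rw [sum_addOut] at h4 h6
    have hn := h.supp _ hw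
    set n := ∏ i, f i with hn_def
    have hℓ : ∑ i, lg f i = Real.log n := sum_lg_univ hf1
    have hn0 : (0 : ℝ) < n := by linarith [hn.1]
    have hl₁ : Real.log (x / 2) < Real.log n := Real.log_lt_log (by linarith) hn.1
    have hl₂ : Real.log n ≤ Real.log x := Real.log_le_log hn0 hn.2
    have hℓ0 : 0 < Real.log n := Real.log_pos (by linarith [hn.1])
    rw [hℓ] at h4 h6
    obtain ⟨M, hM⟩ := exists_nat_gt (1 / P.ν)
    have hM0 : (0 : ℝ) < M := (by have := hP.ν_pos; positivity : (0 : ℝ) < 1 / P.ν).trans hM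
    have hMν : 1 / (M : ℝ) < P.ν := by rw [div_lt_comm₀ hM0 hP.ν_pos]; exact hM
    have hsum : ∑ i, lg f (.inl i) + ∑ i, lg f (.inr i) = Real.log n := by
      rw [← hℓ]
      exact (Fintype.sum_sum_type _).symm
    have hR := InR0.of_no_factorization hP hM (u := fun i => lg f (.inl i))
      (v := fun i => lg f (.inr i)) (fun i => lg_nonneg _ _) (fun b => ⟨lg_nonneg _ _, ?_⟩)
      hl₁ hl₂ hℓ0 hsum ?_
    -- The vector of ℛ is regrouped: the primes and both smooth factors belonging to `q` form the
    -- block `q`, and the smooth numbers of `Y` form the small part. This is the coagulation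
    -- excluded by hypothesis.
    · refine h6 (HasCoag.of_family (fun q => div_pos (h5 q) hℓ0)
        (Sum.elim (fun b => some b.1) fun p => (Sum.elim (Sum.elim (fun _ => none)
          fun q => some q) (fun q => some q) p.1)) _ hR ?_ ?_ ?_)
      · rintro (b | p) hp
        · cases hp
        · have hle : lg f (.inl p.1) ≤ Real.log n := by
            have h7 := single_le_sum (f := fun i => lg f (.inl i)) (fun i _ => lg_nonneg _ _)
              (mem_univ p.1)
            have h8 : 0 ≤ ∑ i, lg f (.inr i) := sum_nonneg fun i _ => lg_nonneg _ _
            linarith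
          refine lt_of_le_of_lt ?_ hMν
          exact div_le_div_of_nonneg_right ((div_le_one hℓ0).2 hle) hM0.le
      · rw [sum_filter]
        simp only [Fintype.sum_sum_type, Sum.elim_inl, Sum.elim_inr, Fintype.sum_prod_type, addOut,
          reduceCtorEq, if_false, if_true, sum_const_zero, add_zero, zero_add, sum_const, card_univ,
          Fintype.card_fin, nsmul_eq_mul]
        rw [sum_div]
        exact sum_congr rfl fun y _ => by field_simp
      · intro q
        rw [sum_filter]
        simp only [Fintype.sum_sum_type, Sum.elim_inl, Sum.elim_inr, Fintype.sum_prod_type, addOut,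
          reduceCtorEq, if_false, sum_const_zero, zero_add, Option.some.injEq]
        have hsingle : ∀ g : Q → ℝ, ∑ r, (if r = q then g r else 0) = g q := fun g => by simp
        have e1 : ∀ (g : Q → Fin T → ℝ), ∑ r, ∑ t, (if r = q then g r t else 0) = ∑ t, g q t := by
          intro g
          rw [← hsingle fun r => ∑ t, g r t]
          refine sum_congr rfl fun r _ => ?_
          split_ifs <;> simp
        have e2 : ∀ (g : Q → ℝ), ∑ r, ∑ _t : Fin M, (if r = q then g r / M else 0) = g q := by
          intro g
          rw [← hsingle g]
          refine sum_congr rfl fun r _ => ?_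
          split_ifs
          · rw [sum_const, card_univ, Fintype.card_fin, nsmul_eq_mul]
            field_simp
          · simp
        rw [e1 fun r t => lg f (.inr (r, t)) / Real.log n,
          e2 fun r => lg f (.inl (.inl (.inr r))) / Real.log n,
          e2 fun r => lg f (.inl (.inr r)) / Real.log n, ← sum_div]
        ring
    · refine lt_of_le_of_lt ?_ (h4 b.1)
      simp only [addOut, Sum.elim_inr]
      have h7 := single_le_sum (f := fun t => lg f (.inr (b.1, t))) (fun i _ => lg_nonneg _ _)
        (mem_univ b.2)
      have h8 := lg_nonneg f (.inl (.inr b.1))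
      linarith
    · intro A₀ hA₀
      have hp : ∀ A₀ : Finset (Q × Fin T), ∑ i ∈ A₀, lg f (.inr i) =
          Real.log ((∏ q ∈ A₀, f (.inr q) : ℕ) : ℝ) := fun A₀ =>
        sum_lg (f := fun b => f (.inr b)) (fun b => hf1 _) A₀
      have hu : ∑ i, lg f (.inl i) = Real.log ((∏ y, f (.inl y) : ℕ) : ℝ) :=
        sum_lg_univ (f := fun b => f (.inl b)) (fun b => hf1 _)
      have hq1 : 1 ≤ ∏ q ∈ A₀, f (.inr q) := Finset.one_le_prod' fun i _ => hf1 _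
      have hy1 : 1 ≤ ∏ y, f (.inl y) := Finset.one_le_prod' fun i _ => hf1 _
      have hq0 : (0 : ℝ) < ((∏ q ∈ A₀, f (.inr q) : ℕ) : ℝ) := by exact_mod_cast hq1
      have hy0 : (0 : ℝ) < ((∏ y, f (.inl y) : ℕ) : ℝ) := by exact_mod_cast hy1
      rw [hp] at hA₀ ⊢
      rw [hu, ← Real.log_mul hq0.ne' hy0.ne', ← Real.log_rpow (by linarith)]
      rw [← Real.log_rpow (by linarith), Real.log_le_log_iff hq0 (by positivity)] at hA₀
      exact Real.log_le_log (by positivity) (hno A₀ hA₀)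

/-! ### Replacing primes by integers free of small prime factors -/

section
variable {Y Q : Type*} [Fintype Y] [Fintype Q]

/-- The support of `Ω` contains no (unnormalized) coagulations. -/
def AvoidsCoag (P : Params) (Ω : (Y ⊕ Q → ℝ) → ℝ) : Prop :=
  ∀ L, (∀ i, 0 ≤ L i) → Ω L ≠ 0 →
    ¬ HasCoag P ((∑ y, L (.inl y)) / ∑ i, L i) fun q => L (.inr q) / ∑ i, L i

/-- The logarithmic form of `mulPair`. -/
def addPair (L : (Y ⊕ Q) ⊕ Q → ℝ) : Y ⊕ Q → ℝ :=
  Sum.elim (fun y => L (.inl (.inl y))) fun q => L (.inl (.inr q)) + L (.inr q)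

theorem lg_mulPair {f : (Y ⊕ Q) ⊕ Q → ℕ} (hf : ∀ i, 1 ≤ f i) : lg (mulPair f) = addPair (lg f) := by
  funext i
  rcases i with y | q
  · rfl
  · have h1 : ∀ i, (f i : ℝ) ≠ 0 := fun i => by
      have := hf i; norm_cast; omega
    simp only [lg, mulPair, addPair, Sum.elim_inr]
    push_cast
    rw [Real.log_mul (h1 _) (h1 _)]

theorem isAff_addPair (i : Y ⊕ Q) : IsAff fun L : (Y ⊕ Q) ⊕ Q → ℝ => addPair L i := by
  rcases i with y | q
  · exact IsAff.coord _
  · exact (IsAff.coord _).add (IsAff.coord _)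

theorem sum_addPair (L : (Y ⊕ Q) ⊕ Q → ℝ) : ∑ i, addPair L i = ∑ i, L i := by
  simp only [addPair, Fintype.sum_sum_type, Sum.elim_inl, Sum.elim_inr, sum_add_distrib, add_assoc]

open Classical in
/-- The logarithmic form of `extendOne`. -/
def extendZero {K : Type*} (S : Finset K) (L : Y ⊕ S → ℝ) : Y ⊕ K → ℝ :=
  Sum.elim (fun y => L (.inl y)) fun k => if h : k ∈ S then L (.inr ⟨k, h⟩) else 0

theorem lg_extendOne {K : Type*} (S : Finset K) (f : Y ⊕ S → ℕ) :
    lg (extendOne S f) = extendZero S (lg f) := by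
  funext i
  rcases i with y | k
  · rfl
  · simp only [lg, extendOne, extendZero, Sum.elim_inr]
    split_ifs <;> simp

theorem isAff_extendZero {K : Type*} (S : Finset K) (i : Y ⊕ K) :
    IsAff fun L : Y ⊕ S → ℝ => extendZero S L i := by
  rcases i with y | k
  · exact IsAff.coord _
  · simp only [extendZero, Sum.elim_inr]
    split_ifs
    · exact IsAff.coord _
    · exact IsAff.const _

open Classical in
theorem sum_extendZero_fiber {T : ℕ} (S : Finset (Q × Fin T)) (L : Y ⊕ S → ℝ) (q : Q) :
    ∑ t, extendZero S L (.inr (q, t)) = ∑ b : S with b.1.1 = q, L (.inr b) := by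
  have h1 : ∀ b : S, (if b.1.1 = q then L (.inr b) else 0) =
      (fun c : Q × Fin T => if c.1 = q then extendZero S L (.inr c) else 0) b.1 := fun b => by
    have : extendZero S L (.inr b.1) = L (.inr b) := by simp [extendZero]
    simp only [this]
  rw [sum_filter, sum_congr rfl fun b _ => h1 b, sum_coe_sort S
    (fun c : Q × Fin T => if c.1 = q then extendZero S L (.inr c) else 0),
    sum_subset (subset_univ S), Fintype.sum_prod_type, sum_eq_single q]
  · simp
  · intro r _ hr
    exact sum_eq_zero fun t _ => if_neg hr
  · simp
  · intro c _ hc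
    simp [extendZero, hc]

end

open Classical in
/-- Sums over tuples of integers free of small prime factors. -/
theorem exists_bound_rough (P : Params) (Y Q : Type) [Fintype Y] [Fintype Q] (K : ℕ) :
    ∃ A : ℕ, ∀ (B x : ℝ) (w : ℕ → ℝ), Balanced P B x w → A ≤ B →
      ∀ (τ : Y → Bool) (Ω : (Y ⊕ Q → ℝ) → ℝ), SignFn K Ω → (∀ v, |Ω v| ≤ 1) →
      AvoidsCoag P Ω → (∀ L, (∀ i, 0 ≤ L i) → Ω L ≠ 0 → ∀ q, 0 < L (.inr q)) →
      |tupleSum ⌊x⌋₊ w fun f => (∏ y, smoothWt ((x / 2) ^ P.ν) (τ y) (f (.inl y))) *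
        (∏ q, roughWt ((x / 2) ^ P.ν) (f (.inr q))) * Ω (lg f)| ≤ errBd A B x := by
  let e := Fintype.equivFin Q
  let big : Q → ((Y ⊕ Q) ⊕ Q → ℝ) → Prop := fun q L => (1 - P.γ) * ∑ i, L i ≤ L (.inr q)
  let π := {Ω : (Y ⊕ Q → ℝ) → ℝ // SignFn K Ω} × Option Q
  have hbig : ∀ q, Unif fun (_ : π) L => big q L := fun q =>
    Unif.le (fun _ => (IsAff.sum _ fun i _ => IsAff.coord i).mulc _) fun _ => IsAff.coord _
  have hΩU : Unif fun (a : π) (L : (Y ⊕ Q) ⊕ Q → ℝ) => a.1.1 (addPair L) :=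
    (Unif.of_signFn fun a : π => a.1.2).comp fun a i => isAff_addPair i
  have hU0 : Unif fun (a : π) (L : (Y ⊕ Q) ⊕ Q → ℝ) =>
      if ∃ q, big q L then 0 else a.1.1 (addPair L) :=
    Unif.ite (Unif.ex fun q => hbig q) (Unif.const _) hΩU
  have hU1 : ∀ q, Unif fun (a : π) (L : (Y ⊕ Q) ⊕ Q → ℝ) =>
      if big q L ∧ ∀ q', e q' < e q → ¬ big q' L then a.1.1 (addPair L) else 0 := fun q =>
    Unif.ite ((hbig q).and (Unif.all fun q' => (Unif.const _).imp (hbig q').not)) hΩU (Unif.const _)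
  obtain ⟨N₀, hN₀⟩ := hU0
  choose N₁ hN₁ using hU1
  obtain ⟨A₀, hA₀⟩ := exists_bound_small P Y Q N₀
  refine ⟨A₀ + (∑ q, 3 ^ N₁ q) + Fintype.card ((Y ⊕ Q) ⊕ Q),
    fun B x w h hB τ Ω hΩ hΩ1 hcoag hpos => ?_⟩
  have hx8 := h.eight_le
  have hP := h.good
  push_cast at hB
  have hB1 : (A₀ : ℝ) ≤ B := by
    have : (0 : ℝ) ≤ ∑ q, 3 ^ N₁ q := sum_nonneg fun _ _ => by positivity
    have : (0 : ℝ) ≤ Fintype.card ((Y ⊕ Q) ⊕ Q) := by positivity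
    linarith
  have hB2 : (Fintype.card ((Y ⊕ Q) ⊕ Q) : ℝ) ≤ B := by
    have : (0 : ℝ) ≤ ∑ q, 3 ^ N₁ q := sum_nonneg fun _ _ => by positivity
    have : (0 : ℝ) ≤ A₀ := by positivity
    linarith
  set z := (x / 2) ^ P.ν with hz
  let τ' : Y ⊕ Q → Bool := Sum.elim τ fun _ => true
  let V : ((Y ⊕ Q) ⊕ Q → ℕ) → ℝ := fun f => ∏ i, smoothWt z (τ' i) (f (.inl i))
  let Ω₀ : ((Y ⊕ Q) ⊕ Q → ℝ) → ℝ := fun L => if ∃ q, big q L then 0 else Ω (addPair L)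
  let Ω₁ : Q → ((Y ⊕ Q) ⊕ Q → ℝ) → ℝ := fun q L =>
    if big q L ∧ ∀ q', e q' < e q → ¬ big q' L then Ω (addPair L) else 0
  -- The sieve condition on each component is opened, which turns it into a smooth number with
  -- Möbius weight times a free variable. The sum is then divided according to the first free
  -- variable of size at least `n ^ (1 - γ)`, if there is one.
  have hopen : tupleSum ⌊x⌋₊ w (fun f => (∏ y, smoothWt z (τ y) (f (.inl y))) *
      (∏ q, roughWt z (f (.inr q))) * Ω (lg f)) =
      tupleSum ⌊x⌋₊ w (fun f => V f * Ω₀ (lg f)) +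
        ∑ q, tupleSum ⌊x⌋₊ w fun f => V f * Ω₁ q (lg f) := by
    rw [← tupleSum_sum, ← tupleSum_add]
    have e1 : tupleSum ⌊x⌋₊ w (fun f => (∏ y, smoothWt z (τ y) (f (.inl y))) *
      (∏ q, roughWt z (f (.inr q))) * Ω (lg f)) = tupleSum ⌊x⌋₊ w fun f =>
        (∏ q, ∑ d ∈ (f (.inr q)).divisors, smoothWt z true d) *
          ((∏ y, smoothWt z (τ y) (f (.inl y))) * Ω (lg f)) := by
      refine tupleSum_congr fun f hf _ => ?_
      rw [prod_congr rfl fun q _ => sum_smoothWt (by have := (mem_box.1 hf (.inr q)).1; omega)]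
      ring
    rw [e1, tupleSum_divisors h.le_floor]
    refine tupleSum_congr fun f hf _ => ?_
    have hf1 : ∀ i, 1 ≤ f i := fun i => (mem_box.1 hf i).1
    rw [lg_mulPair hf1, ← mul_sum, ← mul_add]
    have e2 : Ω₀ (lg f) + ∑ q, Ω₁ q (lg f) = Ω (addPair (lg f)) := by
      by_cases hb : ∃ q, big q (lg f)
      · simp only [Ω₀, Ω₁]
        rw [if_pos hb, zero_add, sum_first e (fun q => big q (lg f)) _ hb]
      · simp only [Ω₀, Ω₁]
        rw [if_neg hb, sum_eq_zero, add_zero]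
        intro q _
        exact if_neg fun h => hb ⟨q, h.1⟩
    rw [e2]
    simp only [V, τ', Fintype.prod_sum_type, Sum.elim_inl, Sum.elim_inr, mulPair]
    ring
  rw [hopen]
  refine (abs_add_le _ _).trans ?_
  have hb0 : |tupleSum ⌊x⌋₊ w fun f => V f * Ω₀ (lg f)| ≤ errBd A₀ B x := by
    refine hA₀ B x w h hB1 τ' Ω₀ (hN₀ (⟨Ω, hΩ⟩, none)) (fun v => ?_) fun L hL hΩL => ?_
    · simp only [Ω₀]
      split_ifs
      · simp
      · exact hΩ1 _
    · have hnb : ¬ ∃ q, big q L := fun hb => hΩL (if_pos hb)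
      have hΩL' : Ω (addPair L) ≠ 0 := by
        simp only [Ω₀, if_neg hnb] at hΩL
        exact hΩL
      have hL' : ∀ i, 0 ≤ addPair L i := by
        rintro (y | q)
        · exact hL _
        · exact add_nonneg (hL _) (hL _)
      refine ⟨fun q => ?_, fun q => hpos _ hL' hΩL' q, ?_⟩
      · by_contra hq
        exact hnb ⟨q, not_lt.1 hq⟩
      · have := hcoag _ hL' hΩL'
        rw [sum_addPair] at this
        exact this
  -- The product of the other components is at most `n ^ γ ≤ x ^ γ`, so this is a Type I sum in the
  -- large free variable.
  have hb1 : ∀ q, |tupleSum ⌊x⌋₊ w fun f => V f * Ω₁ q (lg f)| ≤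
      3 ^ N₁ q * (x / Real.log x ^ B) := fun q => by
    refine h.linear hB2 (.inr q) V (fun f => abs_prod_le_one _ fun i => abs_smoothWt_le _ _ _)
      (fun f k => rfl) (hN₁ q (⟨Ω, hΩ⟩, none)) (fun v => ?_) fun f hf _ h2 hw => ?_
    · simp only [Ω₁]
      split_ifs
      · exact hΩ1 _
      · simp
    · have hf1 : ∀ i, 1 ≤ f i := fun i => (mem_box.1 hf i).1
      have hb : big q (lg f) := by
        by_contra hb
        exact h2 (if_neg fun hh => hb hh.1)
      have hn := h.supp _ hw
      have hp0 : (0 : ℝ) < ((∏ i ∈ univ.erase (.inr q), f i : ℕ) : ℝ) := by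
        exact_mod_cast Finset.prod_pos fun i _ => hf1 i
      have hx0 := h.x_pos
      rw [← Real.log_le_log_iff hp0 (by positivity), Real.log_rpow hx0, ← sum_lg hf1]
      have h3 : ∑ i, lg f i ≤ Real.log x := by
        rw [sum_lg_univ hf1]
        exact Real.log_le_log (by linarith [hn.1]) hn.2
      have h4 := add_sum_erase univ (lg f) (mem_univ (.inr q))
      have h5 : (1 - P.γ) * ∑ i, lg f i ≤ lg f (.inr q) := hb
      nlinarith [hP.γ_pos]
  refine (add_le_add hb0 ((abs_sum_le_sum_abs _ _).trans (sum_le_sum fun q _ => hb1 q))).trans ?_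
  rw [← sum_mul]
  have hb2 : (∑ q, 3 ^ N₁ q : ℝ) * (x / Real.log x ^ B) ≤
      errBd ((∑ q, 3 ^ N₁ q) + Fintype.card ((Y ⊕ Q) ⊕ Q)) B x := by
    have := le_errBd (M := ∑ q, 3 ^ N₁ q) (k := 0)
      (A := (∑ q, 3 ^ N₁ q) + Fintype.card ((Y ⊕ Q) ⊕ Q)) (B := B) hx8 ?_ (by positivity)
    · rwa [pow_zero, mul_one] at this
    · push_cast
      have : (0 : ℝ) ≤ Fintype.card ((Y ⊕ Q) ⊕ Q) := by positivity
      linarith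
  refine (add_le_add le_rfl hb2).trans ((errBd_add hx8).trans (errBd_mono hx8 ?_))
  omega

theorem roughWt_prod_primeOne {z : ℝ} {ι : Type*} (s : Finset ι) {p : ι → ℕ}
    (hp : ∀ i ∈ s, (p i).Prime ∧ z ≤ p i) : roughWt z (∏ i ∈ s, p i) = 1 := by
  refine if_pos fun r hr => ?_
  rw [Nat.mem_primeFactors] at hr
  obtain ⟨i, hi, hri⟩ := (Nat.Prime.prime hr.1).exists_mem_finset_dvd hr.2.1
  rw [(Nat.prime_dvd_prime_iff_eq hr.1 (hp i hi).1).1 hri]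
  exact (hp i hi).2

theorem roughWt_eq_zero_of_smooth_dvd {z : ℝ} {s n : ℕ} (hs : ∀ p ∈ s.primeFactors, (p : ℝ) < z)
    (hs1 : s ≠ 1) (hn : n ≠ 0) (h : s ∣ n) : roughWt z n = 0 := by
  refine if_neg fun hr => ?_
  obtain ⟨p, hp, hps⟩ := Nat.exists_prime_and_dvd hs1
  have hs0 : s ≠ 0 := fun h0 => hn (Nat.eq_zero_of_zero_dvd (h0 ▸ h))
  have h1 := hs p (Nat.mem_primeFactors.2 ⟨hp, hps, hs0⟩)
  have h2 := hr p (Nat.mem_primeFactors.2 ⟨hp, hps.trans h, hn⟩)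
  linarith

theorem primeWt_eq_zero_of_roughWt {z : ℝ} {n : ℕ} (h : roughWt z n = 0) : primeWt z n = 0 := by
  refine if_neg fun hp => ?_
  have : roughWt z n = 1 := if_pos fun p hpn => by
    rw [hp.1.primeFactors, mem_singleton] at hpn
    exact hpn ▸ hp.2
  rw [h] at this
  exact zero_ne_one this

section
variable {Y Q : Type*} [Fintype Y] [Fintype Q]

/-- The difference between integers free of small primes and primes. -/
def nonprimeWt (z : ℝ) (f : Q → ℕ) : ℝ := ∏ q, roughWt z (f q) - ∏ q, primeWt z (f q)

-- Each `m_q` is presented as a smooth number times the primes in its fibre of `S`. It is free of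
-- small primes exactly when the smooth number is `1`, and then prime exactly when the fibre has one
-- element. As no fibre is empty, all `m_q` are prime unless `S` has more elements than `Q`: the
-- difference consists of tuples with strictly more primes.
open Classical in
theorem nonprimeWt_mulOut {z : ℝ} {T : ℕ} {S : Finset (Q × Fin T)} {f : (Y ⊕ Q) ⊕ S → ℕ}
    (hs : ∀ q, ∀ p ∈ (f (.inl (.inr q))).primeFactors, (p : ℝ) < z)
    (hp : ∀ b, (f (.inr b)).Prime ∧ z ≤ f (.inr b))
    (hne : ∀ q, 1 < mulOut (extendOne S f) (.inr q)) :
    nonprimeWt z (fun q => mulOut (extendOne S f) (.inr q)) =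
      if (∀ q, ∃ t, (q, t) ∈ S) ∧ Fintype.card Q < #S ∧ ∀ q, f (.inl (.inr q)) = 1 then 1
      else 0 := by
  set m : Q → ℕ := fun q => mulOut (extendOne S f) (.inr q) with hm
  have hprod : ∀ q, m q = f (.inl (.inr q)) * ∏ b : S with b.1.1 = q, f (.inr b) := by
    intro q
    have h1 : ∀ b : S, (if b.1.1 = q then f (.inr b) else 1) =
        (fun c : Q × Fin T => if c.1 = q then extendOne S f (.inr c) else 1) b.1 := fun b => by
      have : extendOne S f (.inr b.1) = f (.inr b) := by simp [extendOne]
      simp only [this]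
    simp only [hm, mulOut, Sum.elim_inr]
    rw [prod_filter, prod_congr rfl fun b _ => h1 b, prod_coe_sort S
      (fun c : Q × Fin T => if c.1 = q then extendOne S f (.inr c) else 1),
      prod_subset (subset_univ S), Fintype.prod_prod_type, prod_eq_single q]
    · simp [extendOne]
    · intro r _ hr
      exact prod_eq_one fun t _ => if_neg hr
    · simp
    · intro c _ hc
      simp [extendOne, hc]
  have hm0 : ∀ q, m q ≠ 0 := fun q => (zero_lt_one.trans (hne q)).ne'
  unfold nonprimeWt
  by_cases h1 : ∀ q, f (.inl (.inr q)) = 1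
  · have hm' : ∀ q, m q = ∏ b : S with b.1.1 = q, f (.inr b) := fun q => by
      rw [hprod, h1, one_mul]
    have hrough : ∏ q, roughWt z (m q) = 1 := prod_eq_one fun q _ => by
      rw [hm']
      exact roughWt_prod_primeOne _ fun b _ => hp b
    have hex : ∀ q, ∃ t, (q, t) ∈ S := fun q => by
      by_contra hq
      push Not at hq
      have h2 := hne q
      have h3 := hm' q
      rw [filter_eq_empty_iff.2, prod_empty] at h3
      · simp only [hm] at h3
        omega
      · rintro b - rfl
        exact hq b.1.2 b.2
    have hsurj : Function.Surjective fun b : S => b.1.1 := fun q => by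
      obtain ⟨t, ht⟩ := hex q
      exact ⟨⟨(q, t), ht⟩, rfl⟩
    rw [hrough]
    by_cases hc : Fintype.card Q < #S
    · rw [if_pos ⟨hex, hc, h1⟩]
      have hinj : ¬ Function.Injective fun b : S => b.1.1 := fun hinj => by
        have := Fintype.card_le_of_injective _ hinj
        rw [Fintype.card_coe] at this
        omega
      rw [Function.Injective] at hinj
      push Not at hinj
      obtain ⟨b, b', hbb, hne'⟩ := hinj
      have h0 : ∏ q, primeWt z (m q) = 0 := by
        refine prod_eq_zero (mem_univ b.1.1) (if_neg fun hpr => ?_)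
        have hsub : ({b, b'} : Finset S) ⊆ ({c : S | c.1.1 = b.1.1} : Finset S) := by
          intro c hc
          rw [mem_insert, mem_singleton] at hc
          rw [mem_filter]
          rcases hc with rfl | rfl
          · exact ⟨mem_univ _, rfl⟩
          · exact ⟨mem_univ _, hbb.symm⟩
        have hd := prod_dvd_prod_of_subset _ _ (fun c => f (.inr c)) hsub
        rw [prod_pair hne', ← hm'] at hd
        rcases (Nat.dvd_prime hpr.1).1 hd with h2 | h2
        · exact (hp b).1.ne_one (Nat.eq_one_of_mul_eq_one_right h2)
        · exact Nat.not_prime_mul (hp b).1.ne_one (hp b').1.ne_one (h2 ▸ hpr.1)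
      rw [h0, sub_zero]
    · rw [if_neg fun hh => hc hh.2.1]
      have hbij : Function.Bijective fun b : S => b.1.1 := by
        rw [Fintype.bijective_iff_surjective_and_card, Fintype.card_coe]
        refine ⟨hsurj, le_antisymm (not_lt.1 hc) ?_⟩
        have := Fintype.card_le_of_surjective _ hsurj
        rwa [Fintype.card_coe] at this
      rw [prod_eq_one, sub_self]
      intro q _
      obtain ⟨b, rfl⟩ := hbij.2 q
      have : ({c : S | c.1.1 = b.1.1} : Finset S) = {b} := by
        ext c
        rw [mem_filter, mem_singleton]
        exact ⟨fun hc => hbij.1 hc.2, fun hc => ⟨mem_univ _, by rw [hc]⟩⟩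
      refine if_pos ?_
      rw [hm', this, prod_singleton]
      exact hp b
  · rw [if_neg fun hh => h1 hh.2.2]
    push Not at h1
    obtain ⟨q, hq⟩ := h1
    have h2 : roughWt z (m q) = 0 :=
      roughWt_eq_zero_of_smooth_dvd (hs q) hq (hm0 q) ⟨_, hprod q⟩
    rw [prod_eq_zero (mem_univ q) h2, prod_eq_zero (mem_univ q) (primeWt_eq_zero_of_roughWt h2),
      sub_zero]

end

/-- The sums over tuples of smooth numbers and primes. -/
def primeTupleSum {Y Q : Type*} [Fintype Y] [Fintype Q] (z x : ℝ) (w : ℕ → ℝ) (τ : Y → Bool)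
    (Ω : (Y ⊕ Q → ℝ) → ℝ) : ℝ :=
  tupleSum ⌊x⌋₊ w fun f => (∏ y, smoothWt z (τ y) (f (.inl y))) *
    (∏ q, primeWt z (f (.inr q))) * Ω (lg f)

/-- The product of so many primes `≥ (x / 2) ^ ν` exceeds `x`. This is where the induction on the
number of primes begins. -/
theorem primeTupleSum_eq_zero {P : Params} {B x : ℝ} {w : ℕ → ℝ} (h : Balanced P B x w)
    {Y Q : Type*} [Fintype Y] [Fintype Q] (hQ : maxPrimes P ≤ Fintype.card Q) (τ : Y → Bool)
    (Ω : (Y ⊕ Q → ℝ) → ℝ) : primeTupleSum ((x / 2) ^ P.ν) x w τ Ω = 0 := by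
  refine sum_eq_zero fun f hf => ?_
  by_contra hne
  have hf1 : ∀ i, 1 ≤ f i := fun i => (mem_box.1 hf i).1
  have h1 := left_ne_zero_of_mul hne
  have h2 := right_ne_zero_of_mul (left_ne_zero_of_mul h1)
  have hz := one_le_rpow_nu h.good h.eight_le
  have h3 : ((x / 2) ^ P.ν) ^ Fintype.card Q ≤ x := by
    refine le_trans ?_ (h.supp _ (right_ne_zero_of_mul hne)).2
    rw [Fintype.prod_sum_type]
    push_cast
    have h4 : ((x / 2) ^ P.ν) ^ Fintype.card Q ≤ ∏ q, (f (.inr q) : ℝ) := by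
      rw [← card_univ, ← prod_const]
      refine prod_le_prod (fun _ _ => by linarith) fun q _ => ?_
      exact (primeWt_eq (prod_ne_zero_iff.1 h2 q (mem_univ q))).1.2
    have h5 : (1 : ℝ) ≤ ∏ y, (f (.inl y) : ℝ) := by
      rw [← Nat.cast_prod]
      exact_mod_cast Finset.one_le_prod' fun i _ => hf1 _
    have h6 : (0 : ℝ) ≤ ∏ q, (f (.inr q) : ℝ) := by positivity
    nlinarith
  exact absurd (lt_maxPrimes h.good h.eight_le h3) (not_lt.2 hQ)

open Classical in
/-- Sums over tuples of smooth numbers and primes avoiding the coagulations are small. -/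
theorem exists_bound_primes (P : Params) (s : ℕ) : ∀ (Y Q : Type) [Fintype Y] [Fintype Q] (K : ℕ),
    maxPrimes P ≤ Fintype.card Q + s →
    ∃ A : ℕ, ∀ (B x : ℝ) (w : ℕ → ℝ), Balanced P B x w → A ≤ B →
      ∀ (τ : Y → Bool) (Ω : (Y ⊕ Q → ℝ) → ℝ), SignFn K Ω → (∀ v, |Ω v| ≤ 1) → AvoidsCoag P Ω →
      |primeTupleSum ((x / 2) ^ P.ν) x w τ Ω| ≤ errBd A B x := by
  induction s with
  | zero =>
    intro Y Q _ _ K hs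
    refine ⟨0, fun B x w h _ τ Ω _ _ _ => ?_⟩
    rw [primeTupleSum_eq_zero h hs, abs_zero]
    exact errBd_nonneg h.eight_le
  | succ s ih =>
    intro Y Q _ _ K hs
    let T := maxPrimes P
    let π := {Ω : (Y ⊕ Q → ℝ) → ℝ // SignFn K Ω}
    have hposU : Unif fun (a : π) (L : Y ⊕ Q → ℝ) =>
        if ∀ q, 0 < L (.inr q) then a.1 L else 0 :=
      Unif.ite (Unif.all fun q => Unif.lt (fun _ => IsAff.const _) fun _ => IsAff.coord _)
        (Unif.of_signFn fun a : π => a.2) (Unif.const _)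
    obtain ⟨K', hK'⟩ := hposU
    obtain ⟨A₀, hA₀⟩ := exists_bound_rough P Y Q K'
    let π' := {Ω : (Y ⊕ Q → ℝ) → ℝ // SignFn K' Ω}
    -- The weight of the correction tuples. The former smooth parts stay as components but are
    -- forced to be `1`, and the primes of each `m_q` occur in order, so that each factorization is
    -- counted once.
    let Φ : (S : Finset (Q × Fin T)) → ((Y ⊕ Q → ℝ) → ℝ) → ((Y ⊕ Q) ⊕ S → ℝ) → ℝ := fun S Ω L =>
      if (∀ q, ∃ t, (q, t) ∈ S) ∧ Fintype.card Q < #S ∧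
        (∀ q, L (.inl (.inr q)) = 0) ∧ PaddedLog (fun b => extendZero S L (.inr b)) then
        Ω (addOut (extendZero S L)) else 0
    have hΦU : ∀ S, Unif fun (a : π') L => Φ S a.1 L := fun S => by
      refine Unif.ite ?_ ?_ (Unif.const _)
      · refine (Unif.const _).and ((Unif.const _).and (Unif.and (Unif.all fun q => ?_) ?_))
        · exact Unif.eq (fun _ => IsAff.coord _) fun _ => IsAff.const _
        · exact unif_paddedLog (fun L b => extendZero S L (.inr b)) fun b => isAff_extendZero S _
      · exact ((Unif.of_signFn fun a : π' => a.2).comp fun a i => isAff_addOut i).comp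
          fun a i => isAff_extendZero S i
    choose KS hKS using hΦU
    have hIH : ∀ S : Finset (Q × Fin T), ∃ A : ℕ, maxPrimes P ≤ #S + s →
        ∀ (B x : ℝ) (w : ℕ → ℝ), Balanced P B x w → A ≤ B →
        ∀ (τ : Y ⊕ Q → Bool) (Ω : ((Y ⊕ Q) ⊕ S → ℝ) → ℝ), SignFn (KS S) Ω → (∀ v, |Ω v| ≤ 1) →
        AvoidsCoag P Ω → |primeTupleSum ((x / 2) ^ P.ν) x w τ Ω| ≤ errBd A B x := fun S => by
      by_cases hS : maxPrimes P ≤ #S + s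
      · obtain ⟨A, hA⟩ := ih (Y ⊕ Q) S (KS S) (by rwa [Fintype.card_coe])
        exact ⟨A, fun _ => hA⟩
      · exact ⟨0, fun hS' => absurd hS' hS⟩
    choose AS hAS using hIH
    refine ⟨A₀ + ∑ S, AS S, fun B x w h hB τ Ω₁ hΩ₁ hΩ₁1 hcoag₁ => ?_⟩
    have hx8 := h.eight_le
    have hP := h.good
    push_cast at hB
    have hS0 : ∀ S, (AS S : ℝ) ≤ ∑ S, (AS S : ℝ) := fun S =>
      single_le_sum (f := fun S => (AS S : ℝ)) (fun _ _ => by positivity) (mem_univ S)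
    have hB0 : (A₀ : ℝ) ≤ B := by
      have : (0 : ℝ) ≤ ∑ S, (AS S : ℝ) := sum_nonneg fun _ _ => by positivity
      linarith
    have hBS : ∀ S, (AS S : ℝ) ≤ B := fun S => by
      have := hS0 S
      have : (0 : ℝ) ≤ A₀ := by positivity
      linarith
    set z := (x / 2) ^ P.ν with hz
    have hz1 : 1 ≤ z := one_le_rpow_nu hP hx8
    -- Components equal to `1` are cut off. For primes this changes nothing, whereas `1` would count
    -- as free of small primes without being prime.
    set Ω : (Y ⊕ Q → ℝ) → ℝ := fun L => if ∀ q, 0 < L (.inr q) then Ω₁ L else 0 with hΩdef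
    have hΩ : SignFn K' Ω := hK' ⟨Ω₁, hΩ₁⟩
    have hΩ1 : ∀ v, |Ω v| ≤ 1 := fun v => by
      simp only [hΩdef]
      split_ifs
      · exact hΩ₁1 _
      · simp
    have hpos : ∀ L, Ω L ≠ 0 → ∀ q, 0 < L (.inr q) := fun L hL => by
      by_contra hq
      exact hL (if_neg hq)
    have hcoag : AvoidsCoag P Ω := fun L hL hΩL => hcoag₁ L hL fun h0 => hΩL (by
      simp only [hΩdef, h0, ite_self])
    have hRS := hA₀ B x w h hB0 τ Ω hΩ hΩ1 hcoag fun L _ => hpos L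
    rw [← hz] at hRS
    set RS := tupleSum ⌊x⌋₊ w fun f => (∏ y, smoothWt z (τ y) (f (.inl y))) *
        (∏ q, roughWt z (f (.inr q))) * Ω (lg f) with hRSdef
    have hsplit : primeTupleSum z x w τ Ω₁ = RS - ∑ S : Finset (Q × Fin T),
        primeTupleSum z x w (Sum.elim τ fun _ => false) (Φ S Ω) := by
      have e1 : primeTupleSum z x w τ Ω₁ = primeTupleSum z x w τ Ω := by
        refine tupleSum_congr fun f hf _ => ?_
        by_cases h0 : (∏ q, primeWt z (f (.inr q))) = 0
        · rw [h0, mul_zero, zero_mul, zero_mul]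
        · have : Ω (lg f) = Ω₁ (lg f) := if_pos fun q => by
            have := (primeWt_eq (prod_ne_zero_iff.1 h0 q (mem_univ q))).1.1.one_lt
            exact Real.log_pos (by exact_mod_cast this)
          rw [this]
      have e2 : RS = primeTupleSum z x w τ Ω + tupleSum ⌊x⌋₊ w fun f =>
          (∏ y, smoothWt z (τ y) (f (.inl y))) * nonprimeWt z (fun q => f (.inr q)) *
            Ω (lg f) := by
        rw [hRSdef, primeTupleSum, ← tupleSum_add]
        refine tupleSum_congr fun f _ _ => ?_
        simp only [nonprimeWt]
        ring
      rw [e1, e2]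
      have e3 : tupleSum ⌊x⌋₊ w (fun f => (∏ y, smoothWt z (τ y) (f (.inl y))) *
          nonprimeWt z (fun q => f (.inr q)) * Ω (lg f)) = ∑ S : Finset (Q × Fin T),
          primeTupleSum z x w (Sum.elim τ fun _ => false) (Φ S Ω) := by
        rw [tupleSum_expand (z := z) (T := T) h.le_floor fun n hn hnN =>
          (roughList_length_lt hP hx8 hn ((Nat.le_floor_iff (by linarith)).1 hnN)).le]
        have e4 := tupleSum_pad (z := z) (w := w) (N := ⌊x⌋₊) (K := Q × Fin T) (Y := Y ⊕ Q)
          (Nat.le_floor (by norm_num; linarith)) fun f =>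
          (∏ q, smoothWt z false (f (.inl (.inr q)))) *
            (∏ q, padWt fun t => f (.inr (q, t))) *
            ((∏ y, smoothWt z (τ y) (mulOut f (.inl y))) *
            nonprimeWt z (fun q => mulOut f (.inr q)) * Ω (lg (mulOut f)))
        refine Eq.trans (tupleSum_congr fun f _ _ => ?_) (e4.trans (sum_congr rfl fun S _ =>
          tupleSum_congr fun f hf _ => ?_))
        · ring
        · have hf1 : ∀ i, 1 ≤ f i := fun i => (mem_box.1 hf i).1
          have hfe : ∀ i, 1 ≤ extendOne S f i := by
            rintro (y | b)
            · exact hf1 _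
            · simp only [extendOne, Sum.elim_inr]
              split_ifs
              · exact hf1 _
              · exact le_rfl
          by_cases h0 : (∏ k, primeWt z (f (.inr k))) = 0
          · rw [h0]; ring
          by_cases h0' : (∏ q, smoothWt z false (f (.inl (.inr q)))) = 0
          · have h5 : (∏ q, smoothWt z false (extendOne S f (.inl (.inr q)))) = 0 := h0'
            rw [h5, Fintype.prod_sum_type]
            simp only [Sum.elim_inr, h0']
            ring
          have hpr : ∀ b, (f (.inr b)).Prime ∧ z ≤ f (.inr b) := fun b =>
            (primeWt_eq (prod_ne_zero_iff.1 h0 b (mem_univ b))).1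
          have hsm : ∀ q, smoothWt z false (f (.inl (.inr q))) ≠ 0 := fun q =>
            prod_ne_zero_iff.1 h0' q (mem_univ q)
          have h6 : (∏ q, smoothWt z false (extendOne S f (.inl (.inr q)))) = 1 :=
            prod_eq_one fun q _ => smoothWt_false_eq (hsm q)
          have h7 : (∏ i, smoothWt z (Sum.elim τ (fun _ => false) i) (f (.inl i))) =
              ∏ y, smoothWt z (τ y) (mulOut (extendOne S f) (.inl y)) := by
            rw [Fintype.prod_sum_type]
            simp only [Sum.elim_inr, Sum.elim_inl]
            rw [prod_eq_one (s := univ (α := Q)) fun q _ => smoothWt_false_eq (hsm q), mul_one]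
            rfl
          rw [h6, h7, prod_padWt fun b => hfe (.inr b), one_mul]
          have h8 : (if PaddedLog (lg fun b => extendOne S f (.inr b)) then (1 : ℝ) else 0) *
              (nonprimeWt z (fun q => mulOut (extendOne S f) (.inr q)) *
                Ω (lg (mulOut (extendOne S f)))) = Φ S Ω (lg f) := by
            have h9 : (lg fun b => extendOne S f (.inr b)) =
                fun b => extendZero S (lg f) (.inr b) := by
              rw [← lg_extendOne]; rfl
            rw [h9, lg_mulOut hfe, lg_extendOne]
            by_cases hΩ0 : Ω (addOut (extendZero S (lg f))) = 0
            · simp only [Φ, hΩ0]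
              simp
            · have hne : ∀ q, 1 < mulOut (extendOne S f) (.inr q) := fun q => by
                have h10 := hpos _ hΩ0 q
                rw [← lg_extendOne, ← lg_mulOut hfe] at h10
                by_contra h11
                have : mulOut (extendOne S f) (.inr q) = 0 ∨
                  mulOut (extendOne S f) (.inr q) = 1 := by omega
                rcases this with h12 | h12 <;> simp [lg, h12] at h10
              rw [nonprimeWt_mulOut (fun q => lt_of_smoothWt_ne_zero (hsm q)) hpr hne]
              have h13 : (∀ q, f (.inl (.inr q)) = 1) ↔
                  ∀ q, lg f (.inl (.inr q)) = 0 :=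
                forall_congr' fun q => (lg_eq_zero_iff (hf1 _)).symm
              simp only [Φ, h13]
              by_cases hc : (∀ q, ∃ t, (q, t) ∈ S) ∧ Fintype.card Q < #S ∧
                ∀ q, lg f (.inl (.inr q)) = 0
              · by_cases hd : PaddedLog fun b => extendZero S (lg f) (.inr b)
                · rw [if_pos hc, if_pos hd, if_pos ⟨hc.1, hc.2.1, hc.2.2, hd⟩, one_mul, one_mul]
                · rw [if_pos hc, if_neg hd, zero_mul]
                  exact (if_neg fun hh => hd hh.2.2.2).symm
              · rw [if_neg hc, zero_mul, mul_zero]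
                exact (if_neg fun hh => hc ⟨hh.1, hh.2.1, hh.2.2.1⟩).symm
          rw [← h8]
          ring
      rw [e3]
      ring
    rw [hsplit]
    refine (abs_sub _ _).trans ?_
    have hterm : ∀ S : Finset (Q × Fin T),
        |primeTupleSum z x w (Sum.elim τ fun _ => false) (Φ S Ω)| ≤ errBd (AS S) B x := fun S => by
      by_cases hS : (∀ q, ∃ t, (q, t) ∈ S) ∧ Fintype.card Q < #S
      -- The set `S` has more elements than `Q`, so the induction hypothesis applies with the
      -- parameter lowered by one.
      · refine hAS S (by omega) B x w h (hBS S) _ _ (hKS S ⟨Ω, hΩ⟩) (fun v => ?_) ?_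
        · simp only [Φ]
          split_ifs
          · exact hΩ1 _
          · simp
        · intro L hL hΦL hc
          have hcond : (∀ q, L (.inl (.inr q)) = 0) ∧ Ω (addOut (extendZero S L)) ≠ 0 := by
            simp only [Φ] at hΦL
            split_ifs at hΦL with hh
            · exact ⟨hh.2.2.1, hΦL⟩
            · exact absurd rfl hΦL
          have hL1 : ∀ i, 0 ≤ extendZero S L i := by
            rintro (y | b)
            · exact hL _
            · simp only [extendZero, Sum.elim_inr]
              split_ifs
              · exact hL _
              · exact le_rfl
          have hL2 : ∀ i, 0 ≤ addOut (extendZero S L) i := by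
            rintro (y | q)
            · exact hL1 (.inl (.inl y))
            · exact add_nonneg (hL1 _) (sum_nonneg fun _ _ => hL1 _)
          have hval : ∀ q, addOut (extendZero S L) (.inr q) =
              ∑ b : S with b.1.1 = q, L (.inr b) := fun q => by
            rw [← sum_extendZero_fiber]
            simp only [addOut, Sum.elim_inr]
            have : extendZero S L (.inl (.inr q)) = L (.inl (.inr q)) := rfl
            rw [this, hcond.1, zero_add]
          have hsum : ∑ i, addOut (extendZero S L) i = ∑ i, L i := by
            rw [Fintype.sum_sum_type, Fintype.sum_sum_type, Fintype.sum_sum_type]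
            have e5 : ∑ q, addOut (extendZero S L) (.inr q) = ∑ b : S, L (.inr b) := by
              rw [sum_congr rfl fun q _ => hval q]
              exact sum_fiberwise _ _ _
            rw [e5, sum_eq_zero fun q _ => hcond.1 q, add_zero]
            rfl
          have hp2 := hpos _ hcond.2
          refine hcoag _ hL2 hcond.2 ?_
          have hℓ : 0 ≤ ∑ i, L i := sum_nonneg fun i _ => hL i
          rw [hsum]
          -- Multiplying together the primes of each `m_q` would turn a coagulation of the finer
          -- tuple into one of the original tuple.
          refine hc.coarsen (fun b => some b.1.1) (by simp) (fun q => ?_) ?_ fun q => ?_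
          · refine div_pos (hp2 q) (hℓ.lt_of_ne fun h0 => ?_)
            have h14 := single_le_sum (fun i _ => hL2 i) (mem_univ (.inr q))
            rw [hsum, ← h0] at h14
            exact absurd (hp2 q) (not_lt.2 h14)
          · simp only [reduceCtorEq, filter_false, sum_empty, add_zero]
            have e6 : ∑ i, L (.inl i) = ∑ y, L (.inl (.inl y)) := by
              rw [Fintype.sum_sum_type, sum_eq_zero fun q _ => hcond.1 q, add_zero]
            rw [e6]
            rfl
          · simp only [Option.some.injEq]
            rw [hval, sum_div]
      · have : primeTupleSum z x w (Sum.elim τ fun _ => false) (Φ S Ω) = 0 := by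
          refine sum_eq_zero fun f _ => ?_
          have : Φ S Ω (lg f) = 0 := if_neg fun hh => hS ⟨hh.1, hh.2.1⟩
          simp only [this, mul_zero, zero_mul]
        rw [this, abs_zero]
        exact errBd_nonneg hx8
    refine (add_le_add hRS ((abs_sum_le_sum_abs _ _).trans
      ((sum_le_sum fun S _ => hterm S).trans (sum_errBd_le _ _ hx8)))).trans (errBd_add hx8)

/-! ### Functions of the prime factors of an integer -/

/-- Evaluation at the vector of the members of a list. -/
def onList (h : VecFun) (l : List ℝ) : ℝ := h l.length l.get

/-- The list of the quotients `log p / ℓ` for the prime factors `p` of `n`. -/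
def logList (ℓ : ℝ) (n : ℕ) : List ℝ := n.primeFactorsList.map fun p : ℕ => Real.log p / ℓ

theorem vecFun_congr (h : VecFun) {k k' : ℕ} (hk : k = k') {x : Fin k → ℝ} {x' : Fin k' → ℝ}
    (hx : ∀ i, x i = x' (Fin.cast hk i)) : h k x = h k' x' := by
  subst hk
  exact congrArg _ (funext hx)

/-- Families with the same values up to order. -/
theorem exists_equiv_of_map_eq {α β γ : Type*} [Fintype α] [Fintype β] {f : α → γ} {g : β → γ}
    (h : univ.val.map f = univ.val.map g) : ∃ e : α ≃ β, ∀ a, g (e a) = f a := by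
  classical
  have hcard : ∀ c, Fintype.card {a // f a = c} = Fintype.card {b // g b = c} := fun c => by
    have := congrArg (Multiset.count c) h
    rw [Multiset.count_map, Multiset.count_map] at this
    rw [Fintype.card_subtype, Fintype.card_subtype]
    simp only [eq_comm (a := c)] at this
    exact this
  refine ⟨(Equiv.sigmaFiberEquiv f).symm.trans ((Equiv.sigmaCongrRight fun c =>
    Fintype.equivOfCardEq (hcard c)).trans (Equiv.sigmaFiberEquiv g)), fun a => ?_⟩
  exact (Fintype.equivOfCardEq (hcard (f a)) ⟨a, rfl⟩).2

theorem map_get_univ {γ : Type*} (l : List γ) : univ.val.map l.get = (l : Multiset γ) := by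
  rw [Fin.univ_val_map, List.ofFn_get]

theorem primeFactorsList_prod {l : List ℕ} (hl : ∀ p ∈ l, p.Prime) (hs : l.SortedLE) :
    l.prod.primeFactorsList = l := by
  have h := factor_unique (z := 0) (s := 1) (l := l) one_ne_zero (by simp)
    (fun p hp => ⟨hl p hp, by positivity⟩) hs
  rw [one_mul] at h
  have h2 : roughList 0 l.prod = l.prod.primeFactorsList :=
    List.filter_eq_self.2 fun p _ => by simp
  rw [← h2, h.2]

open Classical in
/-- The value of a function at the logarithms of the prime factors, for integers with large prime
factors. -/
def detWt (h : VecFun) (ν ℓ : ℝ) (d : ℕ) : ℝ :=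
  if ∀ p ∈ d.primeFactors, ν * ℓ ≤ Real.log (p : ℕ) then onList h (logList ℓ d) else 0

open Classical in
/-- The Möbius function, for integers with small prime factors. -/
def moebWt (ν ℓ : ℝ) (e : ℕ) : ℝ :=
  if ∀ p ∈ e.primeFactors, Real.log (p : ℕ) < ν * ℓ then (ArithmeticFunction.moebius e : ℝ) else 0

open Classical in
/-- The logarithmic form of `detWt`. -/
def detLog (h : VecFun) (ν ℓ a : ℝ) {T : ℕ} (u : Fin T → ℝ) : ℝ :=
  if a = 0 ∧ ∀ t, u t ≠ 0 → ν * ℓ ≤ u t then ∑ j : Fin (T + 1),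
    if #{t | u t ≠ 0} = j then
      (if 0 < ℓ then h j fun i => u (Fin.castLE (Nat.lt_succ_iff.1 j.2) i) / ℓ else 0)
    else 0
  else 0

open Classical in
/-- The logarithmic form of `moebWt`. -/
def moebLog (ν ℓ : ℝ) {T : ℕ} (u : Fin T → ℝ) : ℝ :=
  if (∀ t, u t < ν * ℓ) ∧ ∀ i j, i ≠ j → u i = u j → u i = 0 then (-1) ^ #{t | u t ≠ 0} else 0

section
variable {T s : ℕ} {p : Fin T → ℕ} {z ν ℓ : ℝ}

/-- Since `log z ≤ ν ℓ`, a nontrivial `z`-smooth factor contains a prime below the threshold, so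
that both sides vanish. Otherwise the primes fill the first places of the padded tuple in increasing
order, and the value of `h` is read off there. -/
theorem detWt_expand (h : VecFun) (hs : s ≠ 0) (hsz : ∀ q ∈ s.primeFactors, (q : ℝ) < z)
    (hp : ∀ t, p t = 1 ∨ (p t).Prime ∧ z ≤ p t) (hpad : Padded p)
    (hzℓ : Real.log z ≤ ν * ℓ) (hℓ : 0 < ℓ) :
    detWt h ν ℓ (s * ∏ t, p t) = detLog h ν ℓ (Real.log s) fun t => Real.log (p t) := by
  obtain ⟨l, hls, hl, hlT, rfl⟩ := hpad.exists_list
  have hlp : ∀ q ∈ l, q.Prime ∧ z ≤ q := fun q hq => by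
    obtain ⟨i, hi, h1⟩ := hl q hq
    rcases hp i with h2 | h2
    · exact absurd (hi ▸ h2) h1
    · rwa [hi] at h2
  rw [prod_pad T l hlT]
  by_cases hs1 : s = 1
  · subst hs1
    have hpf := primeFactorsList_prod (fun q hq => (hlp q hq).1) hls
    have hne : ∀ t : Fin T, Real.log (pad T l t : ℕ) ≠ 0 ↔ (t : ℕ) < l.length := fun t => by
      constructor
      · intro h1
        by_contra h2
        apply h1
        have : pad T l t = 1 := List.getD_eq_default _ _ (not_lt.1 h2)
        rw [this, Nat.cast_one, Real.log_one]
      · intro h1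
        have : pad T l t = l[(t : ℕ)] := List.getD_eq_getElem _ _ h1
        rw [this]
        exact (Real.log_pos (by exact_mod_cast (hlp _ (List.getElem_mem h1)).1.one_lt)).ne'
    have hcard : #{t : Fin T | Real.log (pad T l t : ℕ) ≠ 0} = l.length := by
      simp only [hne]
      rw [Fin.card_filter_val_lt, min_eq_right hlT]
    have hcond : (∀ t : Fin T, Real.log (pad T l t : ℕ) ≠ 0 → ν * ℓ ≤ Real.log (pad T l t : ℕ)) ↔
        ∀ q ∈ l.prod.primeFactors, ν * ℓ ≤ Real.log (q : ℕ) := by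
      have hm : ∀ q, q ∈ l.prod.primeFactors ↔ q ∈ l := fun q => by
        rw [← mem_primeFactors_list_prod fun q hq => (hlp q hq).1]
      constructor
      · intro h1 q hq
        obtain ⟨i, hi, h2⟩ := hl q ((hm q).1 hq)
        have h3 := h1 i
        rw [hi] at h3
        exact h3 (Real.log_pos (by exact_mod_cast (hlp q ((hm q).1 hq)).1.one_lt)).ne'
      · intro h1 t ht
        rw [hne] at ht
        have : pad T l t = l[(t : ℕ)] := List.getD_eq_getElem _ _ ht
        rw [this]
        exact h1 _ ((hm _).2 (List.getElem_mem ht))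
    unfold detWt detLog
    rw [one_mul, Nat.cast_one, Real.log_one]
    by_cases hc : ∀ q ∈ l.prod.primeFactors, ν * ℓ ≤ Real.log (q : ℕ)
    · rw [if_pos hc, if_pos ⟨rfl, hcond.2 hc⟩, sum_eq_single ⟨l.length, Nat.lt_succ_of_le hlT⟩]
      · rw [if_pos hcard, if_pos hℓ, logList, hpf]
        refine vecFun_congr h (List.length_map _) fun i => ?_
        have hi : (i : ℕ) < l.length := lt_of_lt_of_eq i.2 (List.length_map _)
        have h1 : pad T l (Fin.castLE hlT ⟨i, hi⟩) = l[(i : ℕ)] := List.getD_eq_getElem _ _ hi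
        rw [List.get_eq_getElem, List.getElem_map, ← h1]
        rfl
      · intro j _ hj
        rw [if_neg]
        rw [hcard]
        intro h1
        exact hj (Fin.ext h1.symm)
      · simp
    · rw [if_neg hc, if_neg fun h1 => hc (hcond.1 h1.2)]
  · obtain ⟨q, hq, hqs⟩ := Nat.exists_prime_and_dvd hs1
    have hl0 : l.prod ≠ 0 := List.prod_ne_zero fun h0 => (hlp 0 h0).1.ne_zero rfl
    have h1 := hsz q (Nat.mem_primeFactors.2 ⟨hq, hqs, hs⟩)
    have h2 : Real.log q < ν * ℓ :=
      (Real.log_lt_log (by exact_mod_cast hq.pos) h1).trans_le hzℓ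
    unfold detWt detLog
    rw [if_neg, if_neg]
    · rintro ⟨h3, -⟩
      have : (1 : ℝ) < s := by
        have := hq.one_lt.trans_le (Nat.le_of_dvd (Nat.pos_of_ne_zero hs) hqs)
        exact_mod_cast this
      exact (Real.log_pos this).ne' h3
    · intro h3
      exact absurd (h3 q (Nat.mem_primeFactors.2 ⟨hq, hqs.mul_right _, mul_ne_zero hs hl0⟩))
        (not_le.2 h2)

open Classical in
theorem moebius_prod {ι : Type*} [Fintype ι] {p : ι → ℕ} (hp : ∀ t, p t = 1 ∨ (p t).Prime) :
    ArithmeticFunction.moebius (∏ t, p t) =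
      if ∀ i j, i ≠ j → p i = p j → p i = 1 then (-1) ^ #{t | p t ≠ 1} else 0 := by
  split_ifs with h
  · rw [ArithmeticFunction.isMultiplicative_moebius.map_prod]
    · rw [← prod_filter_mul_prod_filter_not univ fun t => p t ≠ 1]
      have h1 : ∏ t with p t ≠ 1, ArithmeticFunction.moebius (p t) = (-1) ^ #{t | p t ≠ 1} := by
        rw [← prod_const]
        refine prod_congr rfl fun t ht => ?_
        exact ArithmeticFunction.moebius_apply_prime ((hp t).resolve_left (mem_filter.1 ht).2)
      rw [h1, prod_eq_one, mul_one]
      intro t ht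
      rw [mem_filter, not_not] at ht
      rw [ht.2, ArithmeticFunction.moebius_apply_one]
    · intro i _ j _ hij
      rcases hp i with h1 | h1
      · simp [Function.onFun, h1]
      rcases hp j with h2 | h2
      · simp [Function.onFun, h2]
      exact (Nat.coprime_primes h1 h2).2 fun h3 => h1.ne_one (h i j hij h3)
  · push Not at h
    obtain ⟨i, j, hij, h1, h2⟩ := h
    refine ArithmeticFunction.moebius_eq_zero_of_not_squarefree fun hsq => ?_
    have hd := prod_dvd_prod_of_subset ({i, j} : Finset ι) univ p (subset_univ _)
    rw [prod_pair hij, ← h1] at hd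
    exact h2 (Nat.isUnit_iff.1 (hsq _ hd))

/-- The `z`-smooth factor keeps its Möbius function as an arithmetic weight. For the primes `≥ z`
the Möbius function is determined by their number and by whether they are distinct, hence by signs
of linear forms in the logarithms. -/
theorem moebWt_expand (hs : s ≠ 0) (hsz : ∀ q ∈ s.primeFactors, (q : ℝ) < z)
    (hp : ∀ t, p t = 1 ∨ (p t).Prime ∧ z ≤ p t)
    (hzℓ : Real.log z ≤ ν * ℓ) (hℓ : 0 < ν * ℓ) :
    moebWt ν ℓ (s * ∏ t, p t) = smoothWt z true s * moebLog ν ℓ fun t => Real.log (p t) := by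
  have hp1 : ∀ t, 1 ≤ p t := fun t => by
    rcases hp t with h | h
    · exact h.ge
    · exact h.1.one_lt.le
  have hp0 : ∏ t, p t ≠ 0 := prod_ne_zero_iff.2 fun t _ => by have := hp1 t; omega
  have hl0 : ∀ t, Real.log (p t) = 0 ↔ p t = 1 := fun t => lg_eq_zero_iff (f := p) (hp1 t)
  have hle : ∀ i j, Real.log (p i) = Real.log (p j) ↔ p i = p j := fun i j => by
    rw [le_antisymm_iff, le_antisymm_iff]
    exact and_congr (lg_le_lg_iff (f := p) (g := p) (hp1 _) (hp1 _))
      (lg_le_lg_iff (f := p) (g := p) (hp1 _) (hp1 _))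
  have hcop : s.Coprime (∏ t, p t) := by
    refine Nat.Coprime.prod_right fun t _ => ?_
    rcases hp t with h | h
    · simp [h]
    · refine (Nat.Prime.coprime_iff_not_dvd h.1).2 (fun hd => ?_) |>.symm
      exact absurd (hsz _ (Nat.mem_primeFactors.2 ⟨h.1, hd, hs⟩)) (not_lt.2 h.2)
  have hcond : (∀ q ∈ (s * ∏ t, p t).primeFactors, Real.log (q : ℕ) < ν * ℓ) ↔
      ∀ t, Real.log (p t) < ν * ℓ := by
    constructor
    · intro h1 t
      rcases hp t with h | h
      · rw [h, Nat.cast_one, Real.log_one]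
        exact hℓ
      · exact h1 _ (Nat.mem_primeFactors.2 ⟨h.1, (dvd_prod_of_mem p (mem_univ t)).mul_left _,
          mul_ne_zero hs hp0⟩)
    · intro h1 q hq
      rw [Nat.mem_primeFactors] at hq
      rcases hq.1.dvd_mul.1 hq.2.1 with h2 | h2
      · exact (Real.log_lt_log (by exact_mod_cast hq.1.pos)
          (hsz q (Nat.mem_primeFactors.2 ⟨hq.1, h2, hs⟩))).trans_le hzℓ
      · obtain ⟨t, _, ht⟩ := hq.1.prime.exists_mem_finset_dvd h2
        rcases hp t with h | h
        · rw [h, Nat.dvd_one] at ht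
          exact absurd ht hq.1.ne_one
        · rw [(Nat.prime_dvd_prime_iff_eq hq.1 h.1).1 ht]
          exact h1 t
  unfold moebWt moebLog
  rw [show smoothWt z true s = (ArithmeticFunction.moebius s : ℝ) by
    unfold smoothWt; rw [if_pos hsz]; rfl]
  rw [ArithmeticFunction.isMultiplicative_moebius.map_mul_of_coprime hcop,
    moebius_prod fun t => (hp t).imp_right And.left]
  simp only [hl0, hle, ne_eq, hcond]
  by_cases h1 : ∀ t, Real.log (p t) < ν * ℓ
  · by_cases h2 : ∀ i j, i ≠ j → p i = p j → p i = 1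
    · rw [if_pos h1, if_pos h2, if_pos ⟨h1, h2⟩]
      push_cast
      rfl
    · rw [if_pos h1, if_neg h2, if_neg fun h3 => h2 h3.2]
      simp
  · rw [if_neg h1, if_neg fun h3 => h1 h3.1, mul_zero]

end

section
variable {I : Type*} [Fintype I] {T : ℕ} {ℓ a : (I → ℝ) → ℝ} {u : (I → ℝ) → Fin T → ℝ}

theorem semilin_detLog {h : VecFun} (hh : ∀ k, Semilin (h k)) (ν : ℝ) (hℓ : IsAff ℓ) (ha : IsAff a)
    (hu : ∀ t, IsAff fun L => u L t) : Semilin fun L => detLog h ν (ℓ L) (a L) (u L) := by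
  classical
  have h1 : Semilin fun L => a L = 0 ∧ ∀ t, u L t ≠ 0 → ν * ℓ L ≤ u L t :=
    (Semilin.eq ha (IsAff.const 0)).and (Semilin.all fun t =>
      ((Semilin.eq (hu t) (IsAff.const 0)).map Not).imp (Semilin.le (hℓ.mulc ν) (hu t)))
  have h2 : Semilin fun L => #{t | u L t ≠ 0} := by
    convert (Semilin.pi fun t => (Semilin.eq (hu t) (IsAff.const 0)).map Not).map
      fun q : Fin T → Prop => #{t | q t}
  have h3 : ∀ j : Fin (T + 1), Semilin fun L => if 0 < ℓ L then h j fun i =>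
      u L (Fin.castLE (Nat.lt_succ_iff.1 j.2) i) / ℓ L else 0 := fun j => by
    obtain ⟨N, hN⟩ := hh j
    exact ⟨_, hN.div (fun i => hu _) hℓ 0⟩
  have h4 := (h2.map₂ (Semilin.pi h3) fun n r => ∑ j : Fin (T + 1), if n = j then r j else 0)
  unfold detLog
  convert h1.map₂ h4 fun (q : Prop) (r : ℝ) => if q then r else 0

theorem semilin_moebLog (ν : ℝ) (hℓ : IsAff ℓ) (hu : ∀ t, IsAff fun L => u L t) :
    Semilin fun L => moebLog ν (ℓ L) (u L) := by
  classical
  have h1 : Semilin fun L => (∀ t, u L t < ν * ℓ L) ∧ ∀ i j, i ≠ j → u L i = u L j → u L i = 0 :=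
    (Semilin.all fun t => Semilin.lt (hu t) (hℓ.mulc ν)).and (Semilin.all fun i =>
      Semilin.all fun j => (Semilin.const _).imp
        ((Semilin.eq (hu i) (hu j)).imp (Semilin.eq (hu i) (IsAff.const 0))))
  have h2 : Semilin fun L => (-1 : ℝ) ^ #{t | u L t ≠ 0} := by
    convert (Semilin.pi fun t => (Semilin.eq (hu t) (IsAff.const 0)).map Not).map
      fun q : Fin T → Prop => (-1 : ℝ) ^ #{t | q t}
  unfold moebLog
  convert h1.map₂ h2 fun (q : Prop) (r : ℝ) => if q then r else 0

end

/-! ### The coagulation condition for integers -/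

/-- The prime factors of `n` that are at least `n ^ ν` and the remaining smooth part form a
coagulation. -/
def BigCoag (P : Params) (n : ℕ) : Prop :=
  HasCoag P (Real.log (smoothPart ((n : ℝ) ^ P.ν) n) / Real.log n)
    (((roughList ((n : ℝ) ^ P.ν) n).map fun p : ℕ => Real.log p / Real.log n).get)

/-- The logarithmic form of `BigCoag`. -/
def CoagLog (P : Params) {K : Type*} (ℓ : ℝ) (L : K → ℝ) : Prop :=
  ∃ S : Finset K, (∀ b, b ∈ S ↔ P.ν * ℓ ≤ L b) ∧
    HasCoag P ((ℓ - ∑ b : S, L b) / ℓ) fun b : S => L b / ℓ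

/-- There are finitely many candidates for the set `S` of large components; for each one
`SignFn.div` handles the division by `ℓ`. -/
theorem semilin_coagLog {P : Params} (hP : P.Good) {I K : Type*} [Fintype I] [Finite K]
    {ℓ : (I → ℝ) → ℝ} {L : (I → ℝ) → K → ℝ} (hℓ : IsAff ℓ) (hL : ∀ b, IsAff fun v => L v b) :
    Semilin fun v => 0 < ℓ v ∧ CoagLog P (ℓ v) (L v) := by
  classical
  have : Fintype K := Fintype.ofFinite K
  have h1 : ∀ S : Finset K, Semilin fun v => 0 < ℓ v ∧ (∀ b, b ∈ S ↔ P.ν * ℓ v ≤ L v b) ∧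
      HasCoag P ((ℓ v - ∑ b : S, L v b) / ℓ v) fun b : S => L v b / ℓ v := fun S => by
    obtain ⟨N, hN⟩ := Semilin.hasCoag (κ := S) hP
    have h2 := hN.div (A := fun v (o : Option S) =>
      o.elim (ℓ v - ∑ b : S, L v b) fun b => L v b) (fun o => by
        rcases o with _ | b
        · exact hℓ.sub (IsAff.sum _ fun b _ => hL b)
        · exact hL b) hℓ False
    have h3 : Semilin fun v => ∀ b, b ∈ S ↔ P.ν * ℓ v ≤ L v b :=
      Semilin.all fun b => (Semilin.le (hℓ.mulc P.ν) (hL b)).map fun q => b ∈ S ↔ q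
    refine Exists.imp (fun N hN => ?_) (h3.and (⟨_, h2⟩ : Semilin _))
    convert hN using 2 with v
    by_cases h4 : 0 < ℓ v
    · simp only [h4, if_true, true_and, Option.elim]
    · simp only [h4, if_false, false_and, and_false]
  refine Exists.imp (fun N hN => ?_) (Semilin.ex h1)
  convert hN using 2 with v
  rw [exists_and_left]
  rfl

theorem prod_smooth_rough {z : ℝ} {Y K : Type*} [Fintype Y] [Fintype K] {f : Y ⊕ K → ℕ}
    (hf1 : ∀ i, 1 ≤ f i) (hs : ∀ y, ∀ q ∈ (f (.inl y)).primeFactors, (q : ℝ) < z)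
    (hp : ∀ b, f (.inr b) = 1 ∨ (f (.inr b)).Prime) {S : Finset K}
    (hS : ∀ b, b ∈ S ↔ f (.inr b) ≠ 1 ∧ z ≤ f (.inr b)) :
    (smoothPart z (∏ i, f i) * ∏ b : S, f (.inr b) = ∏ i, f i) ∧
      ((roughList z (∏ i, f i) : List ℕ) : Multiset ℕ) =
        univ.val.map fun b : S => f (.inr b) := by
  classical
  set m : Multiset ℕ := univ.val.map fun b : S => f (.inr b) with hm
  set l : List ℕ := m.sort (· ≤ ·) with hl
  have hlm : (l : Multiset ℕ) = m := Multiset.sort_eq _ _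
  have hlprod : l.prod = ∏ b : S, f (.inr b) := by
    rw [← Multiset.prod_coe, hlm]
    rfl
  set s := (∏ y, f (.inl y)) * ∏ b with b ∉ S, f (.inr b) with hsdef
  have hprod : ∏ i, f i = s * l.prod := by
    rw [hlprod, prod_coe_sort S fun b => f (.inr b), hsdef, Fintype.prod_sum_type, mul_assoc]
    congr 1
    rw [← prod_filter_mul_prod_filter_not univ fun b => b ∈ S, mul_comm]
    congr 2
    ext b
    simp
  have hf0 : ∀ i, f i ≠ 0 := fun i => by have := hf1 i; omega
  have hs0 : s ≠ 0 := mul_ne_zero (prod_ne_zero_iff.2 fun y _ => hf0 _)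
    (prod_ne_zero_iff.2 fun y _ => hf0 _)
  have hu := factor_unique (z := z) (s := s) (l := l) hs0 (fun q hq => ?_) (fun q hq => ?_)
    (Multiset.pairwise_sort m (· ≤ ·)).sortedLE
  · rw [← hprod] at hu
    refine ⟨?_, by rw [hu.2, hlm]⟩
    rw [hu.1, ← hlprod, ← hprod]
  · rw [Nat.mem_primeFactors] at hq
    rcases hq.1.dvd_mul.1 hq.2.1 with h | h
    · obtain ⟨y, _, hy⟩ := hq.1.prime.exists_mem_finset_dvd h
      exact hs y q (Nat.mem_primeFactors.2 ⟨hq.1, hy, hf0 _⟩)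
    · obtain ⟨b, hb, hqb⟩ := hq.1.prime.exists_mem_finset_dvd h
      rw [mem_filter] at hb
      rcases hp b with h1 | h1
      · rw [h1, Nat.dvd_one] at hqb
        exact absurd hqb hq.1.ne_one
      · rw [(Nat.prime_dvd_prime_iff_eq hq.1 h1).1 hqb]
        by_contra h2
        exact hb.2 ((hS b).2 ⟨h1.ne_one, not_lt.1 h2⟩)
  · have h1 : q ∈ m := by rw [← hlm]; exact hq
    rw [hm, Multiset.mem_map] at h1
    obtain ⟨b, _, rfl⟩ := h1
    exact ⟨(hp b).resolve_left ((hS b).1 b.2).1, ((hS b).1 b.2).2⟩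

/-- The tuple may be cut at a level `z` lower than `n ^ ν`. The primes between the two levels join
the smooth part of `n`, whose logarithm is what the remaining primes leave over. -/
theorem bigCoag_iff {P : Params} (hP : P.Good) {z : ℝ} {Y K : Type*} [Fintype Y] [Fintype K]
    {f : Y ⊕ K → ℕ} (hf1 : ∀ i, 1 ≤ f i)
    (hs : ∀ y, ∀ q ∈ (f (.inl y)).primeFactors, (q : ℝ) < z)
    (hp : ∀ b, f (.inr b) = 1 ∨ (f (.inr b)).Prime) (hn : 1 < ∏ i, f i)
    (hz : z ≤ ((∏ i, f i : ℕ) : ℝ) ^ P.ν) :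
    BigCoag P (∏ i, f i) ↔
      CoagLog P (Real.log ((∏ i, f i : ℕ) : ℝ)) fun b => lg f (.inr b) := by
  classical
  set n := ∏ i, f i with hn_def
  have hn0 : (0 : ℝ) < n := by exact_mod_cast zero_lt_one.trans hn
  have hlog : 0 < Real.log n := Real.log_pos (by exact_mod_cast hn)
  set S : Finset K := {b | P.ν * Real.log n ≤ lg f (.inr b)} with hSdef
  have hS : ∀ b, b ∈ S ↔ f (.inr b) ≠ 1 ∧ (n : ℝ) ^ P.ν ≤ f (.inr b) := fun b => by
    have hb0 : (0 : ℝ) < f (.inr b) := by exact_mod_cast hf1 _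
    rw [hSdef, mem_filter, ← Real.log_rpow hn0]
    simp only [mem_univ, true_and, lg]
    rw [Real.log_le_log_iff (by positivity) hb0]
    refine ⟨fun h => ⟨fun h1 => ?_, h⟩, And.right⟩
    rw [h1, Nat.cast_one] at h
    exact absurd h (not_le.2 (Real.one_lt_rpow (by exact_mod_cast hn) hP.ν_pos))
  obtain ⟨h1, h2⟩ := prod_smooth_rough hf1 (fun y q hq => (hs y q hq).trans_le hz) hp hS
  rw [← hn_def] at h1 h2
  have hmap : univ.val.map (((roughList ((n : ℝ) ^ P.ν) n).map fun p : ℕ =>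
      Real.log p / Real.log n).get) =
      univ.val.map fun b : S => lg f (.inr b) / Real.log n := by
    rw [map_get_univ, ← Multiset.map_coe, h2, Multiset.map_map]
    rfl
  obtain ⟨e, he⟩ := exists_equiv_of_map_eq hmap
  have hσ : Real.log (smoothPart ((n : ℝ) ^ P.ν) n) =
      Real.log n - ∑ b : S, lg f (.inr b) := by
    have h3 : (smoothPart ((n : ℝ) ^ P.ν) n : ℝ) ≠ 0 := by exact_mod_cast smoothPart_ne_zero
    have h4 : (∏ b : S, (f (.inr b) : ℝ)) ≠ 0 :=
      prod_ne_zero_iff.2 fun b _ => by have := hf1 (.inr b.1); norm_cast; omega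
    have h5 : Real.log n = Real.log (smoothPart ((n : ℝ) ^ P.ν) n) +
        Real.log (∏ b : S, (f (.inr b) : ℝ)) := by
      rw [← Real.log_mul h3 h4]
      congr 1
      rw [← Nat.cast_prod, ← Nat.cast_mul, h1]
    rw [h5, Real.log_prod fun b _ => prod_ne_zero_iff.1 h4 b (mem_univ b)]
    simp [lg]
  unfold BigCoag CoagLog
  rw [hσ]
  constructor
  · intro h
    refine ⟨S, fun b => by simp [hSdef], ?_⟩
    have := h.reindex e.symm
    convert this using 2 with b
    rw [← he, Equiv.apply_symm_apply]
  · rintro ⟨S', hS', h⟩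
    have hSS : S' = S := by
      ext b
      rw [hS', hSdef, mem_filter]
      simp
    subst hSS
    have := h.reindex e
    convert this using 2 with b
    exact (he b).symm

/-! ### Divisor sums over coagulations as sums over factorizations `n = d e k` -/

open Classical in
/-- The sum of `h` over the divisors of `n`, for integers `n` whose vector of prime factors is a
coagulation with large components. -/
def coagSum (P : Params) (h : VecFun) (n : ℕ) : ℝ :=
  if (∀ p ∈ n.primeFactors, (n : ℝ) ^ P.ν ≤ (p : ℕ)) ∧
      HasCoag P 0 (logList (Real.log n) n).get then
    ∑ d ∈ n.divisors, onList h (logList (Real.log n) d)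
  else 0

open Classical in
/-- The weight of a factorization `n = d e k`. -/
def tripleWt (P : Params) (h : VecFun) (ℓ : ℝ) (d e : ℕ) : ℝ :=
  if Real.log d + Real.log e ≤ P.γ * ℓ then detWt h P.ν ℓ d * moebWt P.ν ℓ e else 0

open Classical in
/-- The logarithmic form of `tripleWt`. -/
def coreLog (P : Params) (h : VecFun) (ℓ a : ℝ) {T : ℕ} (u : Fin T → ℝ) (a' : ℝ) (u' : Fin T → ℝ) :
    ℝ :=
  if a + ∑ t, u t + (a' + ∑ t, u' t) ≤ P.γ * ℓ then detLog h P.ν ℓ a u * moebLog P.ν ℓ u' else 0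

theorem sum_logList {d : ℕ} (hd : d ≠ 0) (ℓ : ℝ) :
    ∑ i, (logList ℓ d).get i = Real.log d / ℓ := by
  have h : ∀ l : List ℕ, (∀ p ∈ l, p ≠ 0) →
      (l.map fun p : ℕ => Real.log p / ℓ).sum = Real.log (l.prod : ℕ) / ℓ := by
    intro l
    induction l with
    | nil => simp
    | cons p l ih =>
      intro hl
      have h1 : (p : ℝ) ≠ 0 := by exact_mod_cast hl p (by simp)
      have h2 : ((l.prod : ℕ) : ℝ) ≠ 0 := by
        exact_mod_cast List.prod_ne_zero fun h0 => hl 0 (by simp [h0]) rfl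
      rw [List.map_cons, List.sum_cons, ih fun q hq => hl q (by simp [hq]), List.prod_cons,
        Nat.cast_mul, Real.log_mul h1 h2, add_div]
  rw [← List.sum_ofFn, List.ofFn_get, logList,
    h _ fun p hp => (Nat.prime_of_mem_primeFactorsList hp).ne_zero, Nat.prod_primeFactorsList hd]

theorem abs_detLog_le {h : VecFun} (h1 : ∀ k x, |h k x| ≤ 1) (ν ℓ a : ℝ) {T : ℕ} (u : Fin T → ℝ) :
    |detLog h ν ℓ a u| ≤ 1 := by
  classical
  unfold detLog
  split_ifs
  · by_cases hj : #{t | u t ≠ 0} < T + 1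
    · rw [sum_eq_single ⟨_, hj⟩ (fun j _ hj' => if_neg fun h2 => hj' (Fin.ext h2.symm))
        (by simp), if_pos (by rfl)]
      exact h1 _ _
    · rw [sum_eq_zero fun j _ => if_neg fun h2 => hj (by rw [h2]; exact j.2)]
      simp
  · simp
  · simp

theorem abs_moebLog_le (ν ℓ : ℝ) {T : ℕ} (u : Fin T → ℝ) : |moebLog ν ℓ u| ≤ 1 := by
  unfold moebLog
  split_ifs
  · simp
  · simp

theorem abs_coreLog_le {P : Params} {h : VecFun} (h1 : ∀ k x, |h k x| ≤ 1) (ℓ a a' : ℝ) {T : ℕ}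
    (u u' : Fin T → ℝ) : |coreLog P h ℓ a u a' u'| ≤ 1 := by
  unfold coreLog
  split_ifs
  · rw [abs_mul]
    exact mul_le_one₀ (abs_detLog_le h1 _ _ _ _) (abs_nonneg _) (abs_moebLog_le _ _ _)
  · simp

theorem semilin_coreLog {P : Params} {h : VecFun} (hh : ∀ k, Semilin (h k)) {I : Type*} [Fintype I]
    {T : ℕ} {ℓ a a' : (I → ℝ) → ℝ} {u u' : (I → ℝ) → Fin T → ℝ} (hℓ : IsAff ℓ) (ha : IsAff a)
    (ha' : IsAff a') (hu : ∀ t, IsAff fun L => u L t) (hu' : ∀ t, IsAff fun L => u' L t) :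
    Semilin fun L => coreLog P h (ℓ L) (a L) (u L) (a' L) (u' L) := by
  classical
  have h1 : Semilin fun L => a L + ∑ t, u L t + (a' L + ∑ t, u' L t) ≤ P.γ * ℓ L :=
    Semilin.le ((ha.add (IsAff.sum _ fun t _ => hu t)).add (ha'.add (IsAff.sum _ fun t _ => hu' t)))
      (hℓ.mulc _)
  unfold coreLog
  convert h1.map₂ ((semilin_detLog hh P.ν hℓ ha hu).map₂ (semilin_moebLog P.ν hℓ hu')
    fun r r' => r * r') fun (q : Prop) (r : ℝ) => if q then r else 0

theorem tripleWt_expand {P : Params} (h : VecFun) {T s s' : ℕ} {p p' : Fin T → ℕ} {z ℓ : ℝ}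
    (hs : s ≠ 0) (hsz : ∀ q ∈ s.primeFactors, (q : ℝ) < z)
    (hp : ∀ t, p t = 1 ∨ (p t).Prime ∧ z ≤ p t) (hpad : Padded p)
    (hs' : s' ≠ 0) (hsz' : ∀ q ∈ s'.primeFactors, (q : ℝ) < z)
    (hp' : ∀ t, p' t = 1 ∨ (p' t).Prime ∧ z ≤ p' t)
    (hzℓ : Real.log z ≤ P.ν * ℓ) (hℓ : 0 < ℓ) (hℓ' : 0 < P.ν * ℓ) :
    tripleWt P h ℓ (s * ∏ t, p t) (s' * ∏ t, p' t) = smoothWt z true s' *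
      coreLog P h ℓ (Real.log s) (fun t => Real.log (p t)) (Real.log s')
        fun t => Real.log (p' t) := by
  have hlog : ∀ {s : ℕ} {p : Fin T → ℕ}, s ≠ 0 → (∀ t, p t = 1 ∨ (p t).Prime ∧ z ≤ p t) →
      Real.log ((s * ∏ t, p t : ℕ) : ℝ) = Real.log s + ∑ t, Real.log (p t) := fun {s p} hs hp => by
    have h1 : ∀ t, (p t : ℝ) ≠ 0 := fun t => by
      rcases hp t with h | h
      · simp [h]
      · exact_mod_cast h.1.ne_zero
    push_cast
    rw [Real.log_mul (by exact_mod_cast hs) (prod_ne_zero_iff.2 fun t _ => h1 t),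
      Real.log_prod fun t _ => h1 t]
  unfold tripleWt coreLog
  rw [hlog hs hp, hlog hs' hp', detWt_expand h hs hsz hp hpad hzℓ hℓ,
    moebWt_expand hs' hsz' hp' hzℓ hℓ']
  split_ifs
  · ring
  · rw [mul_zero]

open Classical in
theorem sum_triples {N n : ℕ} (hn : n ≠ 0) (hnN : n ≤ N) (G : ℕ → ℕ → ℝ) :
    ∑ f ∈ box (Unit ⊕ Bool) N with ∏ i, f i = n, G (f (.inr true)) (f (.inr false)) =
      ∑ d ∈ n.divisors, ∑ e ∈ (n / d).divisors, G d e := by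
  have hprod : ∀ f : Unit ⊕ Bool → ℕ,
      ∏ i, f i = f (.inl ()) * (f (.inr true) * f (.inr false)) := fun f => by
    rw [Fintype.prod_sum_type, Fintype.prod_bool]
    simp
  rw [Finset.sum_sigma']
  refine sum_bij' (fun f _ => ⟨f (.inr true), f (.inr false)⟩)
    (fun r _ => Sum.elim (fun _ => n / r.1 / r.2) fun b => if b then r.1 else r.2) ?_ ?_ ?_ ?_ ?_
  · intro f hf
    rw [mem_filter, hprod] at hf
    obtain ⟨hf1, hf2⟩ := hf
    have h1 := (mem_box.1 hf1 (.inr true)).1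
    simp only [mem_sigma, Nat.mem_divisors]
    have h2 : n / f (.inr true) = f (.inl ()) * f (.inr false) := by
      rw [← hf2, mul_left_comm, Nat.mul_div_cancel_left _ (by omega)]
    rw [h2]
    have h3 := (mem_box.1 hf1 (.inr false)).1
    have h4 := (mem_box.1 hf1 (.inl ())).1
    refine ⟨⟨⟨f (.inl ()) * f (.inr false), by rw [← hf2]; ring⟩, hn⟩, ⟨_, mul_comm _ _⟩, ?_⟩
    exact mul_ne_zero (by omega) (by omega)
  · rintro ⟨d, e⟩ hr
    simp only [mem_sigma, Nat.mem_divisors] at hr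
    have h1 : n / d / e * (d * e) = n := by
      rw [mul_comm d e, ← mul_assoc, Nat.div_mul_cancel hr.2.1, Nat.div_mul_cancel hr.1.1]
    have h2 : ∏ i, (Sum.elim (fun _ => n / d / e) fun b => if b then d else e : Unit ⊕ Bool → ℕ) i =
        n := by
      rw [hprod]
      simpa using h1
    rw [mem_filter]
    refine ⟨mem_box_of_prod_le ?_ (h2.trans_le hnN), h2⟩
    rintro (_ | _ | _)
    · refine Nat.one_le_iff_ne_zero.2 fun h0 => hn ?_
      simp only [Sum.elim_inl] at h0
      rw [← h1, h0, zero_mul]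
    · exact Nat.one_le_iff_ne_zero.2 fun h0 => hn (by
        simp only [Sum.elim_inr] at h0
        rw [← h1, show e = 0 by simpa using h0, mul_zero, mul_zero])
    · exact Nat.one_le_iff_ne_zero.2 fun h0 => hn (by
        simp only [Sum.elim_inr] at h0
        rw [← h1, show d = 0 by simpa using h0, zero_mul, mul_zero])
  · intro f hf
    rw [mem_filter, hprod] at hf
    obtain ⟨hf1, hf2⟩ := hf
    have h1 := (mem_box.1 hf1 (.inr true)).1
    have h3 := (mem_box.1 hf1 (.inr false)).1
    funext i
    rcases i with _ | _ | _
    · simp only [Sum.elim_inl]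
      rw [← hf2, Nat.div_div_eq_div_mul, Nat.mul_div_cancel _ (Nat.mul_pos (by omega) (by omega))]
    · simp
    · simp
  · rintro ⟨d, e⟩ _
    simp
  · intro f _
    rfl

section
variable {P : Params} {n : ℕ}

theorem logList_sublist {z : ℝ} {d : ℕ} (hn : n ≠ 0) (hd : d ∣ n)
    (hr : ∀ p ∈ d.primeFactors, z ≤ (p : ℕ)) (ℓ : ℝ) :
    (logList ℓ d).Sublist ((roughList z n).map fun p : ℕ => Real.log p / ℓ) := by
  refine List.Sublist.map _ ?_
  have h1 := (Nat.primeFactorsList_sublist_of_dvd hd hn).filter fun p : ℕ => decide (z ≤ (p : ℝ))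
  rwa [List.filter_eq_self.2 fun p hp => by
    simpa using hr p (by simpa using hp)] at h1

theorem HasCoag.subCoag_of_sublist {l l' : List ℝ} (hl : l.Sublist l') {σ : ℝ}
    (h : HasCoag P σ l'.get) : SubCoag P σ l.get := by
  classical
  obtain ⟨g, hg⟩ := List.sublist_iff_exists_fin_orderEmbedding_get_eq.1 hl
  have hiff : ∀ i j, (some (if h : ∃ j, g j = i then some h.choose else none) :
      Option (Option (Fin l.length))) = some (some j) ↔ i = g j := fun i j => by
    rw [Option.some.injEq]
    constructor
    · intro h1
      split_ifs at h1 with h2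
      rw [← Option.some.inj h1]
      exact h2.choose_spec.symm
    · rintro rfl
      have h2 : ∃ j', g j' = g j := ⟨j, rfl⟩
      rw [dif_pos h2, g.injective h2.choose_spec]
  refine h.restrict (fun i => some (if h : ∃ j, g j = i then some h.choose else none))
    (fun i hi => by cases hi) ?_ (fun j => ?_) fun j => ?_
  · simp
  · simp only [hiff]
    rw [sum_filter, sum_ite_eq' univ, if_pos (mem_univ _), hg]
  · rw [hg]
    exact h.1 _

theorem rpow_le_iff (hn : 1 < n) {p : ℕ} (hp : p.Prime) (ν : ℝ) :
    (n : ℝ) ^ ν ≤ p ↔ ν * Real.log n ≤ Real.log p := by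
  have hn0 : (0 : ℝ) < n := by exact_mod_cast zero_lt_one.trans hn
  have hp0 : (0 : ℝ) < p := by exact_mod_cast hp.pos
  rw [← Real.log_rpow hn0, Real.log_le_log_iff (by positivity) hp0]

/-- Divisors with vector in `𝒢₁` are small, even when multiplied by the smooth part. -/
theorem BigCoag.log_add_le (hB : BigCoag P n) (hn : 1 < n) {d : ℕ} (hd : d ∣ n)
    (hr : ∀ p ∈ d.primeFactors, P.ν * Real.log n ≤ Real.log (p : ℕ))
    (hG : (logList (Real.log n) d).get ∈ regionG1 P (logList (Real.log n) d).length) :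
    Real.log d + Real.log (smoothPart ((n : ℝ) ^ P.ν) n) ≤ P.γ * Real.log n := by
  have hn0 : n ≠ 0 := by omega
  have hd0 : d ≠ 0 := fun h0 => hn0 (Nat.eq_zero_of_zero_dvd (h0 ▸ hd))
  have hlog : 0 < Real.log n := Real.log_pos (by exact_mod_cast hn)
  have h1 := HasCoag.subCoag_of_sublist (logList_sublist hn0 hd (fun p hp =>
    (rpow_le_iff hn (Nat.prime_of_mem_primeFactors hp) P.ν).2 (hr p hp)) (Real.log n)) hB
  have h2 := (mem_regionG1_iff.1 hG).2.2 _ h1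
  rw [sum_logList hd0, ← add_div, div_le_iff₀ hlog] at h2
  exact h2

theorem bigCoag_iff_of_rough (hn : 1 < n) (hr : ∀ p ∈ n.primeFactors, (n : ℝ) ^ P.ν ≤ (p : ℕ)) :
    BigCoag P n ↔ HasCoag P 0 (logList (Real.log n) n).get := by
  have hn0 : n ≠ 0 := by omega
  have h1 : smoothPart ((n : ℝ) ^ P.ν) n = 1 := (smoothPart_eq_one_iff hn0).2 hr
  have h2 : roughList ((n : ℝ) ^ P.ν) n = n.primeFactorsList :=
    List.filter_eq_self.2 fun p hp => by simpa using hr p (by simpa using hp)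
  unfold BigCoag logList
  rw [h1, h2, Nat.cast_one, Real.log_one, zero_div]

-- For a coagulation `n` and a divisor `d` in the support of `h`, the product of `d` with the whole
-- smooth part of `n` is at most `n ^ γ`. Hence the truncation in `tripleWt` never excludes a smooth
-- `e`, and the sum over `e` is the full sieve for `n / d`. As `d` has only large primes, `n / d` is
-- free of small primes if and only if `n` is.
open Classical in
theorem sum_tripleWt {h : VecFun} (hG : ∀ k x, h k x ≠ 0 → x ∈ regionG1 P k) (hn : 1 < n) {N : ℕ}
    (hnN : n ≤ N) :
    (∑ f ∈ box (Unit ⊕ Bool) N with ∏ i, f i = n,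
      tripleWt P h (Real.log n) (f (.inr true)) (f (.inr false))) *
        (if BigCoag P n then 1 else 0) = coagSum P h n := by
  have hn0 : n ≠ 0 := by omega
  have hlog : 0 < Real.log n := Real.log_pos (by exact_mod_cast hn)
  set z := (n : ℝ) ^ P.ν with hz
  have hr_iff : ∀ m : ℕ, (∀ p ∈ m.primeFactors, z ≤ (p : ℕ)) ↔
      ∀ p ∈ m.primeFactors, P.ν * Real.log n ≤ Real.log (p : ℕ) := fun m =>
    forall₂_congr fun p hp => rpow_le_iff hn (Nat.prime_of_mem_primeFactors hp) P.ν
  by_cases hB : BigCoag P n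
  · rw [if_pos hB, mul_one, sum_triples hn0 hnN]
    have hinner : ∀ d ∈ n.divisors, ∑ e ∈ (n / d).divisors, tripleWt P h (Real.log n) d e =
        detWt h P.ν (Real.log n) d * roughWt z (n / d) := fun d hd => by
      rw [Nat.mem_divisors] at hd
      have hnd : n / d ≠ 0 := by
        rw [Ne, Nat.div_eq_zero_iff, not_or, not_lt]
        exact ⟨fun h0 => hn0 (Nat.eq_zero_of_zero_dvd (h0 ▸ hd.1)),
          Nat.le_of_dvd (by omega) hd.1⟩
      by_cases h0 : detWt h P.ν (Real.log n) d = 0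
      · rw [h0, zero_mul]
        refine sum_eq_zero fun e _ => ?_
        unfold tripleWt
        rw [h0, zero_mul, ite_self]
      · have hr : ∀ p ∈ d.primeFactors, P.ν * Real.log n ≤ Real.log (p : ℕ) := by
          by_contra hr
          exact h0 (if_neg hr)
        have h2 : onList h (logList (Real.log n) d) ≠ 0 := by
          unfold detWt at h0
          rwa [if_pos hr] at h0
        have h3 := hB.log_add_le hn hd.1 hr (hG _ _ h2)
        rw [← sum_smoothWt hnd, mul_sum]
        refine sum_congr rfl fun e he => ?_
        rw [Nat.mem_divisors] at he
        have he0 : e ≠ 0 := fun h0 => he.2 (Nat.eq_zero_of_zero_dvd (h0 ▸ he.1))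
        have h4 : moebWt P.ν (Real.log n) e = smoothWt z true e := by
          unfold moebWt smoothWt
          have : (∀ p ∈ e.primeFactors, Real.log (p : ℕ) < P.ν * Real.log n) ↔
              ∀ p ∈ e.primeFactors, ((p : ℕ) : ℝ) < z := forall₂_congr fun p hp => by
            rw [← not_le, ← not_le, rpow_le_iff hn (Nat.prime_of_mem_primeFactors hp)]
          simp only [this, if_true]
        unfold tripleWt
        rw [h4]
        split_ifs with h5
        · rfl
        · by_cases h6 : smoothWt z true e = 0
          · rw [h6, mul_zero]
          · exfalso
            apply h5
            have h7 : e ∣ smoothPart z n := (dvd_smoothPart_iff hn0).2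
              ⟨he.1.trans (Nat.div_dvd_of_dvd hd.1), lt_of_smoothWt_ne_zero h6⟩
            have h8 : Real.log e ≤ Real.log (smoothPart z n) :=
              Real.log_le_log (by exact_mod_cast Nat.pos_of_ne_zero he0)
                (by exact_mod_cast Nat.le_of_dvd (Nat.pos_of_ne_zero smoothPart_ne_zero) h7)
            linarith
    rw [sum_congr rfl hinner]
    unfold coagSum
    by_cases hr : ∀ p ∈ n.primeFactors, z ≤ (p : ℕ)
    · rw [if_pos ⟨hr, (bigCoag_iff_of_rough hn hr).1 hB⟩]
      refine sum_congr rfl fun d hd => ?_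
      rw [Nat.mem_divisors] at hd
      have h1 : ∀ m, m ∣ n → ∀ p ∈ m.primeFactors, z ≤ (p : ℕ) := fun m hm p hp =>
        hr p (Nat.primeFactors_mono hm hn0 hp)
      unfold detWt roughWt
      rw [if_pos ((hr_iff d).1 (h1 d hd.1)), if_pos (h1 _ (Nat.div_dvd_of_dvd hd.1)), mul_one]
    · rw [if_neg fun h1 => hr h1.1]
      refine sum_eq_zero fun d hd => ?_
      rw [Nat.mem_divisors] at hd
      by_cases h1 : ∀ p ∈ d.primeFactors, P.ν * Real.log n ≤ Real.log (p : ℕ)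
      · unfold roughWt
        rw [if_neg, mul_zero]
        intro h2
        apply hr
        intro p hp
        have hp' := Nat.prime_of_mem_primeFactors hp
        have h3 : p ∣ d * (n / d) := by
          rw [Nat.mul_div_cancel' hd.1]; exact Nat.dvd_of_mem_primeFactors hp
        have h4 : d * (n / d) ≠ 0 := by rwa [Nat.mul_div_cancel' hd.1]
        rcases hp'.dvd_mul.1 h3 with h5 | h5
        · exact (hr_iff d).2 h1 p (Nat.mem_primeFactors.2 ⟨hp', h5, left_ne_zero_of_mul h4⟩)
        · exact h2 p (Nat.mem_primeFactors.2 ⟨hp', h5, right_ne_zero_of_mul h4⟩)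
      · unfold detWt
        rw [if_neg h1, zero_mul]
  · rw [if_neg hB, mul_zero, coagSum, if_neg]
    rintro ⟨h1, h2⟩
    exact hB ((bigCoag_iff_of_rough hn h1).2 h2)

end

theorem tupleSum_reindex {I J : Type*} [Fintype I] [Fintype J] (e : I ≃ J) (N : ℕ) (w : ℕ → ℝ)
    (W : (I → ℕ) → ℝ) : tupleSum N w W = tupleSum N w fun f : J → ℕ => W fun i => f (e i) := by
  unfold tupleSum
  refine sum_equiv (Equiv.arrowCongr e (Equiv.refl ℕ)) (fun f => ?_) fun f _ => ?_
  · simp only [mem_box, Equiv.arrowCongr_apply]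
    exact ⟨fun h j => h _, fun h i => by simpa using h (e i)⟩
  · have h1 : (fun i => (Equiv.arrowCongr e (Equiv.refl ℕ) f) (e i)) = f := by
      funext i
      simp
    dsimp only
    rw [h1]
    congr 2
    exact (Equiv.prod_comp e.symm f).symm

open Classical in
theorem tupleSum_eq_sum {I : Type*} [Fintype I] {N : ℕ} {w : ℕ → ℝ} (hw : ∀ n, w n ≠ 0 → n ≤ N)
    (W : (I → ℕ) → ℝ) :
    tupleSum N w W = ∑ n ∈ Icc 1 N, w n * ∑ f ∈ box I N with ∏ i, f i = n, W f := by
  have h1 : ∀ n ∈ Icc 1 N, w n * ∑ f ∈ box I N with ∏ i, f i = n, W f =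
      ∑ f ∈ box I N with ∏ i, f i = n, W f * w (∏ i, f i) := fun n _ => by
    rw [mul_sum]
    refine sum_congr rfl fun f hf => ?_
    rw [(mem_filter.1 hf).2, mul_comm]
  rw [sum_congr rfl h1, tupleSum]
  have h2 : ∀ f ∈ box I N, ∏ i, f i ∉ Icc 1 N → W f * w (∏ i, f i) = 0 := fun f hf hn => by
    by_contra h0
    exact hn (mem_Icc.2 ⟨Finset.one_le_prod' fun i _ => (mem_box.1 hf i).1,
      hw _ (right_ne_zero_of_mul h0)⟩)
  rw [← sum_filter_add_sum_filter_not (box I N) fun f => ∏ i, f i ∈ Icc 1 N,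
    sum_eq_zero (s := (box I N).filter fun f => ∏ i, f i ∉ Icc 1 N) (fun f hf =>
      h2 f (mem_filter.1 hf).1 (mem_filter.1 hf).2), add_zero]
  refine (sum_fiberwise_of_maps_to (t := Icc 1 N) (g := fun f : I → ℕ => ∏ i, f i) (fun f hf =>
      (mem_filter.1 hf).2) _).symm.trans ?_
  refine sum_congr rfl fun n hn => sum_congr ?_ fun _ _ => rfl
  ext f
  simp only [mem_filter]
  exact ⟨fun h => ⟨h.1.1, h.2⟩, fun h => ⟨⟨h.1, by rw [h.2]; exact hn⟩, h.2⟩⟩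

theorem sum_extendZero {Y K : Type*} [Fintype Y] [Fintype K] (S : Finset K) (L : Y ⊕ S → ℝ) :
    ∑ i, extendZero S L i = ∑ i, L i := by
  classical
  rw [Fintype.sum_sum_type, Fintype.sum_sum_type]
  congr 1
  rw [← sum_subset (subset_univ S), ← sum_coe_sort S]
  · exact sum_congr rfl fun b _ => by simp [extendZero]
  · intro k _ hk
    simp [extendZero, hk]

-- Components below `ν ℓ` may be dissolved into the small part, so a coagulation in all the primes
-- is also one in the large primes only.
open Classical in
theorem HasCoag.coagLog {P : Params} {K : Type*} [Fintype K] {S : Finset K} {M : K → ℝ} {ℓ σ : ℝ}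
    (hc : HasCoag P σ fun b : S => M b / ℓ) (hℓ : 0 < ℓ) (hS : ∀ b, b ∉ S → M b < P.ν * ℓ) :
    CoagLog P ℓ M := by
  set S' : Finset K := {b | P.ν * ℓ ≤ M b} with hS'
  have hmem : ∀ b, b ∈ S' ↔ P.ν * ℓ ≤ M b := fun b => by simp [hS']
  have hsub : ∀ b, b ∈ S' → b ∈ S := fun b hb => by
    by_contra h
    exact absurd ((hmem b).1 hb) (not_le.2 (hS b h))
  have h1 := hc.coarsen (κ' := S') (y := fun b => M b / ℓ)
    (fun b => if h : b.1 ∈ S' then some ⟨b.1, h⟩ else none) (fun b hb => ?_)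
    (fun b => hc.1 ⟨b.1, hsub _ b.2⟩) rfl fun b => ?_
  · refine ⟨S', hmem, ?_⟩
    have h2 := h1.total
    have h3 : (ℓ - ∑ b : S', M b) / ℓ = 1 - ∑ b : S', M b / ℓ := by
      rw [sub_div, div_self hℓ.ne', sum_div]
    rw [h3, ← h2, add_sub_cancel_right]
    exact h1
  · split_ifs at hb with h
    rw [hmem, not_le] at h
    rwa [div_lt_iff₀ hℓ]
  · have hiff : ∀ b' : S, ((if h : b'.1 ∈ S' then some ⟨b'.1, h⟩ else none : Option S') = some b) ↔
        b' = ⟨b.1, hsub _ b.2⟩ := fun b' => by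
      constructor
      · intro hb
        split_ifs at hb with hb'
        exact Subtype.ext (congrArg (fun c : S' => c.1) (Option.some.inj hb))
      · rintro rfl
        rw [dif_pos b.2]
    simp only [hiff]
    rw [sum_filter, sum_ite_eq' univ, if_pos (mem_univ _)]

open Classical in
/-- The sums of divisor functions of integers whose vector is not a coagulation are small; therefore
the sums over coagulations are evaluated by Type I sums. -/
theorem exists_bound_coagSum {P : Params} (hP : P.Good) {h : VecFun} (hh : ∀ k, Semilin (h k))
    (h1 : ∀ k x, |h k x| ≤ 1) (hG : ∀ k x, h k x ≠ 0 → x ∈ regionG1 P k) :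
    ∃ A : ℕ, ∀ (B x : ℝ) (w : ℕ → ℝ), Balanced P B x w → A ≤ B →
      |∑ n ∈ Icc 1 ⌊x⌋₊, w n * coagSum P h n| ≤ errBd A B x := by
  let T := maxPrimes P
  -- The unit stands for the factor `k`, `true` for `d` and `false` for `e`. In `J₁` only `d` and
  -- `e` are factored into smooth numbers and primes, while `k` stays free; in `J₂` all three are.
  let I := Unit ⊕ Bool
  let J₁ := I ⊕ (Bool × Fin T)
  let J₂ := (Empty ⊕ I) ⊕ (I × Fin T)
  let Ω₁ : (J₁ → ℝ) → ℝ := fun L =>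
    (fun (q : Prop) (r : ℝ) => if q then r else 0)
      ((0 < ∑ i, L i) ∧ PaddedLog fun b => L (.inr b))
      (coreLog P h (∑ i, L i) (L (.inl (.inr true))) (fun t => L (.inr (true, t)))
        (L (.inl (.inr false))) fun t => L (.inr (false, t)))
  let Ω₂ : (J₂ → ℝ) → ℝ := fun L =>
    (fun (q : Prop) (r : ℝ) => if q then r else 0)
      (((0 < ∑ i, L i) ∧ PaddedLog fun b => L (.inr b)) ∧
        ¬ (0 < ∑ i, L i ∧ CoagLog P (∑ i, L i) fun b => L (.inr b)))
      (coreLog P h (∑ i, L i) (L (.inl (.inr (.inr true))))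
        (fun t => L (.inr (.inr true, t))) (L (.inl (.inr (.inr false))))
        fun t => L (.inr (.inr false, t)))
  have hpadS : ∀ {J K : Type} [Fintype J] [Fintype K] (e : (J → ℝ) → K × Fin T → ℝ),
      (∀ b, IsAff fun L => e L b) → Semilin fun L => PaddedLog (e L) := fun e he => by
    obtain ⟨N, hN⟩ := unif_paddedLog (π := Unit) e he
    exact ⟨N, hN ()⟩
  have hsumA : ∀ {J : Type} [Fintype J], IsAff fun L : J → ℝ => ∑ i, L i := fun {J} _ =>
    IsAff.sum _ fun i _ => IsAff.coord i
  have hΩ₁ : Semilin Ω₁ := ((Semilin.lt (IsAff.const 0) hsumA).and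
    (hpadS (fun L b => L (Sum.inr b)) fun b => IsAff.coord _)).map₂
    (semilin_coreLog hh hsumA (IsAff.coord _) (IsAff.coord _) (fun _ => IsAff.coord _)
      fun _ => IsAff.coord _) fun (q : Prop) (r : ℝ) => if q then r else 0
  have hΩ₂ : Semilin Ω₂ := (((Semilin.lt (IsAff.const 0) hsumA).and
    (hpadS (fun L b => L (Sum.inr b)) fun b => IsAff.coord _)).and
    ((semilin_coagLog hP hsumA fun b => IsAff.coord (Sum.inr b)).map Not)).map₂
    (semilin_coreLog hh hsumA (IsAff.coord _) (IsAff.coord _) (fun _ => IsAff.coord _)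
      fun _ => IsAff.coord _) fun (q : Prop) (r : ℝ) => if q then r else 0
  have hΩ₁1 : ∀ v, |Ω₁ v| ≤ 1 := fun v => by
    simp only [Ω₁]
    split_ifs
    · exact abs_coreLog_le h1 _ _ _ _ _
    · simp
  have hΩ₂1 : ∀ v, |Ω₂ v| ≤ 1 := fun v => by
    simp only [Ω₂]
    split_ifs
    · exact abs_coreLog_le h1 _ _ _ _ _
    · simp
  obtain ⟨K₁, hK₁⟩ := hΩ₁
  obtain ⟨K₂, hK₂⟩ := hΩ₂
  -- With the induction parameter `T = maxPrimes P` the hypothesis on the number of primes is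
  -- trivial.
  choose AS hAS using fun S : Finset (I × Fin T) =>
    exists_bound_primes P T (Empty ⊕ I) S K₂ (by omega)
  refine ⟨3 ^ K₁ + Fintype.card J₁ + ∑ S, AS S, fun B x w hw hB => ?_⟩
  have hx8 := hw.eight_le
  push_cast at hB
  have hS0 : ∀ S, (AS S : ℝ) ≤ ∑ S, (AS S : ℝ) := fun S =>
    single_le_sum (f := fun S => (AS S : ℝ)) (fun _ _ => by positivity) (mem_univ S)
  have h3K : (0 : ℝ) ≤ 3 ^ K₁ := by positivity
  have hcJ : (0 : ℝ) ≤ Fintype.card J₁ := by positivity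
  have hSS : (0 : ℝ) ≤ ∑ S, (AS S : ℝ) := sum_nonneg fun _ _ => by positivity
  set N := ⌊x⌋₊ with hN
  set z := (x / 2) ^ P.ν with hz
  have hz1 : 1 ≤ z := one_le_rpow_nu hP hx8
  have hwN : ∀ n, w n ≠ 0 → 1 < n ∧ n ≤ N ∧ Real.log z ≤ P.ν * Real.log n ∧ z ≤ (n : ℝ) ^ P.ν ∧
      0 < Real.log n := fun n hn => by
    have h2 := hw.supp n hn
    have h3 : (1 : ℝ) < n := by linarith [h2.1]
    refine ⟨by exact_mod_cast h3, hw.le_floor n hn, ?_,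
      Real.rpow_le_rpow (by linarith) h2.1.le hP.ν_pos.le, Real.log_pos h3⟩
    rw [hz, Real.log_rpow (by linarith)]
    exact mul_le_mul_of_nonneg_left (Real.log_le_log (by linarith) h2.1.le) hP.ν_pos.le
  have hrough : ∀ n, n ≠ 0 → n ≤ N → (roughList z n).length ≤ T := fun n hn hnN =>
    (roughList_length_lt hP hx8 hn ((Nat.le_floor_iff (by linarith)).1 hnN)).le
  let W : (I → ℕ) → ℝ := fun f =>
    tripleWt P h (Real.log ((∏ i, f i : ℕ) : ℝ)) (f (.inr true)) (f (.inr false))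
  let W' : (I → ℕ) → ℝ := fun f => W f * if BigCoag P (∏ i, f i) then 0 else 1
  -- The sum over coagulations is the sum over all `n` minus the sum over the `n` that are none: a
  -- Type I sum and a sum that `exists_bound_primes` bounds.
  have hmain : ∑ n ∈ Icc 1 N, w n * coagSum P h n = tupleSum N w W - tupleSum N w W' := by
    rw [tupleSum_eq_sum fun n hn => (hwN n hn).2.1, tupleSum_eq_sum fun n hn => (hwN n hn).2.1,
      ← sum_sub_distrib]
    refine sum_congr rfl fun n hn => ?_
    by_cases hwn : w n = 0
    · simp [hwn]
    · rw [← sum_tripleWt hG (hwN n hwn).1 (mem_Icc.1 hn).2, ← mul_sub, ← sum_sub_distrib, sum_mul]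
      congr 1
      refine sum_congr rfl fun f hf => ?_
      simp only [W', W, (mem_filter.1 hf).2]
      split_ifs <;> ring
  have hfalse : ∀ {z : ℝ} {n : ℕ}, smoothWt z false n = 0 → smoothWt z true n = 0 :=
    fun {z n} h0 => by
      by_contra h2
      have h3 := lt_of_smoothWt_ne_zero h2
      rw [show smoothWt z false n = 1 from if_pos h3] at h0
      exact one_ne_zero h0
  have hT1 : |tupleSum N w W| ≤ 3 ^ K₁ * (x / Real.log x ^ B) := by
    rw [show tupleSum N w W = _ from
      tupleSum_expand (z := z) (T := T) (fun n hn => (hwN n hn).2.1) hrough W]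
    let V : (J₁ → ℕ) → ℝ := fun f => (∏ q, smoothWt z false (f (.inl (.inr q)))) *
      (∏ b, primeOneWt z (f (.inr b))) * smoothWt z true (f (.inl (.inr false)))
    have hV1 : ∀ f, |V f| ≤ 1 := fun f => by
      simp only [V]
      rw [abs_mul, abs_mul]
      refine mul_le_one₀ (mul_le_one₀ ?_ (abs_nonneg _) ?_) (abs_nonneg _) (abs_smoothWt_le _ _ _)
      · exact abs_prod_le_one _ fun i => abs_smoothWt_le _ _ _
      · exact abs_prod_le_one _ fun i => abs_primeOneWt_le _ _
    have hVu : ∀ f k, V (Function.update f (.inl (.inl ())) k) = V f := fun f k => by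
      have hu : ∀ b, Function.update f (.inl (.inl ())) k (.inl (.inr b)) =
          f (.inl (.inr b)) := fun b =>
        Function.update_of_ne (fun h0 => Sum.inr_ne_inl (Sum.inl.inj h0)) _ _
      have hu' : ∀ b, Function.update f (.inl (.inl ())) k (.inr b) = f (.inr b) :=
        fun b => Function.update_of_ne Sum.inr_ne_inl _ _
      simp only [V, hu, hu']
    have hlin := hw.linear (I := J₁) (by linarith) (.inl (.inl ())) V hV1 hVu hK₁
      hΩ₁1 fun f hf h2 h3 hwf => ?_
    · refine le_of_eq_of_le (congrArg _ (tupleSum_congr fun f hf hwf => ?_)) hlin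
      have hf1 : ∀ i, 1 ≤ f i := fun i => (mem_box.1 hf i).1
      obtain ⟨hn1, hn2, hn3, hn4, hn5⟩ := hwN _ hwf
      rw [prod_padWt fun b => hf1 (.inr b)]
      by_cases h2 : (∏ q, smoothWt z false (f (.inl (.inr q)))) = 0
      · simp only [V, h2]
        ring
      by_cases h3 : (∏ b, primeOneWt z (f (.inr b))) = 0
      · simp only [V, h3]
        ring
      have h4 := fun q => lt_of_smoothWt_ne_zero (prod_ne_zero_iff.1 h2 q (mem_univ q))
      have h5 := fun b => (primeOneWt_eq (prod_ne_zero_iff.1 h3 b (mem_univ b))).1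
      simp only [V, Ω₁]
      rw [sum_lg_univ hf1]
      have h8 : (lg fun b => f (.inr b)) = fun b => lg f (.inr b) := rfl
      rw [h8]
      by_cases h6 : PaddedLog fun b => lg f (.inr b)
      · rw [if_pos h6, if_pos ⟨hn5, h6⟩]
        have h7 := tripleWt_expand h (P := P) (s := f (.inl (.inr true)))
          (s' := f (.inl (.inr false))) (p := fun t => f (.inr (true, t)))
          (p' := fun t => f (.inr (false, t))) (by have := hf1 (.inl (.inr true)); omega)
          (h4 _) (fun t => h5 _) ((padded_iff fun b => hf1 (.inr b)).2 h6 true)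
          (by have := hf1 (.inl (.inr false)); omega) (h4 _) (fun t => h5 _) hn3 hn5
          (mul_pos hP.ν_pos hn5)
        have h9 : W (mulOut f) = tripleWt P h (Real.log ((∏ i, f i : ℕ) : ℝ))
            (f (.inl (.inr true)) * ∏ t, f (.inr (true, t)))
            (f (.inl (.inr false)) * ∏ t, f (.inr (false, t))) := by
          simp only [W]
          rw [prod_mulOut]
          rfl
        rw [h9, h7]
        simp only [lg]
        ring
      · rw [if_neg h6, if_neg fun h => h6 h.2]
        ring
    · have hf1 : ∀ i, 1 ≤ f i := fun i => (mem_box.1 hf i).1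
      obtain ⟨hn1, hn2, hn3, hn4, hn5⟩ := hwN _ hwf
      have h4 : coreLog P h (∑ i, lg f i) (lg f (.inl (.inr true)))
          (fun t => lg f (.inr (true, t))) (lg f (.inl (.inr false)))
          (fun t => lg f (.inr (false, t))) ≠ 0 := fun h0 => h3 (by
        simp only [Ω₁, h0, ite_self])
      have h5 : lg f (.inl (.inr true)) + ∑ t, lg f (.inr (true, t)) +
          (lg f (.inl (.inr false)) + ∑ t, lg f (.inr (false, t))) ≤
          P.γ * ∑ i, lg f i := by
        by_contra h6
        exact h4 (if_neg h6)
      have hp0 : (0 : ℝ) < ((∏ i ∈ univ.erase (.inl (.inl ())), f i : ℕ) : ℝ) := by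
        exact_mod_cast Finset.prod_pos fun i _ => hf1 i
      have hx0 := hw.x_pos
      rw [← Real.log_le_log_iff hp0 (by positivity), Real.log_rpow hx0, ← sum_lg hf1]
      have h6 := add_sum_erase univ (lg f) (mem_univ (.inl (.inl ()) : J₁))
      have h7 : ∑ i, lg f i = lg f (.inl (.inl ())) +
          (lg f (.inl (.inr true)) + ∑ t, lg f (.inr (true, t)) +
          (lg f (.inl (.inr false)) + ∑ t, lg f (.inr (false, t)))) := by
        rw [Fintype.sum_sum_type, Fintype.sum_sum_type, Fintype.sum_prod_type, Fintype.sum_bool,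
          Fintype.sum_bool]
        simp only [univ_unique, PUnit.default_eq_unit, sum_singleton]
        ring
      have h8 : ∑ i, lg f i ≤ Real.log x := by
        rw [sum_lg_univ hf1]
        exact Real.log_le_log (by exact_mod_cast zero_lt_one.trans hn1) (hw.supp _ hwf).2
      have h9 := mul_le_mul_of_nonneg_left h8 hP.γ_pos.le
      linarith
  let ΩS : (S : Finset (I × Fin T)) → ((Empty ⊕ I) ⊕ S → ℝ) → ℝ := fun S L => Ω₂ (extendZero S L)
  -- Only the smooth part of `e` carries the Möbius function.
  let τ : Empty ⊕ I → Bool := fun i => if i = .inr (.inr false) then true else false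
  have hexp : tupleSum N w W' = ∑ S : Finset (I × Fin T), primeTupleSum z x w τ (ΩS S) := by
    rw [tupleSum_reindex (Equiv.emptySum Empty I).symm,
      tupleSum_expand (z := z) (T := T) (fun n hn => (hwN n hn).2.1) hrough]
    have e4 := tupleSum_pad (z := z) (w := w) (N := N) (K := I × Fin T) (Y := Empty ⊕ I)
      (Nat.le_floor (by norm_num; linarith)) fun f =>
      (∏ q, smoothWt z false (f (.inl (.inr q)))) *
        (∏ q, padWt fun t => f (.inr (q, t))) * W' fun i => mulOut f (.inr i)
    refine Eq.trans (tupleSum_congr fun f _ _ => ?_) (e4.trans (sum_congr rfl fun S _ =>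
      tupleSum_congr fun f hf hwf => ?_))
    · simp only [Equiv.emptySum_symm_apply]
      ring
    · have hf1 : ∀ i, 1 ≤ f i := fun i => (mem_box.1 hf i).1
      obtain ⟨hn1, hn2, hn3, hn4, hn5⟩ := hwN _ hwf
      set g : J₂ → ℕ := extendOne S f with hg
      have hgprod : ∏ i, g i = ∏ i, f i := prod_extendOne S f
      rw [← hgprod] at hn1 hn2 hn3 hn4 hn5
      have hg1 : ∀ i, 1 ≤ g i := by
        rintro (y | b)
        · exact hf1 _
        · simp only [hg, extendOne, Sum.elim_inr]
          split_ifs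
          · exact hf1 _
          · exact le_rfl
      have hτ : (∏ i, smoothWt z (τ i) (f (.inl i))) =
          (∏ q, smoothWt z false (g (.inl (.inr q)))) *
            smoothWt z true (g (.inl (.inr (.inr false)))) := by
        have h2 : ∀ i, smoothWt z (τ i) (f (.inl i)) = smoothWt z false (f (.inl i)) *
            if i = .inr (.inr false) then
              smoothWt z true (f (.inl (.inr (.inr false)))) else 1 := fun i => by
          by_cases hi : i = .inr (.inr false)
          · subst hi
            simp only [τ, if_true]
            by_cases h3 : smoothWt z false (f (.inl (.inr (.inr false)))) = 0
            · rw [h3, hfalse h3, zero_mul]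
            · rw [smoothWt_false_eq h3, one_mul]
          · simp [τ, hi]
        rw [prod_congr rfl fun i _ => h2 i, prod_mul_distrib, prod_ite_eq' univ,
          if_pos (mem_univ _), Fintype.prod_sum_type]
        simp only [univ_eq_empty, prod_empty, one_mul]
        rfl
      rw [hτ]
      by_cases h2 : (∏ q, smoothWt z false (g (.inl (.inr q)))) = 0
      · rw [h2]
        ring
      by_cases h3 : (∏ k, primeWt z (f (.inr k))) = 0
      · rw [h3]
        ring
      have h4 := fun q => lt_of_smoothWt_ne_zero (prod_ne_zero_iff.1 h2 q (mem_univ q))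
      have h5 : ∀ b, g (.inr b) = 1 ∨ (g (.inr b)).Prime ∧ z ≤ g (.inr b) := fun b => by
        by_cases hb : b ∈ S
        · have : g (.inr b) = f (.inr ⟨b, hb⟩) := by simp [hg, extendOne, hb]
          rw [this]
          exact Or.inr (primeWt_eq (prod_ne_zero_iff.1 h3 ⟨b, hb⟩ (mem_univ _))).1
        · exact Or.inl (by simp [hg, extendOne, hb])
      have hone : (∏ q, smoothWt z false (g (.inl (.inr q)))) = 1 :=
        prod_eq_one fun q _ => smoothWt_false_eq (prod_ne_zero_iff.1 h2 q (mem_univ q))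
      have hΩg : ΩS S (lg f) = Ω₂ (lg g) := by
        simp only [ΩS]
        rw [← lg_extendOne]
      have hprod' : ∏ i, mulOut g (.inr i) = ∏ i, g i := by
        have h11 := Fintype.prod_sum_type (mulOut g)
        rw [prod_mulOut, univ_eq_empty (α := Empty), prod_empty, one_mul] at h11
        exact h11.symm
      have hcoag := bigCoag_iff hP (f := g) (z := z) hg1 (by
        rintro (e | i)
        · exact e.elim
        · exact h4 i) (fun b => (h5 b).imp_right And.left) hn1 hn4
      rw [hone, prod_padWt fun b => hg1 (.inr b), hΩg]
      simp only [Ω₂]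
      rw [sum_lg_univ hg1]
      have h8 : (lg fun b => g (.inr b)) = fun b => lg g (.inr b) := rfl
      rw [h8]
      simp only [W']
      rw [hprod', hcoag]
      by_cases h6 : PaddedLog fun b => lg g (.inr b)
      · by_cases h10 : CoagLog P (Real.log ((∏ i, g i : ℕ) : ℝ)) fun b => lg g (.inr b)
        · rw [if_pos h10, mul_zero, mul_zero, mul_zero]
          exact (mul_eq_zero_of_right _ (if_neg fun h => h.2 ⟨hn5, h10⟩)).symm
        · rw [if_pos h6, if_neg h10, if_pos ⟨⟨hn5, h6⟩, fun h => h10 h.2⟩]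
          have h7 := tripleWt_expand h (P := P) (s := g (.inl (.inr (.inr true))))
            (s' := g (.inl (.inr (.inr false)))) (p := fun t => g (.inr (.inr true, t)))
            (p' := fun t => g (.inr (.inr false, t)))
            (by have := hg1 (.inl (.inr (.inr true))); omega)
            (h4 _) (fun t => h5 _) ((padded_iff fun b => hg1 (.inr b)).2 h6 (.inr true))
            (by have := hg1 (.inl (.inr (.inr false))); omega) (h4 _) (fun t => h5 _) hn3
            hn5 (mul_pos hP.ν_pos hn5)
          have h9 : W (fun i => mulOut g (.inr i)) =
              tripleWt P h (Real.log ((∏ i, g i : ℕ) : ℝ))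
              (g (.inl (.inr (.inr true))) * ∏ t, g (.inr (.inr true, t)))
              (g (.inl (.inr (.inr false))) * ∏ t, g (.inr (.inr false, t))) := by
            simp only [W]
            rw [hprod']
            rfl
          rw [h9, h7]
          simp only [lg]
          ring
      · rw [if_neg h6, mul_zero, zero_mul, mul_zero]
        exact (mul_eq_zero_of_right _ (if_neg fun h => h6 h.1.2)).symm
  have hT2 : ∀ S : Finset (I × Fin T), |primeTupleSum z x w τ (ΩS S)| ≤ errBd (AS S) B x :=
    fun S => by
    refine hAS S B x w hw (by linarith [hS0 S]) τ (ΩS S) (hK₂.comp fun i => isAff_extendZero S i)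
      (fun v => hΩ₂1 _) fun L hL hΩ hc => ?_
    -- A coagulation formed by all the primes of the tuple would, by `HasCoag.coagLog`, contradict
    -- the negated condition in `Ω₂`.
    have h2 : (0 < ∑ i, extendZero S L i) ∧ ¬ (0 < ∑ i, extendZero S L i ∧
        CoagLog P (∑ i, extendZero S L i) fun b => extendZero S L (.inr b)) := by
      by_contra h3
      apply hΩ
      simp only [ΩS, Ω₂]
      rw [if_neg]
      exact fun h4 => h3 ⟨h4.1.1, h4.2⟩
    rw [sum_extendZero] at h2
    refine h2.2 ⟨h2.1, HasCoag.coagLog (S := S) (σ := (∑ y, L (.inl y)) / ∑ i, L i) ?_ h2.1 ?_⟩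
    · convert hc using 2 with b
      simp [extendZero]
    · intro b hb
      simp only [extendZero, Sum.elim_inr, hb, dif_neg, not_false_iff]
      exact mul_pos hP.ν_pos h2.1
  rw [hmain, hexp]
  refine (abs_sub _ _).trans ((add_le_add hT1 ((abs_sum_le_sum_abs _ _).trans
    ((sum_le_sum fun S _ => hT2 S).trans (sum_errBd_le _ _ hx8)))).trans ?_)
  have hb2 : (3 : ℝ) ^ K₁ * (x / Real.log x ^ B) ≤ errBd (3 ^ K₁ + Fintype.card J₁) B x := by
    have := le_errBd (M := 3 ^ K₁) (k := 0) (A := 3 ^ K₁ + Fintype.card J₁) (B := B) hx8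
      (by push_cast; linarith) (by positivity)
    rwa [pow_zero, mul_one] at this
  exact (add_le_add hb2 le_rfl).trans (errBd_add hx8)

/-! ### Measurability, null sets and bounds on the hyperplane -/

open MeasureTheory in
theorem measurable_affEval {I : Type*} [Fintype I] (l : (I → ℝ) × ℝ) : Measurable (affEval l) := by
  unfold affEval
  fun_prop

/-- The signs of finitely many affine forms. -/
def signs {I : Type*} [Fintype I] (S : Finset ((I → ℝ) × ℝ)) (v : I → ℝ) : S → SignType :=
  fun l => SignType.sign (affEval l v)

theorem measurableSet_signs_eq {I : Type*} [Fintype I] (S : Finset ((I → ℝ) × ℝ))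
    (σ : S → SignType) : MeasurableSet {v | signs S v = σ} := by
  have : {v | signs S v = σ} = ⋂ l, {v | SignType.sign (affEval l.1 v) = σ l} := by
    ext v
    simp [signs, funext_iff]
  rw [this]
  refine MeasurableSet.iInter fun l => ?_
  have hm := measurable_affEval l.1
  rcases σ l with _ | _ | _
  · change MeasurableSet {v | SignType.sign (affEval l.1 v) = 0}
    simp only [sign_eq_zero_iff]
    exact measurableSet_eq_fun hm measurable_const
  · change MeasurableSet {v | SignType.sign (affEval l.1 v) = -1}
    simp only [sign_eq_neg_one_iff]
    exact measurableSet_lt hm measurable_const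
  · change MeasurableSet {v | SignType.sign (affEval l.1 v) = 1}
    simp only [sign_eq_one_iff]
    exact measurableSet_lt measurable_const hm

theorem SignFn.exists_signs {I α : Type*} [Fintype I] {f : (I → ℝ) → α} {N : ℕ} (hf : SignFn N f) :
    ∃ S, ∀ v v', signs S v = signs S v' → f v = f v' := by
  obtain ⟨S, -, hS⟩ := hf
  exact ⟨S, fun v v' h => hS v v' fun l hl => congrFun h ⟨l, hl⟩⟩

/-- Every preimage is a finite union of sign cells, whatever the set of values. -/
theorem Semilin.measurableSet_preimage {I α : Type*} [Fintype I] {f : (I → ℝ) → α} (hf : Semilin f)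
    (s : Set α) : MeasurableSet (f ⁻¹' s) := by
  obtain ⟨N, hN⟩ := hf
  obtain ⟨S, hS⟩ := hN.exists_signs
  have : f ⁻¹' s = ⋃ σ ∈ signs S '' (f ⁻¹' s), {v | signs S v = σ} := by
    ext v
    simp only [Set.mem_iUnion, Set.mem_ofPred_eq, Set.mem_preimage, exists_prop]
    constructor
    · intro h
      exact ⟨_, ⟨v, h, rfl⟩, rfl⟩
    · rintro ⟨_, ⟨v', h, rfl⟩, h'⟩
      rw [hS v v' h']
      exact h
  rw [this]
  exact MeasurableSet.biUnion (Set.toFinite _).countable fun σ _ => measurableSet_signs_eq S σ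

theorem Semilin.measurable {I : Type*} [Fintype I] {f : (I → ℝ) → ℝ} (hf : Semilin f) :
    Measurable f := fun s _ => hf.measurableSet_preimage s

theorem isAff_hyperplanePoint {m : ℕ} (i : Fin (m + 1)) :
    IsAff fun u : Fin m → ℝ => hyperplanePoint u i := by
  induction i using Fin.lastCases with
  | last =>
    simp only [hyperplanePoint, Fin.snoc_last]
    exact (IsAff.const 1).sub (IsAff.sum _ fun j _ => IsAff.coord j)
  | cast i =>
    simp only [hyperplanePoint, Fin.snoc_castSucc]
    exact IsAff.coord i

theorem measurable_hyperplanePoint {m : ℕ} :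
    Measurable (hyperplanePoint : (Fin m → ℝ) → Fin (m + 1) → ℝ) := by
  refine measurable_pi_iff.2 fun i => ?_
  obtain ⟨l, hl⟩ := isAff_hyperplanePoint (m := m) i
  rw [funext hl]
  exact measurable_affEval l

open MeasureTheory in
/-- A hyperplane that meets `∑ xᵢ = 1` properly is a null set. -/
theorem volume_hyperplane_eq_zero {m : ℕ} {c : Fin (m + 1) → ℝ} (hc : ∃ i j, c i ≠ c j) (b : ℝ) :
    volume {u : Fin m → ℝ | ∑ i, c i * hyperplanePoint u i = b} = 0 := by
  let φ : (Fin m → ℝ) →ₗ[ℝ] ℝ :=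
    ∑ i, (c i.castSucc - c (Fin.last m)) • LinearMap.proj (R := ℝ) (φ := fun _ : Fin m => ℝ) i
  have hφ : ∀ u, φ u = ∑ i, (c i.castSucc - c (Fin.last m)) * u i := fun u => by
    simp [φ, LinearMap.sum_apply]
  have hval : ∀ u : Fin m → ℝ, ∑ i, c i * hyperplanePoint u i = φ u + c (Fin.last m) := fun u => by
    rw [hφ, Fin.sum_univ_castSucc]
    simp only [hyperplanePoint, Fin.snoc_castSucc, Fin.snoc_last, sub_mul, sum_sub_distrib,
      ← mul_sum]
    ring
  have hne : ∃ i : Fin m, c i.castSucc ≠ c (Fin.last m) := by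
    by_contra! h
    obtain ⟨i, j, hij⟩ := hc
    have h' : ∀ i, c i = c (Fin.last m) := fun i => by
      induction i using Fin.lastCases with
      | last => rfl
      | cast i => exact h i
    exact hij ((h' i).trans (h' j).symm)
  obtain ⟨i, hi⟩ := hne
  have hker : LinearMap.ker φ ≠ ⊤ := fun h => by
    have h1 : Pi.single i 1 ∈ LinearMap.ker φ := h ▸ Submodule.mem_top
    rw [LinearMap.mem_ker, hφ, sum_eq_single i] at h1
    · simp only [Pi.single_eq_same, mul_one] at h1
      exact hi (sub_eq_zero.1 h1)
    · intro j _ hj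
      simp [hj]
    · simp
  by_cases hn : ∃ u₀, φ u₀ + c (Fin.last m) = b
  · obtain ⟨u₀, hu₀⟩ := hn
    have hset : {u : Fin m → ℝ | ∑ i, c i * hyperplanePoint u i = b} =
        (AffineSubspace.mk' u₀ (LinearMap.ker φ) : Set (Fin m → ℝ)) := by
      ext u
      rw [Set.mem_ofPred_eq, hval, SetLike.mem_coe, AffineSubspace.mem_mk', vsub_eq_sub,
        LinearMap.mem_ker, map_sub, ← hu₀, sub_eq_zero]
      exact add_left_inj _
    rw [hset]
    refine Measure.addHaar_affineSubspace _ _ fun h => hker ?_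
    rw [← AffineSubspace.direction_mk' u₀ (LinearMap.ker φ), h, AffineSubspace.direction_top]
  · have hset : {u : Fin m → ℝ | ∑ i, c i * hyperplanePoint u i = b} = ∅ := by
      ext u
      simp only [Set.mem_ofPred_eq, Set.mem_empty_iff_false, iff_false, hval]
      exact fun h => hn ⟨u, h⟩
    rw [hset, measure_empty]

-- On `S` all components are `≥ ν`, so `∏ xᵢ ≥ ν ^ (m + 1)`, and the projection of `S` lies in the
-- unit cube. A bound for `F` almost everywhere thus gives integrability and a bound for the
-- integral.
open MeasureTheory in
theorem hyperplane_bound {ν : ℝ} (hν : 0 < ν) {m : ℕ} {S : Set (Fin (m + 1) → ℝ)}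
    (hS : ∀ x ∈ S, ∀ i, ν ≤ x i) (hSm : MeasurableSet {u : Fin m → ℝ | hyperplanePoint u ∈ S})
    {F : (Fin (m + 1) → ℝ) → ℝ}
    (hF : AEStronglyMeasurable (fun u : Fin m → ℝ => F (hyperplanePoint u))
      (volume.restrict {u : Fin m → ℝ | hyperplanePoint u ∈ S}))
    {C : ℝ} (hC0 : 0 ≤ C)
    (hC : ∀ᵐ u : Fin m → ℝ, hyperplanePoint u ∈ S → |F (hyperplanePoint u)| ≤ C) :
    HyperplaneIntegrable (m + 1) S (fun x => F x / ∏ i, x i) ∧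
      |hyperplaneIntegral (m + 1) S fun x => F x / ∏ i, x i| ≤ C * (1 / ν) ^ (m + 1) := by
  set R := {u : Fin m → ℝ | hyperplanePoint u ∈ S} with hR
  have hsub : R ⊆ Set.Icc 0 1 := fun u hu => by
    have h1 : ∀ i : Fin m, ν ≤ u i := fun i => by
      have := hS _ hu i.castSucc
      simpa [hyperplanePoint] using this
    have h2 : ν ≤ 1 - ∑ i, u i := by
      have := hS _ hu (Fin.last m)
      simpa [hyperplanePoint] using this
    refine ⟨fun i => hν.le.trans (h1 i), fun i => ?_⟩
    have := single_le_sum (fun i _ => hν.le.trans (h1 i)) (mem_univ i)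
    change u i ≤ 1
    linarith
  have hvol : volume (Set.Icc (0 : Fin m → ℝ) 1) = 1 := by
    rw [Real.volume_Icc_pi]
    simp
  have hfin : volume R < ⊤ := (measure_mono hsub).trans_lt (by rw [hvol]; exact ENNReal.one_lt_top)
  have hle : (volume R).toReal ≤ 1 := by
    have := ENNReal.toReal_mono (by simp) ((measure_mono hsub).trans_eq hvol)
    simpa using this
  have hbd : ∀ᵐ u : Fin m → ℝ, u ∈ R →
      ‖F (hyperplanePoint u) / ∏ i, hyperplanePoint u i‖ ≤ C * (1 / ν) ^ (m + 1) := by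
    filter_upwards [hC] with u hu huR
    have h1 : ν ^ (m + 1) ≤ ∏ i, hyperplanePoint u i := by
      have := prod_le_prod (s := univ) (f := fun _ : Fin (m + 1) => ν) (fun _ _ => hν.le)
        fun i _ => hS _ huR i
      simpa using this
    have h2 : 0 < ν ^ (m + 1) := by positivity
    rw [Real.norm_eq_abs, abs_div, abs_of_pos (h2.trans_le h1), one_div, inv_pow, ← div_eq_mul_inv]
    exact div_le_div₀ hC0 (hu huR) h2 h1
  have hmeas : AEStronglyMeasurable
      (fun u : Fin m → ℝ => F (hyperplanePoint u) / ∏ i, hyperplanePoint u i)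
      (volume.restrict R) := by
    have h1 : Measurable fun u : Fin m → ℝ => ∏ i, hyperplanePoint u i :=
      Finset.measurable_prod _ fun i _ => (measurable_pi_apply i).comp measurable_hyperplanePoint
    exact (hF.aemeasurable.div h1.aemeasurable).aestronglyMeasurable
  constructor
  · have : IsFiniteMeasure (volume.restrict R) := ⟨by rwa [Measure.restrict_apply_univ]⟩
    exact Integrable.of_bound hmeas _ ((ae_restrict_iff' hSm).2 hbd)
  · have := norm_setIntegral_le_of_norm_le_const_ae' hfin hbd
    refine this.trans ?_
    rw [Measure.real]
    exact mul_le_of_le_one_right (by positivity) hle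

theorem Semilin.orderedH {P : Params} (hP : P.Good) (k : ℕ) :
    Semilin fun x : Fin k → ℝ => x ∈ orderedH P k :=
  ((Semilin.coagulations hP k).and ((Semilin.all fun i =>
    Semilin.le (IsAff.const P.ν) (IsAff.coord i)).and (Semilin.const (2 ≤ k)))).and
    (Semilin.all fun i => Semilin.all fun j => (Semilin.const (i ≤ j)).imp
      (Semilin.le (IsAff.coord i) (IsAff.coord j)))

theorem Semilin.measurableSet_hyperplane {m : ℕ} {S : Set (Fin (m + 1) → ℝ)}
    (hS : Semilin fun x => x ∈ S) : MeasurableSet {u : Fin m → ℝ | hyperplanePoint u ∈ S} :=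
  (hS.comp isAff_hyperplanePoint).measurableSet_preimage {q | q}

theorem Semilin.aestronglyMeasurable_hyperplane {m : ℕ} {f : (Fin (m + 1) → ℝ) → ℝ}
    (hf : Semilin f) (μ : MeasureTheory.Measure (Fin m → ℝ)) :
    MeasureTheory.AEStronglyMeasurable (fun u : Fin m → ℝ => f (hyperplanePoint u)) μ :=
  (hf.measurable.comp measurable_hyperplanePoint).aestronglyMeasurable

theorem convex_signs_eq {I : Type*} [Fintype I] (S : Finset ((I → ℝ) × ℝ)) (σ : S → SignType) :
    Convex ℝ {v | signs S v = σ} := by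
  have hset : {v | signs S v = σ} = ⋂ l, {v | SignType.sign (affEval l.1 v) = σ l} := by
    ext v
    simp [signs, funext_iff]
  rw [hset]
  refine convex_iInter fun l => ?_
  intro v hv v' hv' a a' ha ha' h1
  have haff : affEval l.1 (a • v + a' • v') = a * affEval l.1 v + a' * affEval l.1 v' := by
    unfold affEval
    simp only [Pi.add_apply, Pi.smul_apply, smul_eq_mul, mul_add, sum_add_distrib, mul_sum]
    have : l.1.2 = a * l.1.2 + a' * l.1.2 := by rw [← add_mul, h1, one_mul]
    rw [add_add_add_comm, ← this]
    congr 2 <;> exact sum_congr rfl fun i _ => by ring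
  rw [Set.mem_ofPred_eq] at hv hv' ⊢
  rw [haff]
  rw [← hv'] at hv
  rcases ha.eq_or_lt with rfl | ha0
  · rw [zero_add] at h1
    rw [h1, zero_mul, zero_add, one_mul, hv']
  have hs := sign_eq_of_between (a := affEval l.1 v) (c := affEval l.1 v')
    (b := a * affEval l.1 v + a' * affEval l.1 v') ?_ hv
  · rw [hs, hv, hv']
  · obtain rfl : a' = 1 - a := by linarith
    rcases le_total (affEval l.1 v) (affEval l.1 v') with h | h
    · left
      constructor
      · linarith [mul_nonneg ha' (sub_nonneg.2 h)]
      · linarith [mul_nonneg ha (sub_nonneg.2 h)]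
    · right
      constructor
      · linarith [mul_nonneg ha (sub_nonneg.2 h)]
      · linarith [mul_nonneg ha' (sub_nonneg.2 h)]

/-! ### The generalized prime number theorem on sign cells -/

open Classical in
/-- The generalized prime number theorem for functions of finitely many signs. -/
theorem exists_genPNT_semilin {P : Params} (hP : P.Good) {k : ℕ} (hk2 : 2 ≤ k)
    (hk : (k : ℝ) ≤ 1 / P.ν) {f : (Fin k → ℝ) → ℝ} (hf : Semilin f) :
    ∃ M : ℝ, 0 ≤ M ∧ ∀ (B x : ℝ) (b : ℕ → ℝ), GenPNT P B x b → ∃ E : ℝ, |E| ≤ M / B ∧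
      ∑ n ∈ (window x).filter (fun n => n.primeFactorsList.length = k ∧
          primeVec k n ∈ orderedH P k), b n * f (primeVec k n) =
        primeSum x b * (hyperplaneIntegral k (orderedH P k) (fun u => f u / ∏ i, u i) + E) := by
  obtain ⟨N, hN⟩ := hf.map₂ (Semilin.orderedH hP k) fun r (q : Prop) => (r, q)
  obtain ⟨S, hS⟩ := hN.exists_signs
  have hS1 : ∀ v v', signs S v = signs S v' → f v = f v' := fun v v' h =>
    (Prod.mk.inj (hS v v' h)).1
  have hS2 : ∀ v v', signs S v = signs S v' → (v ∈ orderedH P k ↔ v' ∈ orderedH P k) :=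
    fun v v' h => iff_of_eq (Prod.mk.inj (hS v v' h)).2
  let val : (S → SignType) → ℝ := fun σ => if h : ∃ v, signs S v = σ then f h.choose else 0
  have hval : ∀ v, f v = val (signs S v) := fun v => by
    have h : ∃ v', signs S v' = signs S v := ⟨v, rfl⟩
    simp only [val]
    rw [dif_pos h]
    exact hS1 _ _ h.choose_spec.symm
  -- The forms also decide membership in `orderedH P k`, so each of these sets is empty or a whole
  -- sign cell; in both cases it is convex.
  let T : (S → SignType) → Set (Fin k → ℝ) := fun σ => {v | v ∈ orderedH P k ∧ signs S v = σ}
  have hTconv : ∀ σ, Convex ℝ (T σ) := fun σ => by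
    by_cases h : (T σ).Nonempty
    · obtain ⟨v, hv⟩ := h
      have : T σ = {v | signs S v = σ} := by
        ext v'
        refine ⟨And.right, fun h' => ⟨?_, h'⟩⟩
        exact (hS2 v v' (hv.2.trans h'.symm)).1 hv.1
      rw [this]
      exact convex_signs_eq S σ
    · rw [Set.not_nonempty_iff_eq_empty.1 h]
      exact convex_empty
  have hint : hyperplaneIntegral k (orderedH P k) (fun u => f u / ∏ i, u i) =
      ∑ σ, val σ * hyperplaneIntegral k (T σ) fun u => 1 / ∏ i, u i := by
    obtain ⟨m, rfl⟩ : ∃ m, k = m + 1 := ⟨k - 1, by omega⟩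
    have hTm : ∀ σ, MeasurableSet {u : Fin m → ℝ | hyperplanePoint u ∈ T σ} := fun σ =>
      (Semilin.measurableSet_hyperplane (Semilin.orderedH hP (m + 1))).inter
        (measurable_hyperplanePoint (measurableSet_signs_eq S σ))
    have hun : {u : Fin m → ℝ | hyperplanePoint u ∈ orderedH P (m + 1)} =
        ⋃ σ ∈ (univ : Finset (S → SignType)), {u | hyperplanePoint u ∈ T σ} := by
      ext u
      simp [T]
    have hcongr : ∀ σ, ∀ u ∈ {u : Fin m → ℝ | hyperplanePoint u ∈ T σ},
        f (hyperplanePoint u) / ∏ i, hyperplanePoint u i =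
          val σ * (1 / ∏ i, hyperplanePoint u i) := fun σ u hu => by
      rw [hval, hu.2]
      ring
    have hone : ∀ σ, MeasureTheory.IntegrableOn
        (fun u : Fin m → ℝ => 1 / ∏ i, hyperplanePoint u i) {u | hyperplanePoint u ∈ T σ} :=
      fun σ => (hyperplane_bound hP.ν_pos (fun x hx => hx.1.1.2.1) (hTm σ)
        (F := fun _ => 1) MeasureTheory.aestronglyMeasurable_const zero_le_one
          (Filter.Eventually.of_forall fun _ _ => by simp)).1
    simp only [hyperplaneIntegral]
    rw [hun, MeasureTheory.integral_biUnion_finset]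
    · refine sum_congr rfl fun σ _ => ?_
      rw [MeasureTheory.setIntegral_congr_fun (hTm σ) (hcongr σ),
        MeasureTheory.integral_const_mul]
    · exact fun σ _ => hTm σ
    · intro σ _ σ' _ hne
      refine Set.disjoint_left.2 fun u hu hu' => hne (hu.2.symm.trans hu'.2)
    · intro σ _
      exact MeasureTheory.IntegrableOn.congr_fun ((hone σ).const_mul (val σ))
        (fun u hu => (hcongr σ u hu).symm) (hTm σ)
  refine ⟨∑ σ, |val σ|, sum_nonneg fun _ _ => abs_nonneg _, fun B x b hb => ?_⟩
  -- On a cell `f` is constant, so the hypothesis is needed only for the function `1`.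
  choose E hE1 hE2 using fun σ => hb k hk2 hk (T σ) (hTconv σ)
    (fun v hv => ⟨hv.1.1.1, hv.1.1.2.1, hv.1.2⟩) (fun _ => 1) (fun _ _ => by simp)
    fun _ _ _ _ => by simp
  refine ⟨∑ σ, val σ * E σ, ?_, ?_⟩
  · refine (abs_sum_le_sum_abs _ _).trans ?_
    rw [sum_div]
    refine sum_le_sum fun σ _ => ?_
    rw [abs_mul, div_eq_mul_one_div]
    exact mul_le_mul_of_nonneg_left (hE1 σ) (abs_nonneg _)
  · rw [hint, ← sum_add_distrib, mul_sum]
    have h1 : ∀ σ, primeSum x b * (val σ * hyperplaneIntegral k (T σ) (fun u => 1 / ∏ i, u i) +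
        val σ * E σ) = ∑ n ∈ (window x).filter (fun n => n.primeFactorsList.length = k ∧
          primeVec k n ∈ T σ), b n * f (primeVec k n) := fun σ => by
      rw [← mul_add, mul_left_comm, ← hE2 σ, mul_sum]
      refine sum_congr (by congr!) fun n hn => ?_
      rw [hval, (mem_filter.1 hn).2.2.2]
      ring
    rw [sum_congr rfl fun σ _ => h1 σ, ← sum_fiberwise _ fun n => signs S (primeVec k n)]
    refine sum_congr rfl fun σ _ => sum_congr ?_ fun _ _ => rfl
    ext n
    simp only [mem_filter, T, Set.mem_ofPred_eq, and_assoc]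

/-! ### Approximation of functions of the class 𝒢₁ -/

/-- The vector `x` lies on one of the hyperplanes of `W`. -/
def OnPlanes {I : Type*} [Fintype I] (W : Finset ((I → ℝ) × ℝ)) (x : I → ℝ) : Prop :=
  ∃ l ∈ W, ∑ i, l.1 i * x i = l.2

theorem Semilin.onPlanes {I : Type*} [Fintype I] (W : Finset ((I → ℝ) × ℝ)) :
    Semilin fun x : I → ℝ => OnPlanes W x := by
  have h : Semilin fun x : I → ℝ => ∃ l : W, ∑ i, l.1.1 i * x i = l.1.2 :=
    Semilin.ex fun l => Semilin.eq (IsAff.sum _ fun i _ => (IsAff.coord i).mulc _) (IsAff.const _)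
  refine h.map₂ (Semilin.const ()) (fun q _ => q) |>.map id |> fun h' => ?_
  convert h' using 2 with x
  simp [OnPlanes]

/-- Equal signs relative to all points of a grid of mesh `δ` put both numbers into the same mesh
interval. -/
theorem abs_sub_le_of_sign_eq {δ : ℝ} (hδ : 0 < δ) {M : ℕ} {s t : ℝ} (hs : 0 ≤ s) (ht : 0 ≤ t)
    (hsM : s ≤ M * δ) (htM : t ≤ M * δ)
    (h : ∀ m ∈ range (M + 2), SignType.sign (s - m * δ) = SignType.sign (t - m * δ)) :
    |s - t| ≤ δ := by
  wlog hst : t ≤ s generalizing s t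
  · rw [abs_sub_comm]
    exact this ht hs htM hsM (fun m hm => (h m hm).symm) (le_of_not_ge hst)
  have h1 := Nat.floor_le (div_nonneg ht hδ.le)
  have h2 := Nat.lt_floor_add_one (t / δ)
  set m := ⌊t / δ⌋₊
  rw [le_div_iff₀ hδ] at h1
  rw [div_lt_iff₀ hδ] at h2
  have hm : m ≤ M := by
    have : (m : ℝ) * δ ≤ M * δ := h1.trans htM
    exact_mod_cast le_of_mul_le_mul_right this hδ
  have h3 := h (m + 1) (mem_range.2 (by omega))
  push_cast at h3
  rw [sign_neg (sub_neg.2 h2), sign_eq_neg_one_iff, sub_neg] at h3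
  rw [abs_of_nonneg (sub_nonneg.2 hst)]
  linarith

theorem isOpen_setOf_sum_lt {I κ : Type*} [Fintype I] [Finite κ] (c : κ → I → ℝ) (b : κ → ℝ) :
    IsOpen {x : I → ℝ | ∀ i, ∑ j, c i j * x j < b i} := by
  have : {x : I → ℝ | ∀ i, ∑ j, c i j * x j < b i} = ⋂ i, {x | ∑ j, c i j * x j < b i} := by
    ext
    simp
  rw [this]
  exact isOpen_iInter_of_finite fun i => isOpen_lt (by fun_prop) continuous_const

/-- A polytope is decided by the signs of finitely many affine forms; its points off the bounding
hyperplanes are interior. -/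
theorem IsConvexPolytope.exists_forms {k : ℕ} {T : Set (Fin k → ℝ)} (hT : IsConvexPolytope T) :
    Convex ℝ T ∧ ∃ (W S : Finset ((Fin k → ℝ) × ℝ)), (∀ l ∈ W, l.1 ≠ 0) ∧
      (∀ x ∈ T, ¬OnPlanes W x → x ∈ interior T) ∧
      ∀ x y, signs S x = signs S y → (x ∈ T ↔ y ∈ T) ∧ (OnPlanes W x ↔ OnPlanes W y) := by
  classical
  obtain ⟨-, p, q, c, b, c', b', rfl⟩ := hT
  constructor
  · have : ∀ d : Fin k → ℝ, IsLinearMap ℝ fun x : Fin k → ℝ => ∑ j, d j * x j := fun d =>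
      ⟨fun x y => by simp [mul_add, sum_add_distrib], fun r x => by
        simp only [Pi.smul_apply, smul_eq_mul, mul_sum]
        exact sum_congr rfl fun _ _ => by ring⟩
    rw [Set.ofPred_and, Set.ofPred_forall, Set.ofPred_forall]
    exact (convex_iInter fun i => convex_halfSpace_lt (this _) _).inter
      (convex_iInter fun i => convex_halfSpace_le (this _) _)
  · set W : Finset ((Fin k → ℝ) × ℝ) :=
      (univ.image fun i => (c' i, b' i)).filter fun l => l.1 ≠ 0 with hW
    have hsem : Semilin fun x : Fin k → ℝ =>
        (((∀ i, ∑ j, c i j * x j < b i) ∧ ∀ i, ∑ j, c' i j * x j ≤ b' i : Prop), OnPlanes W x) := by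
      have haff : ∀ d : Fin k → ℝ, IsAff fun x : Fin k → ℝ => ∑ j, d j * x j := fun d =>
        IsAff.sum _ fun i _ => (IsAff.coord i).mulc _
      exact Semilin.map₂ ((Semilin.all fun i => Semilin.lt (haff _) (IsAff.const _)).and
        (Semilin.all fun i => Semilin.le (haff _) (IsAff.const _))) (Semilin.onPlanes W)
        fun p q => (p, q)
    obtain ⟨N, hN⟩ := hsem
    obtain ⟨S, hS⟩ := hN.exists_signs
    refine ⟨W, S, fun l hl => (mem_filter.1 hl).2, ?_, fun x y h => ?_⟩
    · rintro x ⟨hx, hx'⟩ hxW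
      have hopen := (isOpen_setOf_sum_lt c b).inter
        (isOpen_setOf_sum_lt (fun i : {i // c' i ≠ 0} => c' i) fun i => b' i)
      refine mem_interior.2 ⟨_, ?_, hopen, hx, ?_⟩
      · rintro y ⟨hy, hy'⟩
        refine ⟨hy, fun i => ?_⟩
        by_cases hi : c' i = 0
        · simpa [hi] using hx' i
        · exact (hy' ⟨i, hi⟩).le
      · rintro ⟨i, hi⟩
        refine lt_of_le_of_ne (hx' i) fun h => hxW ⟨(c' i, b' i), ?_, h⟩
        exact mem_filter.2 ⟨mem_image_of_mem _ (mem_univ i), hi⟩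
    · have := Prod.mk.inj (hS x y h)
      exact ⟨iff_of_eq this.1, iff_of_eq this.2⟩

theorem sum_le_of_mem_regionG1 {P : Params} {k : ℕ} {x : Fin k → ℝ} (hx : x ∈ regionG1 P k) :
    ∑ i, x i ≤ P.γ := by
  obtain ⟨h1, -, h2⟩ := mem_regionG1_iff.1 hx
  simpa using h2 0 h1

theorem signs_mono {I : Type*} [Fintype I] {S S' : Finset ((I → ℝ) × ℝ)} (h : S ⊆ S') {x y : I → ℝ}
    (hxy : signs S' x = signs S' y) : signs S x = signs S y :=
  funext fun l => congrFun hxy ⟨l.1, h l.2⟩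

/-- A smooth piece is nearly constant on small sign cells off finitely many hyperplanes. -/
theorem IsSmoothPiece.exists_forms {k : ℕ} {h : (Fin k → ℝ) → ℝ} (hh : IsSmoothPiece h) :
    ∃ (W S : Finset ((Fin k → ℝ) × ℝ)) (K : ℝ), 0 ≤ K ∧ (∀ l ∈ W, l.1 ≠ 0) ∧ (∀ x, |h x| ≤ K) ∧
      (∀ x y, signs S x = signs S y → (OnPlanes W x ↔ OnPlanes W y)) ∧
      ∀ x y, signs S x = signs S y → ¬OnPlanes W x → |h x - h y| ≤ K * ‖x - y‖ := by
  obtain ⟨T, hT, -, h0, ⟨K, hK⟩, hd, K', hK'⟩ := hh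
  obtain ⟨hconv, W, S, hW, hint, hS⟩ := hT.exists_forms
  refine ⟨W, S, max K (max K' 0), le_max_of_le_right (le_max_right _ _), hW,
    fun x => (hK x).trans (le_max_left _ _), fun x y hxy => (hS x y hxy).2, fun x y hxy hx => ?_⟩
  have hC : 0 ≤ max K (max K' 0) * ‖x - y‖ :=
    mul_nonneg (le_max_of_le_right (le_max_right _ _)) (norm_nonneg _)
  by_cases hxT : x ∈ T
  · have hyT := (hS x y hxy).1.1 hxT
    have hx' := hint x hxT hx
    have hy' := hint y hyT fun h => hx ((hS x y hxy).2.2 h)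
    -- Off the hyperplanes both points are interior. The interior is convex, so the mean value
    -- inequality applies with the bound for the derivative.
    have := hconv.interior.norm_image_sub_le_of_norm_fderiv_le (𝕜 := ℝ)
      (fun z hz => (hd.differentiableOn one_ne_zero).differentiableAt (isOpen_interior.mem_nhds hz))
      (fun z hz => hK' z hz) hy' hx'
    rw [Real.norm_eq_abs] at this
    exact this.trans (mul_le_mul_of_nonneg_right (le_max_of_le_right (le_max_left _ _))
      (norm_nonneg _))
  · rw [h0 x hxT, h0 y fun h => hxT ((hS x y hxy).1.2 h), sub_zero, abs_zero]
    exact hC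

/-- Functions in the class `𝒢₁` are approximated by functions of finitely many signs, off finitely
many hyperplanes. -/
theorem exists_approx_dim {P : Params} (hP : P.Good) {g : VecFun} (hg : g ∈ ClassG1 P) (k : ℕ) :
    ∃ (W : Finset ((Fin k → ℝ) × ℝ)) (K : ℝ), 0 ≤ K ∧ (∀ l ∈ W, l.1 ≠ 0) ∧
      (∀ x, Monotone x → |g k x| ≤ K) ∧ ∀ ε : ℝ, 0 < ε → ∃ h : (Fin k → ℝ) → ℝ, Semilin h ∧
        (∀ x, h x ≠ 0 → x ∈ regionG1 P k) ∧ (∀ x, |h x| ≤ K) ∧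
        ∀ x, Monotone x → x ∈ regionG1 P k → ¬OnPlanes W x → |g k x - h x| ≤ ε := by
  classical
  obtain ⟨-, hg0, hgp⟩ := hg
  obtain ⟨N, p, hp, hgx⟩ := hgp k
  choose W S K hK0 hW hK hSW hS using fun j => (hp j).exists_forms
  obtain ⟨N1, hN1⟩ := Semilin.regionG1 hP k
  obtain ⟨S1, hS1⟩ := hN1.exists_signs
  have hgK : ∀ x, Monotone x → |g k x| ≤ ∑ j, K j := fun x hx => by
    rw [hgx x hx]
    exact (abs_sum_le_sum_abs _ _).trans (sum_le_sum fun j _ => hK j x)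
  have hKs : 0 ≤ ∑ j, K j := sum_nonneg fun j _ => hK0 j
  refine ⟨univ.biUnion W, ∑ j, K j, hKs, ?_, hgK, fun ε hε => ?_⟩
  · intro l hl
    obtain ⟨j, -, hj⟩ := mem_biUnion.1 hl
    exact hW j l hj
  set δ := ε / (∑ j, K j + 1) with hδ
  have hδ0 : 0 < δ := by positivity
  obtain ⟨M, hM⟩ := exists_nat_ge (1 / δ)
  rw [div_le_iff₀ hδ0] at hM
  -- These forms place each coordinate in a grid of mesh `δ`. Coordinates of vectors in 𝒢₁ are at
  -- most `γ < 1 ≤ M δ`, so the grid covers them and vectors of 𝒢₁ in one cell are within `δ` of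
  -- each other.
  set S2 : Finset ((Fin k → ℝ) × ℝ) := (univ ×ˢ range (M + 2)).image fun r : Fin k × ℕ =>
    ((Pi.single r.1 1 : Fin k → ℝ), -(r.2 * δ)) with hS2
  set S' := S1 ∪ (univ.biUnion S ∪ S2) with hS'
  have h1 : S1 ⊆ S' := subset_union_left
  have h2 : ∀ j, S j ⊆ S' := fun j => ((subset_biUnion_of_mem S (mem_univ j)).trans
    subset_union_left).trans subset_union_right
  have h3 : S2 ⊆ S' := subset_union_right.trans subset_union_right
  let Q : (S' → SignType) → (Fin k → ℝ) → Prop := fun σ y =>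
    y ∈ regionG1 P k ∧ Monotone y ∧ signs S' y = σ
  -- The approximation takes the value of `g` at a chosen ordered vector of the cell in 𝒢₁, or `0`
  -- if the cell contains none.
  let val : (S' → SignType) → ℝ := fun σ => if h : ∃ y, Q σ y then g k h.choose else 0
  refine ⟨fun x => val (signs S' x), ⟨S'.card, S', le_rfl, fun v v' h => ?_⟩, fun x hx => ?_,
    fun x => ?_, fun x hx hxG hxW => ?_⟩
  · have : signs S' v = signs S' v' := funext fun l => h l.1 l.2
    simp only [this]
  · by_cases h : ∃ y, Q (signs S' x) y
    · exact (iff_of_eq (hS1 _ _ (signs_mono h1 h.choose_spec.2.2))).1 h.choose_spec.1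
    · simp only [val] at hx
      rw [dif_neg h] at hx
      exact absurd rfl hx
  · simp only [val]
    split_ifs with h
    · exact hgK _ h.choose_spec.2.1
    · simpa using hKs
  · have h : ∃ y, Q (signs S' x) y := ⟨x, hxG, hx, rfl⟩
    simp only [val]
    rw [dif_pos h]
    obtain ⟨hyG, hy, hxy⟩ := h.choose_spec
    set y := h.choose
    have hrange : ∀ z ∈ regionG1 P k, ∀ i, 0 ≤ z i ∧ z i ≤ M * δ := fun z hz i => by
      have hpos : ∀ i, 0 ≤ z i := fun i => hP.ν_pos.le.trans ((mem_regionG1_iff.1 hz).2.1 i)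
      have := single_le_sum (fun i _ => hpos i) (mem_univ i)
      exact ⟨hpos i, (this.trans (sum_le_of_mem_regionG1 hz)).trans (hP.γ_lt.le.trans hM)⟩
    have hnorm : ‖x - y‖ ≤ δ := by
      refine (pi_norm_le_iff_of_nonneg hδ0.le).2 fun i => ?_
      rw [Real.norm_eq_abs]
      refine abs_sub_le_of_sign_eq hδ0 (hrange x hxG i).1 (hrange y hyG i).1 (hrange x hxG i).2
        (hrange y hyG i).2 fun m hm => ?_
      have hmem : ((Pi.single i 1 : Fin k → ℝ), -(m * δ)) ∈ S' :=
        h3 (mem_image.2 ⟨(i, m), mem_product.2 ⟨mem_univ _, hm⟩, rfl⟩)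
      have := congrFun hxy ⟨_, hmem⟩
      simpa [signs, affEval, Pi.single_apply, ← sub_eq_add_neg] using this.symm
    rw [hgx x hx, hgx y hy, ← sum_sub_distrib]
    refine (abs_sum_le_sum_abs _ _).trans ?_
    calc ∑ j, |p j x - p j y| ≤ ∑ j, K j * δ := sum_le_sum fun j _ =>
          (hS j x y (signs_mono (h2 j) hxy.symm) fun h' => hxW ?_).trans
            (mul_le_mul_of_nonneg_left hnorm (hK0 j))
      _ = (∑ j, K j) * δ := (sum_mul _ _ _).symm
      _ ≤ ε := by
        rw [hδ, ← mul_div_assoc, div_le_iff₀ (by positivity)]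
        nlinarith
    obtain ⟨l, hl, hl'⟩ := h'
    exact ⟨l, mem_biUnion.2 ⟨j, mem_univ _, hl⟩, hl'⟩

theorem regionG1_eq_empty {P : Params} (hP : P.Good) {k : ℕ} (hk : 1 / P.ν ≤ k) :
    regionG1 P k = ∅ := by
  ext x
  refine ⟨fun hx => ?_, fun h => h.elim⟩
  have h1 := sum_le_of_mem_regionG1 hx
  have h2 := sum_le_sum fun i (_ : i ∈ univ) => (mem_regionG1_iff.1 hx).2.1 i
  rw [sum_const, card_univ, Fintype.card_fin, nsmul_eq_mul] at h2
  rw [div_le_iff₀ hP.ν_pos] at hk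
  linarith [hP.γ_lt]

/-- A vector function on the set `𝒢₁` that takes finitely many values, on finitely many sign
cells. -/
structure SimpleFun (P : Params) (h : VecFun) (K : ℝ) : Prop where
  semilin : ∀ k, Semilin (h k)
  supp : ∀ k x, h k x ≠ 0 → x ∈ regionG1 P k
  bound : ∀ k x, |h k x| ≤ K

-- The set 𝒢₁ is empty in dimensions `≥ 1 / ν`, so finitely many bounds have a common one. The value
-- at `∅` is kept exactly, because it multiplies the sum over primes. The point `1 / 2` is added to
-- the exceptional planes in dimension `1` with a view to the integers `n = p ^ 2`.
open Classical in
theorem exists_approx {P : Params} (hP : P.Good) {g : VecFun} (hg : g ∈ ClassG1 P) :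
    ∃ (W : ∀ k, Finset ((Fin k → ℝ) × ℝ)) (K : ℝ), 0 < K ∧ (∀ k, ∀ l ∈ W k, l.1 ≠ 0) ∧
      (fun _ => 1, 1 / 2) ∈ W 1 ∧ (∀ k x, Monotone x → |g k x| ≤ K) ∧
      ∀ ε : ℝ, 0 < ε → ∃ h : VecFun, SimpleFun P h K ∧ h 0 ![] = g 0 ![] ∧
        ∀ k x, Monotone x → x ∈ regionG1 P k → ¬OnPlanes (W k) x → |g k x - h k x| ≤ ε := by
  choose W K hK0 hW hgK happ using fun k => exists_approx_dim hP hg k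
  obtain ⟨M, hM⟩ := exists_nat_ge (1 / P.ν)
  have hempty : ∀ k, M ≤ k → regionG1 P k = ∅ := fun k hk =>
    regionG1_eq_empty hP (hM.trans (by exact_mod_cast hk))
  have hle : ∀ k, k < M → K k ≤ ∑ j ∈ range M, K j + 1 := fun k hk =>
    (single_le_sum (fun j _ => hK0 j) (mem_range.2 hk)).trans (by linarith)
  have hpos : 0 < ∑ j ∈ range M, K j + 1 := by
    have := sum_nonneg fun j (_ : j ∈ range M) => hK0 j
    linarith
  let W' : ∀ k, Finset ((Fin k → ℝ) × ℝ) := fun k =>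
    if hk : k = 1 then insert (fun _ => 1, 1 / 2) (W k) else W k
  have hsub : ∀ k, W k ⊆ W' k := fun k => by
    simp only [W']
    split_ifs
    · exact subset_insert _ _
    · exact Subset.rfl
  refine ⟨W', ∑ j ∈ range M, K j + 1, hpos, ?_, mem_insert_self _ _, ?_, fun ε hε => ?_⟩
  · intro k l hl
    simp only [W'] at hl
    split_ifs at hl with hk
    · rcases mem_insert.1 hl with rfl | hl
      · subst hk
        exact fun h => one_ne_zero (congrFun h 0)
      · exact hW k l hl
    · exact hW k l hl
  · intro k x hx
    rcases lt_or_ge k M with hk | hk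
    · exact (hgK k x hx).trans (hle k hk)
    · rw [hg.2.1 k x (by simp [hempty k hk]), abs_zero]
      exact hpos.le
  · choose h h1 h2 h3 h4 using fun k => happ k ε hε
    have hg0 : ∀ x : Fin 0 → ℝ, g 0 x = g 0 ![] := fun x => by rw [Subsingleton.elim x ![]]
    refine ⟨fun k x => if k = 0 then g k x else h k x, ⟨fun k => ?_, fun k x => ?_, fun k x => ?_⟩,
      by simp, fun k x hx hxG hxW => ?_⟩
    · rcases Nat.eq_zero_or_pos k with rfl | hk
      · simp only [if_true]
        convert Semilin.const (I := Fin 0) (g 0 ![]) using 2 with x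
        exact hg0 x
      · simpa only [hk.ne', if_false] using h1 k
    · split_ifs with hk
      · exact fun hne => by_contra fun h' => hne (hg.2.1 k x h')
      · exact h2 k x
    · rcases lt_or_ge k M with hkM | hkM
      · split_ifs with hk
        · subst hk
          exact (hgK 0 x fun i => i.elim0).trans (hle 0 hkM)
        · exact (h3 k x).trans (hle k hkM)
      · have : (if k = 0 then g k x else h k x) = 0 := by
          have he := hempty k hkM
          split_ifs
          · exact hg.2.1 k x (by simp [he])
          · by_contra hne
            have := h2 k x hne
            simp [he] at this
        rw [this, abs_zero]
        exact hpos.le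
    · by_cases hk : k = 0
      · simpa [hk] using hε.le
      · simp only [hk, if_false]
        exact h4 k x hx hxG fun ⟨l, hl, hl'⟩ => hxW ⟨l, hsub k hl, hl'⟩

/-! ### Sums over submultisets -/

/-- Evaluation of a vector function at the members of a multiset in increasing order. -/
def multiVal (h : VecFun) (m : Multiset ℝ) : ℝ := onList h (m.sort (· ≤ ·))

/-- The sum of `G` over all submultisets, with multiplicity. -/
def star (G : Multiset ℝ → ℝ) (m : Multiset ℝ) : ℝ := (m.powerset.map G).sum

theorem onList_eq_multiVal (h : VecFun) {l : List ℝ} (hl : l.SortedLE) :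
    onList h l = multiVal h l := by
  have : (l : Multiset ℝ).sort (· ≤ ·) = l := by
    refine List.Perm.eq_of_pairwise (le := (· ≤ ·)) (fun _ _ _ _ h h' => le_antisymm h h')
      (Multiset.pairwise_sort _ _) hl.pairwise ?_
    rw [← Multiset.coe_eq_coe, Multiset.sort_eq]
  rw [multiVal, this]

theorem eq_multiVal (h : VecFun) {k : ℕ} {x : Fin k → ℝ} (hx : Monotone x) :
    h k x = multiVal h (univ.val.map x) := by
  have h1 : (univ.val.map x : Multiset ℝ) = (List.ofFn x : Multiset ℝ) := by
    rw [Fin.univ_val_map]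
  rw [h1, ← onList_eq_multiVal h (List.sortedLE_ofFn_iff.2 hx)]
  exact vecFun_congr h (List.length_ofFn).symm fun i => by simp

theorem star_zero (G : Multiset ℝ → ℝ) : star G 0 = G 0 := by
  simp [star]

theorem star_cons (G : Multiset ℝ → ℝ) (y : ℝ) (m : Multiset ℝ) :
    star G (y ::ₘ m) = star G m + star (fun t => G (y ::ₘ t)) m := by
  simp [star, Multiset.powerset_cons]

theorem star_eq_zero {G : Multiset ℝ → ℝ} (hG : ∀ t, G t = 0) (m : Multiset ℝ) : star G m = 0 := by
  simp [star, hG]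

theorem star_map {ι : Type*} [DecidableEq ι] (G : Multiset ℝ → ℝ) (f : ι → ℝ) (s : Finset ι) :
    star G (s.val.map f) = ∑ A ∈ s.powerset, G (A.val.map f) := by
  induction s using Finset.induction_on generalizing G with
  | empty => simp [star]
  | insert a s ha ih =>
    rw [sum_powerset_insert ha, insert_val_of_notMem ha, Multiset.map_cons, star_cons, ih, ih]
    congr 1
    refine sum_congr rfl fun t ht => ?_
    rw [insert_val_of_notMem fun h => ha (mem_powerset.1 ht h), Multiset.map_cons]

theorem subvec_monotone {k : ℕ} {x : Fin k → ℝ} (hx : Monotone x) (A : Finset (Fin k)) :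
    Monotone (subvec x A) := fun _ _ hij => hx ((A.orderEmbOfFin rfl).monotone hij)

theorem map_subvec {k : ℕ} (x : Fin k → ℝ) (A : Finset (Fin k)) :
    univ.val.map (subvec x A) = A.val.map x := by
  conv_rhs => rw [← map_orderEmbOfFin_univ A rfl]
  rw [map_val, Multiset.map_map]
  rfl

theorem sum_subvec {k : ℕ} (x : Fin k → ℝ) (A : Finset (Fin k)) :
    ∑ i, subvec x A i = ∑ i ∈ A, x i :=
  congrArg Multiset.sum (map_subvec x A)

theorem oneStar_eq_star (h : VecFun) {k : ℕ} {x : Fin k → ℝ} (hx : Monotone x) :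
    oneStar h k x = star (multiVal h) (univ.val.map x) := by
  rw [star_map, powerset_univ, oneStar]
  refine sum_congr rfl fun A _ => ?_
  rw [eq_multiVal h (subvec_monotone hx A), map_subvec]

theorem star_add_of_null {F : Multiset ℝ → ℝ} (U : Multiset ℝ) {M : Multiset ℝ}
    (hF : ∀ y ∈ M, ∀ t, F (y ::ₘ t) = 0) : star F (U + M) = star F U := by
  induction M using Multiset.induction_on with
  | empty => rw [add_zero]
  | cons y M ih =>
    rw [Multiset.add_cons, star_cons, star_eq_zero (hF y (Multiset.mem_cons_self _ _)), add_zero,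
      ih fun y' hy' => hF y' (Multiset.mem_cons_of_mem hy')]

/-- The members of `M` exclude each other. -/
theorem star_add_of_large {G : Multiset ℝ → ℝ} {c : ℝ}
    (hG : ∀ t, G t ≠ 0 → t.sum ≤ c ∧ ∀ y ∈ t, 0 ≤ y) (U : Multiset ℝ) {M : Multiset ℝ}
    (hM : ∀ y ∈ M, c < 2 * y) :
    star G (U + M) = star G U + (M.map fun y => star (fun t => G (y ::ₘ t)) U).sum := by
  induction M using Multiset.induction_on with
  | empty => simp
  | cons y M ih =>
    rw [Multiset.add_cons, star_cons, ih fun y' hy' => hM y' (Multiset.mem_cons_of_mem hy'),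
      star_add_of_null, Multiset.map_cons, Multiset.sum_cons]
    · ring
    · intro y' hy' t
      by_contra hne
      obtain ⟨h1, h2⟩ := hG _ hne
      rw [Multiset.sum_cons, Multiset.sum_cons] at h1
      have h3 := Multiset.sum_nonneg fun z hz =>
        h2 z (Multiset.mem_cons_of_mem (Multiset.mem_cons_of_mem hz))
      have h4 := hM y (Multiset.mem_cons_self _ _)
      have h5 := hM y' (Multiset.mem_cons_of_mem hy')
      linarith

/-! ### Coagulations as multisets -/

/-- The members of `m` form a coagulation of a vector of the fundamental region. -/
def MCoag (P : Params) (m : Multiset ℝ) : Prop := HasCoag P 0 (m.sort (· ≤ ·)).get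

section
variable {P : Params}

theorem mcoag_map_iff {κ : Type*} [Fintype κ] (x : κ → ℝ) :
    MCoag P (univ.val.map x) ↔ HasCoag P 0 x := by
  have h : (univ.val.map ((univ.val.map x).sort (· ≤ ·)).get) = univ.val.map x := by
    rw [map_get_univ, Multiset.sort_eq]
  constructor
  · intro hc
    obtain ⟨e, he⟩ := exists_equiv_of_map_eq h.symm
    have := hc.reindex e
    simpa only [he] using this
  · intro hc
    obtain ⟨e, he⟩ := exists_equiv_of_map_eq h
    have := hc.reindex e
    simp only [he] at this
    exact this

theorem mcoag_coe_iff (l : List ℝ) : MCoag P l ↔ HasCoag P 0 l.get := by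
  rw [← map_get_univ, mcoag_map_iff]

theorem exists_fin_map (m : Multiset ℝ) : ∃ (k : ℕ) (x : Fin k → ℝ), Monotone x ∧ k = m.card ∧
    univ.val.map x = m :=
  ⟨_, (m.sort (· ≤ ·)).get, (Multiset.pairwise_sort m (· ≤ ·)).sortedLE.monotone_get,
    by simp, by rw [map_get_univ, Multiset.sort_eq]⟩

theorem MCoag.merge {m r : Multiset ℝ} (h : MCoag P (m + r)) (hr : r ≠ 0) :
    MCoag P (m + {r.sum}) := by
  classical
  obtain ⟨a, x, -, -, hx⟩ := exists_fin_map m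
  obtain ⟨b, y, -, hb, hy⟩ := exists_fin_map r
  have h1 : univ.val.map (Sum.elim x y) = m + r := by
    rw [← univ_disjSum_univ, val_disjSum, Multiset.disjSum, Multiset.map_add, Multiset.map_map,
      Multiset.map_map]
    simp [hx, hy]
  have hys : r.sum = ∑ i, y i := by rw [← hy]; rfl
  have h2 : univ.val.map (Sum.elim x fun _ : Unit => r.sum) = m + {r.sum} := by
    rw [← univ_disjSum_univ, val_disjSum, Multiset.disjSum, Multiset.map_add, Multiset.map_map,
      Multiset.map_map]
    simp [hx]
  rw [← h1, mcoag_map_iff] at h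
  rw [← h2, mcoag_map_iff]
  have hpos := h.1
  refine h.coarsen (fun i => some (Sum.map id (fun _ => ()) i)) (by simp) ?_ (by simp) ?_
  · rintro (i | i)
    · exact hpos (Sum.inl i)
    · simp only [Sum.elim_inr, hys]
      have : Nonempty (Fin b) := ⟨⟨0, hb ▸ Multiset.card_pos.2 hr⟩⟩
      exact sum_pos (fun j _ => hpos (Sum.inr j)) univ_nonempty
  · rintro (i | i)
    · simp [sum_filter, Fintype.sum_sum_type, Sum.map]
    · simp [sum_filter, Fintype.sum_sum_type, Sum.map, hys]

/-- The replacements concern disjoint groups of members and can be made one group at a time. -/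
theorem MCoag.merge_sum {ι : Type*} {L : Finset ι} {r s : ι → Multiset ℝ}
    (hrs : ∀ p ∈ L, ∀ m, MCoag P (m + r p) → MCoag P (m + s p)) {m : Multiset ℝ}
    (h : MCoag P (m + ∑ p ∈ L, r p)) : MCoag P (m + ∑ p ∈ L, s p) := by
  classical
  induction L using Finset.induction_on generalizing m with
  | empty => simpa using h
  | insert a L ha ih =>
    rw [sum_insert ha] at h ⊢
    rw [← add_assoc]
    refine ih (fun p hp => hrs p (mem_insert_of_mem hp)) ?_
    rw [add_right_comm]
    refine hrs a (mem_insert_self _ _) _ ?_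
    rwa [add_right_comm, add_assoc]

theorem multiVal_ne_zero {g : VecFun} (hG : ∀ k x, g k x ≠ 0 → x ∈ regionG1 P k) (hP : P.Good)
    {t : Multiset ℝ} (ht : multiVal g t ≠ 0) : t.sum ≤ P.γ ∧ ∀ y ∈ t, 0 ≤ y := by
  obtain ⟨k, x, hx, -, rfl⟩ := exists_fin_map t
  rw [← eq_multiVal g hx] at ht
  have h := hG k x ht
  refine ⟨sum_le_of_mem_regionG1 h, fun y hy => ?_⟩
  obtain ⟨i, -, rfl⟩ := Multiset.mem_map.1 hy
  exact hP.ν_pos.le.trans ((mem_regionG1_iff.1 h).2.1 i)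

theorem star_nonpos_of_mcoag {g : VecFun} {σ : ℝ}
    (hH : ∀ k x, x ∈ regionH P k → σ * oneStar g k x ≤ 0) {m : Multiset ℝ} (hm : MCoag P m)
    (hν : ∀ y ∈ m, P.ν ≤ y) (h2 : 2 ≤ m.card) : σ * star (multiVal g) m ≤ 0 := by
  obtain ⟨k, x, hx, hk, rfl⟩ := exists_fin_map m
  rw [← oneStar_eq_star g hx]
  exact hH k x ⟨mem_coagulations_iff.2 ((mcoag_map_iff x).1 hm),
    fun i => hν _ (Multiset.mem_map_of_mem x (mem_univ_val i)), hk ▸ h2⟩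

/-- A coagulation whose repeated members are large: the sum over the subsets of its distinct
members is the mean of the sums over the submultisets of two further coagulations. -/
theorem star_nonpos_of_repeated {g : VecFun} {σ : ℝ} (hP : P.Good)
    (hG : ∀ k x, g k x ≠ 0 → x ∈ regionG1 P k)
    (hH : ∀ k x, x ∈ regionH P k → σ * oneStar g k x ≤ 0) {ι : Type*} [DecidableEq ι] {D : Finset ι}
    {x : ι → ℝ} {a : ι → ℕ} (hc : MCoag P (∑ p ∈ D, Multiset.replicate (a p) (x p)))
    (hν : ∀ p ∈ D, P.ν ≤ x p) (ha : ∀ p ∈ D, 1 ≤ a p) (hrep : ∀ p ∈ D, 2 ≤ a p → P.γ < 2 * x p)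
    (h2 : 2 ≤ ∑ p ∈ D, a p) (hsq : ∀ p ∈ D, a p = 2 → D ≠ {p}) :
    σ * star (multiVal g) (D.val.map x) ≤ 0 := by
  set U := D.filter fun p => a p = 1 with hU
  set L := D.filter fun p => ¬a p = 1 with hL
  have hLa : ∀ p ∈ L, 2 ≤ a p := fun p hp => by
    have := mem_filter.1 hp
    have := ha p this.1
    omega
  have hLx : ∀ p ∈ L, P.γ < 2 * x p := fun p hp => hrep p (mem_filter.1 hp).1 (hLa p hp)
  have hx0 : ∀ p ∈ L, 0 < x p := fun p hp => hP.ν_pos.trans_le (hν p (mem_filter.1 hp).1)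
  have hsplit : ∀ f : ι → Multiset ℝ, ∑ p ∈ D, f p = ∑ p ∈ U, f p + ∑ p ∈ L, f p := fun f =>
    (sum_filter_add_sum_filter_not D _ f).symm
  have hval : ∀ s : Finset ι, s.val.map x = ∑ p ∈ s, {x p} := fun s => by
    rw [← Multiset.sum_map_singleton (s.val.map x), Multiset.map_map]
    rfl
  have hUc : ∑ p ∈ U, Multiset.replicate (a p) (x p) = U.val.map x := by
    rw [hval]
    refine sum_congr rfl fun p hp => ?_
    rw [(mem_filter.1 hp).2, Multiset.replicate_one]
  rw [hsplit, hUc] at hc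
  -- The first coagulation keeps one copy of each repeated member and merges the others.
  set y : ι → ℝ := fun p => (a p - 1 : ℕ) * x p with hy
  have hyx : ∀ p ∈ L, x p ≤ y p := fun p hp => by
    have : (1 : ℝ) ≤ (a p - 1 : ℕ) := by exact_mod_cast Nat.le_sub_of_add_le (hLa p hp)
    exact le_mul_of_one_le_left (hx0 p hp).le this
  have hrepl : ∀ p ∈ L, ({x p} + Multiset.replicate (a p - 1) (x p) : Multiset ℝ) =
      Multiset.replicate (a p) (x p) := fun p hp => by
    rw [Multiset.singleton_add, ← Multiset.replicate_succ]
    congr 1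
    have := hLa p hp
    omega
  have hm1 : ∀ p ∈ L, ∀ m, MCoag P (m + Multiset.replicate (a p) (x p)) →
      MCoag P (m + {x p, y p}) := fun p hp m h => by
    rw [← hrepl p hp, ← add_assoc] at h
    have := h.merge (by
      rw [← Multiset.card_pos, Multiset.card_replicate]
      have := hLa p hp
      omega)
    rw [Multiset.sum_replicate, nsmul_eq_mul, add_assoc] at this
    exact this
  -- The second coagulation merges both copies of a double member and agrees with the first one
  -- elsewhere.
  set s2 : ι → Multiset ℝ := fun p => if a p = 2 then {2 * x p} else {x p, y p} with hs2
  have hm2 : ∀ p ∈ L, ∀ m, MCoag P (m + Multiset.replicate (a p) (x p)) →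
      MCoag P (m + s2 p) := fun p hp m h => by
    simp only [hs2]
    split_ifs with h'
    · rw [h'] at h
      have := h.merge (by simp)
      rwa [Multiset.sum_replicate, nsmul_eq_mul, Nat.cast_ofNat] at this
    · exact hm1 p hp m h
  set G := multiVal g
  set G1 : ℝ → ℝ := fun z => star (fun t => G (z ::ₘ t)) (U.val.map x) with hG1
  have hGs : ∀ t, G t ≠ 0 → t.sum ≤ P.γ ∧ ∀ y ∈ t, 0 ≤ y := fun t => multiVal_ne_zero hG hP
  have hG1z : ∀ z, P.γ < z → G1 z = 0 := fun z hz => star_eq_zero (fun t => by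
    by_contra hne
    obtain ⟨h1, h3⟩ := hGs _ hne
    have := Multiset.sum_nonneg fun z' hz' => h3 z' (Multiset.mem_cons_of_mem hz')
    rw [Multiset.sum_cons] at h1
    linarith) _
  -- All members that arise from `L` exceed `γ / 2`, so a submultiset in the support of `g` contains
  -- at most one of them and the sum splits.
  have hsum : ∀ s : ι → Multiset ℝ, (∀ p ∈ L, ∀ z ∈ s p, x p ≤ z) →
      star G (U.val.map x + ∑ p ∈ L, s p) =
        star G (U.val.map x) + ∑ p ∈ L, ((s p).map G1).sum := fun s hs => by
    rw [star_add_of_large hGs]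
    · congr 1
      have := map_sum (Multiset.mapAddMonoidHom G1) s L
      simp only [Multiset.coe_mapAddMonoidHom] at this
      rw [this]
      exact map_sum Multiset.sumAddMonoidHom _ _
    · intro z hz
      obtain ⟨p, hp, hzp⟩ := Multiset.mem_sum.1 hz
      linarith [hs p hp z hzp, hLx p hp]
  have hb1 : ∀ p ∈ L, ∀ z ∈ ({x p, y p} : Multiset ℝ), x p ≤ z := fun p hp z hz => by
    simp only [Multiset.insert_eq_cons, Multiset.mem_cons, Multiset.mem_singleton] at hz
    rcases hz with rfl | rfl
    · exact le_rfl
    · exact hyx p hp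
  have hb2 : ∀ p ∈ L, ∀ z ∈ s2 p, x p ≤ z := fun p hp z hz => by
    simp only [hs2] at hz
    split_ifs at hz
    · rw [Multiset.mem_singleton] at hz
      linarith [hx0 p hp]
    · exact hb1 p hp z hz
  have hnonneg : ∀ s : ι → Multiset ℝ, (∀ p ∈ L, ∀ z ∈ s p, x p ≤ z) →
      ∀ z ∈ U.val.map x + ∑ p ∈ L, s p, P.ν ≤ z := fun s hs z hz => by
    rcases Multiset.mem_add.1 hz with hz | hz
    · obtain ⟨p, hp, rfl⟩ := Multiset.mem_map.1 hz
      exact hν p (mem_filter.1 hp).1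
    · obtain ⟨p, hp, hzp⟩ := Multiset.mem_sum.1 hz
      exact (hν p (mem_filter.1 hp).1).trans (hs p hp z hzp)
  have hcardU : #D = #U + #L := (card_filter_add_card_filter_not _).symm
  have hD : L = ∅ → 2 ≤ #U := fun h => by
    rw [h, card_empty, add_zero] at hcardU
    rw [← hcardU]
    refine h2.trans (le_of_eq ?_)
    rw [card_eq_sum_ones]
    refine sum_congr rfl fun p hp => ?_
    by_contra hne
    have : p ∈ L := mem_filter.2 ⟨hp, hne⟩
    simp [h] at this
  have key1 := star_nonpos_of_mcoag hH (MCoag.merge_sum hm1 hc) (hnonneg _ hb1) (by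
    rw [Multiset.card_add, Multiset.card_map, card_val, Multiset.card_sum]
    simp only [Multiset.insert_eq_cons, Multiset.card_cons, Multiset.card_singleton, sum_const]
    rcases eq_or_ne #L 0 with h | h
    · have := hD (card_eq_zero.1 h)
      omega
    · rw [smul_eq_mul]
      omega)
  have key2 := star_nonpos_of_mcoag hH (MCoag.merge_sum hm2 hc) (hnonneg _ hb2) (by
    rw [Multiset.card_add, Multiset.card_map, card_val, Multiset.card_sum]
    have hge : ∀ p ∈ L, 1 ≤ (s2 p).card := fun p _ => by
      simp only [hs2]
      split_ifs <;> simp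
    have hge' : #L ≤ ∑ p ∈ L, (s2 p).card := by
      rw [card_eq_sum_ones]
      exact sum_le_sum hge
    -- The hypothesis on ℋ requires two components. With a single distinct member the second
    -- coagulation has two unless its multiplicity is two, which is excluded.
    rcases Nat.lt_or_ge #D 2 with h | h
    · have hL1 : #L ≠ 0 := fun h' => by
        have := hD (card_eq_zero.1 h')
        omega
      have hL2 : #L = 1 := by omega
      obtain ⟨p, hp⟩ := card_eq_one.1 hL2
      have hDL : D = L := by
        have h' : #D ≤ #L := by omega
        exact (eq_of_subset_of_card_le (show L ⊆ D from filter_subset _ _) h').symm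
      have hpL : p ∈ L := by simp [hp]
      have : a p ≠ 2 := fun h' => hsq p (hDL ▸ hpL) h' (hDL.trans hp)
      rw [hp, sum_singleton]
      simp [hs2, this]
    · omega)
  rw [hsum _ hb1] at key1
  rw [hsum _ hb2] at key2
  have hDs : star G (D.val.map x) = star G (U.val.map x) + ∑ p ∈ L, G1 (x p) := by
    rw [hval D, hsplit, ← hval U, hsum _ fun p _ z hz => (Multiset.mem_singleton.1 hz).ge]
    simp
  -- For multiplicity two the first coagulation contributes `2 G1 (x p)` and the second `G1 (2 x p)
  -- = 0`, as `2 x p > γ`. For higher multiplicity both contribute `G1 (x p)`, as `y p ≥ 2 x p > γ`.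
  -- The mean is `G1 (x p)` in either case.
  have hhalf : ∑ p ∈ L, (({x p, y p} : Multiset ℝ).map G1).sum + ∑ p ∈ L, ((s2 p).map G1).sum =
      2 * ∑ p ∈ L, G1 (x p) := by
    rw [← sum_add_distrib, mul_sum]
    refine sum_congr rfl fun p hp => ?_
    simp only [hs2]
    by_cases h' : a p = 2
    · have : y p = x p := by simp [hy, h']
      simp only [h', if_true, this]
      simp [hG1z _ (hLx p hp)]
      ring
    · have : G1 (y p) = 0 := hG1z _ ((hLx p hp).trans_le (by
        have h3 : 2 ≤ a p - 1 := by
          have := hLa p hp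
          omega
        have h3' : (2 : ℝ) ≤ (a p - 1 : ℕ) := by exact_mod_cast h3
        exact mul_le_mul_of_nonneg_right h3' (hx0 p hp).le))
      simp [h', this]
      ring
  rw [hDs]
  have : σ * (2 * star G (U.val.map x) + 2 * ∑ p ∈ L, G1 (x p)) ≤ 0 := by
    rw [← hhalf]
    linarith
  linarith

end
/-! ### Sums over the divisors of an integer -/

/-- The sum of `h` over the divisors of `n`. -/
def divSum (h : VecFun) (ℓ : ℝ) (n : ℕ) : ℝ := ∑ d ∈ n.divisors, onList h (logList ℓ d)

theorem monotone_log_div {ℓ : ℝ} (hℓ : 0 ≤ ℓ) : Monotone fun p : ℕ => Real.log p / ℓ := by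
  intro p q hpq
  refine div_le_div_of_nonneg_right ?_ hℓ
  rcases Nat.eq_zero_or_pos p with rfl | hp
  · simpa using Real.log_natCast_nonneg q
  · exact Real.log_le_log (by exact_mod_cast hp) (by exact_mod_cast hpq)

theorem sortedLE_logList {ℓ : ℝ} (hℓ : 0 ≤ ℓ) (n : ℕ) : (logList ℓ n).SortedLE :=
  (List.pairwise_map.2 ((Nat.primeFactorsList_sorted n).pairwise.imp fun h =>
    monotone_log_div hℓ h)).sortedLE

theorem primeFactorsList_prod_val {A : Finset ℕ} (hA : ∀ p ∈ A, p.Prime) :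
    (A.val.prod.primeFactorsList : Multiset ℕ) = A.val := by
  have h := primeFactorsList_prod (l := A.sort (· ≤ ·)) (fun p hp => hA p ((mem_sort _).1 hp))
    (pairwise_sort A _).sortedLE
  rw [← sort_eq A (· ≤ ·), Multiset.prod_coe, h]

/-- Squarefree divisors correspond to sets of distinct prime factors. -/
theorem sum_squarefree_divisors (h : VecFun) {ℓ : ℝ} (hℓ : 0 ≤ ℓ) {n : ℕ} (hn : n ≠ 0) :
    ∑ d ∈ n.divisors with Squarefree d, onList h (logList ℓ d) =
      star (multiVal h) (n.primeFactors.val.map fun p : ℕ => Real.log p / ℓ) := by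
  rw [Nat.sum_divisors_filter_squarefree hn, star_map]
  have : (UniqueFactorizationMonoid.normalizedFactors n).toFinset = n.primeFactors := by
    rw [Nat.factors_eq]
    rfl
  rw [this]
  refine sum_congr rfl fun A hA => ?_
  rw [onList_eq_multiVal h (sortedLE_logList hℓ _), logList, ← Multiset.map_coe,
    primeFactorsList_prod_val fun p hp => Nat.prime_of_mem_primeFactors (mem_powerset.1 hA hp)]

theorem divSum_of_squarefree (h : VecFun) {ℓ : ℝ} (hℓ : 0 ≤ ℓ) {n : ℕ} (hn : Squarefree n) :
    divSum h ℓ n = star (multiVal h) (n.primeFactors.val.map fun p : ℕ => Real.log p / ℓ) := by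
  rw [← sum_squarefree_divisors h hℓ hn.ne_zero, divSum,
    Nat.divisors_filter_squarefree_of_squarefree hn]

/-- The square of a prime divides `n` whose logarithm is at most `γ log n`. -/
def SmallSquare (P : Params) (n : ℕ) : Prop :=
  ∃ p : ℕ, p.Prime ∧ p * p ∣ n ∧ 2 * Real.log p ≤ P.γ * Real.log n

/-- A divisor `d` with nonzero value satisfies `d ≤ n ^ γ`. If it were not squarefree, then the
square of a prime dividing it would be at most `n ^ γ`. -/
theorem divSum_of_not_smallSquare {P : Params} {h : VecFun}
    (hG : ∀ k x, h k x ≠ 0 → x ∈ regionG1 P k) {n : ℕ} (hn : 1 < n) (hs : ¬SmallSquare P n) :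
    divSum h (Real.log n) n =
      star (multiVal h) (n.primeFactors.val.map fun p : ℕ => Real.log p / Real.log n) := by
  have hℓ : 0 < Real.log n := Real.log_pos (by exact_mod_cast hn)
  rw [← sum_squarefree_divisors h hℓ.le (by omega), sum_filter, divSum]
  refine sum_congr rfl fun d hd => ?_
  split_ifs with hd2
  · rfl
  · by_contra hne
    obtain ⟨hdn, hn0⟩ := Nat.mem_divisors.1 hd
    have hd0 : d ≠ 0 := ne_zero_of_dvd_ne_zero hn0 hdn
    rw [Nat.squarefree_iff_prime_squarefree] at hd2
    push Not at hd2
    obtain ⟨p, hp, hpd⟩ := hd2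
    refine hs ⟨p, hp, hpd.trans hdn, ?_⟩
    have h1 := sum_le_of_mem_regionG1 (hG _ _ hne)
    rw [sum_logList hd0, div_le_iff₀ hℓ] at h1
    have h2 : Real.log ((p * p : ℕ) : ℝ) ≤ Real.log d :=
      Real.log_le_log (by exact_mod_cast Nat.mul_pos hp.pos hp.pos)
        (by exact_mod_cast Nat.le_of_dvd (Nat.pos_of_ne_zero hd0) hpd)
    rw [Nat.cast_mul, Real.log_mul (by exact_mod_cast hp.ne_zero) (by exact_mod_cast hp.ne_zero)]
      at h2
    linarith

theorem abs_divSum_le {h : VecFun} {K : ℝ} (hK : ∀ k x, |h k x| ≤ K) (ℓ : ℝ) {n : ℕ} (hn : n ≠ 0) :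
    |divSum h ℓ n| ≤ K * 2 ^ n.primeFactorsList.length := by
  have hcard : #n.divisors ≤ 2 ^ n.primeFactorsList.length := by
    have : n.divisors.card ≤ n.primeFactorsList.sublists.toFinset.card := by
      refine card_le_card_of_injOn (fun d => d.primeFactorsList) (fun d hd => ?_) ?_
      · have hd' := Nat.mem_divisors.1 hd
        simp only [List.coe_toFinset, Set.mem_ofPred_eq, List.mem_sublists]
        exact Nat.primeFactorsList_sublist_of_dvd hd'.1 hn
      · intro d hd d' hd' h
        have h1 := ne_zero_of_dvd_ne_zero hn (Nat.mem_divisors.1 hd).1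
        have h2 := ne_zero_of_dvd_ne_zero hn (Nat.mem_divisors.1 hd').1
        rw [← Nat.prod_primeFactorsList h1, ← Nat.prod_primeFactorsList h2]
        exact congrArg List.prod h
    exact this.trans ((List.toFinset_card_le _).trans (List.length_sublists _).le)
  have hK0 : 0 ≤ K := (abs_nonneg _).trans (hK 0 ![])
  calc |divSum h ℓ n| ≤ ∑ d ∈ n.divisors, |onList h (logList ℓ d)| := abs_sum_le_sum_abs _ _
    _ ≤ ∑ d ∈ n.divisors, K := sum_le_sum fun d _ => hK _ _
    _ = #n.divisors * K := by rw [sum_const, nsmul_eq_mul]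
    _ ≤ (2 ^ n.primeFactorsList.length) * K :=
      mul_le_mul_of_nonneg_right (by exact_mod_cast hcard) hK0
    _ = _ := mul_comm _ _

/-! ### Integers whose vector of prime factors lies in the region -/

/-- The vector of the logarithms of the prime factors of `n` lies in `ℋ(P)`. -/
def CoagInt (P : Params) (n : ℕ) : Prop :=
  primeVec n.primeFactorsList.length n ∈ orderedH P n.primeFactorsList.length

theorem primeVec_eq {n : ℕ} (i : Fin n.primeFactorsList.length) :
    primeVec n.primeFactorsList.length n i = Real.log (n.primeFactorsList.get i : ℕ) / Real.log n := by
  simp [primeVec]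

theorem map_primeVec (n : ℕ) :
    univ.val.map (primeVec n.primeFactorsList.length n) = logList (Real.log n) n := by
  rw [logList, ← Multiset.map_coe, ← map_get_univ, Multiset.map_map]
  exact Multiset.map_congr rfl fun i _ => primeVec_eq i

theorem monotone_primeVec (n : ℕ) : Monotone (primeVec n.primeFactorsList.length n) := by
  intro i j hij
  rw [primeVec_eq, primeVec_eq]
  exact monotone_log_div (Real.log_natCast_nonneg n)
    ((Nat.primeFactorsList_sorted n).monotone_get hij)

theorem divSum_eq_oneStar (h : VecFun) {n : ℕ} (hn : Squarefree n) :
    divSum h (Real.log n) n = oneStar h _ (primeVec n.primeFactorsList.length n) := by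
  rw [oneStar_eq_star h (monotone_primeVec n), map_primeVec,
    divSum_of_squarefree h (Real.log_natCast_nonneg n) hn, logList, ← Multiset.map_coe]
  congr 2
  exact (Multiset.toFinset_val _).trans ((Multiset.coe_nodup.2
    ((Nat.squarefree_iff_nodup_primeFactorsList hn.ne_zero).1 hn)).dedup)

section
variable {P : Params} {n : ℕ}

theorem hasCoag_primeVec_iff :
    HasCoag P 0 (primeVec n.primeFactorsList.length n) ↔
      HasCoag P 0 (logList (Real.log n) n).get := by
  rw [← mcoag_map_iff, map_primeVec, mcoag_coe_iff]

theorem rough_iff (hn : 1 < n) : (∀ p ∈ n.primeFactors, (n : ℝ) ^ P.ν ≤ (p : ℕ)) ↔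
    ∀ i, P.ν ≤ primeVec n.primeFactorsList.length n i := by
  have hℓ : 0 < Real.log n := Real.log_pos (by exact_mod_cast hn)
  constructor
  · intro h i
    have hi : n.primeFactorsList.get i ∈ n.primeFactors :=
      List.mem_toFinset.2 (List.get_mem _ _)
    rw [primeVec_eq, le_div_iff₀ hℓ]
    exact (rpow_le_iff hn (Nat.prime_of_mem_primeFactors hi) _).1 (h _ hi)
  · intro h p hp
    obtain ⟨i, hi⟩ := List.mem_iff_get.1 (List.mem_toFinset.1 hp)
    rw [rpow_le_iff hn (Nat.prime_of_mem_primeFactors hp), ← hi, ← le_div_iff₀ hℓ, ← primeVec_eq]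
    exact h i

theorem two_le_length_iff (hn : 1 < n) : 2 ≤ n.primeFactorsList.length ↔ ¬n.Prime := by
  constructor
  · intro h hp
    rw [Nat.primeFactorsList_prime hp] at h
    simp at h
  · intro h
    by_contra hlt
    have h1 : n.primeFactorsList.length ≠ 0 := fun h0 => by
      rcases (Nat.primeFactorsList_eq_nil _).1 (List.length_eq_zero_iff.1 h0) with h | h <;> omega
    obtain ⟨p, hp⟩ := List.length_eq_one_iff.1 (show n.primeFactorsList.length = 1 by omega)
    have h2 := Nat.prod_primeFactorsList (n := n) (by omega)
    rw [hp, List.prod_singleton] at h2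
    exact h (h2 ▸ Nat.prime_of_mem_primeFactorsList (n := n) (by simp [hp]))

theorem coagInt_iff (hn : 1 < n) : CoagInt P n ↔ ¬n.Prime ∧
    (∀ p ∈ n.primeFactors, (n : ℝ) ^ P.ν ≤ (p : ℕ)) ∧ HasCoag P 0 (logList (Real.log n) n).get := by
  rw [← two_le_length_iff hn, rough_iff hn, ← hasCoag_primeVec_iff, ← mem_coagulations_iff]
  simp only [CoagInt, orderedH, regionH, Set.mem_ofPred_eq, monotone_primeVec, and_true]
  tauto

/-- The vector `(1)` is the total coagulation of any vector of the fundamental region; this uses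
that the region is nonempty. -/
theorem hasCoag_of_prime (hR : ∃ k, (fundRegion P k).Nonempty) (hn : n.Prime) :
    HasCoag P 0 (logList (Real.log n) n).get := by
  obtain ⟨k, x, hx⟩ := hR
  rw [← mcoag_coe_iff, logList, Nat.primeFactorsList_prime hn, List.map_singleton,
    div_self (Real.log_pos (by exact_mod_cast hn.one_lt)).ne']
  have : univ.val.map (fun _ : Unit => (1 : ℝ)) = ([1] : List ℝ) := rfl
  rw [← this, mcoag_map_iff]
  refine HasCoag.of_family (fun _ => zero_lt_one) (fun _ => some ()) x (fundRegion.inR0 hx) (by simp) (by simp) ?_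
  intro _
  simpa using hx.2.1

/-- The divisor `n` itself has the vector `(1)`, whose sum exceeds `γ`; only the divisor `1`
contributes. -/
theorem coagSum_of_prime (hP : P.Good) (hR : ∃ k, (fundRegion P k).Nonempty) {h : VecFun}
    (hG : ∀ k x, h k x ≠ 0 → x ∈ regionG1 P k) (hn : n.Prime) : coagSum P h n = h 0 ![] := by
  have hℓ : 0 < Real.log n := Real.log_pos (by exact_mod_cast hn.one_lt)
  have hv : primeVec n.primeFactorsList.length n = fun _ => 1 := by
    funext i
    have : ∀ p ∈ n.primeFactorsList, p = n := fun p hp => by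
      simpa [Nat.primeFactorsList_prime hn] using hp
    have := this _ (List.get_mem _ i)
    rw [primeVec_eq, this, div_self hℓ.ne']
  rw [coagSum, if_pos, hn.sum_divisors, add_comm]
  · have h1 : onList h (logList (Real.log n) n) = 0 := by
      by_contra hne
      have := sum_le_of_mem_regionG1 (hG _ _ hne)
      rw [sum_logList hn.ne_zero, div_self hℓ.ne'] at this
      linarith [hP.γ_lt]
    have h2 : onList h (logList (Real.log n) 1) = h 0 ![] := by
      refine vecFun_congr h (by simp [logList]) fun i => ?_
      have := i.2
      simp [logList] at this
    rw [h1, h2]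
    simp
  · refine ⟨(rough_iff hn.one_lt).2 fun i => ?_, hasCoag_of_prime hR hn⟩
    rw [hv]
    linarith [hP.ν_lt, hP.γ_pos]

open Classical in
theorem coagSum_eq (hP : P.Good) (hR : ∃ k, (fundRegion P k).Nonempty) {h : VecFun}
    (hG : ∀ k x, h k x ≠ 0 → x ∈ regionG1 P k) (hn : 1 < n) :
    coagSum P h n = (if n.Prime then h 0 ![] else 0) +
      if CoagInt P n then divSum h (Real.log n) n else 0 := by
  by_cases hp : n.Prime
  · rw [coagSum_of_prime hP hR hG hp, if_pos hp, if_neg fun h => ((coagInt_iff hn).1 h).1 hp,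
      add_zero]
  · rw [if_neg hp, zero_add, coagSum, divSum]
    refine if_congr ?_ rfl rfl
    rw [coagInt_iff hn]
    tauto

theorem CoagInt.length_le (hP : P.Good) (h : CoagInt P n) (hn : 1 < n) :
    (n.primeFactorsList.length : ℝ) ≤ 1 / P.ν := by
  have h1 := ((coagInt_iff hn).1 h).2.2.total
  have h2 := sum_le_sum fun i (_ : i ∈ univ) => h.1.2.1 i
  rw [zero_add, sum_logList (by omega)] at h1
  have h3 : ∑ i, primeVec n.primeFactorsList.length n i = 1 := by
    have := congrArg Multiset.sum (map_primeVec n)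
    rw [← h1, ← sum_logList (show n ≠ 0 by omega) (Real.log n)]
    refine this.trans ?_
    rw [← map_get_univ (logList (Real.log n) n)]
    rfl
  rw [h3, sum_const, card_univ, Fintype.card_fin, nsmul_eq_mul] at h2
  rwa [le_div_iff₀ hP.ν_pos]

end
-- The pointwise inequality for the approximating functions
open Classical in
/-- A bound for the error of approximation. -/
def cellErr (P : Params) (W : ∀ k, Finset ((Fin k → ℝ) × ℝ)) (K ε : ℝ) : VecFun := fun k x =>
  if x ∈ regionG1 P k then ε + (if OnPlanes (W k) x then 2 * K else 0) else 0

section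
variable {P : Params} {W : ∀ k, Finset ((Fin k → ℝ) × ℝ)} {K ε : ℝ}

theorem cellErr_nonneg (hK : 0 ≤ K) (hε : 0 ≤ ε) (k : ℕ) (x : Fin k → ℝ) :
    0 ≤ cellErr P W K ε k x := by
  unfold cellErr
  split_ifs <;> positivity

theorem simpleFun_cellErr (hP : P.Good) (hK : 0 ≤ K) (hε : 0 ≤ ε) :
    SimpleFun P (cellErr P W K ε) (ε + 2 * K) := by
  classical
  refine ⟨fun k => ?_, fun k x hx => ?_, fun k x => ?_⟩
  · have := (Semilin.regionG1 hP k).map₂ (Semilin.onPlanes (W k)) fun q r =>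
      (if q then ε + (if r then 2 * K else 0) else 0 : ℝ)
    unfold cellErr
    convert this
  · by_contra h
    exact hx (if_neg h)
  · rw [abs_of_nonneg (cellErr_nonneg hK hε k x)]
    unfold cellErr
    split_ifs <;> linarith

theorem abs_sub_le_cellErr {g h : VecFun} (hg : ∀ k x, g k x ≠ 0 → x ∈ regionG1 P k)
    (hgK : ∀ k x, Monotone x → |g k x| ≤ K) (hh : SimpleFun P h K) (hε : 0 ≤ ε)
    (happ : ∀ k x, Monotone x → x ∈ regionG1 P k → ¬OnPlanes (W k) x → |g k x - h k x| ≤ ε)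
    {k : ℕ} {x : Fin k → ℝ} (hx : Monotone x) : |g k x - h k x| ≤ cellErr P W K ε k x := by
  unfold cellErr
  by_cases hxG : x ∈ regionG1 P k
  · rw [if_pos hxG]
    split_ifs with hW
    · have := abs_sub (g k x) (h k x)
      linarith [hgK k x hx, hh.bound k x]
    · simpa using happ k x hx hxG hW
  · rw [if_neg hxG, not_not.1 fun h' => hxG (hg k x h'), not_not.1 fun h' => hxG (hh.supp k x h')]
    simp

end

theorem star_singleton (G : Multiset ℝ → ℝ) (y : ℝ) : star G {y} = G 0 + G {y} := by
  rw [← Multiset.cons_zero, star_cons, star_zero, star_zero]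

theorem sum_replicate_log {n : ℕ} (ℓ : ℝ) :
    ∑ p ∈ n.primeFactors, Multiset.replicate (n.factorization p) (Real.log p / ℓ) = logList ℓ n := by
  have h1 := Multiset.toFinset_sum_count_nsmul_eq (n.primeFactorsList : Multiset ℕ)
  rw [logList, ← Multiset.map_coe, ← h1]
  have h2 := map_sum (Multiset.mapAddMonoidHom fun p : ℕ => Real.log p / ℓ)
    (fun a => Multiset.count a (n.primeFactorsList : Multiset ℕ) • ({a} : Multiset ℕ))
    (n.primeFactorsList : Multiset ℕ).toFinset
  rw [Multiset.coe_mapAddMonoidHom] at h2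
  rw [h2]
  refine sum_congr rfl fun p _ => ?_
  rw [Multiset.coe_count, Nat.primeFactorsList_count_eq, Multiset.nsmul_singleton,
    Multiset.map_replicate]

theorem abs_divSum_sub_le {g h u : VecFun}
    (hu : ∀ k x, Monotone x → |g k x - h k x| ≤ u k x) {ℓ : ℝ} (hℓ : 0 ≤ ℓ) (n : ℕ) :
    |divSum g ℓ n - divSum h ℓ n| ≤ divSum u ℓ n := by
  rw [divSum, divSum, ← sum_sub_distrib]
  exact (abs_sum_le_sum_abs _ _).trans (sum_le_sum fun d _ =>
    hu _ _ (sortedLE_logList hℓ d).monotone_get)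

section
variable {P : Params} {g h u : VecFun} {σ K : ℝ}

/-- Up to the majorant `u`, `h` may be replaced by `g`. The divisor sum of `g` runs over the
distinct primes only, and `star_nonpos_of_repeated` gives its sign from the hypothesis on ℋ. -/
theorem divSum_le_of_not_smallSquare (hP : P.Good) (hg : ∀ k x, g k x ≠ 0 → x ∈ regionG1 P k)
    (hh : SimpleFun P h K) (huG : ∀ k x, u k x ≠ 0 → x ∈ regionG1 P k) (hu0 : ∀ k x, 0 ≤ u k x)
    (hu : ∀ k x, Monotone x → |g k x - h k x| ≤ u k x)
    (hhalf : (fun _ => 1 / 2) ∈ regionG1 P 1 → 2 * K ≤ u 1 fun _ => 1 / 2)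
    (hσ : σ = 1 ∨ σ = -1) (hH : ∀ k x, x ∈ regionH P k → σ * oneStar g k x ≤ 0) {n : ℕ}
    (hn : 1 < n) (hc : CoagInt P n) (hs : ¬SmallSquare P n) :
    σ * divSum h (Real.log n) n ≤ divSum u (Real.log n) n := by
  have hℓ : 0 < Real.log n := Real.log_pos (by exact_mod_cast hn)
  have hσ1 : |σ| = 1 := by rcases hσ with rfl | rfl <;> simp
  have hdiff : σ * divSum h (Real.log n) n ≤
      σ * divSum g (Real.log n) n + divSum u (Real.log n) n := by
    have h1 := abs_divSum_sub_le hu hℓ.le n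
    have h2 : σ * divSum h (Real.log n) n - σ * divSum g (Real.log n) n ≤
        |divSum g (Real.log n) n - divSum h (Real.log n) n| := by
      rw [← mul_sub, abs_sub_comm]
      refine (le_abs_self _).trans ?_
      rw [abs_mul, hσ1, one_mul]
    linarith
  obtain ⟨-, hr, hcoag⟩ := (coagInt_iff hn).1 hc
  have hm : MCoag P (∑ p ∈ n.primeFactors,
      Multiset.replicate (n.factorization p) (Real.log p / Real.log n)) := by
    rw [sum_replicate_log, mcoag_coe_iff]
    exact hcoag
  -- The case `n = p ^ 2` is apart: merging the two equal components would leave the vector `(1)`,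
  -- which is not in ℋ.
  by_cases hsq : ∃ p ∈ n.primeFactors, n.factorization p = 2 ∧ n.primeFactors = {p}
  · obtain ⟨p, hp, hp2, hD⟩ := hsq
    have hpp := Nat.prime_of_mem_primeFactors hp
    have hlog : Real.log n = 2 * Real.log p := by
      have h1 := Nat.prod_factorization_pow_eq_self (n := n) (by omega)
      rw [Finsupp.prod, Nat.support_factorization, hD, prod_singleton, hp2] at h1
      rw [← h1, Nat.cast_pow, Real.log_pow]
      norm_num
    have hlp : 0 < Real.log p := Real.log_pos (by exact_mod_cast hpp.one_lt)
    have hx : Real.log p / Real.log n = 1 / 2 := by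
      rw [hlog]
      field_simp
    have hval : ∀ f : VecFun, (∀ k x, f k x ≠ 0 → x ∈ regionG1 P k) →
        divSum f (Real.log n) n = f 0 ![] + f 1 fun _ => 1 / 2 := fun f hf => by
      rw [divSum_of_not_smallSquare hf hn hs, hD, singleton_val, Multiset.map_singleton, hx,
        star_singleton, eq_multiVal f (x := ![]) fun i => i.elim0,
        eq_multiVal f (x := fun _ : Fin 1 => 1 / 2) fun _ _ _ => le_rfl]
      simp
    -- If `(1 / 2)` lies in 𝒢₁, then `u` is at least `2 K` there and outweighs the two terms of the
    -- divisor sum. Otherwise only `g(∅)` is left, and this is also the value of `1 ⋆ g` at `(1 / 2,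
    -- 1 / 2)`, a member of ℋ.
    by_cases hG : (fun _ => 1 / 2) ∈ regionG1 P 1
    · rw [hval u huG, hval h hh.supp]
      have h1 := le_abs_self (σ * (h 0 ![] + h 1 fun _ => 1 / 2))
      rw [abs_mul, hσ1, one_mul] at h1
      have h2 := abs_add_le (h 0 ![]) (h 1 fun _ => 1 / 2)
      linarith [hh.bound 0 ![], hh.bound 1 fun _ => 1 / 2, hhalf hG, hu0 0 ![]]
    · have hg1 : (g 1 fun _ => 1 / 2) = 0 := by_contra fun h' => hG (hg _ _ h')
      rw [hD, sum_singleton, hp2, hx] at hm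
      have h1 := star_nonpos_of_mcoag hH hm (fun y hy => by
        rw [Multiset.eq_of_mem_replicate hy, ← hx, le_div_iff₀ hℓ]
        exact (rpow_le_iff hn hpp _).1 (hr p hp)) (by simp)
      have h2 : Multiset.replicate 2 (1 / 2 : ℝ) = (1 / 2) ::ₘ {1 / 2} := rfl
      have h3 : multiVal g ((1 / 2) ::ₘ {1 / 2}) = 0 := by
        by_contra h'
        have := (multiVal_ne_zero hg hP h').1
        rw [Multiset.sum_cons, Multiset.sum_singleton] at this
        linarith [hP.γ_lt]
      have h4 : multiVal g {1 / 2} = 0 := by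
        rw [← hg1, eq_multiVal g (x := fun _ : Fin 1 => 1 / 2) fun _ _ _ => le_rfl]
        simp
      have h5 : multiVal g 0 = g 0 ![] := by
        rw [eq_multiVal g (x := ![]) fun i => i.elim0]
        simp
      rw [h2, star_cons, star_singleton, star_singleton, h3, Multiset.cons_zero, h4, h5] at h1
      rw [hval g hg, hg1] at hdiff
      linarith
  · have h1 := star_nonpos_of_repeated hP hg hH hm (fun p hp => by
      rw [le_div_iff₀ hℓ]
      exact (rpow_le_iff hn (Nat.prime_of_mem_primeFactors hp) _).1 (hr p hp))
      (fun p hp => (Nat.prime_of_mem_primeFactors hp).factorization_pos_of_dvd (by omega)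
        (Nat.dvd_of_mem_primeFactors hp))
      (fun p hp h2 => by
        by_contra hle
        refine hs ⟨p, Nat.prime_of_mem_primeFactors hp, ?_, ?_⟩
        · rw [← sq]
          exact ((Nat.prime_of_mem_primeFactors hp).pow_dvd_iff_le_factorization (by omega)).2 h2
        · rwa [not_lt, ← mul_div_assoc, div_le_iff₀ hℓ] at hle)
      (by
        have := congrArg Multiset.card (sum_replicate_log (n := n) (Real.log n))
        rw [Multiset.card_sum, Multiset.coe_card, logList, List.length_map] at this
        simp only [Multiset.card_replicate] at this
        rw [this]
        exact hc.1.2.2)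
      fun p hp h2 hD => hsq ⟨p, hp, h2, hD⟩
    rw [divSum_of_not_smallSquare hg hn hs] at hdiff
    linarith

-- Integers divisible by the square of a small prime get the trivial bound: at most `1 / ν` prime
-- factors, hence at most `2 ^ ⌊1 / ν⌋` divisors.
open Classical in
theorem divSum_le (hP : P.Good) (hg : ∀ k x, g k x ≠ 0 → x ∈ regionG1 P k)
    (hh : SimpleFun P h K) (huG : ∀ k x, u k x ≠ 0 → x ∈ regionG1 P k) (hu0 : ∀ k x, 0 ≤ u k x)
    (hu : ∀ k x, Monotone x → |g k x - h k x| ≤ u k x)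
    (hhalf : (fun _ => 1 / 2) ∈ regionG1 P 1 → 2 * K ≤ u 1 fun _ => 1 / 2)
    (hσ : σ = 1 ∨ σ = -1) (hH : ∀ k x, x ∈ regionH P k → σ * oneStar g k x ≤ 0) {n : ℕ}
    (hn : 1 < n) (hc : CoagInt P n) :
    σ * divSum h (Real.log n) n ≤ divSum u (Real.log n) n +
      K * 2 ^ ⌊1 / P.ν⌋₊ * if SmallSquare P n then 1 else 0 := by
  split_ifs with hs
  · have h1 := abs_divSum_le hh.bound (Real.log n) (n := n) (by omega)
    have h2 : K * 2 ^ n.primeFactorsList.length ≤ K * 2 ^ ⌊1 / P.ν⌋₊ :=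
      mul_le_mul_of_nonneg_left (pow_le_pow_right₀ one_le_two (Nat.le_floor (hc.length_le hP hn)))
        ((abs_nonneg _).trans (hh.bound 0 ![]))
    have h3 : σ * divSum h (Real.log n) n ≤ |divSum h (Real.log n) n| := by
      rcases hσ with rfl | rfl
      · rw [one_mul]
        exact le_abs_self _
      · rw [neg_one_mul]
        exact neg_le_abs _
    have h4 : 0 ≤ divSum u (Real.log n) n := sum_nonneg fun d _ => hu0 _ _
    linarith
  · rw [mul_zero, add_zero]
    exact divSum_le_of_not_smallSquare hP hg hh huG hu0 hu hhalf hσ hH hn hc hs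

end
-- Integrals of the approximating functions and sums of `b`
theorem one_lt_of_mem_window {x : ℝ} (hx : 2 ≤ x) {n : ℕ} (hn : n ∈ window x) : 1 < n := by
  have := ((mem_window (by linarith) n).1 hn).1
  have : (1 : ℝ) < n := by linarith
  exact_mod_cast this

theorem isAff_subvec {k : ℕ} (A : Finset (Fin k)) (i : Fin A.card) :
    IsAff fun x : Fin k → ℝ => subvec x A i := IsAff.coord _

theorem Semilin.oneStar {h : VecFun} (hh : ∀ k, Semilin (h k)) (k : ℕ) :
    Semilin (oneStar h k) := by
  have : Semilin fun (x : Fin k → ℝ) (A : Finset (Fin k)) => h A.card (subvec x A) :=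
    Semilin.pi fun A => (hh A.card).comp (isAff_subvec A)
  exact this.map fun f => ∑ A, f A

theorem abs_oneStar_le {f : VecFun} {C : ℝ} {k : ℕ} {x : Fin k → ℝ}
    (hf : ∀ A : Finset (Fin k), |f A.card (subvec x A)| ≤ C) : |oneStar f k x| ≤ 2 ^ k * C := by
  refine (abs_sum_le_sum_abs _ _).trans ((sum_le_sum fun A _ => hf A).trans (le_of_eq ?_))
  simp [sum_const]

section
variable {P : Params} {W : ∀ k, Finset ((Fin k → ℝ) × ℝ)} {K ε : ℝ}

theorem sum_eq_one_of_mem_orderedH {k : ℕ} {x : Fin k → ℝ} (hx : x ∈ orderedH P k) :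
    ∑ i, x i = 1 := by
  simpa using (mem_coagulations_iff.1 hx.1.1).total

-- A linear condition on a proper subvector has coefficient `0` at some other component and a
-- nonzero coefficient within, so it is not proportional to the equation `∑ xᵢ = 1`; its solutions
-- form a null set.
open MeasureTheory in
theorem ae_not_onPlanes_subvec (hW : ∀ k, ∀ l ∈ W k, l.1 ≠ 0) (m : ℕ) :
    ∀ᵐ u : Fin m → ℝ, ∀ A : Finset (Fin (m + 1)), A ≠ univ →
      ¬OnPlanes (W A.card) (subvec (hyperplanePoint u) A) := by
  refine ae_all_iff.2 fun A => ?_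
  by_cases hA : A = univ
  · exact Filter.Eventually.of_forall fun _ h => absurd hA h
  have : ∀ᵐ u : Fin m → ℝ, ∀ l : W A.card,
      ∑ i, l.1.1 i * subvec (hyperplanePoint u) A i ≠ l.1.2 := by
    refine ae_all_iff.2 fun l => ?_
    set c : Fin (m + 1) → ℝ := Function.extend (A.orderEmbOfFin rfl) l.1.1 0 with hc
    have hinj := (A.orderEmbOfFin (rfl : A.card = A.card)).injective
    have hsum : ∀ x : Fin (m + 1) → ℝ, ∑ i, l.1.1 i * subvec x A i = ∑ j, c j * x j := fun x => by
      rw [← sum_subset (subset_univ (univ.map (A.orderEmbOfFin rfl).toEmbedding)), sum_map]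
      · refine sum_congr rfl fun i _ => ?_
        simp only [hc, RelEmbedding.coe_toEmbedding, hinj.extend_apply]
        rfl
      · intro j _ hj
        rw [hc, Function.extend_apply' _ _ _ fun ⟨i, hi⟩ => hj (by simp [← hi])]
        simp
    have hne : ∃ i j, c i ≠ c j := by
      obtain ⟨i, hi⟩ := Function.ne_iff.1 (hW _ l.1 l.2)
      obtain ⟨j, hj⟩ : ∃ j, j ∉ A := by
        by_contra! h
        exact hA (eq_univ_of_forall h)
      refine ⟨A.orderEmbOfFin rfl i, j, ?_⟩
      rw [hc, hinj.extend_apply, Function.extend_apply' _ _ _ fun ⟨i', hi'⟩ =>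
        hj (hi' ▸ orderEmbOfFin_mem A rfl i')]
      exact hi
    rw [ae_iff]
    simp only [not_not, hsum]
    exact volume_hyperplane_eq_zero hne _
  filter_upwards [this] with u hu _
  rintro ⟨l, hl, hl'⟩
  exact hu ⟨l, hl⟩ hl'

/-- Almost every vector has no proper subvector on an exceptional plane. The full vector has sum `1
> γ`, so it lies outside 𝒢₁ and contributes nothing. -/
theorem ae_oneStar_le (hP : P.Good) (hW : ∀ k, ∀ l ∈ W k, l.1 ≠ 0) (hε : 0 ≤ ε) {f : VecFun}
    (hG : ∀ k x, f k x ≠ 0 → x ∈ regionG1 P k)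
    (hf : ∀ k x, Monotone x → x ∈ regionG1 P k → ¬OnPlanes (W k) x → |f k x| ≤ ε) (m : ℕ) :
    ∀ᵐ u : Fin m → ℝ, hyperplanePoint u ∈ orderedH P (m + 1) →
      |oneStar f (m + 1) (hyperplanePoint u)| ≤ 2 ^ (m + 1) * ε := by
  filter_upwards [ae_not_onPlanes_subvec hW m] with u hu hH
  refine abs_oneStar_le fun A => ?_
  by_cases h0 : f A.card (subvec (hyperplanePoint u) A) = 0
  · rwa [h0, abs_zero]
  refine hf _ _ (subvec_monotone hH.2 A) (hG _ _ h0) (hu A fun hA => ?_)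
  have := sum_le_of_mem_regionG1 (hG _ _ h0)
  rw [sum_subvec, hA, sum_eq_one_of_mem_orderedH hH] at this
  linarith [hP.γ_lt]

theorem oneStar_sub (f h : VecFun) {k : ℕ} (x : Fin k → ℝ) :
    oneStar (fun k x => f k x - h k x) k x = oneStar f k x - oneStar h k x :=
  sum_sub_distrib _ _

/-- The sum of the integrals of `(1 ⋆ h)(x) / ∏ xᵢ`. -/
def starIntegral (P : Params) (h : VecFun) : ℝ :=
  ∑ k ∈ Icc 2 ⌊1 / P.ν⌋₊, hyperplaneIntegral k (orderedH P k) (sieveIntegrand h k)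

/-- A function on the set `𝒢₁` that is bounded on ordered vectors and approximated by simple
functions. -/
structure Approximable (P : Params) (W : ∀ k, Finset ((Fin k → ℝ) × ℝ)) (K : ℝ) (g : VecFun) :
    Prop where
  planes : ∀ k, ∀ l ∈ W k, l.1 ≠ 0
  supp : ∀ k x, g k x ≠ 0 → x ∈ regionG1 P k
  bound : ∀ k x, Monotone x → |g k x| ≤ K
  approx : ∀ ε : ℝ, 0 < ε → ∃ h : VecFun, SimpleFun P h K ∧ h 0 ![] = g 0 ![] ∧
    ∀ k x, Monotone x → x ∈ regionG1 P k → ¬OnPlanes (W k) x → |g k x - h k x| ≤ ε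

theorem sub_supp {g h : VecFun} (hg : ∀ k x, g k x ≠ 0 → x ∈ regionG1 P k) (hh : SimpleFun P h K)
    (k : ℕ) (x : Fin k → ℝ) (hne : g k x - h k x ≠ 0) : x ∈ regionG1 P k := by
  by_contra hx
  rw [not_not.1 fun h' => hx (hg k x h'), not_not.1 fun h' => hx (hh.supp k x h')] at hne
  simp at hne

-- The function `g` need not be measurable on the boundaries of its polytopes. It is measurable up
-- to null sets, as an almost everywhere limit of functions of signs.
open MeasureTheory in
theorem Approximable.aestronglyMeasurable (hP : P.Good) {g : VecFun} (hg : Approximable P W K g)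
    (m : ℕ) : AEStronglyMeasurable (fun u : Fin m → ℝ => oneStar g (m + 1) (hyperplanePoint u))
      (volume.restrict {u : Fin m → ℝ | hyperplanePoint u ∈ orderedH P (m + 1)}) := by
  choose h hh _ hgh using fun j : ℕ => hg.approx (1 / (j + 1)) (by positivity)
  refine aestronglyMeasurable_of_tendsto_ae Filter.atTop
    (f := fun j (u : Fin m → ℝ) => oneStar (h j) (m + 1) (hyperplanePoint u))
    (fun j => Semilin.aestronglyMeasurable_hyperplane (Semilin.oneStar (hh j).semilin _) _) ?_
  have hae : ∀ᵐ u : Fin m → ℝ, ∀ j : ℕ, hyperplanePoint u ∈ orderedH P (m + 1) →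
      |oneStar (fun k x => g k x - h j k x) (m + 1) (hyperplanePoint u)| ≤
        2 ^ (m + 1) * (1 / ((j : ℝ) + 1)) := ae_all_iff.2 fun j =>
    ae_oneStar_le hP hg.planes (by positivity) (sub_supp hg.supp (hh j)) (hgh j) m
  refine (ae_restrict_iff' (Semilin.measurableSet_hyperplane (Semilin.orderedH hP _))).2 ?_
  filter_upwards [hae] with u hu hH
  refine tendsto_iff_dist_tendsto_zero.2 (squeeze_zero
    (g := fun j : ℕ => 2 ^ (m + 1) * (1 / ((j : ℝ) + 1))) (fun _ => dist_nonneg) (fun j => ?_) ?_)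
  · rw [dist_comm, Real.dist_eq, ← oneStar_sub]
    exact hu j hH
  · simpa using (tendsto_one_div_add_atTop_nhds_zero_nat (𝕜 := ℝ)).const_mul (2 ^ (m + 1))

theorem Approximable.hyperplaneIntegrable (hP : P.Good) {g : VecFun} (hg : Approximable P W K g)
    (m : ℕ) : HyperplaneIntegrable (m + 1) (orderedH P (m + 1)) (sieveIntegrand g (m + 1)) :=
  (hyperplane_bound hP.ν_pos (fun x hx => hx.1.2.1)
    (Semilin.measurableSet_hyperplane (Semilin.orderedH hP _)) (hg.aestronglyMeasurable hP m)
    (C := 2 ^ (m + 1) * K)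
    (mul_nonneg (by positivity) ((abs_nonneg _).trans (hg.bound 0 ![] fun i => i.elim0)))
    (Filter.Eventually.of_forall fun _ hu =>
      abs_oneStar_le fun A => hg.bound _ _ (subvec_monotone hu.2 A))).1

theorem SimpleFun.approximable (hW : ∀ k, ∀ l ∈ W k, l.1 ≠ 0) {h : VecFun} (hh : SimpleFun P h K) :
    Approximable P W K h :=
  ⟨hW, hh.supp, fun k x _ => hh.bound k x, fun ε hε => ⟨h, hh, rfl, fun k x _ _ _ => by
    simpa using hε.le⟩⟩

theorem abs_starIntegral_le (hP : P.Good) (hW : ∀ k, ∀ l ∈ W k, l.1 ≠ 0) (hε : 0 ≤ ε)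
    {f : VecFun} (hG : ∀ k x, f k x ≠ 0 → x ∈ regionG1 P k)
    (hf : ∀ k x, Monotone x → x ∈ regionG1 P k → ¬OnPlanes (W k) x → |f k x| ≤ ε)
    (hm : ∀ m, MeasureTheory.AEStronglyMeasurable
      (fun u : Fin m → ℝ => oneStar f (m + 1) (hyperplanePoint u))
      (MeasureTheory.volume.restrict {u : Fin m → ℝ | hyperplanePoint u ∈ orderedH P (m + 1)})) :
    |starIntegral P f| ≤ (∑ k ∈ Icc 2 ⌊1 / P.ν⌋₊, 2 ^ k * (1 / P.ν) ^ k) * ε := by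
  rw [sum_mul]
  refine (abs_sum_le_sum_abs _ _).trans (sum_le_sum fun k hk => ?_)
  obtain ⟨m, rfl⟩ : ∃ m, k = m + 1 := ⟨k - 1, by have := (mem_Icc.1 hk).1; omega⟩
  have := (hyperplane_bound hP.ν_pos (fun x hx => hx.1.2.1)
    (Semilin.measurableSet_hyperplane (Semilin.orderedH hP _)) (hm m) (by positivity)
    (ae_oneStar_le hP hW hε hG hf m)).2
  refine this.trans (le_of_eq ?_)
  ring

theorem starIntegral_sub (hP : P.Good) {g h : VecFun} {K' : ℝ} (hg : Approximable P W K g)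
    (hh : Approximable P W K' h) :
    starIntegral P (fun k x => g k x - h k x) = starIntegral P g - starIntegral P h := by
  rw [starIntegral, starIntegral, starIntegral, ← sum_sub_distrib]
  refine sum_congr rfl fun k hk => ?_
  obtain ⟨m, rfl⟩ : ∃ m, k = m + 1 := ⟨k - 1, by have := (mem_Icc.1 hk).1; omega⟩
  simp only [hyperplaneIntegral]
  rw [← MeasureTheory.integral_sub (hg.hyperplaneIntegrable hP m) (hh.hyperplaneIntegrable hP m)]
  simp only [sieveIntegrand, oneStar_sub, sub_div]

/-! ### The sums of `b` -/

theorem sum_coagInt_eq (hP : P.Good) {x : ℝ} (hx : 2 ≤ x) (F : ℕ → ℝ) :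
    open Classical in ∑ n ∈ window x with CoagInt P n, F n = ∑ k ∈ Icc 2 ⌊1 / P.ν⌋₊,
      ∑ n ∈ (window x).filter (fun n => n.primeFactorsList.length = k ∧
        primeVec k n ∈ orderedH P k), F n := by
  classical
  rw [← sum_fiberwise_of_maps_to (g := fun n => n.primeFactorsList.length)
    (t := Icc 2 ⌊1 / P.ν⌋₊)]
  · refine sum_congr rfl fun k _ => sum_congr ?_ fun _ _ => rfl
    ext n
    simp only [mem_filter, and_assoc]
    refine and_congr_right fun _ => ?_
    constructor
    · rintro ⟨h, rfl⟩
      exact ⟨rfl, h⟩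
    · rintro ⟨rfl, h⟩
      exact ⟨h, rfl⟩
  · intro n h
    obtain ⟨h1, h2⟩ := mem_filter.1 h
    exact mem_Icc.2 ⟨h2.1.2.2, Nat.le_floor (h2.length_le hP (one_lt_of_mem_window hx h1))⟩

/-- Integers are grouped by the number `k ≤ 1 / ν` of their prime factors, and each group is
evaluated on sign cells. -/
theorem exists_bound_sum_coagInt (hP : P.Good) {f : ∀ k, (Fin k → ℝ) → ℝ}
    (hf : ∀ k, Semilin (f k)) : ∃ M : ℝ, 0 ≤ M ∧ ∀ (B x : ℝ) (b : ℕ → ℝ), GenPNT P B x b → 2 ≤ x →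
      0 ≤ primeSum x b →
      |(open Classical in ∑ n ∈ window x with CoagInt P n, b n * f _ (primeVec n.primeFactorsList.length n)) -
        primeSum x b * ∑ k ∈ Icc 2 ⌊1 / P.ν⌋₊,
          hyperplaneIntegral k (orderedH P k) (fun u => f k u / ∏ i, u i)| ≤
        primeSum x b * (M / B) := by
  classical
  have key : ∀ k : Icc 2 ⌊1 / P.ν⌋₊, _ := fun k => exists_genPNT_semilin hP (mem_Icc.1 k.2).1
    ((Nat.cast_le.2 (mem_Icc.1 k.2).2).trans (Nat.floor_le (by have := hP.ν_pos; positivity)))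
    (hf k)
  choose M hM0 hM using key
  refine ⟨∑ k, M k, sum_nonneg fun k _ => hM0 k, fun B x b hb hx hS => ?_⟩
  choose E hE hE2 using fun k => hM k B x b hb
  rw [sum_coagInt_eq hP hx, ← sum_coe_sort (Icc 2 ⌊1 / P.ν⌋₊) (fun k => hyperplaneIntegral k _ _),
    ← sum_coe_sort (Icc 2 ⌊1 / P.ν⌋₊)]
  have h1 : ∀ k : Icc 2 ⌊1 / P.ν⌋₊, ∑ n ∈ (window x).filter (fun n =>
      n.primeFactorsList.length = (k : ℕ) ∧ primeVec k n ∈ orderedH P k),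
        b n * f _ (primeVec n.primeFactorsList.length n) = primeSum x b *
          (hyperplaneIntegral k (orderedH P k) (fun u => f k u / ∏ i, u i) + E k) := fun k => by
    rw [← hE2 k]
    refine sum_congr (by congr!) fun n hn => ?_
    rw [(mem_filter.1 hn).2.1]
  rw [sum_congr rfl fun k _ => h1 k, ← mul_sum, ← mul_sub, ← sum_sub_distrib, abs_mul,
    abs_of_nonneg hS, sum_div]
  refine mul_le_mul_of_nonneg_left ((abs_sum_le_sum_abs _ _).trans (sum_le_sum fun k _ => ?_)) hS
  rw [add_sub_cancel_left]
  exact hE k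

/-- The contribution of integers that are not squarefree. -/
theorem exists_bound_not_squarefree (hP : P.Good) : ∃ M : ℝ, 0 ≤ M ∧
    ∀ (B x : ℝ) (b : ℕ → ℝ), GenPNT P B x b → 2 ≤ x → (∀ n, 0 ≤ b n) →
      (open Classical in ∑ n ∈ window x with CoagInt P n, b n * if Squarefree n then 0 else 1) ≤
        primeSum x b * (M / B) := by
  classical
  -- Integers that are not squarefree have two equal components. The vectors with this property form
  -- a null set, so the main term vanishes.
  let f : ∀ k, (Fin k → ℝ) → ℝ := fun k x => if ∃ i j, i ≠ j ∧ x i = x j then 1 else 0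
  have hf : ∀ k, Semilin (f k) := fun k => by
    have : Semilin fun x : Fin k → ℝ => ∃ i j, i ≠ j ∧ x i = x j :=
      Semilin.ex fun i => Semilin.ex fun j => (Semilin.const (i ≠ j)).and
        (Semilin.eq (IsAff.coord i) (IsAff.coord j))
    have h' := this.map fun q : Prop => if q then (1 : ℝ) else 0
    simp only [f]
    convert h'
  obtain ⟨M, hM0, hM⟩ := exists_bound_sum_coagInt hP hf
  refine ⟨M, hM0, fun B x b hb hx hb0 => ?_⟩
  have hS : 0 ≤ primeSum x b := sum_nonneg fun n _ => hb0 n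
  have hint : ∑ k ∈ Icc 2 ⌊1 / P.ν⌋₊,
      hyperplaneIntegral k (orderedH P k) (fun u => f k u / ∏ i, u i) = 0 := by
    refine sum_eq_zero fun k hk => ?_
    obtain ⟨m, rfl⟩ : ∃ m, k = m + 1 := ⟨k - 1, by have := (mem_Icc.1 hk).1; omega⟩
    have hae : ∀ᵐ u : Fin m → ℝ, hyperplanePoint u ∈ orderedH P (m + 1) →
        |f (m + 1) (hyperplanePoint u)| ≤ 0 := by
      have : ∀ᵐ u : Fin m → ℝ, ∀ i j : Fin (m + 1), i ≠ j →
          hyperplanePoint u i ≠ hyperplanePoint u j := by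
        refine MeasureTheory.ae_all_iff.2 fun i => MeasureTheory.ae_all_iff.2 fun j => ?_
        by_cases hij : i = j
        · exact Filter.Eventually.of_forall fun _ h => absurd hij h
        have hv := volume_hyperplane_eq_zero (c := Pi.single i 1 - Pi.single j 1)
          ⟨i, j, by simp [hij, Ne.symm hij]; norm_num⟩ 0
        have hset : {u : Fin m → ℝ | ¬(i ≠ j → hyperplanePoint u i ≠ hyperplanePoint u j)} =
            {u | ∑ i', (Pi.single i 1 - Pi.single j 1 : Fin (m + 1) → ℝ) i' *
              hyperplanePoint u i' = 0} := by
          ext u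
          simp [hij, sub_mul, sum_sub_distrib, Pi.single_apply, sub_eq_zero]
        rw [MeasureTheory.ae_iff, hset, hv]
      filter_upwards [this] with u hu _
      have : ¬∃ i j, i ≠ j ∧ hyperplanePoint u i = hyperplanePoint u j := fun ⟨i, j, h1, h2⟩ =>
        hu i j h1 h2
      simp [f, this]
    have := (hyperplane_bound hP.ν_pos (fun x hx => hx.1.2.1)
      (Semilin.measurableSet_hyperplane (Semilin.orderedH hP _))
      (Semilin.aestronglyMeasurable_hyperplane (hf _) _) le_rfl hae).2
    rw [zero_mul] at this
    exact abs_eq_zero.1 (le_antisymm this (abs_nonneg _))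
  have := hM B x b hb hx hS
  rw [hint, mul_zero, sub_zero] at this
  refine le_trans (sum_le_sum fun n hn => ?_) ((le_abs_self _).trans this)
  refine mul_le_mul_of_nonneg_left ?_ (hb0 n)
  split_ifs with hsq
  · simp only [f]
    split_ifs <;> norm_num
  · have hn1 := one_lt_of_mem_window hx (mem_filter.1 hn).1
    rw [Nat.squarefree_iff_nodup_primeFactorsList (by omega), List.nodup_iff_injective_get] at hsq
    simp only [Function.Injective, not_forall] at hsq
    obtain ⟨i, j, h1, h2⟩ := hsq
    have : ∃ i j, i ≠ j ∧ primeVec n.primeFactorsList.length n i =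
        primeVec n.primeFactorsList.length n j := ⟨i, j, h2, by rw [primeVec_eq, primeVec_eq, h1]⟩
    simp only [f, if_pos this, le_refl]

/-- For squarefree `n` the divisor sum is the value of `1 ⋆ h` at the vector of `n`. For the other
`n` both are bounded, and `exists_bound_not_squarefree` makes their contribution small. -/
theorem exists_bound_divSum (hP : P.Good) {h : VecFun} (hh : SimpleFun P h K) :
    ∃ M : ℝ, 0 ≤ M ∧ ∀ (B x : ℝ) (b : ℕ → ℝ), GenPNT P B x b → 2 ≤ x → (∀ n, 0 ≤ b n) →
      |(open Classical in ∑ n ∈ window x with CoagInt P n, b n * divSum h (Real.log n) n) -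
        primeSum x b * starIntegral P h| ≤ primeSum x b * (M / B) := by
  classical
  obtain ⟨M, hM0, hM⟩ := exists_bound_sum_coagInt hP fun k => Semilin.oneStar hh.semilin k
  obtain ⟨M', hM'0, hM'⟩ := exists_bound_not_squarefree hP
  have hK : 0 ≤ K := (abs_nonneg _).trans (hh.bound 0 ![])
  set C := 2 * (K * 2 ^ ⌊1 / P.ν⌋₊) with hC
  have hC0 : 0 ≤ C := by positivity
  refine ⟨M + C * M', by positivity, fun B x b hb hx hb0 => ?_⟩
  have hS : 0 ≤ primeSum x b := sum_nonneg fun n _ => hb0 n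
  have h1 := hM B x b hb hx hS
  have h2 := hM' B x b hb hx hb0
  have h3 : |∑ n ∈ window x with CoagInt P n, b n * divSum h (Real.log n) n -
      ∑ n ∈ window x with CoagInt P n, b n * oneStar h _ (primeVec n.primeFactorsList.length n)| ≤
      C * ∑ n ∈ window x with CoagInt P n, b n * if Squarefree n then 0 else 1 := by
    rw [← sum_sub_distrib, mul_sum]
    refine (abs_sum_le_sum_abs _ _).trans (sum_le_sum fun n hn => ?_)
    obtain ⟨hnx, hc⟩ := mem_filter.1 hn
    have hn1 := one_lt_of_mem_window hx hnx
    rw [← mul_sub, abs_mul, abs_of_nonneg (hb0 n), mul_left_comm]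
    refine mul_le_mul_of_nonneg_left ?_ (hb0 n)
    split_ifs with hsq
    · rw [divSum_eq_oneStar h hsq, sub_self, abs_zero, mul_zero]
    · have hp : (2 : ℝ) ^ n.primeFactorsList.length ≤ 2 ^ ⌊1 / P.ν⌋₊ :=
        pow_le_pow_right₀ one_le_two (Nat.le_floor (hc.length_le hP hn1))
      have h4 := abs_divSum_le hh.bound (Real.log n) (n := n) (by omega)
      have h5 := abs_oneStar_le (x := primeVec n.primeFactorsList.length n) fun A => hh.bound _ _
      have h6 := abs_sub (divSum h (Real.log n) n)
        (oneStar h _ (primeVec n.primeFactorsList.length n))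
      have h7 := mul_le_mul_of_nonneg_left hp hK
      rw [hC]
      linarith
  have h4 := mul_le_mul_of_nonneg_left h2 hC0
  refine (abs_sub_le _ _ _).trans ((add_le_add (h3.trans h4) h1).trans (le_of_eq ?_))
  ring

end
-- Small square factors and error terms
section
variable {P : Params} {B x : ℝ} {w : ℕ → ℝ}

theorem sum_one_div_sq_le {z : ℝ} (hz : 0 < z) {N : ℕ} {A : Finset ℕ}
    (hA : ∀ p ∈ A, z ≤ p ∧ p ≤ N) : ∑ p ∈ A, 1 / ((p : ℝ) * p) ≤ (1 + Real.log N) / z := by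
  have h1 : ∀ p ∈ A, 1 / ((p : ℝ) * p) ≤ (1 / z) * (p : ℝ)⁻¹ := fun p hp => by
    have hp0 : (0 : ℝ) < p := hz.trans_le (hA p hp).1
    rw [one_div, mul_inv, one_div]
    exact mul_le_mul_of_nonneg_right (inv_anti₀ hz (hA p hp).1) (by positivity)
  have h2 : A ⊆ Icc 1 N := fun p hp => by
    have : (0 : ℝ) < p := hz.trans_le (hA p hp).1
    exact mem_Icc.2 ⟨by exact_mod_cast this, (hA p hp).2⟩
  have h3 := harmonic_le_one_add_log N
  rw [harmonic_eq_sum_Icc] at h3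
  push_cast at h3
  calc ∑ p ∈ A, 1 / ((p : ℝ) * p) ≤ ∑ p ∈ A, (1 / z) * (p : ℝ)⁻¹ := sum_le_sum h1
    _ = (1 / z) * ∑ p ∈ A, (p : ℝ)⁻¹ := (mul_sum _ _ _).symm
    _ ≤ (1 / z) * ∑ p ∈ Icc 1 N, (p : ℝ)⁻¹ := mul_le_mul_of_nonneg_left
        (sum_le_sum_of_subset_of_nonneg h2 fun _ _ _ => by positivity) (by positivity)
    _ ≤ (1 / z) * (1 + Real.log N) := mul_le_mul_of_nonneg_left h3 (by positivity)
    _ = _ := by ring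

/-- The multiples of an integer in the window. -/
theorem sum_abs_multiples_le {y : ℝ} (hx : 0 ≤ x) (hy : 0 ≤ y) (hw : ∀ n ∈ window x, -y ≤ w n) {m : ℕ}
    (hm : 0 < m) : ∑ n ∈ window x with m ∣ n, |w n| ≤
      |∑ n ∈ (Icc 1 ⌊x⌋₊).filter (fun n : ℕ => x / 2 < (m : ℝ) * n ∧ (m : ℝ) * n ≤ x), w (m * n)| +
        2 * y * (x * (1 / m)) := by
  have hm0 : (0 : ℝ) < m := by exact_mod_cast hm
  set T := (Icc 1 ⌊x⌋₊).filter (fun n : ℕ => x / 2 < (m : ℝ) * n ∧ (m : ℝ) * n ≤ x)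
  have himg : (window x).filter (fun n => m ∣ n) = T.image fun n => m * n := by
    ext n
    simp only [mem_filter, mem_image, T, mem_Icc, mem_window hx]
    constructor
    · rintro ⟨⟨h1, h2⟩, k, rfl⟩
      push_cast at h1 h2
      have hk : 1 ≤ k := by
        rcases Nat.eq_zero_or_pos k with rfl | hk
        · simp at h1
          linarith
        · exact hk
      refine ⟨k, ⟨⟨hk, Nat.le_floor (le_trans ?_ h2)⟩, h1, h2⟩, rfl⟩
      exact le_mul_of_one_le_left (by positivity) (by exact_mod_cast hm)
    · rintro ⟨k, ⟨-, h1, h2⟩, rfl⟩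
      exact ⟨⟨by exact_mod_cast h1, by exact_mod_cast h2⟩, dvd_mul_right _ _⟩
  rw [himg, sum_image fun a _ b _ h => Nat.eq_of_mul_eq_mul_left hm h]
  have hcard : (#T : ℝ) ≤ x * (1 / m) := by
    have h1 : T ⊆ Icc 1 ⌊x * (1 / m)⌋₊ := fun n hn => by
      obtain ⟨h1, -, h2⟩ := mem_filter.1 hn
      refine mem_Icc.2 ⟨(mem_Icc.1 h1).1, Nat.le_floor ?_⟩
      rw [mul_one_div, le_div_iff₀ hm0]
      linarith
    refine le_trans ?_ (Nat.floor_le (by positivity))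
    have := card_le_card h1
    rw [Nat.card_Icc, Nat.add_sub_cancel] at this
    exact_mod_cast this
  -- The lower bound for `w` trades absolute values for the signed sum, which the Type I bound
  -- controls.
  have habs : ∀ n ∈ T, |w (m * n)| ≤ w (m * n) + 2 * y := fun n hn => by
    have h1 := (mem_filter.1 hn).2
    have h2 := hw (m * n) ((mem_window hx _).2 (by exact_mod_cast h1))
    refine abs_le.2 ⟨by linarith, by linarith⟩
  calc ∑ n ∈ T, |w (m * n)| ≤ ∑ n ∈ T, (w (m * n) + 2 * y) := sum_le_sum habs
    _ = ∑ n ∈ T, w (m * n) + 2 * y * #T := by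
      rw [sum_add_distrib, sum_const, nsmul_eq_mul, mul_comm (#T : ℝ)]
    _ ≤ _ := add_le_add (le_abs_self _) (mul_le_mul_of_nonneg_left hcard (by positivity))

open Classical in
/-- The contribution of the integers divisible by the square of a prime of moderate size. -/
theorem sum_smallSquare_le (hw : Balanced P B x w) (hB : 0 ≤ B) {y : ℝ} (hy : 0 ≤ y)
    (hlow : ∀ n ∈ window x, -y ≤ w n) :
    ∑ n ∈ window x with CoagInt P n, |w n| * (if SmallSquare P n then 1 else 0) ≤
      x / Real.log x ^ B + 2 * y * (x * ((1 + Real.log x) / (x / 2) ^ P.ν)) := by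
  have hx8 := hw.eight_le
  have hP := hw.good
  have hx0 : 0 ≤ x := by linarith
  set z := (x / 2) ^ P.ν with hz
  have hz0 : 0 < z := Real.rpow_pos_of_pos (by linarith) _
  set A := (Icc 1 ⌊x⌋₊).filter fun p : ℕ => z ≤ p ∧ p * p ≤ ⌊x ^ P.γ⌋₊ with hA
  have hApos : ∀ p ∈ A, 0 < p * p := fun p hp => by
    have := (mem_Icc.1 (mem_filter.1 hp).1).1
    positivity
  -- The prime whose square divides `n` is at least `z` because `n` has only large primes, and its
  -- square is at most `x ^ γ`, so that it is an admissible Type I modulus.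
  have hcover : ∀ n ∈ window x, CoagInt P n → SmallSquare P n → ∃ p ∈ A, p * p ∣ n := by
    rintro n hn hc ⟨p, hp, hpn, hle⟩
    have hn1 := one_lt_of_mem_window (by linarith) hn
    have hnx := (mem_window hx0 n).1 hn
    have hn0 : (0 : ℝ) < n := by positivity
    have hpd : p ∣ n := dvd_of_mul_left_dvd hpn
    have hpz : z ≤ p := (Real.rpow_le_rpow (by linarith) hnx.1.le hP.ν_pos.le).trans
      (((coagInt_iff hn1).1 hc).2.1 p (Nat.mem_primeFactors.2 ⟨hp, hpd, by omega⟩))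
    refine ⟨p, mem_filter.2 ⟨mem_Icc.2 ⟨hp.one_le, Nat.le_floor (le_trans ?_ hnx.2)⟩, hpz,
      Nat.le_floor ?_⟩, hpn⟩
    · exact_mod_cast Nat.le_of_dvd (by omega) hpd
    · have hp0 : (0 : ℝ) < p := by exact_mod_cast hp.pos
      refine le_trans ?_ (Real.rpow_le_rpow hn0.le hnx.2 hP.γ_pos.le)
      rw [← Real.log_le_log_iff (by exact_mod_cast Nat.mul_pos hp.pos hp.pos)
        (Real.rpow_pos_of_pos hn0 _), Real.log_rpow hn0, Nat.cast_mul,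
        Real.log_mul hp0.ne' hp0.ne']
      linarith
  have h1 : ∑ n ∈ window x with CoagInt P n, |w n| * (if SmallSquare P n then 1 else 0) ≤
      ∑ p ∈ A, ∑ n ∈ window x with p * p ∣ n, |w n| := by
    simp only [sum_filter]
    rw [sum_comm]
    refine sum_le_sum fun n hn => ?_
    have hnn : ∀ p ∈ A, 0 ≤ if p * p ∣ n then |w n| else 0 := fun p _ => by split_ifs <;> simp
    split_ifs with hc hs
    · obtain ⟨p, hp, hpn⟩ := hcover n hn hc hs
      have := single_le_sum hnn hp
      rw [if_pos hpn] at this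
      rwa [mul_one]
    · rw [mul_zero]
      exact sum_nonneg hnn
    · exact sum_nonneg hnn
  have h2 := hw.type_one (fun _ => 1) fun _ => ⌊x⌋₊
  set F : ℕ → ℝ := fun m => |∑ n ∈ (Icc 1 ⌊x⌋₊).filter
    (fun n : ℕ => x / 2 < (m : ℝ) * n ∧ (m : ℝ) * n ≤ x), w (m * n)| with hF
  have h3 : ∑ p ∈ A, F (p * p) ≤ x / Real.log x ^ B := by
    refine le_trans ?_ h2
    rw [← sum_image (s := A) (g := fun p => p * p) (f := F) fun a _ b _ h =>
      Nat.mul_self_inj.1 h]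
    refine (sum_le_sum_of_subset_of_nonneg (t := Icc 1 ⌊x ^ P.γ⌋₊) ?_ fun _ _ _ =>
      abs_nonneg _).trans (sum_le_sum fun m hm => ?_)
    · intro m hm
      obtain ⟨p, hp, rfl⟩ := mem_image.1 hm
      exact mem_Icc.2 ⟨hApos p hp, (mem_filter.1 hp).2.2⟩
    · exact le_mul_of_one_le_left (abs_nonneg _)
        (Real.one_le_rpow (one_le_tau (by have := (mem_Icc.1 hm).1; omega)) hB)
  have hfl : ⌊x⌋₊ ≠ 0 := (Nat.floor_pos.2 (by linarith)).ne'
  have h4 := sum_one_div_sq_le hz0 (A := A) fun p hp =>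
    ⟨(mem_filter.1 hp).2.1, (mem_Icc.1 (mem_filter.1 hp).1).2⟩
  have h5 : (1 + Real.log ⌊x⌋₊) / z ≤ (1 + Real.log x) / z := by
    refine div_le_div_of_nonneg_right (add_le_add_right (Real.log_le_log ?_ (Nat.floor_le hx0)) _)
      hz0.le
    exact_mod_cast Nat.pos_of_ne_zero hfl
  calc _ ≤ ∑ p ∈ A, ∑ n ∈ window x with p * p ∣ n, |w n| := h1
    _ ≤ ∑ p ∈ A, (F (p * p) + 2 * y * (x * (1 / ((p : ℝ) * p)))) := sum_le_sum fun p hp => by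
      have := sum_abs_multiples_le hx0 hy hlow (hApos p hp)
      simpa only [hF, Nat.cast_mul] using this
    _ = ∑ p ∈ A, F (p * p) + 2 * y * (x * ∑ p ∈ A, 1 / ((p : ℝ) * p)) := by
      rw [sum_add_distrib, mul_sum, mul_sum]
    _ ≤ _ := add_le_add h3 (mul_le_mul_of_nonneg_left
      (mul_le_mul_of_nonneg_left (h4.trans h5) hx0) (by positivity))

open Classical in
/-- The sum over primes in terms of the sum over other coagulations. -/
theorem SimpleFun.exists_bound (hP : P.Good) (hR : ∃ k, (fundRegion P k).Nonempty) {h : VecFun}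
    {K : ℝ} (hK : 0 < K) (hh : SimpleFun P h K) : ∃ A : ℕ, ∀ (B x : ℝ) (w : ℕ → ℝ),
      Balanced P B x w → A ≤ B → |h 0 ![] * primeSum x w +
        ∑ n ∈ window x with CoagInt P n, w n * divSum h (Real.log n) n| ≤ K * errBd A B x := by
  obtain ⟨A, hA⟩ := exists_bound_coagSum hP (h := fun k x => h k x / K)
    (fun k => (hh.semilin k).map fun r => r / K)
    (fun k x => by rw [abs_div, abs_of_pos hK, div_le_one hK]; exact hh.bound k x)
    fun k x hne => hh.supp k x fun h0 => hne (by simp [h0])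
  refine ⟨A, fun B x w hw hAB => ?_⟩
  have h1 := hA B x w hw hAB
  have hx8 := hw.eight_le
  have h2 : ∑ n ∈ Icc 1 ⌊x⌋₊, w n * coagSum P (fun k x => h k x / K) n =
      (h 0 ![] * primeSum x w + ∑ n ∈ window x with CoagInt P n,
        w n * divSum h (Real.log n) n) / K := by
    have hsub : window x ⊆ Icc 1 ⌊x⌋₊ := fun n hn => by
      have := mem_Ioc.1 hn
      exact mem_Icc.2 ⟨by omega, this.2⟩
    rw [← sum_subset hsub]
    · rw [primeSum, sum_filter, sum_filter, mul_sum, ← sum_add_distrib, sum_div]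
      refine sum_congr rfl fun n hn => ?_
      have hd : ∀ ℓ, divSum (fun k x => h k x / K) ℓ n = divSum h ℓ n / K := fun ℓ =>
        (sum_div _ _ _).symm
      rw [coagSum_eq hP hR (fun k x hne => hh.supp k x fun h0 => hne (by simp [h0]))
        (one_lt_of_mem_window (by linarith) hn), hd]
      split_ifs <;> ring
    · intro n _ hn
      have : w n = 0 := by
        by_contra hne
        exact hn ((mem_window (by linarith) n).2 (hw.supp n hne))
      rw [this, zero_mul]
  rwa [h2, abs_div, abs_of_pos hK, div_le_iff₀ hK, mul_comm (errBd A B x)] at h1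

-- The factor `(x / 2) ^ ν` in the denominator comes from the sum of `1 / p ^ 2` over primes `p ≥ (x
-- / 2) ^ ν`; it beats the lower bound `-x ^ (ν / 10)` for `w` by a power of `x`.
open Filter in
theorem eventually_errors_le {ν : ℝ} (hν : 0 < ν) (ϖ : ℝ) {η : ℝ} (hη : 0 < η) :
    ∀ᶠ x : ℝ in atTop, x / Real.log x ^ (ϖ + 1) ≤ η * (x / Real.log x ^ ϖ) ∧
      2 * x ^ (ν / 10) * (x * ((1 + Real.log x) / (x / 2) ^ ν)) ≤ η * (x / Real.log x ^ ϖ) := by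
  have h1 := Real.tendsto_log_atTop.eventually_ge_atTop (max 1 (1 / η))
  have h2 := (isLittleO_log_rpow_rpow_atTop (ϖ + 1) (by positivity : 0 < ν * (9 / 10))).bound
    (c := η / (4 * 2 ^ ν)) (by positivity)
  filter_upwards [h1, h2, eventually_gt_atTop 0] with x h1 h2 hx
  have hL1 : 1 ≤ Real.log x := (le_max_left _ _).trans h1
  have hL : 0 < Real.log x := by linarith
  have hLp : 0 < Real.log x ^ ϖ := Real.rpow_pos_of_pos hL _
  constructor
  · rw [Real.rpow_add_one hL.ne', ← div_div, div_le_iff₀ hL]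
    have : 1 ≤ η * Real.log x := by
      have := (div_le_iff₀ hη).1 ((le_max_right _ _).trans h1)
      linarith
    have hq : 0 ≤ x / Real.log x ^ ϖ := by positivity
    nlinarith
  · rw [Real.norm_of_nonneg (by positivity), Real.norm_of_nonneg (by positivity),
      Real.rpow_add_one hL.ne'] at h2
    have hsplit : x ^ ν = x ^ (ν / 10) * x ^ (ν * (9 / 10)) := by
      rw [← Real.rpow_add hx]
      ring_nf
    have ha : 0 < x ^ (ν / 10) := Real.rpow_pos_of_pos hx _
    have hb : 0 < x ^ (ν * (9 / 10)) := Real.rpow_pos_of_pos hx _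
    have h2p : (0 : ℝ) < 2 ^ ν := by positivity
    rw [Real.div_rpow hx.le zero_le_two, hsplit]
    set G := x ^ (ν * (9 / 10))
    rw [div_mul_eq_mul_div, le_div_iff₀ (by positivity)] at h2
    have h3 : (1 + Real.log x) * Real.log x ^ ϖ * (2 * 2 ^ ν) ≤ η * G := by
      refine le_trans ?_ h2
      have : (1 + Real.log x) * Real.log x ^ ϖ ≤ 2 * (Real.log x ^ ϖ * Real.log x) := by nlinarith
      nlinarith
    have h4 : 2 * x ^ (ν / 10) * (x * ((1 + Real.log x) /
        (x ^ (ν / 10) * G / 2 ^ ν))) =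
        x * ((1 + Real.log x) * (2 * 2 ^ ν)) / G := by
      field_simp
    rw [h4, ← mul_div_assoc, div_le_div_iff₀ hb hLp]
    nlinarith

end

/-! ### The sieve inequality and the constants -/

open Classical in
/-- The sieve inequality, with a sign. -/
theorem exists_sieve_bound {P : Params} (hP : P.Good) (hR : ∃ k, (fundRegion P k).Nonempty)
    {g : VecFun} (hg : g ∈ ClassG1 P) (hg1 : g 0 ![] = 1) {σ : ℝ} (hσ : σ = 1 ∨ σ = -1)
    (hH : ∀ k x, x ∈ regionH P k → σ * oneStar g k x ≤ 0) {δ : ℝ} (hδ : 0 < δ) {ϖ : ℝ}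
    (hϖ : 1 < ϖ) : ∃ B : ℝ, 0 < B ∧ ∃ x₀ : ℝ, ∀ x : ℝ, x₀ ≤ x → ∀ a b : ℕ → ℝ,
      InPsi P B ϖ x a b →
        σ * sieveConstant P g * primeSum x b - δ * primeSum x b ≤ σ * primeSum x a := by
  obtain ⟨W, K, hK, hW, hhalf, hgK, happ⟩ := exists_approx hP hg
  have hgG : ∀ k x, g k x ≠ 0 → x ∈ regionG1 P k := fun k x h => by_contra fun h' =>
    h (hg.2.1 k x h')
  have hgA : Approximable P W K g := ⟨hW, hgG, hgK, happ⟩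
  have hσ1 : |σ| = 1 := by rcases hσ with rfl | rfl <;> simp
  have hσle : ∀ t, σ * t ≤ |t| := fun t => (le_abs_self _).trans (by rw [abs_mul, hσ1, one_mul])
  set CI := ∑ k ∈ Icc 2 ⌊1 / P.ν⌋₊, 2 ^ k * (1 / P.ν) ^ k with hCI
  have hCI0 : 0 ≤ CI := sum_nonneg fun k _ => by have := hP.ν_pos; positivity
  -- The approximation costs `CI ε` for the integral of `h`, `CI ε` for that of `u` and `ε` for
  -- `u(∅)`: together a quarter of `δ`. The error of the generalized prime number theorem and the
  -- remaining errors take a quarter each.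
  set ε := δ / (4 * (2 * CI + 1)) with hε
  have hε0 : 0 < ε := by positivity
  obtain ⟨h, hh, hh0, hgh⟩ := happ ε hε0
  set u := cellErr P W K ε with hu
  have hus : SimpleFun P u (ε + 2 * K) := simpleFun_cellErr hP hK.le hε0.le
  have hu0 : ∀ k x, 0 ≤ u k x := cellErr_nonneg hK.le hε0.le
  have hclose : ∀ k x, Monotone x → |g k x - h k x| ≤ u k x := fun k x hx =>
    abs_sub_le_cellErr hgG hgK hh hε0.le hgh hx
  have hupl : ∀ k x, x ∈ regionG1 P k → ¬OnPlanes (W k) x → u k x = ε := fun k x hx hx' => by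
    simp [hu, cellErr, hx, hx']
  have hu00 : u 0 ![] ≤ ε := by
    have : ¬OnPlanes (W 0) ![] := fun ⟨l, hl, _⟩ => hW 0 l hl (Subsingleton.elim _ _)
    by_cases h0 : (![] : Fin 0 → ℝ) ∈ regionG1 P 0
    · exact (hupl 0 _ h0 this).le
    · have h' : u 0 ![] = 0 := if_neg h0
      rw [h']
      exact hε0.le
  have hpoint := fun (n : ℕ) (hn : 1 < n) (hc : CoagInt P n) => divSum_le hP hgG hh hus.supp hu0
    hclose (fun hG => by
      have : OnPlanes (W 1) fun _ => 1 / 2 := ⟨_, hhalf, by simp⟩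
      simp only [hu, cellErr, if_pos hG, if_pos this]
      linarith) hσ hH hn hc
  have hIh : |starIntegral P g - starIntegral P h| ≤ CI * ε := by
    rw [← starIntegral_sub hP hgA (hh.approximable hW)]
    refine abs_starIntegral_le hP hW hε0.le (sub_supp hgG hh) hgh fun m => ?_
    simp only [oneStar_sub]
    exact (hgA.aestronglyMeasurable hP m).sub ((hh.approximable hW).aestronglyMeasurable hP m)
  have hIu : |starIntegral P u| ≤ CI * ε :=
    abs_starIntegral_le hP hW hε0.le hus.supp (fun k x _ hx hx' => by
      rw [hupl k x hx hx', abs_of_pos hε0])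
      ((hus.approximable hW).aestronglyMeasurable hP)
  obtain ⟨A₁, hA₁⟩ := hh.exists_bound hP hR hK
  obtain ⟨A₂, hA₂⟩ := hus.exists_bound hP hR (by positivity)
  obtain ⟨M₁, hM₁0, hM₁⟩ := exists_bound_divSum hP hh
  obtain ⟨M₂, hM₂0, hM₂⟩ := exists_bound_divSum hP hus
  obtain ⟨M₃, hM₃0, hM₃⟩ := exists_bound_not_squarefree hP
  set C := K * 2 ^ ⌊1 / P.ν⌋₊ with hC
  have hC0 : 0 ≤ C := by positivity
  set M := M₁ + M₂ + C * M₃ with hM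
  have hM0 : 0 ≤ M := by positivity
  set Q := K * A₁ + (ε + 2 * K) * A₂ + 2 * C with hQ
  have hQ0 : 0 ≤ Q := by positivity
  -- The first terms make the errors smaller than the sum of `b` over primes by a factor `log x`, in
  -- view of its lower bound `x / (log x) ^ ϖ`; the last one makes `M / B` at most `δ / 4`.
  set B := A₁ + A₂ + ϖ + 1 + 4 * M / δ with hB
  have hMδ : 0 ≤ 4 * M / δ := by positivity
  have hA₁0 : (0 : ℝ) ≤ A₁ := Nat.cast_nonneg _
  have hA₂0 : (0 : ℝ) ≤ A₂ := Nat.cast_nonneg _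
  have hBϖ : ϖ + 1 ≤ B := by linarith
  have hB0 : 0 < B := by linarith
  obtain ⟨x₀, hx₀⟩ := Filter.eventually_atTop.1 (eventually_errors_le hP.ν_pos ϖ
    (η := δ / (4 * (Q + 1))) (by positivity))
  refine ⟨B, hB0, max x₀ 8, fun x hx a b hab => ?_⟩
  have hx8 : 8 ≤ x := (le_max_right _ _).trans hx
  obtain ⟨hE1, hE2⟩ := hx₀ x ((le_max_left _ _).trans hx)
  set w : ℕ → ℝ := fun n => a n - b n with hw
  set S := primeSum x b with hS
  have hbal : Balanced P B x w := by
    refine ⟨hP, hx8, fun n hn => ?_, hab.type_one, hab.type_two⟩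
    by_contra h'
    exact hn (by simp [hw, hab.supp_a n h', hab.supp_b n h'])
  have hL : 1 ≤ Real.log x := by
    rw [Real.le_log_iff_exp_le (by linarith)]
    linarith [Real.exp_one_lt_d9]
  have hS0 : 0 ≤ S := sum_nonneg fun n _ => hab.nonneg_b n
  have hSa : 0 ≤ primeSum x a := sum_nonneg fun n _ => hab.nonneg_a n
  set Y := x / Real.log x ^ (ϖ + 1) with hY
  have herr : ∀ A : ℕ, A + ϖ + 1 ≤ B → errBd A B x ≤ A * Y := fun A hA => by
    rw [errBd, hY, mul_assoc, ← Real.rpow_natCast, mul_div_assoc']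
    refine mul_le_mul_of_nonneg_left ?_ (Nat.cast_nonneg _)
    rw [div_le_div_iff₀ (by positivity) (by positivity), mul_right_comm, ← Real.rpow_add (by
      linarith), mul_comm x]
    exact mul_le_mul_of_nonneg_right (Real.rpow_le_rpow_of_exponent_le hL (by linarith))
      (by linarith)
  have hw1 := (hA₁ B x w hbal (by linarith)).trans
    (mul_le_mul_of_nonneg_left (herr A₁ (by linarith)) hK.le)
  have hw2 := (hA₂ B x w hbal (by linarith)).trans
    (mul_le_mul_of_nonneg_left (herr A₂ (by linarith)) (by positivity))
  have hw3 := sum_smallSquare_le hbal hB0.le (Real.rpow_nonneg (by linarith) _) hab.growth.2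
  have hYB : x / Real.log x ^ B ≤ Y := div_le_div_of_nonneg_left (by linarith) (by positivity)
    (Real.rpow_le_rpow_of_exponent_le hL hBϖ)
  have hb1 := hM₁ B x b hab.gen_pnt (by linarith) hab.nonneg_b
  have hb2 := hM₂ B x b hab.gen_pnt (by linarith) hab.nonneg_b
  have hb3 := hM₃ B x b hab.gen_pnt (by linarith) hab.nonneg_b
  set V := (window x).filter fun n => CoagInt P n with hV
  set j : ℕ → ℝ := fun n => if SmallSquare P n then 1 else 0 with hj
  have hj0 : ∀ n, 0 ≤ j n := fun n => by
    simp only [hj]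
    split_ifs <;> norm_num
  have hj1 : ∀ n, j n ≤ if Squarefree n then 0 else 1 := fun n => by
    simp only [hj]
    split_ifs with h1 h2
    · obtain ⟨p, hp, hpn, -⟩ := h1
      exact absurd hpn (Nat.squarefree_iff_prime_squarefree.1 h2 p hp)
    all_goals norm_num
  have hprime : primeSum x w = primeSum x a - S := sum_sub_distrib _ _
  have hsplit : ∀ f : ℕ → ℝ, ∑ n ∈ V, w n * f n = ∑ n ∈ V, a n * f n - ∑ n ∈ V, b n * f n :=
    fun f => by
      rw [← sum_sub_distrib]
      exact sum_congr rfl fun n _ => sub_mul _ _ _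
  -- Here `a ≥ 0` enters. The sums of `a` on the right cannot be evaluated directly; the first is
  -- compared with the corresponding sum of `b` by the identity for `u`, and the second by the bound
  -- for small squares.
  have ha1 : σ * ∑ n ∈ V, a n * divSum h (Real.log n) n ≤
      ∑ n ∈ V, a n * divSum u (Real.log n) n + C * ∑ n ∈ V, a n * j n := by
    rw [mul_sum, mul_sum, ← sum_add_distrib]
    refine sum_le_sum fun n hn => ?_
    obtain ⟨hnw, hc⟩ := mem_filter.1 hn
    have := mul_le_mul_of_nonneg_left (hpoint n (one_lt_of_mem_window (by linarith) hnw) hc)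
      (hab.nonneg_a n)
    linarith
  have ha2 : ∑ n ∈ V, a n * j n ≤ S * (M₃ / B) + ∑ n ∈ V, |w n| * j n := by
    refine le_trans ?_ (add_le_add_left hb3 _)
    rw [← sum_add_distrib]
    refine sum_le_sum fun n _ => ?_
    have h1 := mul_le_mul_of_nonneg_left (hj1 n) (hab.nonneg_b n)
    have h2 := mul_le_mul_of_nonneg_right (le_abs_self (w n)) (hj0 n)
    have h3 : w n * j n = a n * j n - b n * j n := sub_mul _ _ _
    linarith
  rw [hprime, hsplit, hh0, hg1, one_mul] at hw1
  rw [hprime, hsplit] at hw2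
  have hBM : S * (M₁ / B) + S * (M₂ / B) + C * (S * (M₃ / B)) ≤ S * (δ / 4) := by
    have : M / B ≤ δ / 4 := by
      rw [div_le_iff₀ hB0]
      have h1 : M = δ / 4 * (4 * M / δ) := by field_simp
      have h2 : 4 * M / δ ≤ B := by linarith
      calc M = δ / 4 * (4 * M / δ) := h1
        _ ≤ δ / 4 * B := mul_le_mul_of_nonneg_left h2 (by positivity)
    calc _ = S * (M / B) := by
          rw [hM]
          ring
      _ ≤ _ := mul_le_mul_of_nonneg_left this hS0
  have hεS : S * ((2 * CI + 1) * ε) = S * (δ / 4) := by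
    rw [hε]
    field_simp
  have hη : (Q + 1) * (δ / (4 * (Q + 1)) * (x / Real.log x ^ ϖ)) ≤ S * (δ / 4) := by
    have h1 := hab.primes_lower
    have h2 : (Q + 1) * (δ / (4 * (Q + 1)) * (x / Real.log x ^ ϖ)) =
        x / Real.log x ^ ϖ * (δ / 4) := by
      field_simp
    rw [h2]
    exact mul_le_mul_of_nonneg_right h1 (by positivity)
  set q := δ / (4 * (Q + 1)) * (x / Real.log x ^ ϖ) with hq
  have hq0 : 0 ≤ q := by positivity
  have hQq : K * (A₁ * Y) + (ε + 2 * K) * (A₂ * Y) + C * (2 * q) ≤ Q * q := by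
    have h1 : K * (A₁ * Y) ≤ K * (A₁ * q) := by gcongr
    have h2 : (ε + 2 * K) * (A₂ * Y) ≤ (ε + 2 * K) * (A₂ * q) := by gcongr
    rw [hQ]
    linarith
  have hw3' : C * ∑ n ∈ V, |w n| * j n ≤ C * (q + q) := mul_le_mul_of_nonneg_left (hw3.trans (add_le_add (hYB.trans hE1) hE2)) hC0
  have ha2' := mul_le_mul_of_nonneg_left ha2 hC0
  have hsc : sieveConstant P g = 1 + starIntegral P g := rfl
  -- The chain behind the final linear arithmetic: the identity for `h` (`t3`) relates the primes of
  -- `a` and `b` to the sums over ℋ; the sum of `b` is evaluated (`t1`) and `h` replaced by `g` in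
  -- the integral (`t2`). The sum of `a` against `u` is passed to `b` (`t4`), where it is small
  -- (`t5`, `t6`). The identity for `u` also contains `u(∅)` times the difference of the prime sums;
  -- its part with `a` has a favourable sign (`t7`) and its part with `b` is small (`t8`).
  have t1 := (hσle (S * starIntegral P h - ∑ n ∈ V, b n * divSum h (Real.log n) n)).trans
    ((abs_sub_comm _ _).trans_le hb1)
  have t2 := mul_le_mul_of_nonneg_left ((hσle _).trans hIh) hS0
  have t3 := (hσle _).trans ((abs_neg _).trans_le hw1)
  have t4 := (le_abs_self _).trans hw2
  have t5 := (le_abs_self _).trans hb2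
  have t6 := mul_le_mul_of_nonneg_left ((le_abs_self _).trans hIu) hS0
  have t7 := mul_nonneg (hu0 0 ![]) hSa
  have t8 := mul_le_mul_of_nonneg_right hu00 hS0
  have t9 := mul_nonneg hS0 hδ.le
  rw [← hS] at t1 t5
  rw [hsc]
  linarith

/-- The constant itself need not be admissible; it is enough that all smaller ones are. -/
theorem le_Cminus {P : Params} {c : ℝ} (h : ∀ δ : ℝ, 0 < δ → LowerAdmissible P (c - δ)) :
    (c : EReal) ≤ Cminus P := by
  refine le_of_forall_lt fun y hy => ?_
  obtain ⟨r, hr1, hr2⟩ := EReal.lt_iff_exists_real_btwn.1 hy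
  have hr := h (c - r) (sub_pos.2 (EReal.coe_lt_coe_iff.1 hr2))
  rw [sub_sub_cancel] at hr
  exact hr1.trans_le (le_sSup ⟨r, hr, rfl⟩)

theorem Cplus_le {P : Params} {c : ℝ} (h : ∀ δ : ℝ, 0 < δ → UpperAdmissible P (c + δ)) :
    Cplus P ≤ (c : EReal) := by
  refine le_of_forall_gt fun y hy => ?_
  obtain ⟨r, hr1, hr2⟩ := EReal.lt_iff_exists_real_btwn.1 hy
  have hr := h (r - c) (sub_pos.2 (EReal.coe_lt_coe_iff.1 hr1))
  rw [add_sub_cancel] at hr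
  exact (show Cplus P ≤ r from sInf_le ⟨r, hr, rfl⟩).trans_lt hr2

end PrimeSieve
end

theorem mainTheorem10 (P : PrimeSieve.Params) (hP : P.InQ0)
    (hR : ∃ k : ℕ, (PrimeSieve.fundRegion P k).Nonempty)
    (g : PrimeSieve.VecFun) (hg : g ∈ PrimeSieve.ClassG1 P) (hg1 : g 0 ![] = 1) :
    (∀ k ∈ Finset.Icc 2 ⌊1 / P.ν⌋₊,
      PrimeSieve.HyperplaneIntegrable k (PrimeSieve.orderedH P k)
        (PrimeSieve.sieveIntegrand g k)) ∧
    ((∀ (k : ℕ) (x : Fin k → ℝ), x ∈ PrimeSieve.regionH P k → PrimeSieve.oneStar g k x ≤ 0) →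
      ((PrimeSieve.sieveConstant P g : ℝ) : EReal) ≤ PrimeSieve.Cminus P) ∧
    ((∀ (k : ℕ) (x : Fin k → ℝ), x ∈ PrimeSieve.regionH P k → 0 ≤ PrimeSieve.oneStar g k x) →
      PrimeSieve.Cplus P ≤ ((PrimeSieve.sieveConstant P g : ℝ) : EReal)) := by
  have hG := hP.good hR
  obtain ⟨W, K, -, hW, -, hgK, happ⟩ := PrimeSieve.exists_approx hG hg
  have hgA : PrimeSieve.Approximable P W K g :=
    ⟨hW, fun k x h => by_contra fun h' => h (hg.2.1 k x h'), hgK, happ⟩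
  refine ⟨fun k hk => ?_, fun hH => PrimeSieve.le_Cminus fun δ hδ ϖ hϖ => ?_,
    fun hH => PrimeSieve.Cplus_le fun δ hδ ϖ hϖ => ?_⟩
  · obtain ⟨m, rfl⟩ : ∃ m, k = m + 1 := ⟨k - 1, by have := (Finset.mem_Icc.1 hk).1; omega⟩
    exact hgA.hyperplaneIntegrable hG m
  · obtain ⟨B, hB, x₀, hx₀⟩ := PrimeSieve.exists_sieve_bound hG hR hg hg1 (σ := 1) (Or.inl rfl)
      (fun k x hx => by simpa using hH k x hx) hδ hϖ
    refine ⟨B, hB, x₀, fun x hx a b hab => ?_⟩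
    have := hx₀ x hx a b hab
    linarith
  · obtain ⟨B, hB, x₀, hx₀⟩ := PrimeSieve.exists_sieve_bound hG hR hg hg1 (σ := -1) (Or.inr rfl)
      (fun k x hx => by simpa using hH k x hx) hδ hϖ
    refine ⟨B, hB, x₀, fun x hx a b hab => ?_⟩
    have := hx₀ x hx a b hab
    linarith
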